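/- **Setting.** Let $n\ge 3$, let $M\subset\mathbb R^n$ be open with coordinates $(x^1,\dots,x^{n-2},u,v)$, let $\Omega\subset\mathbb R^{n-1}$ be its image under $(x,u,v)\mapsto(x,u)$, and let $H=H(x,u)$ be a smooth function on $\Omega$. Let $$g=2\,du\,dv+H\,du^2+\sum_{i=1}^{n-2}(dx^i)^2$$ be the corresponding Lorentzian pp-wave on $M$, and let $\Delta=\sum_{i=1}^{n-2}\partial_{x^i}^2$. An *ambient metric* (in normal form with respect to $g$) over a $\rho$-interval $J$ is a metric $\tilde g=2\,dt\,d(\rho t)+t^2\gamma(\cdot,\rho)$ on $(0,\infty)\times M\times J$, where $\gamma(\cdot,\rho)$ is a family of nondegenerate symmetric bilinear forms on $M$, smooth on $M\times J$ and continuous up to $\rho=0$, with $\gamma(\cdot,0)=g$, such that $\mathrm{Ric}(\tilde g)=O(\rho^N)$ for all $N$ if $n$ is odd, and, if $n$ is even, $\mathrm{Ric}(\tilde g)=O(\rho^{n/2-1})$ and $\mathrm{tr}_g\big(\rho^{1-n/2}\mathrm{Ric}(\tilde g)|_{TM\otimes TM}\big)\to 0$ as $\rho\to0$. Here $O(\cdot)$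 is meant componentwise as $\rho\to 0$ in $J$, locally uniformly, and $J=(-\varepsilon,\varepsilon)$ or, where stated, $J=(0,\varepsilon)$. For $n$ even, the *obstruction tensor* $\mathcal O$, for a fixed normalising constant $\kappa\neq0$, is the tensor $\kappa\,\big(\rho^{1-n/2}\mathrm{Ric}(\tilde g)|_{TM\otimes TM}\big)\big|_{\rho=0}$ for every ambient metric $\tilde g$ over some $(-\varepsilon,\varepsilon)$. For a smooth function $f=f(x,u)$ on $\Omega$ consider the formal expressions $$a=\sum_{k=1}^{m}\frac{\Delta^kH}{k!\prod_{i=1}^k(2i-n)}\rho^k,\qquad b_f=\sum_{k=0}^\infty\frac{\Delta^kf}{k!\prod_{i=1}^k(2i+n)}\rho^k,$$ with $m=\infty$ if $n$ is odd and $m=\frac{n-2}2$ if $n$ is even, and the metric $$\tilde g=2\,dt\,d(\rho t)+t^2g+t^2\big(a+\rho^{n/2}b_f\big)du^2.\qquad(*)$$ The series "converges on $(-\varepsilon,\varepsilon)$" if it converges for $|\rho|<\varepsilon$, with all $(x,u)$-derivatives, uniformly on compact subsets of $\Omega\times(-\varepsilon,\varepsilon)$. A *realisation* of a power series in $\rho$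 is a smooth function on $\Omega\times(-\varepsilon,\varepsilon)$ with that Taylor series at $\rho=0$. **Theorem.** **(0)** For every smooth $f$ there are realisations of $a$ and $b_f$ (even on $\Omega\times\mathbb R$), and for all realisations of them on $\Omega\times(-\varepsilon,\varepsilon)$, $(*)$ is an ambient metric over $(-\varepsilon,\varepsilon)$ if $n$ is even and over $(0,\varepsilon)$ if $n$ is odd. **(1)** Let $n$ be odd. * If $f=0$, then $(*)$ (that is, $2\,dt\,d(\rho t)+t^2g+t^2a\,du^2$, for every realisation of $a$) is an ambient metric over $(-\varepsilon,\varepsilon)$. If the series $a$ converges on $(-\varepsilon,\varepsilon)$, its sum gives an ambient metric over $(-\varepsilon,\varepsilon)$ that is Ricci-flat and analytic in $\rho$, and it is the only ambient metric over $(-\varepsilon,\varepsilon)$ that is analytic in $\rho$. * Without any assumption of convergence: if an ambient metric over $(-\varepsilon,\varepsilon)$ is analytic in $\rho$, then at each point of $M$ and for all sufficiently small $|\rho|$ the series $a$ converges and $\gamma=g+a\,du^2$. * If $a$ and $b_f$ converge on $(-\varepsilon,\varepsilon)$, then $(*)$ is a Ricci-flat ambient metric over $(0,\varepsilon)$. *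 If $A,B$ are smooth on $\Omega\times(-\varepsilon,\varepsilon)$ and $\gamma=g+(A+\rho^{n/2}B)\,du^2$ defines an ambient metric over $(0,\varepsilon)$, then $A$ and $B$ are realisations of $a$ and $b_f$ with $f=B(\cdot,0)$. **(2)** Let $n$ be even. * The obstruction tensor is $\mathcal O=c_n\,\Delta^{n/2}H\,du^2$ for a constant $c_n\ne0$ depending only on $n$ (and $\kappa$). * If $\mathcal O=0$, then for every smooth $f$ the metric $(*)$ (with any realisations of $a$ and $b_f$) satisfies $\mathrm{Ric}(\tilde g)=O(\rho^N)$ for all $N$; if the series $b_f$ converges on $(-\varepsilon,\varepsilon)$, then $(*)$ is an ambient metric over $(-\varepsilon,\varepsilon)$ that is Ricci-flat and analytic in $\rho$. * If $\gamma=g+h(x,u,\rho)\,du^2$ defines an ambient metric over $(-\varepsilon,\varepsilon)$ that is Ricci-flat and analytic in $\rho$, then $\mathcal O=0$, and there is a smooth $f$ on $\Omega$ such that at each point of $\Omega$ and for all sufficiently small $|\rho|$ one has $h=a+\rho^{n/2}b_f$, the series being convergent. * Whether or not $\mathcal O=0$: write $n=2s$, $q_k=\sum_{i=1}^k\frac{n+4i}{i(n+2i)}$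 and $C_n=-\frac1{(s-1)!\prod_{i=0}^{s-1}(2i-n)}$. If $b_f$ and $b_{\Delta^sH}$ converge on $(-\varepsilon,\varepsilon)$, then $\gamma=g+h\,du^2$ with $$h=a+\rho^sb_f+C_n\rho^s\sum_{k=0}^\infty(\log\rho-q_k)\frac{\Delta^{s+k}H}{k!\prod_{i=1}^k(2i+n)}\rho^k$$ defines a Ricci-flat ambient metric over $(0,\varepsilon)$. -/

import Mathlib

open Set Filter Topology
open scoped ContDiff

noncomputable section

namespace PPWave

/-! ### Pseudo-Riemannian metrics in a coordinate chart -/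

section Coordinates

variable {ι : Type*} [Fintype ι] [DecidableEq ι]

/-- The partial derivative `∂_i F` of a function of the coordinates `(x^i)_{i : ι}`. -/
def pd (i : ι) (F : (ι → ℝ) → ℝ) (x : ι → ℝ) : ℝ :=
  fderiv ℝ F x (Pi.single i 1)

/-- The Christoffel symbol `Γ^k_{ij}` of the metric with component matrix `g`. -/
def christoffel (g : (ι → ℝ) → Matrix ι ι ℝ) (k i j : ι) (x : ι → ℝ) : ℝ :=
  (1 / 2) * ∑ l, (g x)⁻¹ k l *
    (pd i (fun y => g y j l) x + pd j (fun y => g y i l) x - pd l (fun y => g y i j) x)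

/-- The component `Ric_{ij}` of the Ricci tensor of the metric with component matrix `g`:
`∂_k Γ^k_{ij} - ∂_j Γ^k_{ik} + Γ^k_{kl} Γ^l_{ij} - Γ^k_{jl} Γ^l_{ik}`. -/
def ricci (g : (ι → ℝ) → Matrix ι ι ℝ) (i j : ι) (x : ι → ℝ) : ℝ :=
  ∑ k, (pd k (christoffel g k i j) x - pd j (christoffel g k i k) x) +
    ∑ k, ∑ l, (christoffel g k k l x * christoffel g l i j x -
      christoffel g k j l x * christoffel g l i k x)

/-! ### Ambient metrics

Coordinates on the ambient space are indexed by `ι ⊕ Fin 2`: the coordinates `x^i` of `M` are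
indexed by `Sum.inl i`, the coordinate `t` by `Sum.inr 0` and `ρ` by `Sum.inr 1`. -/

/-- The point of the ambient space with coordinates `(t, x, ρ)`. -/
def ambientPoint (t : ℝ) (x : ι → ℝ) (ρ : ℝ) : ι ⊕ Fin 2 → ℝ := Sum.elim x ![t, ρ]

/-- The `M`-coordinates of an ambient point. -/
def baseCoord (y : ι ⊕ Fin 2 → ℝ) : ι → ℝ := fun i => y (Sum.inl i)

/-- The coordinate `t` of an ambient point. -/
def tCoord (y : ι ⊕ Fin 2 → ℝ) : ℝ := y (Sum.inr 0)

/-- The coordinate `ρ` of an ambient point. -/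
def rhoCoord (y : ι ⊕ Fin 2 → ℝ) : ℝ := y (Sum.inr 1)

/-- The domain `(0, ∞) × M × J`. -/
def ambientDomain (M : Set (ι → ℝ)) (J : Set ℝ) : Set (ι ⊕ Fin 2 → ℝ) :=
  {y | baseCoord y ∈ M ∧ 0 < tCoord y ∧ rhoCoord y ∈ J}

/-- The metric `2 dt d(ρt) + t² γ(x, ρ) = 2ρ dt² + 2t dt dρ + t² γ_{ij}(x, ρ) dx^i dx^j`. -/
def ambientMetric (γ : (ι → ℝ) → ℝ → Matrix ι ι ℝ) (y : ι ⊕ Fin 2 → ℝ) :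
    Matrix (ι ⊕ Fin 2) (ι ⊕ Fin 2) ℝ :=
  Matrix.fromBlocks (tCoord y ^ 2 • γ (baseCoord y) (rhoCoord y)) 0 0
    !![2 * rhoCoord y, tCoord y; tCoord y, 0]

/-- `Ric(2 dt d(ρt) + t² γ) = O(ρ^m)` as `ρ → 0` with `ρ ∈ J`, for all components in the
coordinates `(t, x, ρ)` and locally uniformly in `(t, x) ∈ (0, ∞) × M`. -/
def RicciBigO (M : Set (ι → ℝ)) (J : Set ℝ) (γ : (ι → ℝ) → ℝ → Matrix ι ι ℝ) (m : ℕ) : Prop :=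
  ∀ x ∈ M, ∀ t : ℝ, 0 < t → ∀ a b : ι ⊕ Fin 2,
    (fun y => ricci (ambientMetric γ) a b y) =O[𝓝[ambientDomain M J] (ambientPoint t x 0)]
      (fun y => rhoCoord y ^ m)

/-- `Ric(2 dt d(ρt) + t² γ) = 0` on `(0, ∞) × M × J`. -/
def RicciFlat (M : Set (ι → ℝ)) (J : Set ℝ) (γ : (ι → ℝ) → ℝ → Matrix ι ι ℝ) : Prop :=
  ∀ y ∈ ambientDomain M J, ∀ a b : ι ⊕ Fin 2, ricci (ambientMetric γ) a b y = 0

/-- The family `γ(x, ρ)` is real-analytic in `ρ ∈ J`. -/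
def AnalyticInRho (M : Set (ι → ℝ)) (J : Set ℝ) (γ : (ι → ℝ) → ℝ → Matrix ι ι ℝ) : Prop :=
  ∀ x ∈ M, ∀ i j : ι, AnalyticOnNhd ℝ (fun ρ => γ x ρ i j) J

/-- `2 dt d(ρt) + t² γ(x, ρ)`, on `(0, ∞) × M × J`, is an ambient metric in normal form with
respect to the metric `g` on `M`.  For `J = (-ε, ε)` this is the usual notion.  For `J = (0, ε)`
the metric is required on the side `ρ > 0` only, and to extend continuously to `ρ = 0`; this
allows non-integral powers of `ρ`.  The dimension `n` of `M` is the number of coordinates. -/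
structure IsAmbientMetric (M : Set (ι → ℝ)) (J : Set ℝ) (g : (ι → ℝ) → Matrix ι ι ℝ)
    (γ : (ι → ℝ) → ℝ → Matrix ι ι ℝ) : Prop where
  symm : ∀ x ∈ M, ∀ ρ ∈ J, (γ x ρ).IsSymm
  nondegenerate : ∀ x ∈ M, ∀ ρ ∈ J, (γ x ρ).det ≠ 0
  smooth : ∀ i j, ContDiffOn ℝ ∞ (fun p : (ι → ℝ) × ℝ => γ p.1 p.2 i j) (M ×ˢ J)
  continuous : ∀ i j,
    ContinuousOn (fun p : (ι → ℝ) × ℝ => γ p.1 p.2 i j) (M ×ˢ insert 0 J)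
  initial : ∀ x ∈ M, γ x 0 = g x
  ricci_odd : Odd (Fintype.card ι) → ∀ m : ℕ, RicciBigO M J γ m
  ricci_even : Even (Fintype.card ι) → RicciBigO M J γ (Fintype.card ι / 2 - 1)
  trace_even : Even (Fintype.card ι) → ∀ x ∈ M, ∀ t : ℝ, 0 < t →
    (fun y => ∑ i, ∑ j, (g (baseCoord y))⁻¹ i j *
        ricci (ambientMetric γ) (Sum.inl i) (Sum.inl j) y)
      =o[𝓝[ambientDomain M J] (ambientPoint t x 0)]
      (fun y => rhoCoord y ^ (Fintype.card ι / 2 - 1))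

/-- `O` is the Fefferman-Graham obstruction tensor of `(M, g)`, in even dimension `n` and with
normalising constant `κ`: there are ambient metrics in normal form with respect to `g`, and for
each of them `O = κ (ρ^{1 - n/2} Ric|_{TM ⊗ TM})|_{ρ = 0}`. -/
def IsObstructionTensor (κ : ℝ) (M : Set (ι → ℝ)) (g O : (ι → ℝ) → Matrix ι ι ℝ) : Prop :=
  (∃ ε : ℝ, 0 < ε ∧ ∃ γ, IsAmbientMetric M (Ioo (-ε) ε) g γ) ∧
  ∀ ε : ℝ, 0 < ε → ∀ γ, IsAmbientMetric M (Ioo (-ε) ε) g γ →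
    ∀ x ∈ M, ∀ t : ℝ, 0 < t → ∀ i j : ι,
      Tendsto
        (fun y => κ * ((rhoCoord y ^ (Fintype.card ι / 2 - 1))⁻¹ *
          ricci (ambientMetric γ) (Sum.inl i) (Sum.inl j) y))
        (𝓝[ambientDomain M (Ioo (-ε) ε \ {0})] (ambientPoint t x 0)) (𝓝 (O x i j))

end Coordinates

/-! ### Lorentzian pp-waves

Coordinates in dimension `n` are indexed by `Fin (n - 2) ⊕ Fin 2`: the coordinates `x^i` by
`Sum.inl i`, the coordinate `u` by `Sum.inr 0` and `v` by `Sum.inr 1`. -/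

/-- The index set of the coordinates `(x^1, …, x^{n-2}, u, v)`. -/
abbrev Idx (n : ℕ) : Type := Fin (n - 2) ⊕ Fin 2

/-- The space of the variables `(x, u) = (x^1, …, x^{n-2}, u)`. -/
abbrev XU (n : ℕ) : Type := EuclideanSpace ℝ (Fin (n - 2)) × ℝ

/-- The projection `(x, u, v) ↦ (x, u)`. -/
def proj {n : ℕ} (z : Idx n → ℝ) : XU n :=
  (WithLp.toLp 2 fun i => z (Sum.inl i), z (Sum.inr 0))

/-- The matrix of `2 du dv + a du² + Σ (dx^i)²`. -/
def ppMatrix (n : ℕ) (a : ℝ) : Matrix (Idx n) (Idx n) ℝ :=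
  Matrix.fromBlocks 1 0 0 !![a, 1; 1, 0]

/-- The matrix of `a du²`. -/
def duSq (n : ℕ) (a : ℝ) : Matrix (Idx n) (Idx n) ℝ :=
  Matrix.fromBlocks 0 0 0 !![a, 0; 0, 0]

/-- The pp-wave `2 du dv + H(x, u) du² + Σ (dx^i)²`. -/
def ppMetric {n : ℕ} (H : XU n → ℝ) (z : Idx n → ℝ) : Matrix (Idx n) (Idx n) ℝ :=
  ppMatrix n (H (proj z))

/-- The family `2 du dv + H(x, u) du² + Σ (dx^i)² + h(x, u, ρ) du²`. -/
def ppFamily {n : ℕ} (H : XU n → ℝ) (h : XU n → ℝ → ℝ) (z : Idx n → ℝ) (ρ : ℝ) :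
    Matrix (Idx n) (Idx n) ℝ :=
  ppMatrix n (H (proj z)) + duSq n (h (proj z) ρ)

/-- The flat Laplacian in the variables `x^1, …, x^{n-2}`, with `u` as a parameter. -/
def lap {n : ℕ} (F : XU n → ℝ) : XU n → ℝ :=
  fun w => Laplacian.laplacian (fun x => F (x, w.2)) w.1

/-- The coefficient of `ρ^k` in `Σ_{k=1}^m Δ^k H / (k! ∏_{i=1}^k (2i - n)) ρ^k`, where `m = ∞`
for `n` odd and `m = (n - 2)/2` for `n` even. -/
def hCoeff {n : ℕ} (H : XU n → ℝ) (k : ℕ) (w : XU n) : ℝ :=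
  if k = 0 ∨ (Even n ∧ n ≤ 2 * k) then 0
  else (lap^[k] H) w / (k.factorial * ∏ i ∈ Finset.Icc 1 k, (2 * (i : ℝ) - n))

/-- The coefficient of `ρ^k` in `Σ_{k=0}^∞ Δ^k f / (k! ∏_{i=1}^k (2i + n)) ρ^k`. -/
def fCoeff {n : ℕ} (f : XU n → ℝ) (k : ℕ) (w : XU n) : ℝ :=
  (lap^[k] f) w / (k.factorial * ∏ i ∈ Finset.Icc 1 k, (2 * (i : ℝ) + n))

/-- `A(x, u, ρ)` is smooth on `Ω × J` and `Σ_k c_k(x, u) ρ^k` is its Taylor series at `ρ = 0`. -/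
def HasTaylorSeries {n : ℕ} (Ω : Set (XU n)) (J : Set ℝ) (c : ℕ → XU n → ℝ)
    (A : XU n → ℝ → ℝ) : Prop :=
  ContDiffOn ℝ ∞ (fun p : XU n × ℝ => A p.1 p.2) (Ω ×ˢ J) ∧
  ∀ w ∈ Ω, ∀ k : ℕ, iteratedDeriv k (A w) 0 = k.factorial * c k w

/-- The power series `Σ_k c_k(x, u) ρ^k` converges for `|ρ| < ε`, together with the series of the
derivatives in `(x, u)` of each order, uniformly on compact subsets of `Ω × (-ε, ε)`.  This is
phrased through the (equivalent) Cauchy-Abel bounds on the coefficients. -/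
def ConvergesOn {n : ℕ} (Ω : Set (XU n)) (ε : ℝ) (c : ℕ → XU n → ℝ) : Prop :=
  ∀ j : ℕ, ∀ K ⊆ Ω, IsCompact K → ∀ r : ℝ, 0 < r → r < ε →
    ∃ C : ℝ, ∀ k : ℕ, ∀ w ∈ K, ‖iteratedFDeriv ℝ j (c k) w‖ * r ^ k ≤ C

/-- The sum `Σ_k c_k(x, u) ρ^k` of a (convergent) power series. -/
def seriesSum {n : ℕ} (c : ℕ → XU n → ℝ) (w : XU n) (ρ : ℝ) : ℝ := ∑' k : ℕ, c k w * ρ ^ k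

/-- The `ρ`-range: `(-ε, ε)` for `n` even; for `n` odd, where `ρ^{n/2}` occurs, `(0, ε)`. -/
def rhoRange (n : ℕ) (ε : ℝ) : Set ℝ := {ρ | |ρ| < ε ∧ (Odd n → 0 < ρ)}

/-- The number `q_k = Σ_{i=1}^k (n + 4i) / (i (n + 2i))`. -/
def logShift (n k : ℕ) : ℝ :=
  ∑ i ∈ Finset.Icc 1 k, ((n : ℝ) + 4 * i) / (i * ((n : ℝ) + 2 * i))

/-- For `n = 2s`, the number `-1 / ((s - 1)! ∏_{i=0}^{s-1} (2i - n))`. -/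
def logConst (n : ℕ) : ℝ :=
  -1 / ((n / 2 - 1).factorial * ∏ i ∈ Finset.range (n / 2), (2 * (i : ℝ) - n))

end PPWave

end

noncomputable section

namespace PPWave

set_option linter.unusedSectionVars false
set_option linter.unusedSimpArgs false

/-! ### Directional derivatives of smooth functions -/

section Directional

variable {E F : Type*} [NormedAddCommGroup E] [NormedSpace ℝ E]
  [NormedAddCommGroup F] [NormedSpace ℝ F]

/-! The family `g + h(x,u,ρ) du²` deforms a pp-wave along the null covector `du`, with a coefficient
independent of `v`. The contractions of `∂_v` with `du` and with `dF` vanish, so all terms quadratic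
in the deformation disappear and the ambient Ricci tensor is exactly linear in `F = H + h`: only its
`du²` component survives, and it equals `ρF'' - (n/2 - 1)F' - ½ΔF` (`IsPPFamily.ricci_eq`,
`ricci_ppFamily`). What remains is the analysis of this equation at its singular point `ρ = 0`,
where the indicial roots are `0` and `n/2`.

The root `0` yields the recurrence solved by `H + a`; conjugation by `ρ^{n/2}` (`waveOp_pow_mul`)
yields the one solved by `b_f`. For odd `n` neither recurrence breaks down. For `n = 2s` the first
one meets a zero factor at order `s` and leaves a nonzero constant times `Δ^s H ρ^{s-1}`: this is
the obstruction (`waveCoeff_totalSeries`). If it vanishes, the coefficient of `ρ^s` is free and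
becomes `f`; otherwise Frobenius' logarithm cancels it (`waveOp_logSolution`). Formal series become
metrics by Borel's lemma (`exists_borel`), with Ricci tensor vanishing to the order of the formal
solution, or by summation when they converge (`SeriesBound.contDiffOn`), with an exact equation.

Uniqueness and the obstruction tensor concern arbitrary families `γ`. If two families agree modulo
`ρ^{m+1}` and `D` is the derivative of order `m + 1` of their difference at `ρ = 0`, then the `m`-th
jets of the tangential Ricci tensors differ by `(m + 1 - n/2) D - ½ tr(D) γ`
(`Comparable.ricciTan_jet`), with trace `(m + 1 - n) tr(D)`; at `m + 1 = n` the trace is recovered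
from `Ric_ρρ` (`Comparable.ricciRho_jet`). So for odd `n` the whole Taylor series is determined, and
an analytic metric must have the series `a`. For even `n` it is determined below order `n/2`; at
that order the factor of `D` is zero and the trace condition kills `tr(D)`, so the limit defining
the obstruction tensor is the same for all ambient metrics and can be read off a pp-wave family.

For odd `n` and `h = A + ρ^{n/2} B`, integral and half-integral exponents cannot cancel each other,
so both parts solve their equations to infinite order (`vanishesTo_of_isBigO_add`). -/

/-- The derivative of `f` in the direction `e`. -/
def dirD (e : E) (f : E → ℝ) (p : E) : ℝ := fderiv ℝ f p e

theorem ContDiffOn.differentiableAt_of_isOpen {U : Set E} {f : E → F}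
    (hf : ContDiffOn ℝ ∞ f U) (hU : IsOpen U) {p : E} (hp : p ∈ U) : DifferentiableAt ℝ f p :=
  (hf.contDiffAt (hU.mem_nhds hp)).differentiableAt (by simp)

theorem ContDiffOn.dirD {U : Set E} {f : E → ℝ} (hf : ContDiffOn ℝ ∞ f U) (hU : IsOpen U)
    (e : E) : ContDiffOn ℝ ∞ (PPWave.dirD e f) U :=
  ((contDiffOn_infty_iff_fderiv_of_isOpen hU).1 hf).2.clm_apply contDiffOn_const

/-- Functions are total but controlled only on an open set. A derivative is local, so identities
valid on that set may be used under `dirD` there. -/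
theorem dirD_congr {U : Set E} (hU : IsOpen U) {f g : E → ℝ} (h : EqOn f g U) (e : E) :
    EqOn (dirD e f) (dirD e g) U := fun p hp => by
  have : f =ᶠ[𝓝 p] g := h.eventuallyEq_of_mem (hU.mem_nhds hp)
  simp only [dirD, this.fderiv_eq]

theorem dirD_const (e : E) (c : ℝ) (p : E) : dirD e (fun _ => c) p = 0 := by
  simp [dirD]

theorem dirD_add (e : E) {f g : E → ℝ} {p : E} (hf : DifferentiableAt ℝ f p)
    (hg : DifferentiableAt ℝ g p) :
    dirD e (fun q => f q + g q) p = dirD e f p + dirD e g p := by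
  simp [dirD, fderiv_fun_add hf hg]

theorem dirD_sub (e : E) {f g : E → ℝ} {p : E} (hf : DifferentiableAt ℝ f p)
    (hg : DifferentiableAt ℝ g p) :
    dirD e (fun q => f q - g q) p = dirD e f p - dirD e g p := by
  simp [dirD, fderiv_fun_sub hf hg]

theorem dirD_mul (e : E) {f g : E → ℝ} {p : E} (hf : DifferentiableAt ℝ f p)
    (hg : DifferentiableAt ℝ g p) :
    dirD e (fun q => f q * g q) p = dirD e f p * g p + f p * dirD e g p := by
  simp only [dirD, fderiv_fun_mul hf hg, add_apply,
    smul_apply, smul_eq_mul]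
  ring

theorem dirD_const_mul (e : E) (c : ℝ) {f : E → ℝ} {p : E} (hf : DifferentiableAt ℝ f p) :
    dirD e (fun q => c * f q) p = c * dirD e f p := by
  rw [dirD_mul e (differentiableAt_const c) hf, dirD_const, zero_mul, zero_add]

theorem dirD_mul_const (e : E) (c : ℝ) {f : E → ℝ} {p : E} (hf : DifferentiableAt ℝ f p) :
    dirD e (fun q => f q * c) p = dirD e f p * c := by
  rw [dirD_mul e hf (differentiableAt_const c), dirD_const, mul_zero, add_zero]

theorem dirD_sum {ι : Type*} (s : Finset ι) (e : E) {f : ι → E → ℝ} {p : E}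
    (hf : ∀ i ∈ s, DifferentiableAt ℝ (f i) p) :
    dirD e (fun q => ∑ i ∈ s, f i q) p = ∑ i ∈ s, dirD e (f i) p := by
  simp [dirD, fderiv_fun_sum hf]

theorem dirD_clm (e : E) (l : E →L[ℝ] ℝ) (p : E) : dirD e (fun q => l q) p = l e := by
  simp [dirD]

theorem dirD_comp_clm (e : E) (l : E →L[ℝ] F) {f : F → ℝ} {p : E}
    (hf : DifferentiableAt ℝ f (l p)) :
    dirD e (fun q => f (l q)) p = dirD (l e) f (l p) := by
  have : fderiv ℝ (f ∘ l) p = (fderiv ℝ f (l p)).comp l := by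
    rw [fderiv_comp p hf l.differentiableAt, l.fderiv]
  change fderiv ℝ (f ∘ l) p e = _
  rw [this]; rfl

/-- Both sides are values of the second Fréchet derivative, which is symmetric. -/
theorem dirD_comm {U : Set E} (hU : IsOpen U) {f : E → ℝ} (hf : ContDiffOn ℝ ∞ f U) (e e' : E)
    {p : E} (hp : p ∈ U) : dirD e (dirD e' f) p = dirD e' (dirD e f) p := by
  have hd : DifferentiableAt ℝ (fderiv ℝ f) p :=
    ContDiffOn.differentiableAt_of_isOpen
      ((contDiffOn_infty_iff_fderiv_of_isOpen hU).1 hf).2 hU hp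
  have key : ∀ a b : E, dirD a (dirD b f) p = fderiv ℝ (fderiv ℝ f) p a b := fun a b => by
    have : fderiv ℝ (fun q => fderiv ℝ f q b) p = (fderiv ℝ (fderiv ℝ f) p).flip b := by
      rw [fderiv_clm_apply hd (differentiableAt_const b)]
      simp
    change fderiv ℝ (fun q => fderiv ℝ f q b) p a = _
    rw [this]; rfl
  rw [key, key]
  exact ((hf.contDiffAt (hU.mem_nhds hp)).isSymmSndFDerivAt (by simpa using ENat.LEInfty.out)) e e'

end Directional

/-! ### Jets in the variable `ρ` along `ρ = 0` -/

section Jets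

variable {E : Type*} [NormedAddCommGroup E] [NormedSpace ℝ E]

/-- The derivative in the second variable. -/
def dr (F : E × ℝ → ℝ) : E × ℝ → ℝ := dirD ((0 : E), (1 : ℝ)) F

/-- The derivatives of `F(x, ρ)` in `ρ` of order less than `k` vanish at `ρ = 0`, `x ∈ M`. -/
def VanishesTo (M : Set E) (k : ℕ) (F : E × ℝ → ℝ) : Prop :=
  ∀ j < k, ∀ x ∈ M, dr^[j] F (x, 0) = 0

theorem VanishesTo.mono {M : Set E} {k l : ℕ} {F : E × ℝ → ℝ} (h : VanishesTo M k F)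
    (hl : l ≤ k) : VanishesTo M l F := fun j hj => h j (hj.trans_le hl)

theorem vanishesTo_zero {M : Set E} {F : E × ℝ → ℝ} : VanishesTo M 0 F :=
  fun j hj => absurd hj (Nat.not_lt_zero j)

/-- Splits off the lowest derivative, the form suited to inductions through the product rule. -/
theorem vanishesTo_succ {M : Set E} {k : ℕ} {F : E × ℝ → ℝ} :
    VanishesTo M (k + 1) F ↔ (∀ x ∈ M, F (x, 0) = 0) ∧ VanishesTo M k (dr F) := by
  constructor
  · intro h
    exact ⟨fun x hx => h 0 k.succ_pos x hx, fun j hj x hx => h (j + 1) (by omega) x hx⟩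
  · rintro ⟨h0, h⟩ j hj x hx
    cases j with
    | zero => exact h0 x hx
    | succ j => exact h j (by omega) x hx

/-- Splits off the highest derivative, the form suited to raising the order by one. -/
theorem vanishesTo_succ' {M : Set E} {k : ℕ} {F : E × ℝ → ℝ} :
    VanishesTo M (k + 1) F ↔ VanishesTo M k F ∧ ∀ x ∈ M, dr^[k] F (x, 0) = 0 := by
  constructor
  · intro h
    exact ⟨h.mono k.le_succ, h k k.lt_succ_self⟩
  · rintro ⟨h, h0⟩ j hj x hx
    rcases Nat.lt_succ_iff_lt_or_eq.1 hj with hj | rfl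
    · exact h j hj x hx
    · exact h0 x hx

variable {M : Set E} {J : Set ℝ}

theorem ContDiffOn.dr {U : Set (E × ℝ)} {F : E × ℝ → ℝ} (hF : ContDiffOn ℝ ∞ F U)
    (hU : IsOpen U) : ContDiffOn ℝ ∞ (PPWave.dr F) U := ContDiffOn.dirD hF hU _

theorem ContDiffOn.dr_iterate {U : Set (E × ℝ)} {F : E × ℝ → ℝ} (hF : ContDiffOn ℝ ∞ F U)
    (hU : IsOpen U) (k : ℕ) : ContDiffOn ℝ ∞ (PPWave.dr^[k] F) U := by
  induction k generalizing F with
  | zero => exact hF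
  | succ k ih => exact ih (ContDiffOn.dr hF hU)

theorem dr_iterate_congr {U : Set (E × ℝ)} (hU : IsOpen U) {F G : E × ℝ → ℝ} (h : EqOn F G U)
    (k : ℕ) : EqOn (dr^[k] F) (dr^[k] G) U := by
  induction k generalizing F G with
  | zero => exact h
  | succ k ih => exact ih (dirD_congr hU h _)

theorem dr_iterate_add {U : Set (E × ℝ)} (hU : IsOpen U) {F G : E × ℝ → ℝ}
    (hF : ContDiffOn ℝ ∞ F U) (hG : ContDiffOn ℝ ∞ G U) (k : ℕ) {p : E × ℝ} (hp : p ∈ U) :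
    dr^[k] (fun p => F p + G p) p = dr^[k] F p + dr^[k] G p := by
  induction k generalizing F G with
  | zero => rfl
  | succ k ih =>
    have h : EqOn (dr fun p => F p + G p) (fun p => dr F p + dr G p) U := fun q hq =>
      dirD_add _ (ContDiffOn.differentiableAt_of_isOpen hF hU hq)
        (ContDiffOn.differentiableAt_of_isOpen hG hU hq)
    rw [Function.iterate_succ_apply, dr_iterate_congr hU h k hp]
    exact ih (ContDiffOn.dr hF hU) (ContDiffOn.dr hG hU)

theorem dr_iterate_const_mul {U : Set (E × ℝ)} (hU : IsOpen U) {F : E × ℝ → ℝ}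
    (hF : ContDiffOn ℝ ∞ F U) (c : ℝ) (k : ℕ) {p : E × ℝ} (hp : p ∈ U) :
    dr^[k] (fun p => c * F p) p = c * dr^[k] F p := by
  induction k generalizing F with
  | zero => rfl
  | succ k ih =>
    have h : EqOn (dr fun p => c * F p) (fun p => c * dr F p) U := fun q hq =>
      dirD_const_mul _ c (ContDiffOn.differentiableAt_of_isOpen hF hU hq)
    rw [Function.iterate_succ_apply, dr_iterate_congr hU h k hp]
    exact ih (ContDiffOn.dr hF hU)

theorem dr_iterate_sub {U : Set (E × ℝ)} (hU : IsOpen U) {F G : E × ℝ → ℝ}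
    (hF : ContDiffOn ℝ ∞ F U) (hG : ContDiffOn ℝ ∞ G U) (k : ℕ) {p : E × ℝ} (hp : p ∈ U) :
    dr^[k] (fun p => F p - G p) p = dr^[k] F p - dr^[k] G p := by
  have h := dr_iterate_add hU hF (contDiffOn_const.mul hG (f := fun _ => (-1 : ℝ))) k hp
  have h' := dr_iterate_const_mul hU hG (-1) k hp
  have e : (fun p => F p - G p) = fun p => F p + -1 * G p := by ext; ring
  rw [e, h, h']; ring

theorem dr_iterate_sum {ι : Type*} (s : Finset ι) {U : Set (E × ℝ)} (hU : IsOpen U)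
    {F : ι → E × ℝ → ℝ} (hF : ∀ i, ContDiffOn ℝ ∞ (F i) U) (k : ℕ) {p : E × ℝ} (hp : p ∈ U) :
    dr^[k] (fun p => ∑ i ∈ s, F i p) p = ∑ i ∈ s, dr^[k] (F i) p := by
  classical
  induction s using Finset.induction_on with
  | empty =>
    have := dr_iterate_const_mul hU (contDiffOn_const (c := (0 : ℝ))) 0 k hp
    simpa using this
  | insert a s ha ih =>
    simp only [Finset.sum_insert ha]
    rw [dr_iterate_add hU (hF a) (ContDiffOn.sum fun i _ => hF i) k hp, ih]

theorem dr_iterate_dirD {U : Set (E × ℝ)} (hU : IsOpen U) {F : E × ℝ → ℝ}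
    (hF : ContDiffOn ℝ ∞ F U) (e : E × ℝ) (k : ℕ) :
    EqOn (dr^[k] (dirD e F)) (dirD e (dr^[k] F)) U := by
  induction k generalizing F with
  | zero => exact fun _ _ => rfl
  | succ k ih =>
    intro p hp
    have h : EqOn (dr (dirD e F)) (dirD e (dr F)) U := fun q hq => dirD_comm hU hF _ _ hq
    rw [Function.iterate_succ_apply, dr_iterate_congr hU h k hp, ih (ContDiffOn.dr hF hU) hp]
    rfl

theorem dr_mul {U : Set (E × ℝ)} (hU : IsOpen U) {F G : E × ℝ → ℝ}
    (hF : ContDiffOn ℝ ∞ F U) (hG : ContDiffOn ℝ ∞ G U) :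
    EqOn (dr fun p => F p * G p) (fun p => dr F p * G p + F p * dr G p) U := fun _ hp =>
  dirD_mul _ (ContDiffOn.differentiableAt_of_isOpen hF hU hp)
    (ContDiffOn.differentiableAt_of_isOpen hG hU hp)

theorem dr_snd (p : E × ℝ) : dr (fun p : E × ℝ => p.2) p = 1 :=
  dirD_clm _ (ContinuousLinearMap.snd ℝ E ℝ) p

theorem dirD_slice {U : Set (E × ℝ)} (hU : IsOpen U) {F : E × ℝ → ℝ} (hF : ContDiffOn ℝ ∞ F U)
    (e : E) {x : E} {ρ : ℝ} (hx : (x, ρ) ∈ U) :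
    dirD (e, (0 : ℝ)) F (x, ρ) = dirD e (fun y => F (y, ρ)) x := by
  have hd := ContDiffOn.differentiableAt_of_isOpen hF hU hx
  have h1 : HasFDerivAt (fun y : E => (y, ρ)) (ContinuousLinearMap.inl ℝ E ℝ) x :=
    (hasFDerivAt_id x).prodMk (hasFDerivAt_const ρ x)
  have := (hd.hasFDerivAt.comp x h1).fderiv
  change _ = fderiv ℝ (F ∘ fun y => (y, ρ)) x e
  rw [this]; rfl

theorem dr_slice {U : Set (E × ℝ)} (hU : IsOpen U) {F : E × ℝ → ℝ} (hF : ContDiffOn ℝ ∞ F U)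
    {x : E} {ρ : ℝ} (hx : (x, ρ) ∈ U) :
    HasDerivAt (fun s => F (x, s)) (dr F (x, ρ)) ρ := by
  have hd := ContDiffOn.differentiableAt_of_isOpen hF hU hx
  have h1 : HasDerivAt (fun s : ℝ => (x, s)) ((0 : E), (1 : ℝ)) ρ :=
    (hasDerivAt_const ρ x).prodMk (hasDerivAt_id ρ)
  exact hd.hasFDerivAt.comp_hasDerivAt ρ h1

theorem dr_iterate_eq_iteratedDeriv (hM : IsOpen M) (hJ : IsOpen J) {F : E × ℝ → ℝ}
    (hF : ContDiffOn ℝ ∞ F (M ×ˢ J)) (k : ℕ) {x : E} (hx : x ∈ M) :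
    ∀ ρ ∈ J, dr^[k] F (x, ρ) = iteratedDeriv k (fun s => F (x, s)) ρ := by
  induction k with
  | zero => intro ρ _; simp
  | succ k ih =>
    intro ρ hρ
    rw [Function.iterate_succ_apply', iteratedDeriv_succ]
    have : (fun s => dr^[k] F (x, s)) =ᶠ[𝓝 ρ] iteratedDeriv k (fun s => F (x, s)) :=
      eventually_of_mem (hJ.mem_nhds hρ) ih
    rw [← this.deriv_eq]
    exact (dr_slice (hM.prod hJ) (ContDiffOn.dr_iterate hF (hM.prod hJ) k)
      (mk_mem_prod hx hρ)).deriv.symm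

theorem VanishesTo.congr (hM : IsOpen M) (hJ : IsOpen J) (h0 : (0 : ℝ) ∈ J) {F G : E × ℝ → ℝ}
    {k : ℕ} (h : VanishesTo M k F) (hFG : EqOn F G (M ×ˢ J)) : VanishesTo M k G :=
  fun j hj x hx => by
    rw [← dr_iterate_congr (hM.prod hJ) hFG j (mk_mem_prod hx h0)]
    exact h j hj x hx

theorem VanishesTo.add (hM : IsOpen M) (hJ : IsOpen J) (h0 : (0 : ℝ) ∈ J) {F G : E × ℝ → ℝ}
    (hF : ContDiffOn ℝ ∞ F (M ×ˢ J)) (hG : ContDiffOn ℝ ∞ G (M ×ˢ J)) {k : ℕ}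
    (h : VanishesTo M k F) (h' : VanishesTo M k G) : VanishesTo M k (fun p => F p + G p) :=
  fun j hj x hx => by
    rw [dr_iterate_add (hM.prod hJ) hF hG j (mk_mem_prod hx h0), h j hj x hx, h' j hj x hx,
      add_zero]

theorem VanishesTo.sub (hM : IsOpen M) (hJ : IsOpen J) (h0 : (0 : ℝ) ∈ J) {F G : E × ℝ → ℝ}
    (hF : ContDiffOn ℝ ∞ F (M ×ˢ J)) (hG : ContDiffOn ℝ ∞ G (M ×ˢ J)) {k : ℕ}
    (h : VanishesTo M k F) (h' : VanishesTo M k G) : VanishesTo M k (fun p => F p - G p) :=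
  fun j hj x hx => by
    rw [dr_iterate_sub (hM.prod hJ) hF hG j (mk_mem_prod hx h0), h j hj x hx, h' j hj x hx,
      sub_zero]

theorem VanishesTo.sum (hM : IsOpen M) (hJ : IsOpen J) (h0 : (0 : ℝ) ∈ J) {ι : Type*}
    (s : Finset ι) {F : ι → E × ℝ → ℝ}
    (hF : ∀ i, ContDiffOn ℝ ∞ (F i) (M ×ˢ J)) {k : ℕ}
    (h : ∀ i, VanishesTo M k (F i)) : VanishesTo M k (fun p => ∑ i ∈ s, F i p) :=
  fun j hj x hx => by
    rw [dr_iterate_sum s (hM.prod hJ) hF j (mk_mem_prod hx h0)]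
    exact Finset.sum_eq_zero fun i _ => h i j hj x hx

theorem VanishesTo.mul_right (hM : IsOpen M) (hJ : IsOpen J) (h0 : (0 : ℝ) ∈ J)
    {F G : E × ℝ → ℝ} (hF : ContDiffOn ℝ ∞ F (M ×ˢ J)) (hG : ContDiffOn ℝ ∞ G (M ×ˢ J)) {k : ℕ}
    (h : VanishesTo M k F) : VanishesTo M k (fun p => F p * G p) := by
  have hU := hM.prod hJ
  induction k generalizing F G with
  | zero => exact vanishesTo_zero
  | succ k ih =>
    have h1 := vanishesTo_succ.1 h
    refine vanishesTo_succ.2 ⟨fun x hx => by simp [h1.1 x hx], ?_⟩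
    -- In the derivative `F'G + FG'` the factor `F'` vanishes to order `k` and `F` even to order `k
    -- + 1`, so the induction hypothesis covers both terms.
    exact (VanishesTo.add hM hJ h0 ((ContDiffOn.dr hF hU).mul hG) (hF.mul (ContDiffOn.dr hG hU))
      (ih (ContDiffOn.dr hF hU) hG h1.2) (ih hF (ContDiffOn.dr hG hU) (h.mono k.le_succ))).congr
      hM hJ h0 (dr_mul hU hF hG).symm

theorem VanishesTo.mul_left (hM : IsOpen M) (hJ : IsOpen J) (h0 : (0 : ℝ) ∈ J)
    {F G : E × ℝ → ℝ} (hF : ContDiffOn ℝ ∞ F (M ×ˢ J)) (hG : ContDiffOn ℝ ∞ G (M ×ˢ J)) {k : ℕ}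
    (h : VanishesTo M k G) : VanishesTo M k (fun p => F p * G p) := by
  simpa only [mul_comm] using VanishesTo.mul_right hM hJ h0 hG hF h

/-- The jets vanish on all of the open set `M`, not just at one point, and `dr` commutes with
derivatives along `M`. Hence such a derivative costs no order. -/
theorem VanishesTo.dirD (hM : IsOpen M) (hJ : IsOpen J) (h0 : (0 : ℝ) ∈ J) {F : E × ℝ → ℝ}
    (hF : ContDiffOn ℝ ∞ F (M ×ˢ J)) (e : E) {k : ℕ} (h : VanishesTo M k F) :
    VanishesTo M k (PPWave.dirD (e, (0 : ℝ)) F) := by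
  intro j hj x hx
  have hU := hM.prod hJ
  have hp : (x, (0 : ℝ)) ∈ M ×ˢ J := mk_mem_prod hx h0
  rw [dr_iterate_dirD hU hF _ j hp, dirD_slice hU (ContDiffOn.dr_iterate hF hU j) e hp,
    dirD_congr hM (g := fun _ => 0) (fun y hy => h j hj y hy) e hx, dirD_const]

/-- In the Leibniz expansion at `ρ = 0` only the term with all derivatives on `F` survives. -/
theorem dr_iterate_mul (hM : IsOpen M) (hJ : IsOpen J) (h0 : (0 : ℝ) ∈ J)
    {F G : E × ℝ → ℝ} (hF : ContDiffOn ℝ ∞ F (M ×ˢ J)) (hG : ContDiffOn ℝ ∞ G (M ×ˢ J)) {k : ℕ}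
    (h : VanishesTo M k F) {x : E} (hx : x ∈ M) :
    dr^[k] (fun p => F p * G p) (x, 0) = dr^[k] F (x, 0) * G (x, 0) := by
  have hU := hM.prod hJ
  have hp : (x, (0 : ℝ)) ∈ M ×ˢ J := mk_mem_prod hx h0
  induction k generalizing F G with
  | zero => rfl
  | succ k ih =>
    have h1 := vanishesTo_succ.1 h
    rw [Function.iterate_succ_apply, dr_iterate_congr hU (dr_mul hU hF hG) k hp,
      dr_iterate_add hU ((ContDiffOn.dr hF hU).mul hG) (hF.mul (ContDiffOn.dr hG hU)) k hp,
      ih (ContDiffOn.dr hF hU) hG h1.2,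
      VanishesTo.mul_right hM hJ h0 hF (ContDiffOn.dr hG hU) h k k.lt_succ_self x hx, add_zero]
    rfl

/-- Exactly one derivative must fall on the factor `ρ`: none leaves a factor that is zero at `ρ =
0`, two kill it. For `k = 0` the truncated `k - 1` is harmless, its coefficient being `0`. -/
theorem dr_iterate_snd_mul (hM : IsOpen M) (hJ : IsOpen J) (h0 : (0 : ℝ) ∈ J)
    {F : E × ℝ → ℝ} (hF : ContDiffOn ℝ ∞ F (M ×ˢ J)) (k : ℕ) {x : E} (hx : x ∈ M) :
    dr^[k] (fun p => p.2 * F p) (x, 0) = k * dr^[k - 1] F (x, 0) := by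
  have hU := hM.prod hJ
  have hp : (x, (0 : ℝ)) ∈ M ×ˢ J := mk_mem_prod hx h0
  have key : ∀ {F : E × ℝ → ℝ}, ContDiffOn ℝ ∞ F (M ×ˢ J) →
      EqOn (dr fun p : E × ℝ => p.2 * F p) (fun p => F p + p.2 * dr F p) (M ×ˢ J) := by
    intro F hF p hp
    rw [dr_mul hU contDiffOn_snd hF hp]
    simp only [dr_snd, one_mul]
  induction k generalizing F with
  | zero => simp
  | succ k ih =>
    have hF' := ContDiffOn.dr hF hU
    rw [Function.iterate_succ_apply, dr_iterate_congr hU (key hF) k hp,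
      dr_iterate_add hU hF (contDiffOn_snd.mul hF') k hp, ih hF']
    cases k with
    | zero => simp
    | succ k =>
      simp only [Nat.add_sub_cancel, Function.iterate_succ_apply]
      push_cast; ring

theorem VanishesTo.snd_mul (hM : IsOpen M) (hJ : IsOpen J) (h0 : (0 : ℝ) ∈ J)
    {F : E × ℝ → ℝ} (hF : ContDiffOn ℝ ∞ F (M ×ˢ J)) {k : ℕ} (h : VanishesTo M k F) :
    VanishesTo M (k + 1) (fun p => p.2 * F p) := by
  intro j hj x hx
  rw [dr_iterate_snd_mul hM hJ h0 hF j hx]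
  cases j with
  | zero => simp
  | succ j => rw [Nat.add_sub_cancel, h j (by omega) x hx, mul_zero]

theorem VanishesTo.pow_mul (hM : IsOpen M) (hJ : IsOpen J) (h0 : (0 : ℝ) ∈ J)
    {F : E × ℝ → ℝ} (hF : ContDiffOn ℝ ∞ F (M ×ˢ J)) {k : ℕ} (h : VanishesTo M k F) (m : ℕ) :
    VanishesTo M (k + m) (fun p => p.2 ^ m * F p) := by
  induction m with
  | zero => simpa using h
  | succ m ih =>
    have := VanishesTo.snd_mul hM hJ h0 ((contDiffOn_snd.pow m).mul hF) ih
    simpa only [pow_succ', mul_assoc, ← add_assoc] using this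

theorem dr_iterate_pow_mul (hM : IsOpen M) (hJ : IsOpen J) (h0 : (0 : ℝ) ∈ J)
    {F : E × ℝ → ℝ} (hF : ContDiffOn ℝ ∞ F (M ×ˢ J)) (m k : ℕ) {x : E} (hx : x ∈ M) :
    dr^[m + k] (fun p => p.2 ^ m * F p) (x, 0) =
      (m + k).descFactorial m * dr^[k] F (x, 0) := by
  induction m with
  | zero => simp
  | succ m ih =>
    have := dr_iterate_snd_mul hM hJ h0 ((contDiffOn_snd.pow m).mul hF) (m + 1 + k) hx
    rw [show m + 1 + k - 1 = m + k by omega, ih] at this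
    simp only [pow_succ', mul_assoc]
    rw [this, show m + 1 + k = (m + k) + 1 by ring, Nat.succ_descFactorial_succ]
    push_cast; ring

/-- A function that vanishes to order `k` at `ρ = 0` is `O(ρ^k)`, locally uniformly. -/
theorem VanishesTo.isBigO (hM : IsOpen M) (hJ : IsOpen J) (h0 : (0 : ℝ) ∈ J)
    {F : E × ℝ → ℝ} (hF : ContDiffOn ℝ ∞ F (M ×ˢ J)) {k : ℕ} (h : VanishesTo M k F)
    {x : E} (hx : x ∈ M) : F =O[𝓝 (x, (0 : ℝ))] fun p => p.2 ^ k := by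
  have hU := hM.prod hJ
  have hp : (x, (0 : ℝ)) ∈ M ×ˢ J := mk_mem_prod hx h0
  induction k generalizing F with
  | zero =>
    simpa using (hF.continuousOn.continuousAt (hU.mem_nhds hp)).isBigO_one (F := ℝ)
  | succ k ih =>
    obtain ⟨h1, h2⟩ := vanishesTo_succ.1 h
    obtain ⟨C, hCnonneg, hC'⟩ := (ih (ContDiffOn.dr hF hU) h2).exists_nonneg
    have hC := hC'.bound
    -- The ball contains the vertical segment from `(p.1, 0)` to each of its points `p`, so the mean
    -- value inequality integrates the bound on `dr F` with a constant uniform in `x`.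
    obtain ⟨r, hr, hball⟩ := Metric.mem_nhds_iff.1 (inter_mem hC (hU.mem_nhds hp))
    refine Asymptotics.IsBigO.of_bound C ?_
    filter_upwards [Metric.ball_mem_nhds (x, (0 : ℝ)) hr] with p hpr
    have hsub : ∀ s ∈ Metric.closedBall (0 : ℝ) |p.2|, (p.1, s) ∈ Metric.ball (x, (0 : ℝ)) r := by
      intro s hs
      simp only [Metric.mem_ball, Prod.dist_eq, Real.dist_eq, sub_zero, max_lt_iff] at hpr ⊢
      simp only [Metric.mem_closedBall, Real.dist_eq, sub_zero] at hs
      exact ⟨hpr.1, hs.trans_lt hpr.2⟩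
    have hder : ∀ s ∈ Metric.closedBall (0 : ℝ) |p.2|,
        HasDerivWithinAt (fun s => F (p.1, s)) (dr F (p.1, s)) (Metric.closedBall 0 |p.2|) s :=
      fun s hs => (dr_slice hU hF (hball (hsub s hs)).2).hasDerivWithinAt
    have hC0 : ∀ s ∈ Metric.closedBall (0 : ℝ) |p.2|, ‖dr F (p.1, s)‖ ≤ C * |p.2| ^ k := by
      intro s hs
      have h3 := (hball (hsub s hs)).1
      simp only [mem_ofPred_eq, norm_pow, Real.norm_eq_abs] at h3 ⊢
      simp only [Metric.mem_closedBall, Real.dist_eq, sub_zero] at hs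
      exact h3.trans (by gcongr)
    have := (convex_closedBall (0 : ℝ) |p.2|).norm_image_sub_le_of_norm_hasDerivWithin_le
      hder hC0 (x := 0) (y := p.2) (by simp) (by simp)
    have hp1 : p.1 ∈ M := (hball hpr).2.1
    rw [h1 p.1 hp1] at this
    simpa [pow_succ, mul_assoc] using this

/-- Subtracting the leading Taylor coefficient raises the order of vanishing. -/
theorem VanishesTo.sub_leading (hM : IsOpen M) (hJ : IsOpen J) (h0 : (0 : ℝ) ∈ J)
    {F : E × ℝ → ℝ} (hF : ContDiffOn ℝ ∞ F (M ×ˢ J)) {k : ℕ} (h : VanishesTo M k F) :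
    ContDiffOn ℝ ∞ (fun p => p.2 ^ k * (dr^[k] F (p.1, 0) / k.factorial)) (M ×ˢ J) ∧
    VanishesTo M (k + 1) fun p => F p - p.2 ^ k * (dr^[k] F (p.1, 0) / k.factorial) := by
  have hU := hM.prod hJ
  have hc : ContDiffOn ℝ ∞ (fun p : E × ℝ => dr^[k] F (p.1, 0) / k.factorial) (M ×ˢ J) := by
    refine ContDiffOn.div_const ?_ _
    exact (ContDiffOn.dr_iterate hF hU k).comp (contDiffOn_fst.prodMk contDiffOn_const)
      (fun p hp => mk_mem_prod hp.1 h0)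
  have hs := (contDiffOn_snd (𝕜 := ℝ) (s := M ×ˢ J) (n := ∞)).pow k |>.mul hc
  refine ⟨hs, vanishesTo_succ'.2 ⟨?_, fun x hx => ?_⟩⟩
  · refine VanishesTo.sub hM hJ h0 hF hs h ?_
    simpa using VanishesTo.pow_mul hM hJ h0 hc vanishesTo_zero k
  · rw [dr_iterate_sub hU hF hs k (mk_mem_prod hx h0)]
    have := dr_iterate_pow_mul hM hJ h0 hc k 0 hx
    simp only [add_zero, Nat.descFactorial_self, Function.iterate_zero, id] at this
    simp only [this]
    field_simp
    ring

/-- A smooth function that is `O(ρ^k)` as `ρ → 0+`, for each `x`, vanishes to order `k`. -/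
theorem vanishesTo_of_isBigO (hM : IsOpen M) (hJ : IsOpen J) (h0 : (0 : ℝ) ∈ J)
    {F : E × ℝ → ℝ} (hF : ContDiffOn ℝ ∞ F (M ×ˢ J)) {k : ℕ}
    (h : ∀ x ∈ M, (fun ρ => F (x, ρ)) =O[𝓝[>] (0 : ℝ)] fun ρ => ρ ^ k) : VanishesTo M k F := by
  suffices H : ∀ j ≤ k, VanishesTo M j F from H k le_rfl
  intro j
  induction j with
  | zero => exact fun _ => vanishesTo_zero
  | succ j ih =>
    intro hj
    have hv := ih (by omega)
    refine vanishesTo_succ'.2 ⟨hv, fun x hx => ?_⟩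
    obtain ⟨hs, hv'⟩ := VanishesTo.sub_leading hM hJ h0 hF hv
    have h1 := VanishesTo.isBigO hM hJ h0 (hF.sub hs) hv' hx
    have ht : Tendsto (fun ρ : ℝ => (x, ρ)) (𝓝[>] 0) (𝓝 (x, 0)) :=
      (Continuous.tendsto (by fun_prop) 0).mono_left nhdsWithin_le_nhds
    have h2 := h1.comp_tendsto ht
    -- As `j + 1 ≤ k`, both `F` and `F` minus its leading term `ρ^j c` are `O(ρ^{j+1})`. Hence so is
    -- `ρ^j c`, and the constant `c` is `O(ρ)`, that is, zero.
    have h3 : (fun ρ => F (x, ρ)) =O[𝓝[>] (0 : ℝ)] fun ρ => ρ ^ (j + 1) := by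
      refine (h x hx).trans (Asymptotics.IsBigO.of_bound 1 ?_)
      have : Ioo (0 : ℝ) 1 ∈ 𝓝[>] (0 : ℝ) := Ioo_mem_nhdsGT one_pos
      filter_upwards [this] with ρ hρ
      rw [norm_pow, norm_pow, one_mul]
      exact pow_le_pow_of_le_one (norm_nonneg _)
        (by rw [Real.norm_eq_abs, abs_of_pos hρ.1]; exact hρ.2.le) hj
    have h4 := h3.sub h2
    set c := dr^[j] F (x, 0) / j.factorial with hc
    have h5 : (fun ρ : ℝ => ρ ^ j * c) =O[𝓝[>] (0 : ℝ)] fun ρ => ρ ^ j * ρ := by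
      refine (h4.congr (fun ρ => ?_) fun ρ => ?_)
      · simp [hc]
      · simp [pow_succ]
    have h6 : (fun _ : ℝ => c) =O[𝓝[>] (0 : ℝ)] fun ρ => ρ := by
      obtain ⟨C, hC⟩ := h5.bound
      refine Asymptotics.IsBigO.of_bound C ?_
      filter_upwards [hC, self_mem_nhdsWithin] with ρ hρ hρ0
      have hpos : 0 < ‖ρ ^ j‖ := norm_pos_iff.2 (pow_ne_zero _ (ne_of_gt hρ0))
      rw [norm_mul, norm_mul] at hρ
      nlinarith
    have h7 : Tendsto (fun _ : ℝ => c) (𝓝[>] (0 : ℝ)) (𝓝 0) :=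
      h6.trans_tendsto (tendsto_id.mono_left nhdsWithin_le_nhds)
    have h8 : c = 0 := tendsto_nhds_unique tendsto_const_nhds h7
    have : (j.factorial : ℝ) ≠ 0 := by positivity
    exact (div_eq_zero_iff.1 h8).resolve_right this

end Jets

set_option linter.unusedTactic false

/-! ### The Ricci tensor of an ambient metric in terms of `γ` -/

section AmbientRicci

variable {ι : Type*} [Fintype ι] [DecidableEq ι]

/-- The projection `(t, x, ρ) ↦ (x, ρ)`. -/
def ambientProj : (ι ⊕ Fin 2 → ℝ) →L[ℝ] (ι → ℝ) × ℝ :=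
  (ContinuousLinearMap.pi fun i => ContinuousLinearMap.proj (Sum.inl i)).prod
    (ContinuousLinearMap.proj (Sum.inr 1))

theorem ambientProj_apply (y : ι ⊕ Fin 2 → ℝ) :
    ambientProj y = (baseCoord y, rhoCoord y) := rfl

theorem ambientProj_single_inl (i : ι) :
    ambientProj (Pi.single (Sum.inl i) 1 : ι ⊕ Fin 2 → ℝ) = (Pi.single i 1, 0) := by
  refine Prod.ext (funext fun j => ?_) ?_
  · simp [ambientProj_apply, baseCoord, Pi.single_apply]
  · simp [ambientProj_apply, rhoCoord]

theorem ambientProj_single_zero :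
    ambientProj (Pi.single (Sum.inr 0) 1 : ι ⊕ Fin 2 → ℝ) = 0 := by
  refine Prod.ext (funext fun j => ?_) ?_
  · simp [ambientProj_apply, baseCoord]
  · simp [ambientProj_apply, rhoCoord]

theorem ambientProj_single_one :
    ambientProj (Pi.single (Sum.inr 1) 1 : ι ⊕ Fin 2 → ℝ) = (0, 1) := by
  refine Prod.ext (funext fun j => ?_) ?_
  · simp [ambientProj_apply, baseCoord]
  · simp [ambientProj_apply, rhoCoord]

/-- The partial derivative `∂_i F(x, ρ)`. -/
def dz (i : ι) (F : (ι → ℝ) × ℝ → ℝ) : (ι → ℝ) × ℝ → ℝ := dirD (Pi.single i 1, 0) F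

/-- All components of the ambient metric and all its Christoffel symbols have this separated form,
so one product rule supplies every partial derivative. -/
theorem pd_smul_comp (A : ι ⊕ Fin 2) {α : ℝ → ℝ} {F : (ι → ℝ) × ℝ → ℝ} {y : ι ⊕ Fin 2 → ℝ}
    (hα : DifferentiableAt ℝ α (tCoord y)) (hF : DifferentiableAt ℝ F (ambientProj y)) :
    pd A (fun y => α (tCoord y) * F (ambientProj y)) y =
      Sum.elim (fun k => α (tCoord y) * dz k F (ambientProj y))
        ![deriv α (tCoord y) * F (ambientProj y), α (tCoord y) * dr F (ambientProj y)] A := by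
  have h1 : DifferentiableAt ℝ (fun y : ι ⊕ Fin 2 → ℝ => α (tCoord y)) y :=
    hα.comp y (ContinuousLinearMap.proj (R := ℝ) (φ := fun _ : ι ⊕ Fin 2 => ℝ)
      (Sum.inr 0)).differentiableAt
  have h2 : DifferentiableAt ℝ (fun y : ι ⊕ Fin 2 → ℝ => F (ambientProj y)) y :=
    hF.comp y ambientProj.differentiableAt
  have h3 : dirD (Pi.single A 1) (fun y : ι ⊕ Fin 2 → ℝ => α (tCoord y)) y =
      (Pi.single A 1 : ι ⊕ Fin 2 → ℝ) (Sum.inr 0) * deriv α (tCoord y) := by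
    have := dirD_comp_clm (Pi.single A 1 : ι ⊕ Fin 2 → ℝ)
      (ContinuousLinearMap.proj (R := ℝ) (φ := fun _ : ι ⊕ Fin 2 => ℝ) (Sum.inr 0))
      (f := α) (p := y) hα
    refine this.trans ?_
    simp only [dirD, fderiv_eq_smul_deriv, smul_eq_mul]
    rfl
  have h4 := dirD_comp_clm (Pi.single A 1 : ι ⊕ Fin 2 → ℝ) ambientProj hF
  change dirD (Pi.single A 1) _ y = _
  rw [dirD_mul _ h1 h2, h3, h4]
  rcases A with k | a
  · simp [ambientProj_single_inl, dz]
  · fin_cases a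
    · simp [ambientProj_single_zero, dirD]
    · simp [ambientProj_single_one, dr]

theorem pd_comp (A : ι ⊕ Fin 2) {F : (ι → ℝ) × ℝ → ℝ} {y : ι ⊕ Fin 2 → ℝ}
    (hF : DifferentiableAt ℝ F (ambientProj y)) :
    pd A (fun y => F (ambientProj y)) y =
      Sum.elim (fun k => dz k F (ambientProj y)) ![0, dr F (ambientProj y)] A := by
  have := pd_smul_comp A (α := fun _ => 1) (differentiableAt_const _) hF
  simpa using this

theorem pd_tCoord (A : ι ⊕ Fin 2) {α : ℝ → ℝ} {y : ι ⊕ Fin 2 → ℝ}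
    (hα : DifferentiableAt ℝ α (tCoord y)) :
    pd A (fun y => α (tCoord y)) y = Sum.elim (fun _ => 0) ![deriv α (tCoord y), 0] A := by
  have := pd_smul_comp A (F := fun _ => 1) hα (differentiableAt_const _)
  simpa [dz, dr, dirD_const] using this

theorem pd_const {κ : Type*} [Fintype κ] [DecidableEq κ] (A : κ) (c : ℝ) (y : κ → ℝ) :
    pd A (fun _ => c) y = 0 :=
  dirD_const _ _ _

theorem pd_congr {κ : Type*} [Fintype κ] [DecidableEq κ] {W : Set (κ → ℝ)} (hW : IsOpen W)
    {f g : (κ → ℝ) → ℝ} (h : EqOn f g W) (A : κ) : EqOn (pd A f) (pd A g) W :=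
  dirD_congr hW h _

/-! ### Regular families and the Christoffel symbols of the ambient metric. -/

/-- The family `γ(x, ρ)` is a smooth family of nondegenerate symmetric matrices on `U`. -/
structure RegularFamily (U : Set ((ι → ℝ) × ℝ)) (γ : (ι → ℝ) → ℝ → Matrix ι ι ℝ) : Prop where
  isOpen : IsOpen U
  symm : ∀ p ∈ U, (γ p.1 p.2).IsSymm
  det_ne : ∀ p ∈ U, (γ p.1 p.2).det ≠ 0
  smooth : ∀ i j, ContDiffOn ℝ ∞ (fun p : (ι → ℝ) × ℝ => γ p.1 p.2 i j) U

/-- The component `γ_{ij}` as a function of `(x, ρ)`. -/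
def comp (γ : (ι → ℝ) → ℝ → Matrix ι ι ℝ) (i j : ι) (p : (ι → ℝ) × ℝ) : ℝ := γ p.1 p.2 i j

/-- The component `γ^{ij}` of the inverse as a function of `(x, ρ)`. -/
def invComp (γ : (ι → ℝ) → ℝ → Matrix ι ι ℝ) (i j : ι) (p : (ι → ℝ) × ℝ) : ℝ :=
  (γ p.1 p.2)⁻¹ i j

/-- The Christoffel symbol `Γ^k_{ij}` of `γ(·, ρ)` as a function of `(x, ρ)`. -/
def chr (γ : (ι → ℝ) → ℝ → Matrix ι ι ℝ) (k i j : ι) (p : (ι → ℝ) × ℝ) : ℝ :=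
  (1 / 2) * ∑ l, invComp γ k l p *
    (dz i (comp γ j l) p + dz j (comp γ i l) p - dz l (comp γ i j) p)

/-- The endomorphism `½ γ^{kl} γ'_{il}`. -/
def shape (γ : (ι → ℝ) → ℝ → Matrix ι ι ℝ) (k i : ι) (p : (ι → ℝ) × ℝ) : ℝ :=
  (1 / 2) * ∑ l, invComp γ k l p * dr (comp γ i l) p

/-- The Christoffel symbols `Γ^K_{IJ}` of the ambient metric. -/
def ambientChr (γ : (ι → ℝ) → ℝ → Matrix ι ι ℝ) :
    ι ⊕ Fin 2 → ι ⊕ Fin 2 → ι ⊕ Fin 2 → (ι ⊕ Fin 2 → ℝ) → ℝ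
  | .inl k, .inl i, .inl j => fun y => chr γ k i j (ambientProj y)
  | .inl k, .inl i, .inr 0 => fun y => (tCoord y)⁻¹ * if k = i then 1 else 0
  | .inl k, .inr 0, .inl i => fun y => (tCoord y)⁻¹ * if k = i then 1 else 0
  | .inl k, .inl i, .inr 1 => fun y => shape γ k i (ambientProj y)
  | .inl k, .inr 1, .inl i => fun y => shape γ k i (ambientProj y)
  | .inl _, .inr _, .inr _ => fun _ => 0
  | .inr 0, .inl i, .inl j => fun y => tCoord y * (-(1 / 2) * dr (comp γ i j) (ambientProj y))
  | .inr 1, .inl i, .inl j => fun y =>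
      (fun p : (ι → ℝ) × ℝ => p.2 * dr (comp γ i j) p - comp γ i j p) (ambientProj y)
  | .inr 1, .inr 0, .inr 1 => fun y => (tCoord y)⁻¹
  | .inr 1, .inr 1, .inr 0 => fun y => (tCoord y)⁻¹
  | _, _, _ => fun _ => 0

variable {U : Set ((ι → ℝ) × ℝ)} {γ : (ι → ℝ) → ℝ → Matrix ι ι ℝ}

theorem contDiffOn_det {κ E : Type*} [Fintype κ] [DecidableEq κ] [NormedAddCommGroup E]
    [NormedSpace ℝ E] {s : Set E} {A : E → Matrix κ κ ℝ}
    (hA : ∀ i j, ContDiffOn ℝ ∞ (fun p => A p i j) s) : ContDiffOn ℝ ∞ (fun p => (A p).det) s := by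
  simp only [Matrix.det_apply]
  exact ContDiffOn.sum fun σ _ => (contDiffOn_prod fun i _ => hA _ _).const_smul _

/-- Cramer's rule: the adjugate and the determinant are polynomial in the smooth entries. -/
theorem RegularFamily.invComp (h : RegularFamily U γ) (i j : ι) :
    ContDiffOn ℝ ∞ (invComp γ i j) U := by
  have : PPWave.invComp γ i j =
      fun p : (ι → ℝ) × ℝ => (γ p.1 p.2).det⁻¹ * (γ p.1 p.2).adjugate i j := by
    ext p
    simp [PPWave.invComp, Matrix.inv_def]
  rw [this]
  refine ((contDiffOn_det h.smooth).inv h.det_ne).mul ?_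
  simp only [Matrix.adjugate_apply]
  refine contDiffOn_det fun k l => ?_
  simp only [Matrix.updateRow_apply]
  split_ifs
  · exact contDiffOn_const
  · exact h.smooth k l

theorem RegularFamily.comp (h : RegularFamily U γ) (i j : ι) :
    ContDiffOn ℝ ∞ (comp γ i j) U := h.smooth i j

theorem RegularFamily.comp_symm (h : RegularFamily U γ) (i j : ι) :
    EqOn (PPWave.comp γ i j) (PPWave.comp γ j i) U := fun p hp => (h.symm p hp).apply j i

theorem RegularFamily.chr (h : RegularFamily U γ) (k i j : ι) :
    ContDiffOn ℝ ∞ (chr γ k i j) U :=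
  contDiffOn_const.mul (ContDiffOn.sum fun l _ => (h.invComp k l).mul
    (((ContDiffOn.dirD (h.comp j l) h.isOpen _).add (ContDiffOn.dirD (h.comp i l) h.isOpen _)).sub
      (ContDiffOn.dirD (h.comp i j) h.isOpen _)))

theorem RegularFamily.shape (h : RegularFamily U γ) (k i : ι) :
    ContDiffOn ℝ ∞ (shape γ k i) U :=
  contDiffOn_const.mul (ContDiffOn.sum fun l _ => (h.invComp k l).mul
    (ContDiffOn.dr (h.comp i l) h.isOpen))

theorem RegularFamily.chr_symm (h : RegularFamily U γ) (k i j : ι) :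
    EqOn (PPWave.chr γ k i j) (PPWave.chr γ k j i) U := fun p hp => by
  simp only [PPWave.chr]
  congr 1
  refine Finset.sum_congr rfl fun l _ => ?_
  have : dz l (PPWave.comp γ i j) p = dz l (PPWave.comp γ j i) p :=
    dirD_congr h.isOpen (h.comp_symm i j) _ hp
  rw [this]; ring

/-- The part of the ambient space over `U`. -/
def ambientOver (U : Set ((ι → ℝ) × ℝ)) : Set (ι ⊕ Fin 2 → ℝ) :=
  {y | ambientProj y ∈ U ∧ 0 < tCoord y}

theorem isOpen_ambientOver (hU : IsOpen U) : IsOpen (ambientOver U) :=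
  (hU.preimage ambientProj.continuous).inter
    (isOpen_lt continuous_const (continuous_apply (Sum.inr (0 : Fin 2))))

/-- The matrix is block diagonal, and its `(t, ρ)` block has determinant `-t²`. -/
theorem ambientMetric_inv (h : RegularFamily U γ) {y : ι ⊕ Fin 2 → ℝ} (hy : y ∈ ambientOver U) :
    (ambientMetric γ y)⁻¹ =
      Matrix.fromBlocks ((tCoord y ^ 2)⁻¹ • (γ (baseCoord y) (rhoCoord y))⁻¹) 0 0
        !![0, (tCoord y)⁻¹; (tCoord y)⁻¹, -(2 * rhoCoord y * (tCoord y ^ 2)⁻¹)] := by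
  have ht : tCoord y ≠ 0 := hy.2.ne'
  have hdet : IsUnit (γ (baseCoord y) (rhoCoord y)).det := (h.det_ne _ hy.1).isUnit
  refine Matrix.inv_eq_right_inv ?_
  rw [ambientMetric, Matrix.fromBlocks_multiply, ← Matrix.fromBlocks_one]
  congr 1
  · rw [Matrix.smul_mul, Matrix.mul_smul, smul_smul, Matrix.mul_nonsing_inv _ hdet]
    simp [ht]
  · simp
  · simp
  · ext i j
    fin_cases i <;> fin_cases j <;> simp [ht]
    field_simp
    ring

theorem pd_metric_inl_inl (h : RegularFamily U γ) {y : ι ⊕ Fin 2 → ℝ} (hy : y ∈ ambientOver U)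
    (A : ι ⊕ Fin 2) (i j : ι) :
    pd A (fun y => ambientMetric γ y (Sum.inl i) (Sum.inl j)) y =
      Sum.elim (fun k => tCoord y ^ 2 * dz k (comp γ i j) (ambientProj y))
        ![2 * tCoord y * comp γ i j (ambientProj y),
          tCoord y ^ 2 * dr (comp γ i j) (ambientProj y)] A := by
  have := pd_smul_comp A (α := fun t => t ^ 2) (y := y) (by fun_prop)
    (ContDiffOn.differentiableAt_of_isOpen (h.comp i j) h.isOpen hy.1)
  simp only [differentiableAt_fun_id, deriv_fun_pow, deriv_id'', Nat.cast_ofNat, mul_one,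
    Nat.add_one_sub_one, pow_one] at this
  exact this

theorem pd_metric_inl_inr (A : ι ⊕ Fin 2) (i : ι) (a : Fin 2) (y : ι ⊕ Fin 2 → ℝ) :
    pd A (fun y => ambientMetric γ y (Sum.inl i) (Sum.inr a)) y = 0 :=
  pd_const _ _ _

theorem pd_metric_inr_inl (A : ι ⊕ Fin 2) (i : ι) (a : Fin 2) (y : ι ⊕ Fin 2 → ℝ) :
    pd A (fun y => ambientMetric γ y (Sum.inr a) (Sum.inl i)) y = 0 :=
  pd_const _ _ _

theorem pd_metric_zero_zero (A : ι ⊕ Fin 2) (y : ι ⊕ Fin 2 → ℝ) :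
    pd A (fun y => ambientMetric γ y (Sum.inr 0) (Sum.inr 0)) y =
      Sum.elim (fun _ => 0) ![0, 2] A := by
  have := pd_comp A (F := fun p : (ι → ℝ) × ℝ => 2 * p.2) (y := y) (by fun_prop)
  have h1 : dr (fun p : (ι → ℝ) × ℝ => 2 * p.2) (ambientProj y) = 2 := by
    rw [dr, dirD_const_mul _ _ (by fun_prop)]
    have := dr_snd (ambientProj y)
    rw [dr] at this
    rw [this, mul_one]
  have h2 : ∀ k, dz k (fun p : (ι → ℝ) × ℝ => 2 * p.2) (ambientProj y) = 0 := fun k => by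
    rw [dz, dirD_const_mul _ _ (by fun_prop)]
    have := dirD_clm ((Pi.single k 1 : ι → ℝ), (0 : ℝ)) (ContinuousLinearMap.snd ℝ (ι → ℝ) ℝ)
      (ambientProj y)
    simp only [ContinuousLinearMap.coe_snd'] at this
    rw [this, mul_zero]
  simp only [h1, h2] at this
  exact this

theorem pd_metric_zero_one (A : ι ⊕ Fin 2) (y : ι ⊕ Fin 2 → ℝ) :
    pd A (fun y => ambientMetric γ y (Sum.inr 0) (Sum.inr 1)) y =
      Sum.elim (fun _ => 0) ![1, 0] A := by
  have := pd_tCoord A (α := fun t => t) (y := y) (by fun_prop)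
  rw [deriv_id''] at this
  exact this

theorem pd_metric_one_zero (A : ι ⊕ Fin 2) (y : ι ⊕ Fin 2 → ℝ) :
    pd A (fun y => ambientMetric γ y (Sum.inr 1) (Sum.inr 0)) y =
      Sum.elim (fun _ => 0) ![1, 0] A := by
  have := pd_tCoord A (α := fun t => t) (y := y) (by fun_prop)
  rw [deriv_id''] at this
  exact this

theorem pd_metric_one_one (A : ι ⊕ Fin 2) (y : ι ⊕ Fin 2 → ℝ) :
    pd A (fun y => ambientMetric γ y (Sum.inr 1) (Sum.inr 1)) y = 0 :=
  pd_const _ _ _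

theorem sum_inv_mul_comp (h : RegularFamily U γ) {p : (ι → ℝ) × ℝ} (hp : p ∈ U) (k i : ι) :
    ∑ l, invComp γ k l p * comp γ i l p = if k = i then 1 else 0 := by
  have hdet : IsUnit (γ p.1 p.2).det := (h.det_ne _ hp).isUnit
  have := congrFun (congrFun (Matrix.nonsing_inv_mul _ hdet) k) i
  rw [Matrix.mul_apply, Matrix.one_apply] at this
  rw [← this]
  exact Finset.sum_congr rfl fun l _ => by
    simp only [comp, invComp]
    rw [(h.symm p hp).apply]

/-- A check over the index types. The mixed symbols with one index `t` reduce to `γ^{kl} γ_{il} =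
δ^k_i`, those with one index `ρ` to the definition of `shape`. -/
theorem christoffel_ambient (h : RegularFamily U γ) (K I J : ι ⊕ Fin 2) :
    EqOn (christoffel (ambientMetric γ) K I J) (ambientChr γ K I J) (ambientOver U) := by
  intro y hy
  have ht : tCoord y ≠ 0 := hy.2.ne'
  have hinv : ∀ k l, (γ (baseCoord y) (rhoCoord y))⁻¹ k l = invComp γ k l (ambientProj y) :=
    fun _ _ => rfl
  have hsum := sum_inv_mul_comp h hy.1
  have hρ : (ambientProj y).2 = rhoCoord y := rfl
  rcases K with k | a <;> rcases I with i | b <;> rcases J with j | c <;>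
    (try fin_cases a) <;> (try fin_cases b) <;> (try fin_cases c) <;>
    simp only [Fin.zero_eta, Fin.mk_one, ambientChr, christoffel, Fintype.sum_sum_type,
      Fin.sum_univ_two, ambientMetric_inv h hy,
      pd_metric_inl_inl h hy, pd_metric_inl_inr, pd_metric_inr_inl, pd_metric_zero_zero,
      pd_metric_zero_one, pd_metric_one_zero, pd_metric_one_one, Matrix.fromBlocks_apply₁₁,
      Matrix.fromBlocks_apply₁₂, Matrix.fromBlocks_apply₂₁, Matrix.fromBlocks_apply₂₂,
      Sum.elim_inl, Sum.elim_inr, Matrix.zero_apply, Matrix.smul_apply, smul_eq_mul,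
      Matrix.cons_val_zero, Matrix.cons_val_one, Matrix.of_apply, zero_mul, mul_zero, add_zero,
      Finset.sum_const_zero, zero_add, sub_zero, hinv, hρ, sub_self, neg_mul, zero_sub,
      Matrix.cons_val_fin_one, Matrix.cons_val']
  all_goals first
    | rfl
    | (field_simp; done)
    | (field_simp; ring; done)
    | (rw [chr]; congr 1; refine Finset.sum_congr rfl fun l _ => ?_; field_simp; done)
    | (rw [shape]; congr 1; refine Finset.sum_congr rfl fun l _ => ?_; field_simp; done)
    | (rw [← hsum, Finset.mul_sum, Finset.mul_sum]; refine Finset.sum_congr rfl fun l _ => ?_;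
       field_simp; done)

theorem pd_chr (h : RegularFamily U γ) {y : ι ⊕ Fin 2 → ℝ} (hy : y ∈ ambientOver U)
    (A : ι ⊕ Fin 2) (k i j : ι) :
    pd A (fun y => chr γ k i j (ambientProj y)) y =
      Sum.elim (fun l => dz l (chr γ k i j) (ambientProj y))
        ![0, dr (chr γ k i j) (ambientProj y)] A :=
  pd_comp A (ContDiffOn.differentiableAt_of_isOpen (h.chr k i j) h.isOpen hy.1)

theorem pd_shape (h : RegularFamily U γ) {y : ι ⊕ Fin 2 → ℝ} (hy : y ∈ ambientOver U)
    (A : ι ⊕ Fin 2) (k i : ι) :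
    pd A (fun y => shape γ k i (ambientProj y)) y =
      Sum.elim (fun l => dz l (shape γ k i) (ambientProj y))
        ![0, dr (shape γ k i) (ambientProj y)] A :=
  pd_comp A (ContDiffOn.differentiableAt_of_isOpen (h.shape k i) h.isOpen hy.1)

theorem pd_inv_tCoord {y : ι ⊕ Fin 2 → ℝ} (ht : tCoord y ≠ 0) (A : ι ⊕ Fin 2) (c : ℝ) :
    pd A (fun y => (tCoord y)⁻¹ * c) y =
      Sum.elim (fun _ => 0) ![-(tCoord y ^ 2)⁻¹ * c, 0] A := by
  have := pd_tCoord A (α := fun t => t⁻¹ * c) (y := y)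
    ((differentiableAt_inv ht).mul_const c)
  rw [deriv_mul_const (differentiableAt_inv ht), deriv_inv] at this
  exact this

theorem pd_inv_tCoord' {y : ι ⊕ Fin 2 → ℝ} (ht : tCoord y ≠ 0) (A : ι ⊕ Fin 2) :
    pd A (fun y => (tCoord y)⁻¹) y = Sum.elim (fun _ => 0) ![-(tCoord y ^ 2)⁻¹, 0] A := by
  simpa using pd_inv_tCoord ht A 1

theorem pd_chr_zero (h : RegularFamily U γ) {y : ι ⊕ Fin 2 → ℝ} (hy : y ∈ ambientOver U)
    (i j : ι) :
    pd (Sum.inr 0) (fun y => tCoord y * (-(1 / 2) * dr (comp γ i j) (ambientProj y))) y =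
      -(1 / 2) * dr (comp γ i j) (ambientProj y) := by
  have := pd_smul_comp (Sum.inr 0) (α := fun t => t)
    (F := fun p => -(1 / 2) * dr (comp γ i j) p) (y := y) (by fun_prop)
    (ContDiffOn.differentiableAt_of_isOpen
      (contDiffOn_const.mul (ContDiffOn.dr (h.comp i j) h.isOpen)) h.isOpen hy.1)
  simpa using this

theorem pd_chr_one (h : RegularFamily U γ) {y : ι ⊕ Fin 2 → ℝ} (hy : y ∈ ambientOver U)
    (i j : ι) :
    pd (Sum.inr 1) (fun y => (ambientProj y).2 * dr (comp γ i j) (ambientProj y) -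
        comp γ i j (ambientProj y)) y =
      rhoCoord y * dr (dr (comp γ i j)) (ambientProj y) := by
  have h1 := h.comp i j
  have h2 := ContDiffOn.dr h1 h.isOpen
  have h3 : ContDiffOn ℝ ∞ (fun p : (ι → ℝ) × ℝ => p.2 * dr (comp γ i j) p) U :=
    contDiffOn_snd.mul h2
  have := pd_comp (Sum.inr 1) (F := fun p => p.2 * dr (comp γ i j) p - comp γ i j p) (y := y)
    (ContDiffOn.differentiableAt_of_isOpen (h3.sub h1) h.isOpen hy.1)
  rw [this]
  have e1 := dirD_sub ((0 : ι → ℝ), (1 : ℝ))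
    (ContDiffOn.differentiableAt_of_isOpen h3 h.isOpen hy.1)
    (ContDiffOn.differentiableAt_of_isOpen h1 h.isOpen hy.1)
  have e2 := dr_mul h.isOpen contDiffOn_snd h2 hy.1
  simp only [dr_snd] at e2
  change dirD _ _ _ = _
  rw [e1]
  change dr _ _ - dr _ _ = _
  rw [e2]
  change 1 * _ + rhoCoord y * _ - _ = _
  ring

/-- Christoffel symbols also enter through their derivatives, so the replacement needs the equality
on an open set and not only at `y`. -/
theorem ricci_ambient (h : RegularFamily U γ) {y : ι ⊕ Fin 2 → ℝ} (hy : y ∈ ambientOver U)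
    (I J : ι ⊕ Fin 2) : ricci (ambientMetric γ) I J y =
      ∑ K, (pd K (ambientChr γ K I J) y - pd J (ambientChr γ K I K) y) +
      ∑ K, ∑ L, (ambientChr γ K K L y * ambientChr γ L I J y -
        ambientChr γ K J L y * ambientChr γ L I K y) := by
  have hW := isOpen_ambientOver h.isOpen
  simp only [ricci, christoffel_ambient h _ _ _ hy]
  congr 1
  refine Finset.sum_congr rfl fun K _ => ?_
  rw [pd_congr hW (christoffel_ambient h K I J) K hy, pd_congr hW (christoffel_ambient h K I K) J hy]

/-! ### Components of the ambient Ricci tensor. -/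

/-- The Ricci tensor of `γ(·, ρ)`. -/
def baseRicci (γ : (ι → ℝ) → ℝ → Matrix ι ι ℝ) (i j : ι) (p : (ι → ℝ) × ℝ) : ℝ :=
  ∑ k, (dz k (chr γ k i j) p - dz j (chr γ k i k) p) +
    ∑ k, ∑ l, (chr γ k k l p * chr γ l i j p - chr γ k j l p * chr γ l i k p)

/-- Lowering the index of `shape` returns `½γ'`. This collapses the products of `shape` with the
summand `-γ_{ik}` of `Γ^ρ_{ik}`. -/
theorem sum_comp_mul_shape (h : RegularFamily U γ) {p : (ι → ℝ) × ℝ} (hp : p ∈ U) (i j : ι) :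
    ∑ k, comp γ i k p * shape γ k j p = (1 / 2) * dr (comp γ j i) p := by
  have hdet : IsUnit (γ p.1 p.2).det := (h.det_ne _ hp).isUnit
  have key : ∀ l, ∑ k, comp γ i k p * invComp γ k l p = if i = l then 1 else 0 := fun l => by
    have := congrFun (congrFun (Matrix.mul_nonsing_inv _ hdet) i) l
    rwa [Matrix.mul_apply, Matrix.one_apply] at this
  calc ∑ k, comp γ i k p * shape γ k j p
      = (1 / 2) * ∑ l, (∑ k, comp γ i k p * invComp γ k l p) * dr (comp γ j l) p := by
        simp only [shape, Finset.mul_sum, Finset.sum_mul]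
        rw [Finset.sum_comm]
        exact Finset.sum_congr rfl fun l _ => Finset.sum_congr rfl fun k _ => by ring
    _ = _ := by simp [key]

/-- The coefficient `1 - n/2` of `γ'` collects `-1/2` from `∂_t Γ^t_{ij}`, `-(n + 1)/2` from the
trace `Γ^K_{Kt} = (n + 1)/t` against `Γ^t_{ij}`, and `2` from the quadratic terms. -/
theorem ricci_inl_inl (h : RegularFamily U γ) {y : ι ⊕ Fin 2 → ℝ} (hy : y ∈ ambientOver U)
    (i j : ι) : ricci (ambientMetric γ) (Sum.inl i) (Sum.inl j) y =
      (fun p : (ι → ℝ) × ℝ => baseRicci γ i j p + p.2 * dr (dr (comp γ i j)) p -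
        ((Fintype.card ι : ℝ) / 2 - 1) * dr (comp γ i j) p -
        (∑ k, shape γ k k p) * comp γ i j p + p.2 * ((∑ k, shape γ k k p) * dr (comp γ i j) p -
          ∑ k, (shape γ k j p * dr (comp γ i k) p + shape γ k i p * dr (comp γ j k) p)))
        (ambientProj y) := by
  have ht : tCoord y ≠ 0 := hy.2.ne'
  have hc : ∀ A (c : ℝ), pd A (fun _ : ι ⊕ Fin 2 → ℝ => c) y = 0 := fun A c => pd_const A c y
  have e1 := sum_comp_mul_shape h hy.1 i j
  have e2 := sum_comp_mul_shape h hy.1 j i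
  rw [ricci_ambient h hy]
  simp only [Fintype.sum_sum_type, Fin.sum_univ_two]
  simp only [ambientChr]
  simp only [hc]
  simp only [pd_chr h hy, pd_chr_zero h hy,
    pd_chr_one h hy, pd_shape h hy, pd_inv_tCoord ht, pd_inv_tCoord' ht, baseRicci,
    Sum.elim_inl, Sum.elim_inr, Matrix.cons_val_zero, Matrix.cons_val_one]
  simp only [zero_mul, mul_zero, add_zero, zero_add, sub_zero, Finset.sum_const_zero,
    Finset.sum_sub_distrib, Finset.sum_add_distrib, mul_ite, ite_mul, mul_one, one_mul,
    Finset.sum_ite_eq, Finset.sum_ite_eq', Finset.mem_univ, if_true, mul_sub, sub_mul]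
  have hρ : (ambientProj y).2 = rhoCoord y := rfl
  have e3 : dr (comp γ j i) (ambientProj y) = dr (comp γ i j) (ambientProj y) :=
    dirD_congr h.isOpen (h.comp_symm j i) _ hy.1
  have s1 : ∀ c, (tCoord y)⁻¹ * (tCoord y * c) = c := fun c => inv_mul_cancel_left₀ ht c
  have s2 : ∀ c, tCoord y * c * (tCoord y)⁻¹ = c := fun c => by field_simp
  have s3 : ∀ a b : ι → ℝ, ∑ x, a x * (rhoCoord y * b x) = rhoCoord y * ∑ x, a x * b x :=
    fun a b => by
      rw [Finset.mul_sum]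
      exact Finset.sum_congr rfl fun x _ => by ring
  have s4 : ∀ a b : ι → ℝ, ∑ x, rhoCoord y * a x * b x = rhoCoord y * ∑ x, b x * a x :=
    fun a b => by
      rw [Finset.mul_sum]
      exact Finset.sum_congr rfl fun x _ => by ring
  have e1' : ∑ x, shape γ x j (ambientProj y) * comp γ i x (ambientProj y) =
      1 / 2 * dr (comp γ j i) (ambientProj y) := by
    rw [← e1]
    exact Finset.sum_congr rfl fun x _ => mul_comm _ _
  simp only [hρ, s1, s2, s3, s4, e1', e2, e3, ← Finset.sum_mul, Finset.sum_const,
    Finset.card_univ, nsmul_eq_mul]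
  ring

theorem ricci_one_one (h : RegularFamily U γ) {y : ι ⊕ Fin 2 → ℝ} (hy : y ∈ ambientOver U) :
    ricci (ambientMetric γ) (Sum.inr 1) (Sum.inr 1) y =
      (fun p : (ι → ℝ) × ℝ => -(∑ k, dr (shape γ k k) p) -
        ∑ k, ∑ l, shape γ k l p * shape γ l k p) (ambientProj y) := by
  have ht : tCoord y ≠ 0 := hy.2.ne'
  have hc : ∀ A (c : ℝ), pd A (fun _ : ι ⊕ Fin 2 → ℝ => c) y = 0 := fun A c => pd_const A c y
  rw [ricci_ambient h hy]
  simp only [Fintype.sum_sum_type, Fin.sum_univ_two]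
  simp only [ambientChr]
  simp only [hc]
  simp [pd_shape h hy, pd_inv_tCoord ht,
    pd_inv_tCoord' ht, Finset.sum_sub_distrib]
  ring

/-- The Euler field `T = t∂_t` satisfies `∇T = id`, so the curvature annihilates `T` and every Ricci
component with an index `t` vanishes identically. Here and below this is verified on components. -/
theorem ricci_zero_zero (h : RegularFamily U γ) {y : ι ⊕ Fin 2 → ℝ} (hy : y ∈ ambientOver U) :
    ricci (ambientMetric γ) (Sum.inr 0) (Sum.inr 0) y = 0 := by
  have ht : tCoord y ≠ 0 := hy.2.ne'
  have hc : ∀ A (c : ℝ), pd A (fun _ : ι ⊕ Fin 2 → ℝ => c) y = 0 := fun A c => pd_const A c y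
  rw [ricci_ambient h hy]
  simp only [Fintype.sum_sum_type, Fin.sum_univ_two]
  simp only [ambientChr]
  simp only [hc]
  simp only [Sum.elim_inl, Sum.elim_inr,
    Matrix.cons_val_zero, Matrix.cons_val_one, pd_inv_tCoord ht,
    pd_inv_tCoord' ht, Finset.sum_sub_distrib]
  simp
  field_simp
  ring

theorem ricci_zero_one (h : RegularFamily U γ) {y : ι ⊕ Fin 2 → ℝ} (hy : y ∈ ambientOver U) :
    ricci (ambientMetric γ) (Sum.inr 0) (Sum.inr 1) y = 0 := by
  have ht : tCoord y ≠ 0 := hy.2.ne'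
  have hc : ∀ A (c : ℝ), pd A (fun _ : ι ⊕ Fin 2 → ℝ => c) y = 0 := fun A c => pd_const A c y
  rw [ricci_ambient h hy]
  simp only [Fintype.sum_sum_type, Fin.sum_univ_two]
  simp only [ambientChr]
  simp only [hc]
  simp only [Sum.elim_inl, Sum.elim_inr,
    Matrix.cons_val_zero, Matrix.cons_val_one, pd_inv_tCoord ht,
    pd_inv_tCoord' ht, Finset.sum_sub_distrib]
  simp

theorem ricci_one_zero (h : RegularFamily U γ) {y : ι ⊕ Fin 2 → ℝ} (hy : y ∈ ambientOver U) :
    ricci (ambientMetric γ) (Sum.inr 1) (Sum.inr 0) y = 0 := by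
  have ht : tCoord y ≠ 0 := hy.2.ne'
  have hc : ∀ A (c : ℝ), pd A (fun _ : ι ⊕ Fin 2 → ℝ => c) y = 0 := fun A c => pd_const A c y
  rw [ricci_ambient h hy]
  simp only [Fintype.sum_sum_type, Fin.sum_univ_two]
  simp only [ambientChr]
  simp only [hc]
  simp only [Sum.elim_inl, Sum.elim_inr,
    Matrix.cons_val_zero, Matrix.cons_val_one, pd_shape h hy, pd_inv_tCoord ht,
    pd_inv_tCoord' ht, Finset.sum_sub_distrib]
  simp [mul_comm]

theorem ricci_inl_zero (h : RegularFamily U γ) {y : ι ⊕ Fin 2 → ℝ} (hy : y ∈ ambientOver U)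
    (i : ι) : ricci (ambientMetric γ) (Sum.inl i) (Sum.inr 0) y = 0 := by
  have ht : tCoord y ≠ 0 := hy.2.ne'
  have hc : ∀ A (c : ℝ), pd A (fun _ : ι ⊕ Fin 2 → ℝ => c) y = 0 := fun A c => pd_const A c y
  have hs : ∀ k, chr γ k k i (ambientProj y) = chr γ k i k (ambientProj y) := fun k =>
    h.chr_symm k k i hy.1
  rw [ricci_ambient h hy]
  simp only [Fintype.sum_sum_type, Fin.sum_univ_two]
  simp only [ambientChr]
  simp only [hc]
  simp only [Sum.elim_inl, Sum.elim_inr,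
    Matrix.cons_val_zero, Matrix.cons_val_one, pd_chr h hy, pd_inv_tCoord ht,
    pd_inv_tCoord' ht, Finset.sum_sub_distrib, hs]
  simp [sub_eq_zero, mul_comm]
  exact Finset.sum_congr rfl fun k _ => by rw [hs k]

theorem ricci_zero_inl (h : RegularFamily U γ) {y : ι ⊕ Fin 2 → ℝ} (hy : y ∈ ambientOver U)
    (i : ι) : ricci (ambientMetric γ) (Sum.inr 0) (Sum.inl i) y = 0 := by
  have ht : tCoord y ≠ 0 := hy.2.ne'
  have hc : ∀ A (c : ℝ), pd A (fun _ : ι ⊕ Fin 2 → ℝ => c) y = 0 := fun A c => pd_const A c y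
  have hs : ∀ k, chr γ k k i (ambientProj y) = chr γ k i k (ambientProj y) := fun k =>
    h.chr_symm k k i hy.1
  rw [ricci_ambient h hy]
  simp only [Fintype.sum_sum_type, Fin.sum_univ_two]
  simp only [ambientChr]
  simp only [hc]
  simp only [Sum.elim_inl, Sum.elim_inr,
    Matrix.cons_val_zero, Matrix.cons_val_one, pd_chr h hy, pd_inv_tCoord ht,
    pd_inv_tCoord' ht, Finset.sum_sub_distrib, hs]
  simp [sub_eq_zero, mul_comm]
  exact Finset.sum_congr rfl fun k _ => by rw [hs k]

/-- The components `(i, ρ)` and `(ρ, i)` are expanded separately, so that no symmetry of `ricci` is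
needed. Here the trace appears as `∂_ρ Γ^k_{ik}`, there as `∂_i` of the trace of `shape`. -/
theorem ricci_inl_one (h : RegularFamily U γ) {y : ι ⊕ Fin 2 → ℝ} (hy : y ∈ ambientOver U)
    (i : ι) : ricci (ambientMetric γ) (Sum.inl i) (Sum.inr 1) y =
      (fun p : (ι → ℝ) × ℝ => ∑ k, (dz k (shape γ k i) p - dr (chr γ k i k) p) +
        ∑ k, ∑ l, (chr γ k k l p * shape γ l i p - shape γ k l p * chr γ l i k p))
        (ambientProj y) := by
  have ht : tCoord y ≠ 0 := hy.2.ne'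
  have hc : ∀ A (c : ℝ), pd A (fun _ : ι ⊕ Fin 2 → ℝ => c) y = 0 := fun A c => pd_const A c y
  rw [ricci_ambient h hy]
  simp only [Fintype.sum_sum_type, Fin.sum_univ_two]
  simp only [ambientChr]
  simp only [hc]
  simp only [Sum.elim_inl, Sum.elim_inr,
    Matrix.cons_val_zero, Matrix.cons_val_one, pd_chr h hy, pd_shape h hy,
    pd_inv_tCoord ht, pd_inv_tCoord' ht, Finset.sum_sub_distrib]
  simp

theorem ricci_one_inl (h : RegularFamily U γ) {y : ι ⊕ Fin 2 → ℝ} (hy : y ∈ ambientOver U)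
    (i : ι) : ricci (ambientMetric γ) (Sum.inr 1) (Sum.inl i) y =
      (fun p : (ι → ℝ) × ℝ => ∑ k, (dz k (shape γ k i) p - dz i (shape γ k k) p) +
        ∑ k, ∑ l, (chr γ k k l p * shape γ l i p - chr γ k i l p * shape γ l k p))
        (ambientProj y) := by
  have ht : tCoord y ≠ 0 := hy.2.ne'
  have hc : ∀ A (c : ℝ), pd A (fun _ : ι ⊕ Fin 2 → ℝ => c) y = 0 := fun A c => pd_const A c y
  rw [ricci_ambient h hy]
  simp only [Fintype.sum_sum_type, Fin.sum_univ_two]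
  simp only [ambientChr]
  simp only [hc]
  simp only [Sum.elim_inl, Sum.elim_inr,
    Matrix.cons_val_zero, Matrix.cons_val_one, pd_chr h hy, pd_shape h hy,
    pd_inv_tCoord ht, pd_inv_tCoord' ht, Finset.sum_sub_distrib]
  simp

end AmbientRicci

/-! ### The ambient Ricci tensor of a family of pp-waves -/

section PPRicci

variable {ι : Type*} [Fintype ι] [DecidableEq ι]
variable {U : Set ((ι → ℝ) × ℝ)} {γ : (ι → ℝ) → ℝ → Matrix ι ι ℝ}

/-- The family `γ` has the form `c + F e ⊗ e` for a constant metric `c` with inverse `c'` and a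
null covector `e`, with dual vector `m`, such that `F` is constant in the direction `m`. -/
structure IsPPFamily (U : Set ((ι → ℝ) × ℝ)) (γ : (ι → ℝ) → ℝ → Matrix ι ι ℝ)
    (c c' : Matrix ι ι ℝ) (e m : ι → ℝ) (F : (ι → ℝ) × ℝ → ℝ) : Prop where
  regular : RegularFamily U γ
  smooth : ContDiffOn ℝ ∞ F U
  comp_eq : ∀ i j, EqOn (comp γ i j) (fun p => c i j + F p * (e i * e j)) U
  inv_eq : ∀ i j, EqOn (invComp γ i j) (fun p => c' i j - F p * (m i * m j)) U
  inv_symm : ∀ i j, c' i j = c' j i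
  dual : ∀ k, ∑ l, c' k l * e l = m k
  null : ∑ l, m l * e l = 0
  parallel : EqOn (fun p => ∑ l, m l * dz l F p) (fun _ => 0) U

namespace IsPPFamily

variable {c c' : Matrix ι ι ℝ} {e m : ι → ℝ} {F : (ι → ℝ) × ℝ → ℝ}

theorem dirD_comp (h : IsPPFamily U γ c c' e m F) (i j : ι) (b : (ι → ℝ) × ℝ) :
    EqOn (dirD b (comp γ i j)) (fun p => dirD b F p * (e i * e j)) U := fun p hp => by
  have hd := ContDiffOn.differentiableAt_of_isOpen h.smooth h.regular.isOpen hp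
  rw [dirD_congr h.regular.isOpen (h.comp_eq i j) b hp,
    dirD_add _ (differentiableAt_const _) (hd.mul_const _), dirD_const, dirD_mul_const _ _ hd,
    zero_add]

/-- The gradient of `F` with respect to `c'`. -/
def grad (c' : Matrix ι ι ℝ) (F : (ι → ℝ) × ℝ → ℝ) (k : ι) (p : (ι → ℝ) × ℝ) : ℝ :=
  ∑ l, c' k l * dz l F p

/-- This is the contraction of the inverse `c' - F m ⊗ m` with a Christoffel symbol of the first
kind. In its uses the terms containing `m·e` or `m·dF` drop out. -/
theorem sum_expand (w x f : ι → ℝ) (m' : ι → ℝ) (a b d : ℝ) :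
    ∑ l, (w l - a * m' l) * (b * x l - d * f l) =
      b * ∑ l, w l * x l - a * b * ∑ l, m' l * x l - d * ∑ l, w l * f l +
        a * d * ∑ l, m' l * f l := by
  simp only [Finset.mul_sum, ← Finset.sum_sub_distrib, ← Finset.sum_add_distrib]
  exact Finset.sum_congr rfl fun l _ => by ring

/-- Since `m·e = 0` and `m·dF = 0`, the correction `F m ⊗ m` of the inverse metric contributes
nothing. The symbols are therefore linear in `F`. -/
theorem chr_eq (h : IsPPFamily U γ c c' e m F) (k i j : ι) :
    EqOn (chr γ k i j) (fun p => (1 / 2) * (m k * (dz i F p * e j + dz j F p * e i) -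
      grad c' F k p * (e i * e j))) U := fun p hp => by
  have hd : ∀ l a b, dz l (comp γ a b) p = dz l F p * (e a * e b) := fun l a b =>
    h.dirD_comp a b _ hp
  have hs := sum_expand (c' k) e (fun l => dz l F p) m (F p * m k)
    (dz i F p * e j + dz j F p * e i) (e i * e j)
  have hpar : ∑ l, m l * dz l F p = 0 := h.parallel hp
  simp only [chr, hd, h.inv_eq _ _ hp, grad]
  rw [h.dual, h.null, hpar] at hs
  congr 1
  refine Eq.trans (Finset.sum_congr rfl fun l _ => ?_) (hs.trans ?_) <;> ring

/-- A multiple of `m ⊗ e`; as `m·e = 0`, both its trace and its square vanish. -/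
theorem shape_eq (h : IsPPFamily U γ c c' e m F) (k i : ι) :
    EqOn (shape γ k i) (fun p => (1 / 2) * (dr F p * (m k * e i))) U := fun p hp => by
  have hd : ∀ a b, dr (comp γ a b) p = dr F p * (e a * e b) := fun a b => h.dirD_comp a b _ hp
  have hs := sum_expand (c' k) e e m (F p * m k) (dr F p * e i) 0
  simp only [shape, hd, h.inv_eq _ _ hp]
  rw [h.dual, h.null] at hs
  congr 1
  refine Eq.trans (Finset.sum_congr rfl fun l _ => ?_) (hs.trans ?_) <;> ring

theorem differentiableAt_dz (h : IsPPFamily U γ c c' e m F) (i : ι) {p : (ι → ℝ) × ℝ}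
    (hp : p ∈ U) : DifferentiableAt ℝ (dz i F) p :=
  ContDiffOn.differentiableAt_of_isOpen (ContDiffOn.dirD h.smooth h.regular.isOpen _)
    h.regular.isOpen hp

theorem dirD_chr (h : IsPPFamily U γ c c' e m F) (k i j : ι) (b : (ι → ℝ) × ℝ) :
    EqOn (dirD b (chr γ k i j)) (fun p => (1 / 2) * (m k * (dirD b (dz i F) p * e j +
      dirD b (dz j F) p * e i) - (∑ l, c' k l * dirD b (dz l F) p) * (e i * e j))) U :=
    fun p hp => by
  have hi := h.differentiableAt_dz i hp
  have hj := h.differentiableAt_dz j hp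
  have hl : ∀ l ∈ (Finset.univ : Finset ι), DifferentiableAt ℝ (fun p => c' k l * dz l F p) p :=
    fun l _ => (h.differentiableAt_dz l hp).const_mul _
  have hg : DifferentiableAt ℝ (grad c' F k) p := DifferentiableAt.fun_sum hl
  have e1 : dirD b (grad c' F k) p = ∑ l, c' k l * dirD b (dz l F) p := by
    refine (dirD_sum _ b hl).trans (Finset.sum_congr rfl fun l _ => ?_)
    rw [dirD_const_mul _ _ (h.differentiableAt_dz l hp)]
  have hij : DifferentiableAt ℝ (fun p => dz i F p * e j + dz j F p * e i) p :=
    (hi.mul_const (e j)).add (hj.mul_const (e i))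
  have hA : DifferentiableAt ℝ (fun p => m k * (dz i F p * e j + dz j F p * e i)) p :=
    hij.const_mul _
  have hB : DifferentiableAt ℝ (fun p => grad c' F k p * (e i * e j)) p := hg.mul_const _
  have hAB : DifferentiableAt ℝ (fun p => m k * (dz i F p * e j + dz j F p * e i) -
    grad c' F k p * (e i * e j)) p := hA.sub hB
  rw [dirD_congr h.regular.isOpen (h.chr_eq k i j) b hp,
    dirD_const_mul _ _ hAB, dirD_sub _ hA hB, dirD_const_mul _ _ hij,
    dirD_add _ (hi.mul_const _) (hj.mul_const _), dirD_mul_const _ _ hi, dirD_mul_const _ _ hj,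
    dirD_mul_const _ _ hg, e1]

theorem dirD_shape (h : IsPPFamily U γ c c' e m F) (k i : ι) (b : (ι → ℝ) × ℝ) :
    EqOn (dirD b (shape γ k i)) (fun p => (1 / 2) * (dirD b (dr F) p * (m k * e i))) U :=
    fun p hp => by
  have hd := ContDiffOn.differentiableAt_of_isOpen (ContDiffOn.dr h.smooth h.regular.isOpen)
    h.regular.isOpen hp
  rw [dirD_congr h.regular.isOpen (h.shape_eq k i) b hp,
    dirD_const_mul _ _ (hd.mul_const _), dirD_mul_const _ _ hd]

/-- The relation `m·dF = 0` holds on an open set and can be differentiated. The primed variant moves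
the new derivative inside by symmetry of second derivatives. -/
theorem parallel_dirD (h : IsPPFamily U γ c c' e m F) (b : (ι → ℝ) × ℝ) {p : (ι → ℝ) × ℝ}
    (hp : p ∈ U) : ∑ l, m l * dirD b (dz l F) p = 0 := by
  have := dirD_congr h.regular.isOpen h.parallel b hp
  rw [dirD_const, dirD_sum _ _ fun l _ => (h.differentiableAt_dz l hp).const_mul _] at this
  rw [← this]
  exact Finset.sum_congr rfl fun l _ => by
    rw [dirD_const_mul _ _ (h.differentiableAt_dz l hp)]

theorem parallel_dirD' (h : IsPPFamily U γ c c' e m F) (b : (ι → ℝ) × ℝ) {p : (ι → ℝ) × ℝ}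
    (hp : p ∈ U) : ∑ l, m l * dz l (dirD b F) p = 0 := by
  rw [← h.parallel_dirD b hp]
  exact Finset.sum_congr rfl fun l _ => by
    rw [dz, dz, dirD_comm h.regular.isOpen h.smooth _ _ hp]

theorem sum_inv_mul (h : IsPPFamily U γ c c' e m F) (f : ι → ℝ) :
    ∑ k, (∑ l, c' k l * f l) * e k = ∑ l, m l * f l := by
  simp only [Finset.sum_mul]
  rw [Finset.sum_comm]
  refine Finset.sum_congr rfl fun l _ => ?_
  rw [← h.dual l, Finset.sum_mul]
  exact Finset.sum_congr rfl fun k _ => by rw [h.inv_symm k l]; ring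

theorem grad_null (h : IsPPFamily U γ c c' e m F) {p : (ι → ℝ) × ℝ} (hp : p ∈ U) :
    ∑ k, grad c' F k p * e k = 0 :=
  (h.sum_inv_mul _).trans (h.parallel hp)

theorem trace_shape (h : IsPPFamily U γ c c' e m F) {p : (ι → ℝ) × ℝ} (hp : p ∈ U) :
    ∑ k, shape γ k k p = 0 := by
  simp only [h.shape_eq _ _ hp, ← Finset.mul_sum, h.null, mul_zero]

theorem trace_chr (h : IsPPFamily U γ c c' e m F) (i : ι) {p : (ι → ℝ) × ℝ} (hp : p ∈ U) :
    ∑ k, chr γ k i k p = 0 := by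
  have h1 := h.null
  have h2 : ∑ l, m l * dz l F p = 0 := h.parallel hp
  have h3 := h.grad_null hp
  have : ∑ k, chr γ k i k p = (1 / 2) * (dz i F p * ∑ k, m k * e k + e i * ∑ k, m k * dz k F p -
      e i * ∑ k, grad c' F k p * e k) := by
    simp only [h.chr_eq _ _ _ hp, Finset.mul_sum, ← Finset.sum_sub_distrib,
      ← Finset.sum_add_distrib]
    exact Finset.sum_congr rfl fun k _ => by ring
  rw [this, h1, h2, h3]; ring

theorem trace_dirD_chr (h : IsPPFamily U γ c c' e m F) (b : (ι → ℝ) × ℝ) (i : ι)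
    {p : (ι → ℝ) × ℝ} (hp : p ∈ U) : ∑ k, dirD b (PPWave.chr γ k i k) p = 0 := by
  have hz : EqOn (fun p => ∑ k, PPWave.chr γ k i k p) (fun _ => 0) U := fun p hp =>
    h.trace_chr i hp
  have := dirD_congr h.regular.isOpen hz b hp
  rwa [dirD_const, dirD_sum _ _ fun k _ =>
    ContDiffOn.differentiableAt_of_isOpen (h.regular.chr k i k) h.regular.isOpen hp] at this

/-- The symbols are built from `m ⊗ dF ⊗ e` and `grad F ⊗ e ⊗ e`. The contractions `m·e`, `m·dF` and
`grad F·e` vanish; the one remaining, `grad F·dF`, is multiplied by `m·e` in the second sum. -/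
theorem chr_mul_chr (h : IsPPFamily U γ c c' e m F) (i j : ι) {p : (ι → ℝ) × ℝ} (hp : p ∈ U) :
    ∑ k, ∑ l, PPWave.chr γ k j l p * PPWave.chr γ l i k p = 0 := by
  have h1 := h.null
  have h2 : ∑ l, m l * dz l F p = 0 := h.parallel hp
  have h3 := h.grad_null hp
  -- the product is contracted over `l` first, then over `k`
  have key : ∀ k, ∑ l, PPWave.chr γ k j l p * PPWave.chr γ l i k p =
      -(1 / 4) * (m k * e i * e j * e k) * ∑ l, grad c' F l p * dz l F p := by
    intro k
    have : ∑ l, PPWave.chr γ k j l p * PPWave.chr γ l i k p =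
        (1 / 4) * ((m k * dz j F p - grad c' F k p * e j) * (dz i F p * e k + dz k F p * e i) *
          ∑ l, m l * e l +
        m k * e j * (dz i F p * e k + dz k F p * e i) * ∑ l, m l * dz l F p -
        (m k * dz j F p - grad c' F k p * e j) * (e i * e k) * ∑ l, grad c' F l p * e l -
        m k * e j * (e i * e k) * ∑ l, grad c' F l p * dz l F p) := by
      simp only [h.chr_eq _ _ _ hp, Finset.mul_sum, ← Finset.sum_sub_distrib,
        ← Finset.sum_add_distrib]
      exact Finset.sum_congr rfl fun l _ => by ring
    rw [this, h1, h2, h3]; ring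
  simp only [key, ← Finset.sum_mul]
  have : ∑ k, -(1 / 4) * (m k * e i * e j * e k) = -(1 / 4) * (e i * e j) * ∑ k, m k * e k := by
    rw [Finset.mul_sum]
    exact Finset.sum_congr rfl fun k _ => by ring
  rw [this, h1]; ring

/-- Traces and products of Christoffel symbols vanish, and so do the divergence terms that
differentiate along `m`. Only the divergence of `-½ grad F ⊗ e ⊗ e` is left. -/
theorem baseRicci_eq (h : IsPPFamily U γ c c' e m F) (i j : ι) {p : (ι → ℝ) × ℝ} (hp : p ∈ U) :
    baseRicci γ i j p =
      -(1 / 2) * (∑ k, ∑ l, c' k l * dz k (dz l F) p) * (e i * e j) := by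
  have t0 : ∀ l, ∑ k, PPWave.chr γ k k l p = 0 := fun l => by
    rw [← h.trace_chr l hp]
    exact Finset.sum_congr rfl fun k _ => h.regular.chr_symm k k l hp
  have t1 : ∑ k, ∑ l, PPWave.chr γ k k l p * PPWave.chr γ l i j p = 0 := by
    rw [Finset.sum_comm]
    simp only [← Finset.sum_mul, t0, zero_mul, Finset.sum_const_zero]
  have t2 : ∑ k, dz j (PPWave.chr γ k i k) p = 0 := h.trace_dirD_chr _ i hp
  have t3 : ∑ k, dz k (PPWave.chr γ k i j) p =
      (1 / 2) * (e j * ∑ k, m k * dz k (dz i F) p + e i * ∑ k, m k * dz k (dz j F) p -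
        (∑ k, ∑ l, c' k l * dz k (dz l F) p) * (e i * e j)) := by
    have : ∀ k, dz k (PPWave.chr γ k i j) p = _ := fun k => h.dirD_chr k i j _ hp
    simp only [this, Finset.mul_sum, Finset.sum_mul, ← Finset.sum_sub_distrib,
      ← Finset.sum_add_distrib, mul_sub, mul_add]
    refine Finset.sum_congr rfl fun k _ => ?_
    simp only [dz]
    ring_nf
  rw [baseRicci]
  simp only [Finset.sum_sub_distrib]
  rw [t1, t2, t3, h.chr_mul_chr i j hp]
  have t4 : ∀ i, ∑ k, m k * dz k (dz i F) p = 0 := fun i => h.parallel_dirD' _ hp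
  rw [t4, t4]; ring

theorem shape_mul_shape (h : IsPPFamily U γ c c' e m F) {p : (ι → ℝ) × ℝ} (hp : p ∈ U) :
    ∑ k, ∑ l, PPWave.shape γ k l p * PPWave.shape γ l k p = 0 := by
  have : ∀ k, ∑ l, PPWave.shape γ k l p * PPWave.shape γ l k p =
      (1 / 4) * dr F p ^ 2 * (m k * e k) * ∑ l, m l * e l := fun k => by
    simp only [h.shape_eq _ _ hp, Finset.mul_sum]
    exact Finset.sum_congr rfl fun l _ => by ring
  simp only [this, h.null, mul_zero, Finset.sum_const_zero]

theorem chr_mul_shape (h : IsPPFamily U γ c c' e m F) (i : ι) {p : (ι → ℝ) × ℝ} (hp : p ∈ U) :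
    ∑ k, ∑ l, PPWave.chr γ k i l p * PPWave.shape γ l k p = 0 := by
  have h1 := h.null
  have h2 : ∑ l, m l * dz l F p = 0 := h.parallel hp
  have : ∀ k, ∑ l, PPWave.chr γ k i l p * PPWave.shape γ l k p =
      (1 / 4) * dr F p * e k * ((m k * dz i F p - grad c' F k p * e i) * ∑ l, m l * e l +
        m k * e i * ∑ l, m l * dz l F p) := fun k => by
    simp only [h.chr_eq _ _ _ hp, h.shape_eq _ _ hp, Finset.mul_sum, ← Finset.sum_add_distrib]
    exact Finset.sum_congr rfl fun l _ => by ring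
  simp only [this, h1, h2, mul_zero, add_zero, Finset.sum_const_zero]

theorem div_shape (h : IsPPFamily U γ c c' e m F) (i : ι) {p : (ι → ℝ) × ℝ} (hp : p ∈ U) :
    ∑ k, dz k (PPWave.shape γ k i) p = 0 := by
  have h1 : ∑ k, m k * dz k (dr F) p = 0 := h.parallel_dirD' _ hp
  have : ∑ k, dz k (PPWave.shape γ k i) p = (1 / 2) * e i * ∑ k, m k * dz k (dr F) p := by
    have : ∀ k, dz k (PPWave.shape γ k i) p = _ := fun k => h.dirD_shape k i _ hp
    simp only [this, Finset.mul_sum]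
    refine Finset.sum_congr rfl fun k _ => ?_
    simp only [dz]
    ring
  rw [this, h1, mul_zero]

theorem trace_dirD_shape (h : IsPPFamily U γ c c' e m F) (b : (ι → ℝ) × ℝ) {p : (ι → ℝ) × ℝ}
    (hp : p ∈ U) : ∑ k, dirD b (PPWave.shape γ k k) p = 0 := by
  simp only [h.dirD_shape _ _ _ hp, ← Finset.mul_sum, h.null, mul_zero]

/-- The only component of the ambient Ricci tensor of a family of pp-waves. -/
def ricciPP (c' : Matrix ι ι ℝ) (F : (ι → ℝ) × ℝ → ℝ) (p : (ι → ℝ) × ℝ) : ℝ :=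
  p.2 * dr (dr F) p - ((Fintype.card ι : ℝ) / 2 - 1) * dr F p -
    (1 / 2) * ∑ k, ∑ l, c' k l * dz k (dz l F) p

/-- Every term other than a linear expression in `F` times `e ⊗ e` contains the trace of `shape`,
the trace of the Christoffel symbols, or one of the vanishing contractions with `m`. -/
theorem ricci_eq (h : IsPPFamily U γ c c' e m F) {y : ι ⊕ Fin 2 → ℝ} (hy : y ∈ ambientOver U)
    (I J : ι ⊕ Fin 2) : ricci (ambientMetric γ) I J y =
      Sum.elim e 0 I * Sum.elim e 0 J * ricciPP c' F (ambientProj y) := by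
  have hr := h.regular
  have hp : ambientProj y ∈ U := hy.1
  rcases I with i | a <;> rcases J with j | b <;> (try fin_cases a) <;> (try fin_cases b) <;>
    simp only [Fin.zero_eta, Fin.mk_one, Sum.elim_inl, Sum.elim_inr, Pi.zero_apply, zero_mul,
      mul_zero]
  · rw [ricci_inl_inl hr hy]
    have d1 : ∀ i j, dr (PPWave.comp γ i j) (ambientProj y) = dr F (ambientProj y) * (e i * e j) :=
      fun i j => h.dirD_comp i j _ hp
    have d2 : dr (dr (PPWave.comp γ i j)) (ambientProj y) =
        dr (dr F) (ambientProj y) * (e i * e j) := by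
      have h1 : EqOn (dr (PPWave.comp γ i j)) (fun p => dr F p * (e i * e j)) U :=
        h.dirD_comp i j _
      have h2 := dirD_congr hr.isOpen h1 (0, 1) hp
      exact h2.trans (dirD_mul_const _ _ (ContDiffOn.differentiableAt_of_isOpen
        (ContDiffOn.dr h.smooth hr.isOpen) hr.isOpen hp))
    -- The term quadratic in `γ'` carries the contraction `m·e`.
    have d3 : ∑ k, (PPWave.shape γ k j (ambientProj y) * dr (PPWave.comp γ i k) (ambientProj y) +
        PPWave.shape γ k i (ambientProj y) * dr (PPWave.comp γ j k) (ambientProj y)) =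
        dr F (ambientProj y) ^ 2 * (e i * e j) * ∑ k, m k * e k := by
      rw [Finset.mul_sum]
      refine Finset.sum_congr rfl fun k _ => ?_
      rw [d1, d1, h.shape_eq _ _ hp, h.shape_eq _ _ hp]
      ring
    simp only [d3]
    simp only [h.baseRicci_eq i j hp, h.trace_shape hp, d2, h.null, d1, ricciPP]
    ring
  · exact ricci_inl_zero hr hy i
  · rw [ricci_inl_one hr hy]
    have t0 : ∀ l, ∑ k, PPWave.chr γ k k l (ambientProj y) = 0 := fun l => by
      rw [← h.trace_chr l hp]
      exact Finset.sum_congr rfl fun k _ => hr.chr_symm k k l hp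
    have t1 : ∑ k, ∑ l, PPWave.chr γ k k l (ambientProj y) *
        PPWave.shape γ l i (ambientProj y) = 0 := by
      rw [Finset.sum_comm]
      simp only [← Finset.sum_mul, t0, zero_mul, Finset.sum_const_zero]
    have t2 : ∑ k, ∑ l, PPWave.shape γ k l (ambientProj y) *
        PPWave.chr γ l i k (ambientProj y) = 0 := by
      rw [Finset.sum_comm, ← h.chr_mul_shape i hp]
      exact Finset.sum_congr rfl fun k _ => Finset.sum_congr rfl fun l _ => mul_comm _ _
    have t3 : ∑ k, dr (PPWave.chr γ k i k) (ambientProj y) = 0 := h.trace_dirD_chr _ i hp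
    simp only [Finset.sum_sub_distrib, t1, t2, t3, h.div_shape i hp]
    ring
  · exact ricci_zero_inl hr hy j
  · rw [ricci_one_inl hr hy]
    have t0 : ∀ l, ∑ k, PPWave.chr γ k k l (ambientProj y) = 0 := fun l => by
      rw [← h.trace_chr l hp]
      exact Finset.sum_congr rfl fun k _ => hr.chr_symm k k l hp
    have t1 : ∑ k, ∑ l, PPWave.chr γ k k l (ambientProj y) *
        PPWave.shape γ l j (ambientProj y) = 0 := by
      rw [Finset.sum_comm]
      simp only [← Finset.sum_mul, t0, zero_mul, Finset.sum_const_zero]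
    have t3 : ∑ k, dz j (PPWave.shape γ k k) (ambientProj y) = 0 := h.trace_dirD_shape _ hp
    simp only [Finset.sum_sub_distrib, t1, h.chr_mul_shape j hp, t3, h.div_shape j hp]
    ring
  · exact ricci_zero_zero hr hy
  · exact ricci_zero_one hr hy
  · exact ricci_one_zero hr hy
  · rw [ricci_one_one hr hy]
    have t3 : ∑ k, dr (PPWave.shape γ k k) (ambientProj y) = 0 := h.trace_dirD_shape _ hp
    simp only [t3, h.shape_mul_shape hp]
    ring

end IsPPFamily

end PPRicci

/-! ### Congruence of functions modulo powers of `ρ` -/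

section JetEq

variable {E : Type*} [NormedAddCommGroup E] [NormedSpace ℝ E]

/-- `F` and `G` are smooth on `M × J` and agree modulo `ρ^k`. -/
structure JetEq (M : Set E) (J : Set ℝ) (k : ℕ) (F G : E × ℝ → ℝ) : Prop where
  isOpen_left : IsOpen M
  isOpen_right : IsOpen J
  zero_mem : (0 : ℝ) ∈ J
  left : ContDiffOn ℝ ∞ F (M ×ˢ J)
  right : ContDiffOn ℝ ∞ G (M ×ˢ J)
  vanish : VanishesTo M k fun p => F p - G p

namespace JetEq

variable {M : Set E} {J : Set ℝ} {k : ℕ} {F F' G G' : E × ℝ → ℝ}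

theorem isOpen (h : JetEq M J k F G) : IsOpen (M ×ˢ J) := h.isOpen_left.prod h.isOpen_right

theorem congr_right (h : JetEq M J k F G) (hG : EqOn G' G (M ×ˢ J)) : JetEq M J k F G' where
  __ := h
  right := h.right.congr hG
  vanish := h.vanish.congr h.isOpen_left h.isOpen_right h.zero_mem fun p hp => by
    simp only [hG hp]

theorem of_eqOn (hM : IsOpen M) (hJ : IsOpen J) (h0 : (0 : ℝ) ∈ J)
    (hF : ContDiffOn ℝ ∞ F (M ×ˢ J)) (hFG : EqOn F G (M ×ˢ J)) : JetEq M J k F G where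
  isOpen_left := hM
  isOpen_right := hJ
  zero_mem := h0
  left := hF
  right := hF.congr hFG.symm
  vanish := by
    have : VanishesTo M k (fun _ : E × ℝ => (0 : ℝ)) := fun j _ x hx => by
      simpa using dr_iterate_const_mul (hM.prod hJ) hF 0 j (mk_mem_prod hx h0)
    exact this.congr hM hJ h0 fun p hp => by simp [hFG hp]

theorem refl (hM : IsOpen M) (hJ : IsOpen J) (h0 : (0 : ℝ) ∈ J)
    (hF : ContDiffOn ℝ ∞ F (M ×ˢ J)) : JetEq M J k F F := of_eqOn hM hJ h0 hF fun _ _ => rfl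

theorem mono (h : JetEq M J k F G) {l : ℕ} (hl : l ≤ k) : JetEq M J l F G where
  __ := h
  vanish := h.vanish.mono hl

theorem add (h : JetEq M J k F G) (h' : JetEq M J k F' G') :
    JetEq M J k (fun p => F p + F' p) (fun p => G p + G' p) where
  __ := h
  left := h.left.add h'.left
  right := h.right.add h'.right
  vanish := (h.vanish.add h.isOpen_left h.isOpen_right h.zero_mem (h.left.sub h.right)
    (h'.left.sub h'.right) h'.vanish).congr h.isOpen_left h.isOpen_right h.zero_mem
    fun p _ => by ring

theorem sub (h : JetEq M J k F G) (h' : JetEq M J k F' G') :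
    JetEq M J k (fun p => F p - F' p) (fun p => G p - G' p) where
  __ := h
  left := h.left.sub h'.left
  right := h.right.sub h'.right
  vanish := (h.vanish.sub h.isOpen_left h.isOpen_right h.zero_mem (h.left.sub h.right)
    (h'.left.sub h'.right) h'.vanish).congr h.isOpen_left h.isOpen_right h.zero_mem
    fun p _ => by ring

theorem mul (h : JetEq M J k F G) (h' : JetEq M J k F' G') :
    JetEq M J k (fun p => F p * F' p) (fun p => G p * G' p) where
  __ := h
  left := h.left.mul h'.left
  right := h.right.mul h'.right
  vanish := ((h.vanish.mul_right h.isOpen_left h.isOpen_right h.zero_mem (h.left.sub h.right)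
    h'.left).add h.isOpen_left h.isOpen_right h.zero_mem ((h.left.sub h.right).mul h'.left)
    (h.right.mul (h'.left.sub h'.right))
    (h'.vanish.mul_left h.isOpen_left h.isOpen_right h.zero_mem h.right
      (h'.left.sub h'.right))).congr h.isOpen_left h.isOpen_right h.zero_mem fun p _ => by ring

theorem const_mul (h : JetEq M J k F G) (c : ℝ) :
    JetEq M J k (fun p => c * F p) (fun p => c * G p) :=
  (refl h.isOpen_left h.isOpen_right h.zero_mem contDiffOn_const).mul h

theorem sum {ι : Type*} [Fintype ι] (hM : IsOpen M) (hJ : IsOpen J) (h0 : (0 : ℝ) ∈ J)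
    {F G : ι → E × ℝ → ℝ} (h : ∀ i, JetEq M J k (F i) (G i)) :
    JetEq M J k (fun p => ∑ i, F i p) (fun p => ∑ i, G i p) where
  isOpen_left := hM
  isOpen_right := hJ
  zero_mem := h0
  left := ContDiffOn.sum fun i _ => (h i).left
  right := ContDiffOn.sum fun i _ => (h i).right
  vanish := by
    simp only [← Finset.sum_sub_distrib]
    exact VanishesTo.sum hM hJ h0 _ (fun i => (h i).left.sub (h i).right) fun i => (h i).vanish

theorem dirD (h : JetEq M J k F G) (e : E) :
    JetEq M J k (PPWave.dirD (e, (0 : ℝ)) F) (PPWave.dirD (e, (0 : ℝ)) G) where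
  __ := h
  left := ContDiffOn.dirD h.left h.isOpen _
  right := ContDiffOn.dirD h.right h.isOpen _
  vanish := (VanishesTo.dirD h.isOpen_left h.isOpen_right h.zero_mem (h.left.sub h.right) e
    h.vanish).congr h.isOpen_left h.isOpen_right h.zero_mem fun _ hp =>
      dirD_sub _ (ContDiffOn.differentiableAt_of_isOpen h.left h.isOpen hp)
        (ContDiffOn.differentiableAt_of_isOpen h.right h.isOpen hp)

/-- A `ρ`-derivative costs one order, and a factor `ρ` gains one by `snd_mul`. This bookkeeping
decides which terms of the Ricci tensor feel the leading difference of two families. -/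
theorem dr (h : JetEq M J (k + 1) F G) : JetEq M J k (PPWave.dr F) (PPWave.dr G) where
  __ := h
  left := ContDiffOn.dr h.left h.isOpen
  right := ContDiffOn.dr h.right h.isOpen
  vanish := (vanishesTo_succ.1 h.vanish).2.congr h.isOpen_left h.isOpen_right h.zero_mem
    fun _ hp => dirD_sub _ (ContDiffOn.differentiableAt_of_isOpen h.left h.isOpen hp)
        (ContDiffOn.differentiableAt_of_isOpen h.right h.isOpen hp)

theorem snd_mul (h : JetEq M J k F G) :
    JetEq M J (k + 1) (fun p => p.2 * F p) (fun p => p.2 * G p) where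
  __ := h
  left := contDiffOn_snd.mul h.left
  right := contDiffOn_snd.mul h.right
  vanish := (h.vanish.snd_mul h.isOpen_left h.isOpen_right h.zero_mem
    (h.left.sub h.right)).congr h.isOpen_left h.isOpen_right h.zero_mem fun p _ => by ring

theorem dr_iterate_eq (h : JetEq M J k F G) {j : ℕ} (hj : j < k) {x : E} (hx : x ∈ M) :
    PPWave.dr^[j] F (x, 0) = PPWave.dr^[j] G (x, 0) := by
  have := h.vanish j hj x hx
  rw [dr_iterate_sub h.isOpen h.left h.right j (mk_mem_prod hx h.zero_mem)] at this
  linarith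

end JetEq

end JetEq

/-! ### Comparison of the Ricci tensors of two ambient metrics -/

section Comparison

variable {ι : Type*} [Fintype ι] [DecidableEq ι]

/-- The component `Ric_{ij}` of the ambient Ricci tensor as a function of `(x, ρ)`. -/
def ricciTan (γ : (ι → ℝ) → ℝ → Matrix ι ι ℝ) (i j : ι) (p : (ι → ℝ) × ℝ) : ℝ :=
  baseRicci γ i j p + p.2 * dr (dr (comp γ i j)) p -
    ((Fintype.card ι : ℝ) / 2 - 1) * dr (comp γ i j) p -
    (∑ k, shape γ k k p) * comp γ i j p + p.2 * ((∑ k, shape γ k k p) * dr (comp γ i j) p -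
      ∑ k, (shape γ k j p * dr (comp γ i k) p + shape γ k i p * dr (comp γ j k) p))

/-- The component `Ric_{ρρ}` of the ambient Ricci tensor as a function of `(x, ρ)`. -/
def ricciRho (γ : (ι → ℝ) → ℝ → Matrix ι ι ℝ) (p : (ι → ℝ) × ℝ) : ℝ :=
  -(∑ k, dr (shape γ k k) p) - ∑ k, ∑ l, shape γ k l p * shape γ l k p

variable {M : Set (ι → ℝ)} {J : Set ℝ} {γ γ' : (ι → ℝ) → ℝ → Matrix ι ι ℝ}

theorem RegularFamily.ricciTan (h : RegularFamily (M ×ˢ J) γ) (i j : ι) :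
    ContDiffOn ℝ ∞ (ricciTan γ i j) (M ×ˢ J) := by
  have hc := h.comp
  have hd : ∀ i j, ContDiffOn ℝ ∞ (dr (PPWave.comp γ i j)) (M ×ˢ J) := fun i j =>
    ContDiffOn.dr (hc i j) h.isOpen
  have hs := h.shape
  have htr : ContDiffOn ℝ ∞ (fun p => ∑ k, PPWave.shape γ k k p) (M ×ˢ J) :=
    ContDiffOn.sum fun k _ => hs k k
  have hz : ∀ k i j l, ContDiffOn ℝ ∞ (dz l (PPWave.chr γ k i j)) (M ×ˢ J) := fun k i j l =>
    ContDiffOn.dirD (h.chr k i j) h.isOpen _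
  have hb : ContDiffOn ℝ ∞ (baseRicci γ i j) (M ×ˢ J) :=
    (ContDiffOn.sum fun k _ => (hz _ _ _ _).sub (hz _ _ _ _)).add
      (ContDiffOn.sum fun k _ => ContDiffOn.sum fun l _ =>
        ((h.chr _ _ _).mul (h.chr _ _ _)).sub ((h.chr _ _ _).mul (h.chr _ _ _)))
  exact (((hb.add (contDiffOn_snd.mul (ContDiffOn.dr (hd i j) h.isOpen))).sub
    (contDiffOn_const.mul (hd i j))).sub (htr.mul (hc i j))).add
    (contDiffOn_snd.mul ((htr.mul (hd i j)).sub (ContDiffOn.sum fun k _ =>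
      ((hs _ _).mul (hd _ _)).add ((hs _ _).mul (hd _ _)))))

theorem RegularFamily.ricciRho (h : RegularFamily (M ×ˢ J) γ) :
    ContDiffOn ℝ ∞ (ricciRho γ) (M ×ˢ J) :=
  (ContDiffOn.sum fun k _ => ContDiffOn.dr (h.shape k k) h.isOpen).neg.sub
    (ContDiffOn.sum fun _ _ => ContDiffOn.sum fun _ _ => (h.shape _ _).mul (h.shape _ _))

/-- Data for the comparison of two families that agree modulo `ρ^{m+1}`. -/
structure Comparable (M : Set (ι → ℝ)) (J : Set ℝ) (m : ℕ)
    (γ γ' : (ι → ℝ) → ℝ → Matrix ι ι ℝ) : Prop where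
  isOpen_left : IsOpen M
  isOpen_right : IsOpen J
  zero_mem : (0 : ℝ) ∈ J
  left : RegularFamily (M ×ˢ J) γ
  right : RegularFamily (M ×ˢ J) γ'
  agree : ∀ i j, VanishesTo M (m + 1) fun p => comp γ i j p - comp γ' i j p

namespace Comparable

variable {m : ℕ}

/-- The difference of the components of two families. -/
def diff (γ γ' : (ι → ℝ) → ℝ → Matrix ι ι ℝ) (i j : ι) (p : (ι → ℝ) × ℝ) : ℝ :=
  comp γ i j p - comp γ' i j p

/-- The trace `½ γ^{kl} (γ - γ')'_{kl}`. -/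
def trDiff (γ γ' : (ι → ℝ) → ℝ → Matrix ι ι ℝ) (k i : ι) (p : (ι → ℝ) × ℝ) : ℝ :=
  (1 / 2) * ∑ l, dr (diff γ γ' i l) p * invComp γ k l p

theorem comp (h : Comparable M J m γ γ') (i j : ι) :
    JetEq M J (m + 1) (comp γ i j) (PPWave.comp γ' i j) where
  __ := h
  left := h.left.comp i j
  right := h.right.comp i j
  vanish := h.agree i j

theorem refl (h : Comparable M J m γ γ') {F : (ι → ℝ) × ℝ → ℝ} {k : ℕ}
    (hF : ContDiffOn ℝ ∞ F (M ×ˢ J)) : JetEq M J k F F :=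
  JetEq.refl h.isOpen_left h.isOpen_right h.zero_mem hF

theorem smooth_diff (h : Comparable M J m γ γ') (i j : ι) :
    ContDiffOn ℝ ∞ (diff γ γ' i j) (M ×ˢ J) := (h.left.comp i j).sub (h.right.comp i j)

/-- The resolvent identity `A⁻¹ - B⁻¹ = A⁻¹ (A - B) (-B⁻¹)` exhibits the difference of the inverses
as a multiple of the difference of the metrics. -/
theorem inv_sub_inv (h : Comparable M J m γ γ') (i j : ι) :
    EqOn (fun p => invComp γ i j p - invComp γ' i j p)
      (fun p => ∑ a, ∑ b, invComp γ i a p * (diff γ γ' a b p * (-1 * invComp γ' b j p)))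
      (M ×ˢ J) := fun p hp => by
  have h1 : IsUnit (γ p.1 p.2).det := (h.left.det_ne p hp).isUnit
  have h2 : IsUnit (γ' p.1 p.2).det := (h.right.det_ne p hp).isUnit
  have : (γ p.1 p.2)⁻¹ * ((γ p.1 p.2 - γ' p.1 p.2) * (-1 * (γ' p.1 p.2)⁻¹)) =
      (γ p.1 p.2)⁻¹ - (γ' p.1 p.2)⁻¹ := by
    rw [neg_one_mul, Matrix.mul_neg, Matrix.sub_mul, Matrix.mul_nonsing_inv _ h2, neg_sub,
      Matrix.mul_sub, Matrix.mul_one, ← Matrix.mul_assoc, Matrix.nonsing_inv_mul _ h1,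
      Matrix.one_mul]
  have := congrFun (congrFun this i) j
  simp only [Matrix.mul_apply, Matrix.sub_apply, neg_one_mul, Matrix.neg_apply] at this
  simp only [invComp, diff, PPWave.comp, ← this, Finset.mul_sum, neg_one_mul]

theorem inv (h : Comparable M J m γ γ') (i j : ι) :
    JetEq M J (m + 1) (invComp γ i j) (invComp γ' i j) where
  __ := h
  left := h.left.invComp i j
  right := h.right.invComp i j
  vanish := by
    refine VanishesTo.congr h.isOpen_left h.isOpen_right h.zero_mem ?_ (h.inv_sub_inv i j).symm
    have hs : ∀ a b, ContDiffOn ℝ ∞ (fun p => diff γ γ' a b p * (-1 * invComp γ' b j p))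
        (M ×ˢ J) := fun a b =>
      (h.smooth_diff a b).mul (contDiffOn_const.mul (h.right.invComp b j))
    refine VanishesTo.sum h.isOpen_left h.isOpen_right h.zero_mem _
      (fun a => ContDiffOn.sum fun b _ => (h.left.invComp i a).mul (hs a b)) fun a =>
      VanishesTo.sum h.isOpen_left h.isOpen_right h.zero_mem _
      (fun b => (h.left.invComp i a).mul (hs a b)) fun b => ?_
    exact VanishesTo.mul_left h.isOpen_left h.isOpen_right h.zero_mem (h.left.invComp i a) (hs a b)
      (VanishesTo.mul_right h.isOpen_left h.isOpen_right h.zero_mem (h.smooth_diff a b)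
        (contDiffOn_const.mul (h.right.invComp b j)) (h.agree a b))

theorem chr (h : Comparable M J m γ γ') (k i j : ι) :
    JetEq M J (m + 1) (chr γ k i j) (PPWave.chr γ' k i j) :=
  (JetEq.sum h.isOpen_left h.isOpen_right h.zero_mem fun l => (h.inv k l).mul
    ((((h.comp j l).dirD _).add ((h.comp i l).dirD _)).sub ((h.comp i j).dirD _))).const_mul _

/-- The Ricci tensor of a slice involves derivatives along `M` only, so no order is lost. -/
theorem baseRicci (h : Comparable M J m γ γ') (i j : ι) :
    JetEq M J (m + 1) (baseRicci γ i j) (PPWave.baseRicci γ' i j) :=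
  (JetEq.sum h.isOpen_left h.isOpen_right h.zero_mem fun k =>
    ((h.chr k i j).dirD _).sub ((h.chr k i k).dirD _)).add
  (JetEq.sum h.isOpen_left h.isOpen_right h.zero_mem fun k =>
    JetEq.sum h.isOpen_left h.isOpen_right h.zero_mem fun l =>
      ((h.chr k k l).mul (h.chr l i j)).sub ((h.chr k j l).mul (h.chr l i k)))

theorem shape (h : Comparable M J m γ γ') (k i : ι) :
    JetEq M J m (shape γ k i) (PPWave.shape γ' k i) :=
  (JetEq.sum h.isOpen_left h.isOpen_right h.zero_mem fun l =>
    ((h.inv k l).mono m.le_succ).mul (h.comp i l).dr).const_mul _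

theorem dr_comp (h : Comparable M J m γ γ') (i j : ι) :
    EqOn (dr (PPWave.comp γ i j)) (fun p => dr (PPWave.comp γ' i j) p + dr (diff γ γ' i j) p)
      (M ×ˢ J) := fun p hp => by
  have := dirD_sub ((0 : ι → ℝ), (1 : ℝ))
    (ContDiffOn.differentiableAt_of_isOpen (h.left.comp i j) h.left.isOpen hp)
    (ContDiffOn.differentiableAt_of_isOpen (h.right.comp i j) h.left.isOpen hp)
  simp only [dr]
  change _ = _ + dirD _ (fun q => PPWave.comp γ i j q - PPWave.comp γ' i j q) p
  rw [this]; ring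

theorem dr_dr_comp (h : Comparable M J m γ γ') (i j : ι) :
    EqOn (dr (dr (PPWave.comp γ i j)))
      (fun p => dr (dr (PPWave.comp γ' i j)) p + dr (dr (diff γ γ' i j)) p) (M ×ˢ J) :=
    fun p hp => by
  have hU := h.left.isOpen
  have h1 := dirD_congr hU (h.dr_comp i j) ((0 : ι → ℝ), (1 : ℝ)) hp
  exact h1.trans (dirD_add _
    (ContDiffOn.differentiableAt_of_isOpen (ContDiffOn.dr (h.right.comp i j) hU) hU hp)
    (ContDiffOn.differentiableAt_of_isOpen (ContDiffOn.dr (h.smooth_diff i j) hU) hU hp))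

theorem smooth_trDiff (h : Comparable M J m γ γ') (k i : ι) :
    ContDiffOn ℝ ∞ (trDiff γ γ' k i) (M ×ˢ J) :=
  contDiffOn_const.mul (ContDiffOn.sum fun l _ =>
    (ContDiffOn.dr (h.smooth_diff i l) h.left.isOpen).mul (h.left.invComp k l))

/-- By itself `shape` agrees only modulo `ρ^m`. The missing order is recorded in `trDiff`;
exchanging the inverses is free, since they agree modulo `ρ^{m+1}`. -/
theorem shape_add (h : Comparable M J m γ γ') (k i : ι) :
    JetEq M J (m + 1) (PPWave.shape γ k i)
      (fun p => PPWave.shape γ' k i p + trDiff γ γ' k i p) := by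
  have hU := h.left.isOpen
  have key : ∀ l, JetEq M J (m + 1) (fun p => invComp γ k l p * dr (PPWave.comp γ i l) p)
      (fun p => invComp γ' k l p * dr (PPWave.comp γ' i l) p +
        dr (diff γ γ' i l) p * invComp γ k l p) := fun l => by
    have e1 : JetEq M J (m + 1) (fun p => invComp γ k l p * dr (PPWave.comp γ i l) p)
        (fun p => invComp γ k l p * dr (PPWave.comp γ' i l) p +
          dr (diff γ γ' i l) p * invComp γ k l p) :=
      JetEq.of_eqOn h.isOpen_left h.isOpen_right h.zero_mem
        ((h.left.invComp k l).mul (ContDiffOn.dr (h.left.comp i l) hU)) fun p hp => by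
          simp only [h.dr_comp i l hp]; ring
    have e2 := ((h.inv k l).mul (h.refl (ContDiffOn.dr (h.right.comp i l) hU))).add
      (h.refl (k := m + 1) ((ContDiffOn.dr (h.smooth_diff i l) hU).mul (h.left.invComp k l)))
    exact { e1 with
      right := e2.right
      vanish := (e1.vanish.add h.isOpen_left h.isOpen_right h.zero_mem (e1.left.sub e1.right)
        (e2.left.sub e2.right) e2.vanish).congr h.isOpen_left h.isOpen_right h.zero_mem
        fun p _ => by ring }
  refine ((JetEq.sum h.isOpen_left h.isOpen_right h.zero_mem key).const_mul (1 / 2)).congr_right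
    fun p _ => ?_
  simp only [PPWave.shape, trDiff, Finset.sum_add_distrib, mul_add]

theorem trace_add (h : Comparable M J m γ γ') :
    JetEq M J (m + 1) (fun p => ∑ k, PPWave.shape γ k k p)
      (fun p => ∑ k, PPWave.shape γ' k k p + ∑ k, trDiff γ γ' k k p) :=
  (JetEq.sum h.isOpen_left h.isOpen_right h.zero_mem fun k => h.shape_add k k).congr_right
    fun p _ => by simp only [Finset.sum_add_distrib]

/-- The terms quadratic in `γ'` agree modulo `ρ^m`, and their prefactor `ρ` raises this to
`ρ^{m+1}`; the slice Ricci tensors agree anyway. What is left is linear in the difference. -/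
theorem ricciTan_add (h : Comparable M J m γ γ') (i j : ι) :
    JetEq M J (m + 1) (ricciTan γ i j) (fun p => PPWave.ricciTan γ' i j p +
      (p.2 * dr (dr (diff γ γ' i j)) p - ((Fintype.card ι : ℝ) / 2 - 1) * dr (diff γ γ' i j) p -
        (∑ k, trDiff γ γ' k k p) * PPWave.comp γ' i j p)) := by
  have hU := h.left.isOpen
  have hc := h.left.comp i j
  have b1 := h.baseRicci i j
  have b2 : JetEq M J (m + 1) (fun p => p.2 * dr (dr (PPWave.comp γ i j)) p)
      (fun p => p.2 * (dr (dr (PPWave.comp γ' i j)) p + dr (dr (diff γ γ' i j)) p)) :=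
    JetEq.of_eqOn h.isOpen_left h.isOpen_right h.zero_mem
      (contDiffOn_snd.mul (ContDiffOn.dr (ContDiffOn.dr hc hU) hU)) fun p hp => by
        simp only [h.dr_dr_comp i j hp]
  have b3 : JetEq M J (m + 1)
      (fun p => ((Fintype.card ι : ℝ) / 2 - 1) * dr (PPWave.comp γ i j) p)
      (fun p => ((Fintype.card ι : ℝ) / 2 - 1) *
        (dr (PPWave.comp γ' i j) p + dr (diff γ γ' i j) p)) :=
    JetEq.of_eqOn h.isOpen_left h.isOpen_right h.zero_mem
      (contDiffOn_const.mul (ContDiffOn.dr hc hU)) fun p hp => by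
        simp only [h.dr_comp i j hp]
  have b4 := h.trace_add.mul (h.comp i j)
  have b5 := ((((JetEq.sum h.isOpen_left h.isOpen_right h.zero_mem fun k => h.shape k k).mul
    (h.comp i j).dr).sub (JetEq.sum h.isOpen_left h.isOpen_right h.zero_mem fun k =>
      ((h.shape k j).mul (h.comp i k).dr).add ((h.shape k i).mul (h.comp j k).dr))).snd_mul)
  refine ((((b1.add b2).sub b3).sub b4).add b5).congr_right fun p _ => ?_
  simp only [PPWave.ricciTan]
  ring

/-- Products of `shape` agree modulo `ρ^m`, so the difference is seen only by the derivative of the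
trace. -/
theorem ricciRho_add (h : Comparable M J m γ γ') :
    JetEq M J m (ricciRho γ)
      (fun p => PPWave.ricciRho γ' p - dr (fun p => ∑ k, trDiff γ γ' k k p) p) := by
  have hU := h.left.isOpen
  have b1 : JetEq M J m (fun p => ∑ k, dr (PPWave.shape γ k k) p)
      (fun p => ∑ k, (dr (fun p => PPWave.shape γ' k k p + trDiff γ γ' k k p)) p) :=
    JetEq.sum h.isOpen_left h.isOpen_right h.zero_mem fun k => (h.shape_add k k).dr
  have b2 : JetEq M J m (fun p => ∑ k, ∑ l, PPWave.shape γ k l p * PPWave.shape γ l k p)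
      (fun p => ∑ k, ∑ l, PPWave.shape γ' k l p * PPWave.shape γ' l k p) :=
    JetEq.sum h.isOpen_left h.isOpen_right h.zero_mem fun k =>
      JetEq.sum h.isOpen_left h.isOpen_right h.zero_mem fun l => (h.shape k l).mul (h.shape l k)
  have b3 := (b1.const_mul (-1)).sub b2
  have e : ricciRho γ = fun p => -1 * ∑ k, dr (PPWave.shape γ k k) p -
      ∑ k, ∑ l, PPWave.shape γ k l p * PPWave.shape γ l k p := by
    ext p; simp only [PPWave.ricciRho]; ring
  rw [e]
  refine b3.congr_right fun p hp => ?_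
  have e1 : dr (fun p => ∑ k, trDiff γ γ' k k p) p = ∑ k, dr (trDiff γ γ' k k) p :=
    dirD_sum _ _ fun k _ => ContDiffOn.differentiableAt_of_isOpen (h.smooth_trDiff k k) hU hp
  have e2 : ∀ k, dr (fun p => PPWave.shape γ' k k p + trDiff γ γ' k k p) p =
      dr (PPWave.shape γ' k k) p + dr (trDiff γ γ' k k) p := fun k =>
    dirD_add _ (ContDiffOn.differentiableAt_of_isOpen (h.right.shape k k) hU hp)
      (ContDiffOn.differentiableAt_of_isOpen (h.smooth_trDiff k k) hU hp)
  simp only [e1, e2, PPWave.ricciRho, Finset.sum_add_distrib]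
  ring

theorem vanish_dr_diff (h : Comparable M J m γ γ') (i j : ι) :
    VanishesTo M m (dr (diff γ γ' i j)) := (vanishesTo_succ.1 (h.agree i j)).2

theorem trDiff_jet (h : Comparable M J m γ γ') {x : ι → ℝ} (hx : x ∈ M) :
    VanishesTo M m (fun p => ∑ k, trDiff γ γ' k k p) ∧
    dr^[m] (fun p => ∑ k, trDiff γ γ' k k p) (x, 0) =
      (1 / 2) * ∑ k, ∑ l, dr^[m + 1] (diff γ γ' k l) (x, 0) * invComp γ k l (x, 0) := by
  have hU := h.left.isOpen
  have hp : (x, (0 : ℝ)) ∈ M ×ˢ J := mk_mem_prod hx h.zero_mem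
  have hs : ∀ k l, ContDiffOn ℝ ∞ (fun p => dr (diff γ γ' k l) p * invComp γ k l p) (M ×ˢ J) :=
    fun k l => (ContDiffOn.dr (h.smooth_diff k l) hU).mul (h.left.invComp k l)
  have hsum : ∀ k, ContDiffOn ℝ ∞ (fun p => ∑ l, dr (diff γ γ' k l) p * invComp γ k l p)
      (M ×ˢ J) := fun k => ContDiffOn.sum fun l _ => hs k l
  constructor
  · refine VanishesTo.sum h.isOpen_left h.isOpen_right h.zero_mem _
      (fun k => h.smooth_trDiff k k) fun k => ?_
    refine VanishesTo.mul_left h.isOpen_left h.isOpen_right h.zero_mem contDiffOn_const (hsum k) ?_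
    refine VanishesTo.sum h.isOpen_left h.isOpen_right h.zero_mem _ (hs k) fun l => ?_
    exact VanishesTo.mul_right h.isOpen_left h.isOpen_right h.zero_mem
      (ContDiffOn.dr (h.smooth_diff k l) hU) (h.left.invComp k l) (h.vanish_dr_diff k l)
  · rw [dr_iterate_sum _ hU (fun k => h.smooth_trDiff k k) m hp, Finset.mul_sum]
    refine Finset.sum_congr rfl fun k _ => ?_
    have := dr_iterate_const_mul hU (hsum k) (1 / 2) m hp
    refine this.trans ?_
    rw [dr_iterate_sum _ hU (hs k) m hp]
    congr 1
    exact Finset.sum_congr rfl fun l _ => dr_iterate_mul h.isOpen_left h.isOpen_right h.zero_mem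
      (ContDiffOn.dr (h.smooth_diff k l) hU) (h.left.invComp k l) (h.vanish_dr_diff k l) hx

theorem comp_zero (h : Comparable M J m γ γ') (i j : ι) {x : ι → ℝ} (hx : x ∈ M) :
    PPWave.comp γ i j (x, 0) = PPWave.comp γ' i j (x, 0) :=
  (h.comp i j).dr_iterate_eq m.succ_pos hx

/-- The leading coefficient of the difference of the components `Ric_{ij}`. -/
theorem ricciTan_jet (h : Comparable M J m γ γ') (i j : ι) {x : ι → ℝ} (hx : x ∈ M) :
    dr^[m] (ricciTan γ i j) (x, 0) - dr^[m] (PPWave.ricciTan γ' i j) (x, 0) =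
      ((m : ℝ) + 1 - (Fintype.card ι : ℝ) / 2) * dr^[m + 1] (diff γ γ' i j) (x, 0) -
      (1 / 2) * (∑ k, ∑ l, dr^[m + 1] (diff γ γ' k l) (x, 0) * invComp γ k l (x, 0)) *
        PPWave.comp γ i j (x, 0) := by
  have hU := h.left.isOpen
  have hp : (x, (0 : ℝ)) ∈ M ×ˢ J := mk_mem_prod hx h.zero_mem
  have hd := ContDiffOn.dr (h.smooth_diff i j) hU
  have hdd := ContDiffOn.dr hd hU
  obtain ⟨ht, ht'⟩ := h.trDiff_jet hx
  have hts : ContDiffOn ℝ ∞ (fun p => ∑ k, trDiff γ γ' k k p) (M ×ˢ J) :=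
    ContDiffOn.sum fun k _ => h.smooth_trDiff k k
  have s1 : ContDiffOn ℝ ∞ (fun p : (ι → ℝ) × ℝ => p.2 * dr (dr (diff γ γ' i j)) p) (M ×ˢ J) :=
    contDiffOn_snd.mul hdd
  have s2 : ContDiffOn ℝ ∞ (fun p : (ι → ℝ) × ℝ =>
    ((Fintype.card ι : ℝ) / 2 - 1) * dr (diff γ γ' i j) p) (M ×ˢ J) := contDiffOn_const.mul hd
  have s3 := hts.mul (h.right.comp i j)
  rw [(h.ricciTan_add i j).dr_iterate_eq m.lt_succ_self hx,
    dr_iterate_add hU (h.right.ricciTan i j) ((s1.sub s2).sub s3) m hp,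
    dr_iterate_sub hU (s1.sub s2) s3 m hp, dr_iterate_sub hU s1 s2 m hp,
    dr_iterate_snd_mul h.isOpen_left h.isOpen_right h.zero_mem hdd m hx,
    dr_iterate_const_mul hU hd _ m hp,
    dr_iterate_mul h.isOpen_left h.isOpen_right h.zero_mem hts (h.right.comp i j) ht hx, ht',
    ← h.comp_zero i j hx]
  -- The term `ρ D''` contributes `m` times the derivative of order `m + 1`; for `m = 0` the
  -- truncated index is multiplied by zero.
  have e : (m : ℝ) * dr^[m - 1] (dr (dr (diff γ γ' i j))) (x, 0) =
      m * dr^[m + 1] (diff γ γ' i j) (x, 0) := by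
    cases m with
    | zero => simp
    | succ m => rfl
  rw [e, ← Function.iterate_succ_apply]
  ring

/-- The leading coefficient of the difference of the components `Ric_{ρρ}`. -/
theorem ricciRho_jet (h : Comparable M J (m + 1) γ γ') {x : ι → ℝ} (hx : x ∈ M) :
    dr^[m] (ricciRho γ) (x, 0) - dr^[m] (PPWave.ricciRho γ') (x, 0) =
      -(1 / 2) * ∑ k, ∑ l, dr^[m + 2] (diff γ γ' k l) (x, 0) * invComp γ k l (x, 0) := by
  have hU := h.left.isOpen
  have hp : (x, (0 : ℝ)) ∈ M ×ˢ J := mk_mem_prod hx h.zero_mem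
  have hts : ContDiffOn ℝ ∞ (fun p => ∑ k, trDiff γ γ' k k p) (M ×ˢ J) :=
    ContDiffOn.sum fun k _ => h.smooth_trDiff k k
  rw [h.ricciRho_add.dr_iterate_eq m.lt_succ_self hx,
    dr_iterate_sub hU h.right.ricciRho (ContDiffOn.dr hts hU) m hp,
    ← Function.iterate_succ_apply, (h.trDiff_jet hx).2]
  ring

theorem sum_inv_mul_comp (h : Comparable M J m γ γ') {x : ι → ℝ} (hx : x ∈ M) :
    ∑ i, ∑ j, invComp γ i j (x, 0) * PPWave.comp γ i j (x, 0) = Fintype.card ι := by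
  have hp : (x, (0 : ℝ)) ∈ M ×ˢ J := mk_mem_prod hx h.zero_mem
  have : ∀ i, ∑ j, invComp γ i j (x, 0) * PPWave.comp γ i j (x, 0) = 1 := fun i => by
    rw [PPWave.sum_inv_mul_comp h.left hp]; simp
  simp [this]

/-- The trace of the leading coefficient of the difference of the components `Ric_{ij}`. -/
theorem trace_ricciTan_jet (h : Comparable M J m γ γ') {x : ι → ℝ} (hx : x ∈ M) :
    ∑ i, ∑ j, invComp γ i j (x, 0) *
      (dr^[m] (ricciTan γ i j) (x, 0) - dr^[m] (PPWave.ricciTan γ' i j) (x, 0)) =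
      ((m : ℝ) + 1 - (Fintype.card ι : ℝ)) *
        ∑ k, ∑ l, dr^[m + 1] (diff γ γ' k l) (x, 0) * invComp γ k l (x, 0) := by
  set T := ∑ k, ∑ l, dr^[m + 1] (diff γ γ' k l) (x, 0) * invComp γ k l (x, 0) with hT
  have e : ∀ i j, invComp γ i j (x, 0) *
      (dr^[m] (ricciTan γ i j) (x, 0) - dr^[m] (PPWave.ricciTan γ' i j) (x, 0)) =
      ((m : ℝ) + 1 - (Fintype.card ι : ℝ) / 2) *
        (dr^[m + 1] (diff γ γ' i j) (x, 0) * invComp γ i j (x, 0)) -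
      (1 / 2) * T * (invComp γ i j (x, 0) * PPWave.comp γ i j (x, 0)) := fun i j => by
    rw [h.ricciTan_jet i j hx, ← hT]; ring
  simp only [e, Finset.sum_sub_distrib, ← Finset.mul_sum]
  rw [h.sum_inv_mul_comp hx, ← hT]
  ring

/-- If the Ricci tensors agree to the next order, then so do the metrics. -/
theorem succ (h : Comparable M J m γ γ') (hn : (m : ℝ) + 1 ≠ (Fintype.card ι : ℝ) / 2)
    (hR : ∀ i j, ∀ x ∈ M,
      dr^[m] (ricciTan γ i j) (x, 0) = dr^[m] (PPWave.ricciTan γ' i j) (x, 0))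
    (hT : (m : ℝ) + 1 ≠ Fintype.card ι ∨ ∃ l, m = l + 1 ∧ ∀ x ∈ M,
      dr^[l] (ricciRho γ) (x, 0) = dr^[l] (PPWave.ricciRho γ') (x, 0)) :
    Comparable M J (m + 1) γ γ' where
  __ := h
  agree i j := by
    refine vanishesTo_succ'.2 ⟨h.agree i j, fun x hx => ?_⟩
    -- The trace is treated first: by the trace of the tangential jets, with factor `m + 1 - n`, or
    -- by `Ric_ρρ` when that factor is zero. The full tensor follows because `m + 1 - n/2` is
    -- nonzero.
    have hT0 : ∑ k, ∑ l, dr^[m + 1] (diff γ γ' k l) (x, 0) * invComp γ k l (x, 0) = 0 := by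
      rcases hT with hT | ⟨l, rfl, hT⟩
      · have := h.trace_ricciTan_jet hx
        simp only [hR _ _ x hx, sub_self, mul_zero, Finset.sum_const_zero] at this
        exact (mul_eq_zero.1 this.symm).resolve_left (sub_ne_zero.2 hT)
      · have := h.ricciRho_jet hx
        rw [hT x hx, sub_self] at this
        linarith
    have := h.ricciTan_jet i j hx
    rw [hR i j x hx, sub_self, hT0, mul_zero, zero_mul, sub_zero] at this
    exact (mul_eq_zero.1 this.symm).resolve_left (sub_ne_zero.2 hn)

end Comparable

end Comparison

/-! ### Jets of ambient metrics -/

/-- This turns the limit in the definition of the obstruction tensor into a jet at `ρ = 0`. The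
remainder after removing the leading term is `O(ρ^{k+1})`. -/
theorem VanishesTo.tendsto_div {E : Type*} [NormedAddCommGroup E] [NormedSpace ℝ E]
    {M : Set E} {J : Set ℝ} (hM : IsOpen M) (hJ : IsOpen J) (h0 : (0 : ℝ) ∈ J)
    {F : E × ℝ → ℝ} (hF : ContDiffOn ℝ ∞ F (M ×ˢ J)) {k : ℕ} (h : VanishesTo M k F)
    {x : E} (hx : x ∈ M) :
    Tendsto (fun p : E × ℝ => (p.2 ^ k)⁻¹ * F p) (𝓝[{p | p.2 ≠ 0}] (x, 0))
      (𝓝 (dr^[k] F (x, 0) / k.factorial)) := by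
  have hU := hM.prod hJ
  have hp : (x, (0 : ℝ)) ∈ M ×ˢ J := mk_mem_prod hx h0
  obtain ⟨hs, hv⟩ := VanishesTo.sub_leading hM hJ h0 hF h
  have hO := (VanishesTo.isBigO hM hJ h0 (hF.sub hs) hv hx).mono
    (nhdsWithin_le_nhds (s := {p | p.2 ≠ 0}))
  have hc : Tendsto (fun p : E × ℝ => dr^[k] F (p.1, 0) / k.factorial) (𝓝[{p | p.2 ≠ 0}] (x, 0))
      (𝓝 (dr^[k] F (x, 0) / k.factorial)) := by
    refine Tendsto.mono_left ?_ nhdsWithin_le_nhds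
    refine Tendsto.div_const ?_ _
    have h1 : ContinuousAt (dr^[k] F) (x, 0) :=
      (ContDiffOn.dr_iterate hF hU k).continuousOn.continuousAt (hU.mem_nhds hp)
    have h2 : Tendsto (fun p : E × ℝ => (p.1, (0 : ℝ))) (𝓝 (x, 0)) (𝓝 (x, 0)) :=
      Continuous.tendsto (by fun_prop) (x, (0 : ℝ))
    exact h1.tendsto.comp h2
  have hr : Tendsto (fun p : E × ℝ => (p.2 ^ k)⁻¹ *
      (F p - p.2 ^ k * (dr^[k] F (p.1, 0) / k.factorial))) (𝓝[{p | p.2 ≠ 0}] (x, 0)) (𝓝 0) := by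
    have h3 : (fun p : E × ℝ => (p.2 ^ k)⁻¹ *
        (F p - p.2 ^ k * (dr^[k] F (p.1, 0) / k.factorial))) =O[𝓝[{p | p.2 ≠ 0}] (x, 0)]
        fun p => p.2 := by
      refine ((Asymptotics.isBigO_refl (fun p : E × ℝ => (p.2 ^ k)⁻¹) _).mul hO).congr'
        (Eventually.of_forall fun _ => rfl) ?_
      filter_upwards [self_mem_nhdsWithin] with p hp
      have : p.2 ^ k ≠ 0 := pow_ne_zero _ hp
      rw [pow_succ, ← mul_assoc, inv_mul_cancel₀ this, one_mul]
    exact h3.trans_tendsto ((Continuous.tendsto continuous_snd (x, (0 : ℝ))).mono_left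
      nhdsWithin_le_nhds)
  have := hc.add hr
  rw [add_zero] at this
  refine this.congr' ?_
  filter_upwards [self_mem_nhdsWithin] with p hp
  have : p.2 ^ k ≠ 0 := pow_ne_zero _ hp
  field_simp
  ring

section AmbientJets

variable {ι : Type*} [Fintype ι] [DecidableEq ι]
variable {M : Set (ι → ℝ)} {J : Set ℝ} {g : (ι → ℝ) → Matrix ι ι ℝ}
  {γ γ' : (ι → ℝ) → ℝ → Matrix ι ι ℝ}

theorem ambientDomain_eq (M : Set (ι → ℝ)) (J : Set ℝ) :
    ambientDomain M J = ambientOver (M ×ˢ J) := by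
  ext y
  simp only [ambientDomain, ambientOver, mem_ofPred_eq, ambientProj_apply, mem_prod]
  tauto

theorem ambientPoint_mem {t : ℝ} (ht : 0 < t) {x : ι → ℝ} (hx : x ∈ M) {ρ : ℝ} (hρ : ρ ∈ J) :
    ambientPoint t x ρ ∈ ambientDomain M J := ⟨hx, ht, hρ⟩

theorem tendsto_ambientProj (t : ℝ) (x : ι → ℝ) (s : Set (ι ⊕ Fin 2 → ℝ)) :
    Tendsto ambientProj (𝓝[s] (ambientPoint t x 0)) (𝓝 (x, 0)) :=
  (ambientProj.continuous.tendsto (ambientPoint t x 0)).mono_left nhdsWithin_le_nhds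

theorem tendsto_ambientPoint (hJ : IsOpen J) (h0 : (0 : ℝ) ∈ J) {t : ℝ} (ht : 0 < t) {x : ι → ℝ}
    (hx : x ∈ M) :
    Tendsto (ambientPoint t x) (𝓝[>] 0) (𝓝[ambientDomain M J] (ambientPoint t x 0)) := by
  refine tendsto_nhdsWithin_iff.2 ⟨?_, ?_⟩
  · refine Tendsto.mono_left (Continuous.tendsto ?_ 0) nhdsWithin_le_nhds
    refine continuous_pi fun a => ?_
    rcases a with i | a
    · exact continuous_const
    · fin_cases a
      · exact continuous_const
      · exact continuous_id
  · have : J ∈ 𝓝[>] (0 : ℝ) := mem_nhdsWithin_of_mem_nhds (hJ.mem_nhds h0)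
    filter_upwards [this] with ρ hρ using ambientPoint_mem ht hx hρ

theorem IsAmbientMetric.regular (h : IsAmbientMetric M J g γ) (hM : IsOpen M) (hJ : IsOpen J) :
    RegularFamily (M ×ˢ J) γ where
  isOpen := hM.prod hJ
  symm p hp := h.symm p.1 hp.1 p.2 hp.2
  det_ne p hp := h.nondegenerate p.1 hp.1 p.2 hp.2
  smooth := h.smooth

theorem RegularFamily.ricci_eq_ricciTan (h : RegularFamily (M ×ˢ J) γ) (i j : ι)
    {y : ι ⊕ Fin 2 → ℝ} (hy : y ∈ ambientDomain M J) :
    ricci (ambientMetric γ) (Sum.inl i) (Sum.inl j) y = PPWave.ricciTan γ i j (ambientProj y) :=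
  ricci_inl_inl h (ambientDomain_eq M J ▸ hy) i j

theorem RegularFamily.ricci_eq_ricciRho (h : RegularFamily (M ×ˢ J) γ)
    {y : ι ⊕ Fin 2 → ℝ} (hy : y ∈ ambientDomain M J) :
    ricci (ambientMetric γ) (Sum.inr 1) (Sum.inr 1) y = PPWave.ricciRho γ (ambientProj y) :=
  ricci_one_one h (ambientDomain_eq M J ▸ hy)

/-- The component depends on `(x, ρ)` only, so the rays `t = 1`, `ρ → 0+` already detect the order
of vanishing. -/
theorem RicciBigO.vanishesTo (hM : IsOpen M) (hJ : IsOpen J) (h0 : (0 : ℝ) ∈ J) {m : ℕ}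
    (h : RicciBigO M J γ m) {A B : ι ⊕ Fin 2} {R : (ι → ℝ) × ℝ → ℝ}
    (hR : ContDiffOn ℝ ∞ R (M ×ˢ J))
    (hAB : ∀ y ∈ ambientDomain M J, ricci (ambientMetric γ) A B y = R (ambientProj y)) :
    VanishesTo M m R := by
  refine vanishesTo_of_isBigO hM hJ h0 hR fun x hx => ?_
  have h1 := (h x hx 1 one_pos A B).comp_tendsto (tendsto_ambientPoint hJ h0 one_pos hx)
  refine h1.congr' ?_ (Eventually.of_forall fun _ => rfl)
  have : J ∈ 𝓝[>] (0 : ℝ) := mem_nhdsWithin_of_mem_nhds (hJ.mem_nhds h0)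
  filter_upwards [this] with ρ hρ
  exact hAB _ (ambientPoint_mem one_pos hx hρ)

theorem IsAmbientMetric.comparable_zero (h : IsAmbientMetric M J g γ)
    (h' : IsAmbientMetric M J g γ') (hM : IsOpen M) (hJ : IsOpen J) (h0 : (0 : ℝ) ∈ J) :
    Comparable M J 0 γ γ' where
  isOpen_left := hM
  isOpen_right := hJ
  zero_mem := h0
  left := h.regular hM hJ
  right := h'.regular hM hJ
  agree i j := by
    refine vanishesTo_succ'.2 ⟨vanishesTo_zero, fun x hx => ?_⟩
    simp [comp, h.initial x hx, h'.initial x hx]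

/-- In odd dimension, two ambient metrics agree to infinite order. -/
theorem IsAmbientMetric.comparable_of_odd (h : IsAmbientMetric M J g γ)
    (h' : IsAmbientMetric M J g γ') (hM : IsOpen M) (hJ : IsOpen J) (h0 : (0 : ℝ) ∈ J)
    (hodd : Odd (Fintype.card ι)) (hn : 1 < Fintype.card ι) (m : ℕ) :
    Comparable M J m γ γ' := by
  have hr := h.regular hM hJ
  have hr' := h'.regular hM hJ
  induction m with
  | zero => exact h.comparable_zero h' hM hJ h0
  | succ m ih =>
    have hv : ∀ l i j, VanishesTo M l (ricciTan γ i j) := fun l i j =>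
      (h.ricci_odd hodd l).vanishesTo hM hJ h0 (hr.ricciTan i j)
        fun y hy => hr.ricci_eq_ricciTan i j hy
    have hv' : ∀ l i j, VanishesTo M l (ricciTan γ' i j) := fun l i j =>
      (h'.ricci_odd hodd l).vanishesTo hM hJ h0 (hr'.ricciTan i j)
        fun y hy => hr'.ricci_eq_ricciTan i j hy
    have hw : ∀ l, VanishesTo M l (ricciRho γ) := fun l =>
      (h.ricci_odd hodd l).vanishesTo hM hJ h0 hr.ricciRho fun y hy => hr.ricci_eq_ricciRho hy
    have hw' : ∀ l, VanishesTo M l (ricciRho γ') := fun l =>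
      (h'.ricci_odd hodd l).vanishesTo hM hJ h0 hr'.ricciRho fun y hy => hr'.ricci_eq_ricciRho hy
    refine ih.succ ?_ (fun i j x hx => ?_) ?_
    -- The resonance `m + 1 = n/2` is excluded by parity.
    · intro e
      obtain ⟨q, hq⟩ := hodd
      have : ((2 * (m + 1) : ℕ) : ℝ) = (Fintype.card ι : ℕ) := by push_cast; linarith
      have := Nat.cast_injective this
      omega
    · rw [hv (m + 1) i j m m.lt_succ_self x hx, hv' (m + 1) i j m m.lt_succ_self x hx]
    -- At `m + 1 = n` the trace of the tangential jets carries no information and `Ric_ρρ` takes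
    -- over; `n > 1` makes `m` a successor.
    · rcases eq_or_ne (m + 1) (Fintype.card ι) with e | e
      · obtain ⟨l, rfl⟩ : ∃ l, m = l + 1 := ⟨m - 1, by omega⟩
        exact Or.inr ⟨l, rfl, fun x hx => by
          rw [hw (l + 1) l l.lt_succ_self x hx, hw' (l + 1) l l.lt_succ_self x hx]⟩
      · exact Or.inl fun e' => e (by exact_mod_cast e')

/-- In even dimension `n`, two ambient metrics agree modulo `ρ^{n/2}`. -/
theorem IsAmbientMetric.comparable_of_even (h : IsAmbientMetric M J g γ)
    (h' : IsAmbientMetric M J g γ') (hM : IsOpen M) (hJ : IsOpen J) (h0 : (0 : ℝ) ∈ J)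
    (heven : Even (Fintype.card ι)) {m : ℕ} (hm : m ≤ Fintype.card ι / 2 - 1) :
    Comparable M J m γ γ' := by
  have hr := h.regular hM hJ
  have hr' := h'.regular hM hJ
  induction m with
  | zero => exact h.comparable_zero h' hM hJ h0
  | succ m ih =>
    have hv : ∀ i j, VanishesTo M (Fintype.card ι / 2 - 1) (ricciTan γ i j) := fun i j =>
      (h.ricci_even heven).vanishesTo hM hJ h0 (hr.ricciTan i j)
        fun y hy => hr.ricci_eq_ricciTan i j hy
    have hv' : ∀ i j, VanishesTo M (Fintype.card ι / 2 - 1) (ricciTan γ' i j) := fun i j =>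
      (h'.ricci_even heven).vanishesTo hM hJ h0 (hr'.ricciTan i j)
        fun y hy => hr'.ricci_eq_ricciTan i j hy
    refine (ih (by omega)).succ ?_ (fun i j x hx => ?_) (Or.inl ?_)
    · intro e
      obtain ⟨q, hq⟩ := heven
      have : ((2 * (m + 1) : ℕ) : ℝ) = (Fintype.card ι : ℕ) := by push_cast; linarith
      have := Nat.cast_injective this
      omega
    · rw [hv i j m (by omega) x hx, hv' i j m (by omega) x hx]
    · intro e
      have : m + 1 = Fintype.card ι := by exact_mod_cast e
      omega

/-- Dividing the trace condition `o(ρ^{n/2-1})` by `ρ^{n/2-1}` and letting `ρ → 0+` gives a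
statement about the leading jets. -/
theorem IsAmbientMetric.trace_jet (h : IsAmbientMetric M J g γ) (hM : IsOpen M) (hJ : IsOpen J)
    (h0 : (0 : ℝ) ∈ J) (heven : Even (Fintype.card ι)) {x : ι → ℝ} (hx : x ∈ M) :
    ∑ i, ∑ j, (g x)⁻¹ i j * dr^[Fintype.card ι / 2 - 1] (ricciTan γ i j) (x, 0) = 0 := by
  have hr := h.regular hM hJ
  set s := Fintype.card ι / 2 - 1 with hs
  have hv : ∀ i j, VanishesTo M s (ricciTan γ i j) := fun i j =>
    (h.ricci_even heven).vanishesTo hM hJ h0 (hr.ricciTan i j)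
      fun y hy => hr.ricci_eq_ricciTan i j hy
  have hline : Tendsto (fun ρ : ℝ => (x, ρ)) (𝓝[>] 0) (𝓝[{p | p.2 ≠ 0}] (x, 0)) := by
    refine tendsto_nhdsWithin_iff.2 ⟨Tendsto.mono_left (Continuous.tendsto (by fun_prop) 0)
      nhdsWithin_le_nhds, ?_⟩
    filter_upwards [self_mem_nhdsWithin] with ρ hρ using ne_of_gt hρ
  have h1 : Tendsto (fun ρ : ℝ => ∑ i, ∑ j, (g x)⁻¹ i j * ((ρ ^ s)⁻¹ * ricciTan γ i j (x, ρ)))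
      (𝓝[>] 0)
      (𝓝 (∑ i, ∑ j, (g x)⁻¹ i j * (dr^[s] (ricciTan γ i j) (x, 0) / s.factorial))) :=
    tendsto_finsetSum _ fun i _ => tendsto_finsetSum _ fun j _ =>
      (((hv i j).tendsto_div hM hJ h0 (hr.ricciTan i j) hx).comp hline).const_mul _
  have h2 := ((h.trace_even heven x hx 1 one_pos).comp_tendsto
    (tendsto_ambientPoint hJ h0 one_pos hx)).tendsto_div_nhds_zero
  have h3 := tendsto_nhds_unique (h1.congr' ?_) h2
  · have : (s.factorial : ℝ) ≠ 0 := by positivity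
    simp only [mul_div_assoc', ← Finset.sum_div] at h3
    exact (div_eq_zero_iff.1 h3).resolve_right this
  · have : J ∈ 𝓝[>] (0 : ℝ) := mem_nhdsWithin_of_mem_nhds (hJ.mem_nhds h0)
    filter_upwards [this] with ρ hρ
    have e : ∀ i j, ricci (ambientMetric γ) (Sum.inl i) (Sum.inl j) (ambientPoint 1 x ρ) =
        ricciTan γ i j (x, ρ) := fun i j =>
      hr.ricci_eq_ricciTan i j (ambientPoint_mem one_pos hx hρ)
    simp only [Function.comp_apply, e, Finset.sum_div]
    refine Finset.sum_congr rfl fun i _ => Finset.sum_congr rfl fun j _ => ?_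
    change _ = (g x)⁻¹ i j * _ / ρ ^ s
    rw [div_eq_mul_inv]; ring

/-- In even dimension `n`, the coefficients of `ρ^{n/2-1}` of the tangential Ricci tensors of two
ambient metrics agree. -/
theorem IsAmbientMetric.ricciTan_jet_eq (h : IsAmbientMetric M J g γ)
    (h' : IsAmbientMetric M J g γ') (hM : IsOpen M) (hJ : IsOpen J) (h0 : (0 : ℝ) ∈ J)
    (heven : Even (Fintype.card ι)) (hn : 1 < Fintype.card ι) (i j : ι) {x : ι → ℝ} (hx : x ∈ M) :
    dr^[Fintype.card ι / 2 - 1] (ricciTan γ i j) (x, 0) =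
      dr^[Fintype.card ι / 2 - 1] (ricciTan γ' i j) (x, 0) := by
  have hc := h.comparable_of_even h' hM hJ h0 heven le_rfl
  set s := Fintype.card ι / 2 - 1 with hs
  obtain ⟨q, hq⟩ := heven
  have hcard : (Fintype.card ι : ℝ) = 2 * (s + 1) := by
    have : Fintype.card ι = 2 * (s + 1) := by omega
    rw [this]; push_cast; ring
  have hg : ∀ i j, invComp γ i j (x, 0) = (g x)⁻¹ i j := fun i j => by
    rw [invComp, h.initial x hx]
  have htr := hc.trace_ricciTan_jet hx
  simp only [mul_sub, Finset.sum_sub_distrib, hg] at htr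
  rw [h.trace_jet hM hJ h0 ⟨q, hq⟩ hx, h'.trace_jet hM hJ h0 ⟨q, hq⟩ hx, hcard, sub_zero] at htr
  -- As `s + 1 = n/2`, the trace factor `s + 1 - n` is nonzero and the trace of the leading
  -- difference vanishes. The leading difference itself stays unknown, but its factor `s + 1 - n/2`
  -- is zero.
  have hne : ((s : ℝ) + 1 - 2 * (s + 1)) ≠ 0 := by
    have : (0 : ℝ) ≤ s := Nat.cast_nonneg s
    intro e; linarith
  have hT := (mul_eq_zero.1 htr.symm).resolve_left hne
  have := hc.ricciTan_jet i j hx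
  simp only [hg, hT, hcard] at this
  have e : (s : ℝ) + 1 - 2 * (s + 1) / 2 = 0 := by ring
  rw [e] at this
  linarith

end AmbientJets

/-! ### Power series in `ρ` with smooth coefficients -/

section Series

variable {W : Type} [NormedAddCommGroup W] [NormedSpace ℝ W]

/-- The coefficients `c_k` are smooth on `Ω` and satisfy the Cauchy-Abel bounds for `|ρ| < ε`. -/
structure SeriesBound {E : Type} [NormedAddCommGroup E] [NormedSpace ℝ E] (Ω : Set W) (ε : ℝ)
    (c : ℕ → W → E) : Prop where
  smooth : ∀ k, ContDiffOn ℝ ∞ (c k) Ω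
  bound : ∀ j : ℕ, ∀ K ⊆ Ω, IsCompact K → ∀ r : ℝ, 0 < r → r < ε →
    ∃ C : ℝ, ∀ k : ℕ, ∀ w ∈ K, ‖iteratedFDeriv ℝ j (c k) w‖ * r ^ k ≤ C

/-- The sum of the power series `Σ_k ρ^k c_k(w)`. -/
def powerSum {E : Type} [NormedAddCommGroup E] [NormedSpace ℝ E] (c : ℕ → W → E) (p : W × ℝ) : E :=
  ∑' k, p.2 ^ k • c k p.1

/-- The coefficients of the `ρ`-derivative of a power series. -/
def shiftCoeff {E : Type} [NormedAddCommGroup E] [NormedSpace ℝ E] (c : ℕ → W → E) (k : ℕ) (w : W) :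
    E := ((k : ℝ) + 1) • c (k + 1) w

namespace SeriesBound

variable {E : Type} [NormedAddCommGroup E] [NormedSpace ℝ E] {Ω : Set W} {ε : ℝ} {c : ℕ → W → E}

/-- Differentiation in `w` raises the order `j` by one, which is why the bounds are required for
every `j`. The values become linear maps, which is why `E` is general. -/
theorem fderiv (hΩ : IsOpen Ω) (h : SeriesBound Ω ε c) :
    SeriesBound Ω ε fun k => _root_.fderiv ℝ (c k) where
  smooth k := ((contDiffOn_infty_iff_fderiv_of_isOpen hΩ).1 (h.smooth k)).2
  bound j K hK hKc r hr hrε := by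
    simp only [norm_iteratedFDeriv_fderiv]
    exact h.bound (j + 1) K hK hKc r hr hrε

theorem clm {G : Type} [NormedAddCommGroup G] [NormedSpace ℝ G] (hΩ : IsOpen Ω)
    (h : SeriesBound Ω ε c) (L : E →L[ℝ] G) : SeriesBound Ω ε fun k w => L (c k w) where
  smooth k := L.contDiff.comp_contDiffOn (h.smooth k)
  bound j K hK hKc r hr hrε := by
    obtain ⟨C, hC⟩ := h.bound j K hK hKc r hr hrε
    refine ⟨‖L‖ * C, fun k w hw => ?_⟩
    have h1 : ‖iteratedFDeriv ℝ j (fun w => L (c k w)) w‖ ≤ ‖L‖ * ‖iteratedFDeriv ℝ j (c k) w‖ :=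
      L.norm_iteratedFDeriv_comp_left ((h.smooth k).contDiffAt (hΩ.mem_nhds (hK hw)))
        (by exact_mod_cast le_top)
    calc _ ≤ ‖L‖ * ‖iteratedFDeriv ℝ j (c k) w‖ * r ^ k := by gcongr
      _ = ‖L‖ * (‖iteratedFDeriv ℝ j (c k) w‖ * r ^ k) := by ring
      _ ≤ ‖L‖ * C := by gcongr; exact hC k w hw

theorem linear_mul_geometric_bounded {q : ℝ} (hq0 : 0 ≤ q) (hq : q < 1) :
    ∃ D, ∀ k : ℕ, ((k : ℝ) + 1) * q ^ k ≤ D := by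
  have h1 : Summable fun k : ℕ => (k : ℝ) ^ 1 * q ^ k :=
    summable_pow_mul_geometric_of_norm_lt_one 1 (by rwa [Real.norm_of_nonneg hq0])
  have h2 : Summable fun k : ℕ => ((k : ℝ) + 1) * q ^ k :=
    (h1.add (summable_geometric_of_lt_one hq0 hq)).congr fun k => by ring
  refine ⟨∑' k : ℕ, ((k : ℝ) + 1) * q ^ k, fun k => h2.le_tsum k fun j _ => by positivity⟩

/-- Linear growth of the factors is absorbed by a radius `r₁` strictly between `r` and `ε`, because
`(k + 1)(r / r₁)^k` is bounded. -/
theorem scale (hΩ : IsOpen Ω) (h : SeriesBound Ω ε c) {p : ℕ → ℝ} {B : ℝ}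
    (hp : ∀ k, |p k| ≤ B * (k + 1)) : SeriesBound Ω ε fun k w => p k • c k w where
  smooth k := (h.smooth k).const_smul _
  bound j K hK hKc r hr hrε := by
    obtain ⟨C, hC⟩ := h.bound j K hK hKc ((r + ε) / 2) (by linarith) (by linarith)
    obtain ⟨D, hD⟩ := linear_mul_geometric_bounded (q := r / ((r + ε) / 2))
      (div_nonneg hr.le (by linarith)) ((div_lt_one (by linarith)).2 (by linarith))
    have hB : 0 ≤ B := by simpa using (abs_nonneg _).trans (hp 0)
    refine ⟨B * D * C, fun k w hw => ?_⟩
    set r1 := (r + ε) / 2 with hr1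
    have hr1pos : 0 < r1 := by rw [hr1]; linarith
    rw [iteratedFDeriv_const_smul_apply' ((h.smooth k).contDiffAt (hΩ.mem_nhds (hK hw)) |>.of_le
      (by exact_mod_cast le_top)), norm_smul, Real.norm_eq_abs]
    calc |p k| * ‖iteratedFDeriv ℝ j (c k) w‖ * r ^ k
        = |p k| * (r / r1) ^ k * (‖iteratedFDeriv ℝ j (c k) w‖ * r1 ^ k) := by
          rw [div_pow]; field_simp
      _ ≤ (B * (k + 1)) * (r / r1) ^ k * C := by
          gcongr
          · exact hp k
          · exact hC k w hw
      _ = B * (((k : ℝ) + 1) * (r / r1) ^ k) * C := by ring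
      _ ≤ B * D * C := by
          have : 0 ≤ C := le_trans (by positivity) (hC k w hw)
          gcongr
          exact hD k

theorem shift (hΩ : IsOpen Ω) (h : SeriesBound Ω ε c) : SeriesBound Ω ε (shiftCoeff c) := by
  have h1 : SeriesBound Ω ε fun k => c (k + 1) :=
    { smooth := fun k => h.smooth _
      bound := fun j K hK hKc r hr hrε => by
        obtain ⟨C, hC⟩ := h.bound j K hK hKc r hr hrε
        refine ⟨C / r, fun k w hw => ?_⟩
        rw [le_div_iff₀ hr, mul_assoc, ← pow_succ]
        exact hC (k + 1) w hw }
  exact h1.scale hΩ (p := fun k => (k : ℝ) + 1) (B := 1) fun k => by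
    rw [abs_of_nonneg (by positivity), one_mul]

/-- The bound at a slightly larger radius provides a geometric majorant, uniform on `K`. -/
theorem summable_bound (h : SeriesBound Ω ε c) {K : Set W} (hK : K ⊆ Ω) (hKc : IsCompact K)
    {r : ℝ} (hr : 0 ≤ r) (hrε : r < ε) :
    ∃ u : ℕ → ℝ, Summable u ∧ ∀ k, ∀ w ∈ K, ∀ ρ : ℝ, |ρ| ≤ r → ‖ρ ^ k • c k w‖ ≤ u k := by
  obtain ⟨C, hC⟩ := h.bound 0 K hK hKc ((r + ε) / 2) (by linarith) (by linarith)
  set r1 := (r + ε) / 2 with hr1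
  have hr1pos : 0 < r1 := by rw [hr1]; linarith
  have hq : r / r1 < 1 := (div_lt_one hr1pos).2 (by rw [hr1]; linarith)
  clear_value r1
  refine ⟨fun k => C * (r / r1) ^ k,
    (summable_geometric_of_lt_one (by positivity) hq).mul_left C, fun k w hw ρ hρ => ?_⟩
  have := hC k w hw
  rw [norm_iteratedFDeriv_zero] at this
  rw [norm_smul, norm_pow, Real.norm_eq_abs]
  calc |ρ| ^ k * ‖c k w‖ ≤ r ^ k * ‖c k w‖ := by gcongr
    _ = (‖c k w‖ * r1 ^ k) * (r / r1) ^ k := by rw [div_pow]; field_simp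
    _ ≤ C * (r / r1) ^ k := by gcongr

theorem summable [CompleteSpace E] (h : SeriesBound Ω ε c) {w : W} (hw : w ∈ Ω) {ρ : ℝ}
    (hρ : |ρ| < ε) : Summable fun k => ρ ^ k • c k w := by
  obtain ⟨u, hu, hb⟩ := h.summable_bound (singleton_subset_iff.2 hw) isCompact_singleton
    (abs_nonneg ρ) hρ
  exact Summable.of_norm_bounded hu fun k => hb k w rfl ρ le_rfl

/-- The term `k = 0` has coefficient zero, so the truncated exponent `k - 1` does no harm. -/
theorem sum_index_shift [CompleteSpace E] (hΩ : IsOpen Ω) (h : SeriesBound Ω ε c) {w : W}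
    (hw : w ∈ Ω) {ρ : ℝ} (hρ : |ρ| < ε) :
    HasSum (fun k : ℕ => ((k : ℝ) * ρ ^ (k - 1)) • c k w) (powerSum (shiftCoeff c) (w, ρ)) := by
  have h1 := ((h.shift hΩ).summable hw hρ).hasSum
  refine (hasSum_nat_add_iff' 1).1 ?_
  simp only [Finset.range_one, Finset.sum_singleton, Nat.cast_zero, zero_mul, zero_smul, sub_zero]
  refine h1.congr_fun ?_
  intro k
  simp only [shiftCoeff, smul_smul, Nat.add_sub_cancel]
  push_cast
  ring_nf

/-- Term-by-term differentiation: near the point, `w` stays in a compact `K ⊆ Ω` and `|ρ| < r < ε`,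
where the series of both partial derivatives have summable majorants. -/
theorem hasFDerivAt [LocallyCompactSpace W] [CompleteSpace E] (hΩ : IsOpen Ω)
    (h : SeriesBound Ω ε c) {p : W × ℝ} (hp : p ∈ Ω ×ˢ Ioo (-ε) ε) :
    HasFDerivAt (powerSum c)
      ((powerSum (fun k => _root_.fderiv ℝ (c k)) p).comp (ContinuousLinearMap.fst ℝ W ℝ) +
        (ContinuousLinearMap.snd ℝ W ℝ).smulRight (powerSum (shiftCoeff c) p)) p := by
  obtain ⟨w0, ρ0⟩ := p
  have hρ0 : |ρ0| < ε := abs_lt.2 hp.2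
  obtain ⟨K, hKc, hwK, hKΩ⟩ := exists_compact_subset hΩ hp.1
  obtain ⟨δ, hδ, hball⟩ := Metric.mem_nhds_iff.1 (mem_interior_iff_mem_nhds.1 hwK)
  obtain ⟨r, hr0, hrε⟩ := exists_between hρ0
  have hr : 0 < r := (abs_nonneg _).trans_lt hr0
  obtain ⟨u, hu, hub⟩ := (h.fderiv hΩ).summable_bound hKΩ hKc hr.le hrε
  obtain ⟨v, hv, hvb⟩ := (h.shift hΩ).summable_bound hKΩ hKc hr.le hrε
  set s : Set (W × ℝ) := Metric.ball w0 δ ×ˢ Metric.ball (0 : ℝ) r with hs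
  have hso : IsOpen s := Metric.isOpen_ball.prod Metric.isOpen_ball
  have hsc : IsPreconnected s :=
    ((convex_ball w0 δ).isPreconnected).prod ((convex_ball (0 : ℝ) r).isPreconnected)
  have hmem : (w0, ρ0) ∈ s := mk_mem_prod (Metric.mem_ball_self hδ) (by simpa using hr0)
  set f' : ℕ → W × ℝ → (W × ℝ →L[ℝ] E) := fun k q =>
    (q.2 ^ k • _root_.fderiv ℝ (c k) q.1).comp (ContinuousLinearMap.fst ℝ W ℝ) +
      (ContinuousLinearMap.snd ℝ W ℝ).smulRight (((k : ℝ) * q.2 ^ (k - 1)) • c k q.1) with hf'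
  -- The `ρ`-derivative of the `k`-th term is the term `k - 1` of `shiftCoeff`; hence the shifted
  -- majorant, with value `0` at `k = 0`.
  set v' : ℕ → ℝ := fun k => if k = 0 then 0 else v (k - 1) with hv'
  have hv's : Summable v' := by
    refine (summable_nat_add_iff 1).1 (hv.congr fun k => ?_)
    simp [hv']
  have hder : ∀ k, ∀ q ∈ s, HasFDerivAt (fun q : W × ℝ => q.2 ^ k • c k q.1) (f' k q) q := by
    intro k q hq
    have h1 : HasFDerivAt (fun q : W × ℝ => q.2 ^ k)
        (((k : ℝ) * q.2 ^ (k - 1)) • ContinuousLinearMap.snd ℝ W ℝ) q := by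
      have := (hasDerivAt_pow k q.2).comp_hasFDerivAt q
        (hasFDerivAt_snd (𝕜 := ℝ) (E := W) (F := ℝ) (p := q))
      exact this
    have h2 : HasFDerivAt (fun q : W × ℝ => c k q.1)
        ((_root_.fderiv ℝ (c k) q.1).comp (ContinuousLinearMap.fst ℝ W ℝ)) q :=
      (ContDiffOn.differentiableAt_of_isOpen (h.smooth k) hΩ
        (hKΩ (hball hq.1))).hasFDerivAt.comp q hasFDerivAt_fst
    refine (h1.smul h2).congr_fderiv ?_
    ext z <;> simp [hf', smul_smul, mul_comm]
  have hbound : ∀ k, ∀ q ∈ s, ‖f' k q‖ ≤ u k + v' k := by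
    intro k q hq
    have hq2 : |q.2| ≤ r := by
      have := hq.2
      rw [Metric.mem_ball, Real.dist_eq, sub_zero] at this
      exact this.le
    refine (norm_add_le _ _).trans (add_le_add ?_ ?_)
    · calc _ ≤ ‖q.2 ^ k • _root_.fderiv ℝ (c k) q.1‖ * ‖ContinuousLinearMap.fst ℝ W ℝ‖ :=
          ContinuousLinearMap.opNorm_comp_le _ _
        _ ≤ u k * 1 := by
          gcongr
          · exact (norm_nonneg _).trans (hub k q.1 (hball hq.1) q.2 hq2)
          · exact hub k q.1 (hball hq.1) q.2 hq2
          · exact ContinuousLinearMap.norm_fst_le ..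
        _ = u k := mul_one _
    · rw [ContinuousLinearMap.norm_smulRight_apply]
      have : ‖((k : ℝ) * q.2 ^ (k - 1)) • c k q.1‖ ≤ v' k := by
        cases k with
        | zero => simp [hv']
        | succ k =>
          have := hvb k q.1 (hball hq.1) q.2 hq2
          simp only [shiftCoeff, smul_smul] at this
          simp only [hv', Nat.add_sub_cancel, if_neg (Nat.succ_ne_zero k)]
          push_cast
          rwa [mul_comm]
      calc _ ≤ 1 * v' k := by
            gcongr
            exact ContinuousLinearMap.norm_snd_le ..
        _ = v' k := one_mul _
  have key := hasFDerivAt_tsum_of_isPreconnected (hu.add hv's) hso hsc hder hbound hmem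
    (h.summable hp.1 hρ0) hmem
  refine key.congr_fderiv ?_
  have e1 := ((h.fderiv hΩ).summable hp.1 hρ0).hasSum
  have e2 := h.sum_index_shift hΩ hp.1 hρ0
  have e3 := (e1.mapL ((ContinuousLinearMap.compL ℝ (W × ℝ) W E).flip
    (ContinuousLinearMap.fst ℝ W ℝ)))
  have e4 := e2.mapL (ContinuousLinearMap.smulRightL ℝ (W × ℝ) E (ContinuousLinearMap.snd ℝ W ℝ))
  exact (e3.add e4).tsum_eq

/-- The derivative is assembled from two series of the same kind, one of them with values in `W
→L[ℝ] E`. The induction on the order therefore runs over all target spaces. -/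
theorem contDiffOn_nat [LocallyCompactSpace W] {Ω : Set W} {ε : ℝ} (hΩ : IsOpen Ω) (m : ℕ) :
    ∀ (E : Type) [NormedAddCommGroup E] [NormedSpace ℝ E] [CompleteSpace E] (c : ℕ → W → E),
      SeriesBound Ω ε c → ContDiffOn ℝ m (powerSum c) (Ω ×ˢ Ioo (-ε) ε) := by
  have hU : IsOpen (Ω ×ˢ Ioo (-ε) ε) := hΩ.prod isOpen_Ioo
  induction m with
  | zero =>
    intro E _ _ _ c h
    rw [Nat.cast_zero, contDiffOn_zero]
    exact fun p hp => (h.hasFDerivAt hΩ hp).continuousAt.continuousWithinAt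
  | succ m ih =>
    intro E _ _ _ c h
    rw [Nat.cast_succ, contDiffOn_succ_iff_fderiv_of_isOpen hU]
    refine ⟨fun p hp => (h.hasFDerivAt hΩ hp).differentiableAt.differentiableWithinAt,
      fun e => absurd e (by simp), ?_⟩
    have h1 := ih (W →L[ℝ] E) _ (h.fderiv hΩ)
    have h2 := ih E _ (h.shift hΩ)
    have h3 : ContDiffOn ℝ m (fun p : W × ℝ =>
        (powerSum (fun k => _root_.fderiv ℝ (c k)) p).comp (ContinuousLinearMap.fst ℝ W ℝ) +
        (ContinuousLinearMap.snd ℝ W ℝ).smulRight (powerSum (shiftCoeff c) p))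
        (Ω ×ˢ Ioo (-ε) ε) :=
      (h1.clm_comp contDiffOn_const).add
        ((ContinuousLinearMap.smulRightL ℝ (W × ℝ) E
          (ContinuousLinearMap.snd ℝ W ℝ)).contDiff.comp_contDiffOn h2)
    exact h3.congr fun p hp => (h.hasFDerivAt hΩ hp).fderiv

/-- The sum of a convergent power series with smooth coefficients is smooth. -/
theorem contDiffOn [LocallyCompactSpace W] [CompleteSpace E] (hΩ : IsOpen Ω)
    (h : SeriesBound Ω ε c) : ContDiffOn ℝ ∞ (powerSum c) (Ω ×ˢ Ioo (-ε) ε) :=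
  contDiffOn_infty.2 fun m => contDiffOn_nat hΩ m E c h

end SeriesBound

end Series

/-! ### Scalar series: derivatives, Taylor coefficients and analyticity. -/

section ScalarSeries

variable {W : Type} [NormedAddCommGroup W] [NormedSpace ℝ W] {Ω : Set W} {ε : ℝ}
  {c : ℕ → W → ℝ}

namespace SeriesBound

theorem dirD_coeff (hΩ : IsOpen Ω) (h : SeriesBound Ω ε c) (e : W) :
    SeriesBound Ω ε fun k => dirD e (c k) :=
  (h.fderiv hΩ).clm hΩ (ContinuousLinearMap.apply ℝ ℝ e)

theorem dirD_powerSum [LocallyCompactSpace W] (hΩ : IsOpen Ω) (h : SeriesBound Ω ε c) (e : W) :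
    EqOn (dirD (e, (0 : ℝ)) (powerSum c)) (powerSum fun k => dirD e (c k))
      (Ω ×ˢ Ioo (-ε) ε) := fun p hp => by
  rw [dirD, (h.hasFDerivAt hΩ hp).fderiv]
  have h1 := ((h.fderiv hΩ).summable hp.1 (abs_lt.2 hp.2)).hasSum
  have h2 := h1.mapL (ContinuousLinearMap.apply ℝ ℝ e)
  simp only [ContinuousLinearMap.apply_apply, smul_apply] at h2
  simp only [add_apply, ContinuousLinearMap.comp_apply,
    ContinuousLinearMap.coe_fst', ContinuousLinearMap.smulRight_apply,
    ContinuousLinearMap.coe_snd', zero_smul, add_zero]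
  exact h2.tsum_eq.symm

theorem dr_powerSum [LocallyCompactSpace W] (hΩ : IsOpen Ω) (h : SeriesBound Ω ε c) :
    EqOn (dr (powerSum c)) (powerSum (shiftCoeff c)) (Ω ×ˢ Ioo (-ε) ε) := fun p hp => by
  rw [dr, dirD, (h.hasFDerivAt hΩ hp).fderiv]
  simp

theorem dr_iterate_powerSum [LocallyCompactSpace W] (hΩ : IsOpen Ω) (hε : 0 < ε)
    (h : SeriesBound Ω ε c) (k : ℕ) {w : W} (hw : w ∈ Ω) :
    dr^[k] (powerSum c) (w, 0) = k.factorial * c k w := by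
  have hU : IsOpen (Ω ×ˢ Ioo (-ε) ε) := hΩ.prod isOpen_Ioo
  have hp : (w, (0 : ℝ)) ∈ Ω ×ˢ Ioo (-ε) ε := mk_mem_prod hw ⟨by linarith, hε⟩
  induction k generalizing c with
  | zero =>
    simp only [Function.iterate_zero, id, powerSum]
    rw [tsum_eq_single 0 fun k hk => by simp [hk]]
    simp
  | succ k ih =>
    rw [Function.iterate_succ_apply, dr_iterate_congr hU (h.dr_powerSum hΩ) k hp,
      ih (h.shift hΩ), shiftCoeff, Nat.factorial_succ]
    push_cast
    simp only [smul_eq_mul]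
    ring

theorem hasSum (h : SeriesBound Ω ε c) {p : W × ℝ} (hp : p ∈ Ω ×ˢ Ioo (-ε) ε) :
    HasSum (fun k => p.2 ^ k * c k p.1) (powerSum c p) :=
  (h.summable hp.1 (abs_lt.2 hp.2)).hasSum

/-- The sum of the series with coefficients `k c_k`. -/
theorem hasSum_snd_mul_dr [LocallyCompactSpace W] (hΩ : IsOpen Ω) (h : SeriesBound Ω ε c)
    {p : W × ℝ} (hp : p ∈ Ω ×ˢ Ioo (-ε) ε) :
    HasSum (fun k : ℕ => p.2 ^ k * ((k : ℝ) * c k p.1)) (p.2 * dr (powerSum c) p) := by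
  have := (h.sum_index_shift hΩ hp.1 (abs_lt.2 hp.2)).mul_left p.2
  rw [h.dr_powerSum hΩ hp]
  refine this.congr_fun fun k => ?_
  cases k with
  | zero => simp
  | succ k => simp only [Nat.add_sub_cancel, smul_eq_mul, pow_succ]; ring

/-- The bounds `|c_k| r^k ≤ C` for all `r < ε` make the radius of convergence at least `ε`. -/
theorem analyticOnNhd (h : SeriesBound Ω ε c) {w : W} (hw : w ∈ Ω) :
    AnalyticOnNhd ℝ (fun ρ => powerSum c (w, ρ)) (Ioo (-ε) ε) := by
  rcases le_or_gt ε 0 with hε | hε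
  · rw [Ioo_eq_empty (by linarith)]
    exact fun x hx => absurd hx (notMem_empty x)
  set q := FormalMultilinearSeries.ofScalars ℝ (fun k => c k w) with hq
  have hrad : ENNReal.ofReal ε ≤ q.radius := by
    refine le_of_forall_lt fun r hr => ?_
    lift r to NNReal using hr.ne_top
    obtain ⟨r', hr', hr'ε⟩ := exists_between hr
    lift r' to NNReal using hr'ε.ne_top
    refine lt_of_lt_of_le hr' ?_
    have h1 : (r' : ℝ) < ε := by
      rw [← ENNReal.ofReal_coe_nnreal] at hr'ε
      exact (ENNReal.ofReal_lt_ofReal_iff hε).1 hr'ε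
    have h2 : (0 : ℝ) < r' := by
      have : r < r' := by exact_mod_cast hr'
      exact_mod_cast (zero_le (a := r)).trans_lt this
    obtain ⟨C, hC⟩ := h.bound 0 {w} (singleton_subset_iff.2 hw) isCompact_singleton r' h2 h1
    refine FormalMultilinearSeries.le_radius_of_bound _ C fun k => ?_
    have := hC k w rfl
    rw [norm_iteratedFDeriv_zero] at this
    rwa [hq, FormalMultilinearSeries.ofScalars_norm]
  have hfun : (fun ρ => powerSum c (w, ρ)) = q.sum := by
    ext ρ
    rw [hq, ← FormalMultilinearSeries.ofScalarsSum, FormalMultilinearSeries.ofScalarsSum_eq_tsum]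
    simp only [powerSum, smul_eq_mul, mul_comm]
  have hpos : 0 < q.radius := lt_of_lt_of_le (ENNReal.ofReal_pos.2 hε) hrad
  have hball := (q.hasFPowerSeriesOnBall hpos).analyticOnNhd
  rw [hfun]
  refine hball.mono fun ρ hρ => ?_
  refine Metric.eball_subset_eball hrad ?_
  rw [Metric.eball_ofReal, Metric.mem_ball, Real.dist_eq, sub_zero]
  exact abs_lt.2 hρ

end SeriesBound

end ScalarSeries

/-! ### The Laplacian and the wave operator -/

section Wave

variable {n : ℕ}

/-- The coordinate direction `∂_{x^i}` in the variables `(x, u)`. -/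
def xdir (i : Fin (n - 2)) : XU n := (EuclideanSpace.single i 1, 0)

/-- Connects the Laplacian on slices `u = const` with iterated directional derivatives on the joint
space, to which the calculus of `dirD` applies. -/
theorem lap_eq {Ω : Set (XU n)} (hΩ : IsOpen Ω) {F : XU n → ℝ} (hF : ContDiffOn ℝ ∞ F Ω)
    {w : XU n} (hw : w ∈ Ω) : lap F w = ∑ i, dirD (xdir i) (dirD (xdir i) F) w := by
  have hs := fun e => ContDiffOn.dirD hF hΩ e
  have hop : IsOpen {x | (x, w.2) ∈ Ω} := hΩ.preimage (by fun_prop)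
  have hinl : ∀ {G : XU n → ℝ} {y : EuclideanSpace ℝ (Fin (n - 2))} (_ : ContDiffOn ℝ ∞ G Ω)
      (_ : (y, w.2) ∈ Ω) (e : EuclideanSpace ℝ (Fin (n - 2))),
      dirD e (fun x => G (x, w.2)) y = dirD (e, (0 : ℝ)) G (y, w.2) := by
    intro G y hG hy e
    exact (dirD_slice hΩ hG e hy).symm
  have hFs : ContDiffOn ℝ ∞ (fun x => F (x, w.2)) {x | (x, w.2) ∈ Ω} :=
    hF.comp (by fun_prop) fun x hx => hx
  rw [lap, InnerProductSpace.laplacian_eq_iteratedFDeriv_orthonormalBasis _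
    (EuclideanSpace.basisFun (Fin (n - 2)) ℝ)]
  refine Finset.sum_congr rfl fun i _ => ?_
  rw [iteratedFDeriv_two_apply]
  simp only [Matrix.cons_val_zero, Matrix.cons_val_one, EuclideanSpace.basisFun_apply]
  have hd : DifferentiableAt ℝ (fderiv ℝ fun x => F (x, w.2)) w.1 :=
    ContDiffOn.differentiableAt_of_isOpen
      ((contDiffOn_infty_iff_fderiv_of_isOpen hop).1 hFs).2 hop hw
  have e1 : fderiv ℝ (fderiv ℝ fun x => F (x, w.2)) w.1 (EuclideanSpace.single i 1)
      (EuclideanSpace.single i 1) =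
      dirD (EuclideanSpace.single i 1) (dirD (EuclideanSpace.single i 1) fun x => F (x, w.2))
        w.1 := by
    have := fderiv_clm_apply hd (differentiableAt_const (EuclideanSpace.single i (1 : ℝ)))
    change _ = fderiv ℝ (fun y => fderiv ℝ (fun x => F (x, w.2)) y (EuclideanSpace.single i 1))
      w.1 _
    rw [this]
    simp
  have e2 : EqOn (dirD (EuclideanSpace.single i 1) fun x => F (x, w.2))
      (fun x => dirD (xdir i) F (x, w.2)) {x | (x, w.2) ∈ Ω} := fun y hy => hinl hF hy _
  rw [e1, dirD_congr hop e2 _ hw, hinl (hs _) hw]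
  rfl

theorem ContDiffOn.lap {Ω : Set (XU n)} (hΩ : IsOpen Ω) {F : XU n → ℝ}
    (hF : ContDiffOn ℝ ∞ F Ω) : ContDiffOn ℝ ∞ (PPWave.lap F) Ω :=
  (ContDiffOn.sum fun i _ => ContDiffOn.dirD (ContDiffOn.dirD hF hΩ (xdir i)) hΩ (xdir i)).congr
    fun _ hw => lap_eq hΩ hF hw

theorem ContDiffOn.lap_iterate {Ω : Set (XU n)} (hΩ : IsOpen Ω) {F : XU n → ℝ}
    (hF : ContDiffOn ℝ ∞ F Ω) (k : ℕ) : ContDiffOn ℝ ∞ (PPWave.lap^[k] F) Ω := by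
  induction k generalizing F with
  | zero => exact hF
  | succ k ih => exact ih (ContDiffOn.lap hΩ hF)

theorem lap_congr {Ω : Set (XU n)} (hΩ : IsOpen Ω) {F G : XU n → ℝ} (h : EqOn F G Ω) :
    EqOn (lap F) (lap G) Ω := fun w hw => by
  refine (InnerProductSpace.laplacian_congr_nhds ?_).eq_of_nhds
  have hop : IsOpen {x | (x, w.2) ∈ Ω} := hΩ.preimage (by fun_prop)
  exact eventually_of_mem (hop.mem_nhds hw) fun x hx => h hx

theorem lap_const_mul {Ω : Set (XU n)} (hΩ : IsOpen Ω) {F : XU n → ℝ}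
    (hF : ContDiffOn ℝ ∞ F Ω) (a : ℝ) : EqOn (lap fun w => a * F w) (fun w => a * lap F w) Ω :=
  fun w hw => by
  have hd : ∀ {G : XU n → ℝ}, ContDiffOn ℝ ∞ G Ω → ∀ e, EqOn (dirD e fun w => a * G w)
      (fun w => a * dirD e G w) Ω := fun hG e w hw =>
    dirD_const_mul e a (ContDiffOn.differentiableAt_of_isOpen hG hΩ hw)
  simp only
  rw [lap_eq hΩ (contDiffOn_const.mul hF) hw, lap_eq hΩ hF hw, Finset.mul_sum]
  refine Finset.sum_congr rfl fun i _ => ?_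
  rw [dirD_congr hΩ (hd hF (xdir i)) _ hw, hd (ContDiffOn.dirD hF hΩ _) _ hw]

/-- The flat Laplacian in the variables `x`, acting on functions of `(x, u, ρ)`. -/
def lapX (F : XU n × ℝ → ℝ) (p : XU n × ℝ) : ℝ :=
  ∑ i : Fin (n - 2), dirD (xdir i, (0 : ℝ)) (dirD (xdir i, (0 : ℝ)) F) p

/-- The operator `ρ ∂_ρ² - c ∂_ρ - ½ Δ`. -/
def waveOp (c : ℝ) (F : XU n × ℝ → ℝ) (p : XU n × ℝ) : ℝ :=
  p.2 * dr (dr F) p - c * dr F p - (1 / 2) * lapX F p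

variable {U : Set (XU n × ℝ)} {F G : XU n × ℝ → ℝ}

theorem ContDiffOn.lapX (hU : IsOpen U) (hF : ContDiffOn ℝ ∞ F U) :
    ContDiffOn ℝ ∞ (PPWave.lapX F) U :=
  ContDiffOn.sum fun _ _ => ContDiffOn.dirD (ContDiffOn.dirD hF hU _) hU _

theorem ContDiffOn.waveOp (hU : IsOpen U) (hF : ContDiffOn ℝ ∞ F U) (c : ℝ) :
    ContDiffOn ℝ ∞ (PPWave.waveOp c F) U :=
  ((contDiffOn_snd.mul (ContDiffOn.dr (ContDiffOn.dr hF hU) hU)).sub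
    (contDiffOn_const.mul (ContDiffOn.dr hF hU))).sub
    (contDiffOn_const.mul (ContDiffOn.lapX hU hF))

theorem waveOp_congr (hU : IsOpen U) (h : EqOn F G U) (c : ℝ) :
    EqOn (waveOp c F) (waveOp c G) U := fun p hp => by
  have h1 : EqOn (dr F) (dr G) U := dirD_congr hU h _
  have h2 : EqOn (dr (dr F)) (dr (dr G)) U := dirD_congr hU h1 _
  have h3 : ∀ e, EqOn (dirD e (dirD e F)) (dirD e (dirD e G)) U := fun e =>
    dirD_congr hU (dirD_congr hU h e) e
  simp only [waveOp, lapX, h1 hp, h2 hp, h3 _ hp]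

theorem waveOp_add (hU : IsOpen U) (hF : ContDiffOn ℝ ∞ F U) (hG : ContDiffOn ℝ ∞ G U) (c : ℝ) :
    EqOn (waveOp c fun p => F p + G p) (fun p => waveOp c F p + waveOp c G p) U := fun p hp => by
  have h1 : ∀ e, EqOn (dirD e fun p => F p + G p) (fun p => dirD e F p + dirD e G p) U :=
    fun e q hq => dirD_add e (ContDiffOn.differentiableAt_of_isOpen hF hU hq)
      (ContDiffOn.differentiableAt_of_isOpen hG hU hq)
  have h2 : ∀ e, EqOn (dirD e (dirD e fun p => F p + G p))
      (fun p => dirD e (dirD e F) p + dirD e (dirD e G) p) U := fun e q hq =>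
    (dirD_congr hU (h1 e) e hq).trans
      (dirD_add e (ContDiffOn.differentiableAt_of_isOpen (ContDiffOn.dirD hF hU e) hU hq)
        (ContDiffOn.differentiableAt_of_isOpen (ContDiffOn.dirD hG hU e) hU hq))
  simp only [waveOp, lapX, dr, h1 _ hp, h2 _ hp, Finset.sum_add_distrib]
  ring

/-- The wave operator applied to `α(ρ) F(x, u, ρ)`. -/
theorem waveOp_mul (hU : IsOpen U) (hF : ContDiffOn ℝ ∞ F U) (c : ℝ) {α α₁ α₂ : ℝ → ℝ}
    (h1 : ∀ p ∈ U, HasDerivAt α (α₁ p.2) p.2) (h2 : ∀ p ∈ U, HasDerivAt α₁ (α₂ p.2) p.2) :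
    EqOn (waveOp c fun p => α p.2 * F p) (fun p => p.2 * (α₂ p.2 * F p + 2 * α₁ p.2 * dr F p +
      α p.2 * dr (dr F) p) - c * (α₁ p.2 * F p + α p.2 * dr F p) -
      (1 / 2) * (α p.2 * lapX F p)) U := by
  have hα : ∀ {β β₁ : ℝ → ℝ}, (∀ p ∈ U, HasDerivAt β (β₁ p.2) p.2) → ∀ p ∈ U,
      ∀ e : XU n × ℝ, DifferentiableAt ℝ (fun p : XU n × ℝ => β p.2) p ∧
        dirD e (fun p : XU n × ℝ => β p.2) p = e.2 * β₁ p.2 := by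
    intro β β₁ hβ p hp e
    have := (hβ p hp).comp_hasFDerivAt p (hasFDerivAt_snd (𝕜 := ℝ) (E := XU n) (F := ℝ) (p := p))
    refine ⟨this.differentiableAt, ?_⟩
    have h3 : fderiv ℝ (fun p : XU n × ℝ => β p.2) p = _ := this.fderiv
    rw [dirD, h3]
    simp [mul_comm]
  have hd : ∀ {G : XU n × ℝ → ℝ}, ContDiffOn ℝ ∞ G U → ∀ p ∈ U, DifferentiableAt ℝ G p :=
    fun hG p hp => ContDiffOn.differentiableAt_of_isOpen hG hU hp
  have hmul : ∀ {β β₁ : ℝ → ℝ} {G : XU n × ℝ → ℝ}, (∀ p ∈ U, HasDerivAt β (β₁ p.2) p.2) →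
      ContDiffOn ℝ ∞ G U → ∀ e : XU n × ℝ, ∀ p ∈ U,
      dirD e (fun p : XU n × ℝ => β p.2 * G p) p = e.2 * β₁ p.2 * G p + β p.2 * dirD e G p := by
    intro β β₁ G hβ hG e p hp
    rw [dirD_mul e (hα hβ p hp e).1 (hd hG p hp), (hα hβ p hp e).2]
  have hdr := ContDiffOn.dr hF hU
  have e1 : EqOn (dr fun p => α p.2 * F p) (fun p => α₁ p.2 * F p + α p.2 * dr F p) U :=
    fun p hp => by
      have := hmul h1 hF ((0 : XU n), (1 : ℝ)) p hp
      simpa using! this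
  have hdiff : ∀ {β β₁ : ℝ → ℝ} {G : XU n × ℝ → ℝ}, (∀ p ∈ U, HasDerivAt β (β₁ p.2) p.2) →
      ContDiffOn ℝ ∞ G U → ∀ p ∈ U, DifferentiableAt ℝ (fun p : XU n × ℝ => β p.2 * G p) p :=
    fun hβ hG p hp => (hα hβ p hp 0).1.mul (hd hG p hp)
  have e2 : EqOn (dr (dr fun p => α p.2 * F p)) (fun p => α₂ p.2 * F p + 2 * α₁ p.2 * dr F p +
      α p.2 * dr (dr F) p) U := fun p hp => by
    have h3 := dirD_congr hU e1 ((0 : XU n), (1 : ℝ)) hp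
    rw [dirD_add _ (hdiff h2 hF p hp) (hdiff h1 hdr p hp), hmul h2 hF _ p hp,
      hmul h1 hdr _ p hp] at h3
    refine h3.trans ?_
    simp only [dr]
    ring
  have e3 : ∀ e : XU n, EqOn (dirD (e, (0 : ℝ)) (dirD (e, (0 : ℝ)) fun p => α p.2 * F p))
      (fun p => α p.2 * dirD (e, (0 : ℝ)) (dirD (e, (0 : ℝ)) F) p) U := fun e p hp => by
    have h4 : EqOn (dirD (e, (0 : ℝ)) fun p => α p.2 * F p)
        (fun p => α p.2 * dirD (e, (0 : ℝ)) F p) U := fun q hq => by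
      rw [hmul h1 hF _ q hq]; simp
    rw [dirD_congr hU h4 _ hp, hmul h1 (ContDiffOn.dirD hF hU _) _ p hp]; simp
  intro p hp
  simp only [waveOp, lapX, e1 hp, e2 hp, e3 _ hp, Finset.mul_sum]

/-- The wave operator applied to `ρ^s F(x, u, ρ)`. -/
theorem waveOp_pow_mul (hU : IsOpen U) (hF : ContDiffOn ℝ ∞ F U) (s : ℝ) {α α₁ α₂ : ℝ → ℝ}
    (h1 : ∀ p ∈ U, HasDerivAt α (α₁ p.2) p.2) (h2 : ∀ p ∈ U, HasDerivAt α₁ (α₂ p.2) p.2)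
    (h3 : ∀ p ∈ U, p.2 * α₁ p.2 = s * α p.2) (h4 : ∀ p ∈ U, p.2 * α₂ p.2 = (s - 1) * α₁ p.2) :
    EqOn (waveOp (s - 1) fun p => α p.2 * F p)
      (fun p => α p.2 * waveOp (-(s + 1)) F p) U := fun p hp => by
  rw [waveOp_mul hU hF _ h1 h2 hp]
  simp only [waveOp]
  -- The terms in undifferentiated `F` cancel because `ρα'' = (s - 1)α'`. By `ρα' = sα` the
  -- first-order terms become `(2s - (s - 1)) αF' = (s + 1) αF'`.
  linear_combination (F p) * h4 p hp + 2 * dr F p * h3 p hp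

/-- The jets of the wave operator at `ρ = 0`. -/
theorem dr_iterate_waveOp {Ω : Set (XU n)} {J : Set ℝ} (hΩ : IsOpen Ω) (hJ : IsOpen J)
    (h0 : (0 : ℝ) ∈ J) (hF : ContDiffOn ℝ ∞ F (Ω ×ˢ J)) (c : ℝ) (k : ℕ) {w : XU n}
    (hw : w ∈ Ω) : dr^[k] (waveOp c F) (w, 0) =
      ((k : ℝ) - c) * dr^[k + 1] F (w, 0) - (1 / 2) * lap (fun w => dr^[k] F (w, 0)) w := by
  have hU := hΩ.prod hJ
  have hp : (w, (0 : ℝ)) ∈ Ω ×ˢ J := mk_mem_prod hw h0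
  have hd := ContDiffOn.dr hF hU
  have hdd := ContDiffOn.dr hd hU
  have s1 : ContDiffOn ℝ ∞ (fun p : XU n × ℝ => p.2 * dr (dr F) p) (Ω ×ˢ J) :=
    contDiffOn_snd.mul hdd
  have s2 : ContDiffOn ℝ ∞ (fun p : XU n × ℝ => c * dr F p) (Ω ×ˢ J) := contDiffOn_const.mul hd
  have s4 := ContDiffOn.lapX hU hF
  have s3 : ContDiffOn ℝ ∞ (fun p : XU n × ℝ => (1 / 2) * lapX F p) (Ω ×ˢ J) :=
    contDiffOn_const.mul s4
  have hk := ContDiffOn.dr_iterate hF hU k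
  have hk0 : ContDiffOn ℝ ∞ (fun w => dr^[k] F (w, 0)) Ω :=
    hk.comp (contDiffOn_id.prodMk contDiffOn_const) fun y hy => mk_mem_prod hy h0
  have e1 : dr^[k] (lapX F) (w, 0) = lap (fun w => dr^[k] F (w, 0)) w := by
    have := dr_iterate_sum Finset.univ hU (F := fun i : Fin (n - 2) =>
      dirD (xdir i, (0 : ℝ)) (dirD (xdir i, (0 : ℝ)) F))
      (fun i => ContDiffOn.dirD (ContDiffOn.dirD hF hU _) hU _) k hp
    refine this.trans ?_
    rw [lap_eq hΩ hk0 hw]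
    refine Finset.sum_congr rfl fun i _ => ?_
    have hk1 := ContDiffOn.dirD hk hU (xdir i, (0 : ℝ))
    rw [dr_iterate_dirD hU (ContDiffOn.dirD hF hU _) _ k hp,
      dirD_congr hU (dr_iterate_dirD hU hF (xdir i, (0 : ℝ)) k) _ hp, dirD_slice hU hk1 _ hp]
    exact dirD_congr hΩ (fun y hy => dirD_slice hU hk _ (mk_mem_prod hy h0)) _ hw
  have e2 : (k : ℝ) * dr^[k - 1] (dr (dr F)) (w, 0) = k * dr^[k + 1] F (w, 0) := by
    cases k with
    | zero => simp
    | succ k => rfl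
  have := dr_iterate_sub hU (s1.sub s2) s3 k hp
  refine this.trans ?_
  rw [dr_iterate_sub hU s1 s2 k hp, dr_iterate_snd_mul hΩ hJ h0 hdd k hw,
    dr_iterate_const_mul hU hd c k hp, dr_iterate_const_mul hU s4 _ k hp, e1, e2,
    ← Function.iterate_succ_apply]
  ring

end Wave

/-! ### Ambient metrics of pp-wave type -/

section PPAmbient

variable {n : ℕ}

/-- The projection `(x, u, v) ↦ (x, u)` as a continuous linear map. -/
def projL : (Idx n → ℝ) →L[ℝ] XU n :=
  (((EuclideanSpace.equiv (Fin (n - 2)) ℝ).symm : (Fin (n - 2) → ℝ) →L[ℝ] _).comp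
    (ContinuousLinearMap.pi fun i => ContinuousLinearMap.proj (Sum.inl i))).prod
    (ContinuousLinearMap.proj (Sum.inr 0))

/-- The point with coordinates `(x, u, v)`. -/
def lift (v : ℝ) (w : XU n) : Idx n → ℝ := Sum.elim (fun i => w.1 i) ![w.2, v]

theorem proj_lift (v : ℝ) (w : XU n) : proj (lift v w) = w := rfl

theorem lift_proj (z : Idx n → ℝ) : lift (z (Sum.inr 1)) (proj z) = z := by
  ext i
  rcases i with i | i
  · rfl
  · fin_cases i <;> rfl

theorem contDiff_lift (v : ℝ) : ContDiff ℝ ∞ (lift (n := n) v) := by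
  refine contDiff_pi.2 fun i => ?_
  rcases i with i | i
  · have : (fun w : XU n => lift v w (Sum.inl i)) = fun w => w.1 i := rfl
    rw [this]
    fun_prop
  · fin_cases i
    · exact contDiff_snd
    · exact contDiff_const

theorem isOpen_image_proj {M : Set (Idx n → ℝ)} (hM : IsOpen M) :
    IsOpen (proj '' M : Set (XU n)) :=
  (projL (n := n)).isOpenMap (fun w => ⟨lift 0 w, proj_lift 0 w⟩) M hM

theorem card_idx (hn : 3 ≤ n) : Fintype.card (Idx n) = n := by
  simp [Idx]; omega

theorem projL_single_inl (i : Fin (n - 2)) :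
    projL (Pi.single (Sum.inl i) 1 : Idx n → ℝ) = xdir i := by
  refine Prod.ext ?_ ?_
  · ext j
    change (Pi.single (Sum.inl i) 1 : Idx n → ℝ) (Sum.inl j) = _
    simp [xdir, Pi.single_apply]
  · change (Pi.single (Sum.inl i) 1 : Idx n → ℝ) (Sum.inr 0) = _
    simp [xdir]

theorem projL_single_one : projL (Pi.single (Sum.inr 1) 1 : Idx n → ℝ) = 0 := by
  refine Prod.ext ?_ ?_
  · ext j
    change (Pi.single (Sum.inr 1) 1 : Idx n → ℝ) (Sum.inl j) = _
    simp
  · change (Pi.single (Sum.inr 1) 1 : Idx n → ℝ) (Sum.inr 0) = _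
    simp

theorem ppFamily_eq (H : XU n → ℝ) (h : XU n → ℝ → ℝ) (z : Idx n → ℝ) (ρ : ℝ) :
    ppFamily H h z ρ = ppMatrix n (H (proj z) + h (proj z) ρ) := by
  rw [ppFamily, ppMatrix, ppMatrix, duSq, Matrix.fromBlocks_add]
  congr 1
  · simp
  · simp
  · simp
  · ext i j
    fin_cases i <;> fin_cases j <;> simp

/-- The inverse of the matrix of a pp-wave. -/
def ppInv (n : ℕ) (a : ℝ) : Matrix (Idx n) (Idx n) ℝ :=
  Matrix.fromBlocks 1 0 0 !![0, 1; 1, -a]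

theorem ppMatrix_mul_ppInv (a : ℝ) : ppMatrix n a * ppInv n a = 1 := by
  rw [ppMatrix, ppInv, Matrix.fromBlocks_multiply, ← Matrix.fromBlocks_one]
  congr 1
  · simp
  · simp
  · simp
  · ext i j
    fin_cases i <;> fin_cases j <;> simp

theorem ppMatrix_inv (a : ℝ) : (ppMatrix n a)⁻¹ = ppInv n a :=
  Matrix.inv_eq_right_inv (ppMatrix_mul_ppInv a)

theorem ppMatrix_det (a : ℝ) : (ppMatrix n a).det ≠ 0 := by
  intro h
  have := congrArg Matrix.det (ppMatrix_mul_ppInv (n := n) a)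
  rw [Matrix.det_mul, h, zero_mul, Matrix.det_one] at this
  exact zero_ne_one this

/-- The covector `du`. -/
def duCovector (n : ℕ) : Idx n → ℝ := Sum.elim 0 ![1, 0]

/-- The vector `∂_v`. -/
def dvVector (n : ℕ) : Idx n → ℝ := Sum.elim 0 ![0, 1]

theorem ppMatrix_apply (a : ℝ) (i j : Idx n) :
    ppMatrix n a i j = ppMatrix n 0 i j + a * (duCovector n i * duCovector n j) := by
  rcases i with i | i <;> rcases j with j | j
  · simp [ppMatrix, duCovector]
  · simp [ppMatrix, duCovector]
  · simp [ppMatrix, duCovector]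
  · fin_cases i <;> fin_cases j <;> simp [ppMatrix, duCovector]

theorem ppInv_apply (a : ℝ) (i j : Idx n) :
    ppInv n a i j = ppMatrix n 0 i j - a * (dvVector n i * dvVector n j) := by
  rcases i with i | i <;> rcases j with j | j
  · simp [ppMatrix, ppInv, dvVector]
  · simp [ppMatrix, ppInv, dvVector]
  · simp [ppMatrix, ppInv, dvVector]
  · fin_cases i <;> fin_cases j <;> simp [ppMatrix, ppInv, dvVector]

theorem ppMatrix_isSymm (a : ℝ) : (ppMatrix n a).IsSymm := by
  ext i j
  rcases i with i | i <;> rcases j with j | j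
  · simp [ppMatrix, Matrix.one_apply, eq_comm]
  · simp [ppMatrix]
  · simp [ppMatrix]
  · fin_cases i <;> fin_cases j <;> simp [ppMatrix]

/-- The map `(z, ρ) ↦ (proj z, ρ)`. -/
def projRho : (Idx n → ℝ) × ℝ →L[ℝ] XU n × ℝ :=
  projL.prodMap (ContinuousLinearMap.id ℝ ℝ)

/-- The total coefficient `H + h` of `du²`, as a function of `(x, u, ρ)`. -/
def totalCoeff (H : XU n → ℝ) (h : XU n → ℝ → ℝ) (p : XU n × ℝ) : ℝ := H p.1 + h p.1 p.2

variable {M : Set (Idx n → ℝ)} {J : Set ℝ} {H : XU n → ℝ} {h : XU n → ℝ → ℝ}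

theorem mapsTo_projRho : MapsTo projRho (M ×ˢ J) ((proj '' M) ×ˢ J) := fun _ hp =>
  ⟨mem_image_of_mem _ hp.1, hp.2⟩

theorem contDiffOn_totalCoeff {Ω : Set (XU n)} (hH : ContDiffOn ℝ ∞ H Ω)
    (hh : ContDiffOn ℝ ∞ (fun p : XU n × ℝ => h p.1 p.2) (Ω ×ˢ J)) :
    ContDiffOn ℝ ∞ (totalCoeff H h) (Ω ×ˢ J) :=
  (hH.comp contDiffOn_fst fun _ hp => hp.1).add hh

/-- The covector is `du` and its dual vector is `∂_v`. The flat matrix is its own inverse and plays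
both roles; `parallel` holds because the coefficient does not depend on `v`. -/
theorem isPPFamily (hM : IsOpen M) (hJ : IsOpen J) (hH : ContDiffOn ℝ ∞ H (proj '' M))
    (hh : ContDiffOn ℝ ∞ (fun p : XU n × ℝ => h p.1 p.2) ((proj '' M) ×ˢ J)) :
    IsPPFamily (M ×ˢ J) (ppFamily H h) (ppMatrix n 0) (ppMatrix n 0) (duCovector n) (dvVector n)
      (fun p => totalCoeff H h (projRho p)) := by
  have hU := (isOpen_image_proj hM).prod hJ
  have hT := contDiffOn_totalCoeff hH hh
  have hF : ContDiffOn ℝ ∞ (fun p => totalCoeff H h (projRho p)) (M ×ˢ J) :=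
    hT.comp projRho.contDiff.contDiffOn mapsTo_projRho
  have hcomp : ∀ i j, comp (ppFamily H h) i j = fun p =>
      ppMatrix n 0 i j + totalCoeff H h (projRho p) * (duCovector n i * duCovector n j) := by
    intro i j
    ext p
    rw [comp, ppFamily_eq, ppMatrix_apply]
    rfl
  refine ⟨⟨hM.prod hJ, fun p _ => ?_, fun p _ => ?_, fun i j => ?_⟩, hF, fun i j p _ => ?_,
    fun i j p _ => ?_, fun i j => ?_, fun k => ?_, ?_, fun p hp => ?_⟩
  · rw [ppFamily_eq]; exact ppMatrix_isSymm _
  · rw [ppFamily_eq]; exact ppMatrix_det _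
  · change ContDiffOn ℝ ∞ (comp (ppFamily H h) i j) _
    rw [hcomp]
    exact contDiffOn_const.add (hF.mul contDiffOn_const)
  · rw [hcomp]
  · rw [invComp, ppFamily_eq, ppMatrix_inv, ppInv_apply]; rfl
  · exact (ppMatrix_isSymm 0).apply j i
  · rcases k with k | k
    · simp [Fintype.sum_sum_type, ppMatrix, duCovector, dvVector]
    · fin_cases k <;> simp [Fintype.sum_sum_type, ppMatrix, duCovector, dvVector]
  · simp [Fintype.sum_sum_type, duCovector, dvVector]
  · have := dirD_comp_clm ((Pi.single (Sum.inr 1) 1 : Idx n → ℝ), (0 : ℝ)) projRho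
      (ContDiffOn.differentiableAt_of_isOpen hT hU (mapsTo_projRho hp))
    have e : projRho ((Pi.single (Sum.inr 1) 1 : Idx n → ℝ), (0 : ℝ)) = 0 :=
      Prod.ext projL_single_one rfl
    have e' : dz (Sum.inr 1) (fun p => totalCoeff H h (projRho p)) p = 0 := by
      rw [dz, this, e]; simp [dirD]
    simp [Fintype.sum_sum_type, dvVector, e']

/-- In the contraction with the flat inverse the `u`, `v` terms all contain a derivative along `v`.
Only the Laplacian in `x` remains. -/
theorem ricciPP_eq (hn : 3 ≤ n) (hM : IsOpen M) (hJ : IsOpen J) {F : XU n × ℝ → ℝ}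
    (hF : ContDiffOn ℝ ∞ F ((proj '' M) ×ˢ J)) {p : (Idx n → ℝ) × ℝ} (hp : p ∈ M ×ˢ J) :
    IsPPFamily.ricciPP (ppMatrix n 0) (fun p => F (projRho p)) p =
      waveOp ((n : ℝ) / 2 - 1) F (projRho p) := by
  have hU := (isOpen_image_proj hM).prod hJ
  have hU' := hM.prod hJ
  have key : ∀ {G : XU n × ℝ → ℝ}, ContDiffOn ℝ ∞ G ((proj '' M) ×ˢ J) →
      ∀ e : (Idx n → ℝ) × ℝ, EqOn (dirD e fun p => G (projRho p))
        (fun p => dirD (projRho e) G (projRho p)) (M ×ˢ J) := fun hG e q hq =>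
    dirD_comp_clm e projRho (ContDiffOn.differentiableAt_of_isOpen hG hU (mapsTo_projRho hq))
  have key2 : ∀ e e' : (Idx n → ℝ) × ℝ, dirD e (dirD e' fun p => F (projRho p)) p =
      dirD (projRho e) (dirD (projRho e') F) (projRho p) := fun e e' => by
    rw [dirD_congr hU' (key hF e') e hp, key (ContDiffOn.dirD hF hU _) e hp]
  have e0 : projRho ((0 : Idx n → ℝ), (1 : ℝ)) = (0, 1) :=
    Prod.ext (map_zero (projL (n := n))) rfl
  have ei : ∀ i, projRho ((Pi.single (Sum.inl i) 1 : Idx n → ℝ), (0 : ℝ)) = (xdir i, 0) := fun i =>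
    Prod.ext (projL_single_inl i) rfl
  have ev : projRho ((Pi.single (Sum.inr 1) 1 : Idx n → ℝ), (0 : ℝ)) = 0 :=
    Prod.ext projL_single_one rfl
  have z1 : ∀ G : XU n × ℝ → ℝ, dirD 0 G = fun _ => 0 := fun G => by
    ext q; simp [dirD]
  have hsum : ∑ k, ∑ l, ppMatrix n 0 k l * dz k (dz l fun p => F (projRho p)) p =
      lapX F (projRho p) := by
    simp only [dz, key2]
    simp [Fintype.sum_sum_type, ppMatrix, Matrix.one_apply, ei, ev, z1, lapX, dirD_const]
  rw [IsPPFamily.ricciPP, waveOp, hsum, card_idx hn]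
  simp only [dr]
  rw [key2, key hF _ hp, e0]
  rfl

/-- The Ricci tensor of the ambient metric given by `g + h du²`. -/
theorem ricci_ppFamily (hn : 3 ≤ n) (hM : IsOpen M) (hJ : IsOpen J)
    (hH : ContDiffOn ℝ ∞ H (proj '' M))
    (hh : ContDiffOn ℝ ∞ (fun p : XU n × ℝ => h p.1 p.2) ((proj '' M) ×ˢ J))
    {y : Idx n ⊕ Fin 2 → ℝ} (hy : y ∈ ambientDomain M J) (A B : Idx n ⊕ Fin 2) :
    ricci (ambientMetric (ppFamily H h)) A B y =
      Sum.elim (duCovector n) 0 A * Sum.elim (duCovector n) 0 B *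
        waveOp ((n : ℝ) / 2 - 1) (totalCoeff H h) (proj (baseCoord y), rhoCoord y) := by
  rw [ambientDomain_eq] at hy
  rw [(isPPFamily hM hJ hH hh).ricci_eq hy,
    ricciPP_eq hn hM hJ (contDiffOn_totalCoeff hH hh) hy.1]
  rfl

theorem ricci_ppFamily_uu (hn : 3 ≤ n) (hM : IsOpen M) (hJ : IsOpen J)
    (hH : ContDiffOn ℝ ∞ H (proj '' M))
    (hh : ContDiffOn ℝ ∞ (fun p : XU n × ℝ => h p.1 p.2) ((proj '' M) ×ˢ J))
    {y : Idx n ⊕ Fin 2 → ℝ} (hy : y ∈ ambientDomain M J) :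
    ricci (ambientMetric (ppFamily H h)) (Sum.inl (Sum.inr 0)) (Sum.inl (Sum.inr 0)) y =
        waveOp ((n : ℝ) / 2 - 1) (totalCoeff H h) (proj (baseCoord y), rhoCoord y) := by
  rw [ricci_ppFamily hn hM hJ hH hh hy]
  simp [duCovector]

theorem ricciFlat_ppFamily (hn : 3 ≤ n) (hM : IsOpen M) (hJ : IsOpen J)
    (hH : ContDiffOn ℝ ∞ H (proj '' M))
    (hh : ContDiffOn ℝ ∞ (fun p : XU n × ℝ => h p.1 p.2) ((proj '' M) ×ˢ J))
    (hR : ∀ p ∈ (proj '' M) ×ˢ J, waveOp ((n : ℝ) / 2 - 1) (totalCoeff H h) p = 0) :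
    RicciFlat M J (ppFamily H h) := fun y hy A B => by
  rw [ricci_ppFamily hn hM hJ hH hh hy, hR _ ⟨mem_image_of_mem _ hy.1, hy.2.2⟩, mul_zero]

theorem ricciBigO_ppFamily (hn : 3 ≤ n) (hM : IsOpen M) (hJ : IsOpen J)
    (hH : ContDiffOn ℝ ∞ H (proj '' M))
    (hh : ContDiffOn ℝ ∞ (fun p : XU n × ℝ => h p.1 p.2) ((proj '' M) ×ˢ J)) {m : ℕ}
    (hR : ∀ w ∈ proj '' M, waveOp ((n : ℝ) / 2 - 1) (totalCoeff H h)
      =O[𝓝[(proj '' M) ×ˢ J] (w, (0 : ℝ))] fun p => p.2 ^ m) :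
    RicciBigO M J (ppFamily H h) m := fun x hx t ht A B => by
  have hcont : Continuous fun y : Idx n ⊕ Fin 2 → ℝ => projRho (ambientProj y) :=
    projRho.continuous.comp ambientProj.continuous
  have h1 : Tendsto (fun y : Idx n ⊕ Fin 2 → ℝ => projRho (ambientProj y))
      (𝓝[ambientDomain M J] (ambientPoint t x 0)) (𝓝[(proj '' M) ×ˢ J] (proj x, (0 : ℝ))) := by
    refine tendsto_nhdsWithin_iff.2 ⟨(hcont.tendsto _).mono_left nhdsWithin_le_nhds, ?_⟩
    filter_upwards [self_mem_nhdsWithin] with y hy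
    exact ⟨mem_image_of_mem _ hy.1, hy.2.2⟩
  have h2 := ((hR _ (mem_image_of_mem _ hx)).comp_tendsto h1).const_mul_left
    (Sum.elim (duCovector n) 0 A * Sum.elim (duCovector n) 0 B)
  refine h2.congr' ?_ (Eventually.of_forall fun _ => rfl)
  filter_upwards [self_mem_nhdsWithin] with y hy
  rw [ricci_ppFamily hn hM hJ hH hh hy]
  rfl

theorem RicciFlat.ricciBigO {ι : Type*} [Fintype ι] [DecidableEq ι] {M : Set (ι → ℝ)} {J : Set ℝ}
    {γ : (ι → ℝ) → ℝ → Matrix ι ι ℝ} (h : RicciFlat M J γ) (m : ℕ) : RicciBigO M J γ m :=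
  fun x _ t _ A B => by
    refine (Asymptotics.isBigO_zero (fun y : ι ⊕ Fin 2 → ℝ => rhoCoord y ^ m) _).congr' ?_
      (Eventually.of_forall fun _ => rfl)
    filter_upwards [self_mem_nhdsWithin] with y hy
    exact (h y hy A B).symm

/-- A criterion for `g + h du²` to be an ambient metric. -/
theorem isAmbientMetric_ppFamily (hn : 3 ≤ n) (hM : IsOpen M) (hJ : IsOpen J)
    (hH : ContDiffOn ℝ ∞ H (proj '' M))
    (hh : ContDiffOn ℝ ∞ (fun p : XU n × ℝ => h p.1 p.2) ((proj '' M) ×ˢ J))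
    (hc : ContinuousOn (fun p : XU n × ℝ => h p.1 p.2) ((proj '' M) ×ˢ insert 0 J))
    (h0 : ∀ w ∈ proj '' M, h w 0 = 0)
    (hodd : Odd n → ∀ m, RicciBigO M J (ppFamily H h) m)
    (heven : Even n → RicciBigO M J (ppFamily H h) (n / 2 - 1)) :
    IsAmbientMetric M J (ppMetric H) (ppFamily H h) where
  symm x _ ρ _ := by rw [ppFamily_eq]; exact ppMatrix_isSymm _
  nondegenerate x _ ρ _ := by rw [ppFamily_eq]; exact ppMatrix_det _
  smooth := (isPPFamily hM hJ hH hh).regular.smooth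
  continuous i j := by
    have : (fun p : (Idx n → ℝ) × ℝ => ppFamily H h p.1 p.2 i j) = fun p =>
        ppMatrix n 0 i j + (H (proj p.1) + h (proj p.1) p.2) *
          (duCovector n i * duCovector n j) := by
      ext p
      rw [ppFamily_eq, ppMatrix_apply]
    rw [this]
    have h1 : ContinuousOn (fun p : (Idx n → ℝ) × ℝ => H (proj p.1)) (M ×ˢ insert 0 J) :=
      hH.continuousOn.comp (projL.continuous.comp continuous_fst).continuousOn
        fun p hp => mem_image_of_mem _ hp.1
    have h2 : ContinuousOn (fun p : (Idx n → ℝ) × ℝ => h (proj p.1) p.2) (M ×ˢ insert 0 J) :=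
      hc.comp projRho.continuous.continuousOn fun p hp => ⟨mem_image_of_mem _ hp.1, hp.2⟩
    exact continuousOn_const.add ((h1.add h2).mul continuousOn_const)
  initial x hx := by rw [ppFamily_eq, h0 _ (mem_image_of_mem _ hx), add_zero]; rfl
  ricci_odd := by rw [card_idx hn]; exact hodd
  ricci_even := by rw [card_idx hn]; exact heven
  trace_even _ x hx t ht := by
    refine (Asymptotics.isLittleO_zero _ _).congr' ?_ (Eventually.of_forall fun _ => rfl)
    filter_upwards [self_mem_nhdsWithin] with y hy
    -- The covector `du` is null, that is `g^{uu} = 0`, so the trace vanishes identically and not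
    -- merely to the required order.
    have : ∀ i j, (ppMetric H (baseCoord y))⁻¹ i j *
        ricci (ambientMetric (ppFamily H h)) (Sum.inl i) (Sum.inl j) y = 0 := by
      intro i j
      rw [ricci_ppFamily hn hM hJ hH hh hy, ppMetric, ppMatrix_inv, ppInv]
      rcases i with i | i <;> rcases j with j | j
      · simp [duCovector]
      · simp [duCovector]
      · simp [duCovector]
      · fin_cases i <;> fin_cases j <;> simp [duCovector]
    simp [this]

end PPAmbient

/-! ### Borel's lemma with parameters -/

section Borel

variable {W : Type} [NormedAddCommGroup W] [NormedSpace ℝ W] [FiniteDimensional ℝ W]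

/-- A smooth function on an open set agrees near a compact subset with a smooth function of
compact support. -/
theorem exists_contDiff_compact_extension {Ω K : Set W} (hΩ : IsOpen Ω) (hK : IsCompact K)
    (hKΩ : K ⊆ Ω) {c : W → ℝ} (hc : ContDiffOn ℝ ∞ c Ω) :
    ∃ c' : W → ℝ, ContDiff ℝ ∞ c' ∧ HasCompactSupport c' ∧ EqOn c' c K := by
  obtain ⟨t, htc, hKt, htΩ⟩ := exists_compact_between hK hΩ hKΩ
  obtain ⟨θ, h1, h0, -⟩ := exists_contMDiffMap_one_nhds_of_subset_interior (n := ⊤)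
    (modelWithCornersSelf ℝ W) hK.isClosed hKt
  have hθ : ContDiff ℝ ∞ θ := θ.contMDiff.contDiff
  have hz : ∀ x ∉ t, θ x * c x = 0 := fun x hx => by rw [h0 x hx, zero_mul]
  refine ⟨fun w => θ w * c w, ?_, ?_, fun w hw => ?_⟩
  -- Outside `Ω` nothing is known about `c`, but there the product vanishes on a neighbourhood,
  -- namely the complement of the compact `t`.
  · rw [contDiff_iff_contDiffAt]
    intro x
    by_cases hx : x ∈ Ω
    · exact hθ.contDiffAt.mul (hc.contDiffAt (hΩ.mem_nhds hx))
    · refine (contDiffAt_const (c := (0 : ℝ))).congr_of_eventuallyEq ?_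
      filter_upwards [htc.isClosed.isOpen_compl.mem_nhds fun h => hx (htΩ h)] with y hy
      exact hz y hy
  · exact HasCompactSupport.intro htc hz
  · have : θ w = 1 := h1.self_of_nhdsSet w hw
    simp [this]

/-- A smooth cutoff function, equal to `1` near `0`. -/
theorem exists_cutoff : ∃ χ : ℝ → ℝ, ContDiff ℝ ∞ χ ∧ HasCompactSupport χ ∧ χ =ᶠ[𝓝 0] 1 := by
  let b : ContDiffBump (0 : ℝ) := ⟨1, 2, one_pos, one_lt_two⟩
  exact ⟨b, b.contDiff, b.hasCompactSupport, b.eventuallyEq_one⟩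

/-- The term `ρ^k c(w) χ(μρ)` of a Borel series. -/
def borelTerm (χ : ℝ → ℝ) (k : ℕ) (μ : ℝ) (c : W → ℝ) (p : W × ℝ) : ℝ :=
  c p.1 * (p.2 ^ k * χ (μ * p.2))

/-- The scaling `(w, ρ) ↦ (w, μρ)`. -/
def scaleRho (μ : ℝ) : W × ℝ →L[ℝ] W × ℝ :=
  (ContinuousLinearMap.fst ℝ W ℝ).prod (μ • ContinuousLinearMap.snd ℝ W ℝ)

theorem norm_scaleRho_le {μ : ℝ} (hμ : 1 ≤ μ) : ‖(scaleRho μ : W × ℝ →L[ℝ] W × ℝ)‖ ≤ μ := by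
  refine ContinuousLinearMap.opNorm_le_bound _ (by linarith) fun p => ?_
  rw [Prod.norm_def]
  have h1 : ‖p.1‖ ≤ ‖p‖ := norm_fst_le p
  have h2 : ‖p.2‖ ≤ ‖p‖ := norm_snd_le p
  refine max_le ?_ ?_
  · change ‖p.1‖ ≤ _
    nlinarith [norm_nonneg p]
  · change ‖μ • p.2‖ ≤ _
    rw [norm_smul, Real.norm_of_nonneg (by linarith : 0 ≤ μ)]
    gcongr

theorem contDiff_borelTerm {χ : ℝ → ℝ} (hχ : ContDiff ℝ ∞ χ) (k : ℕ) (μ : ℝ) {c : W → ℝ}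
    (hc : ContDiff ℝ ∞ c) : ContDiff ℝ ∞ (borelTerm χ k μ c) := by
  unfold borelTerm
  fun_prop

/-- For `μ` large the derivatives of order less than `k` of `ρ^k c(w) χ(μρ)` are small. -/
theorem exists_borel_scale {χ : ℝ → ℝ} (hχ : ContDiff ℝ ∞ χ) (hχc : HasCompactSupport χ) (k : ℕ)
    {c : W → ℝ} (hc : ContDiff ℝ ∞ c) (hcc : HasCompactSupport c) {δ : ℝ} (hδ : 0 < δ) :
    ∃ μ : ℝ, 1 ≤ μ ∧ ∀ i < k, ∀ p, ‖iteratedFDeriv ℝ i (borelTerm χ k μ c) p‖ ≤ δ := by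
  set G : W × ℝ → ℝ := borelTerm χ k 1 c
  have hG : ContDiff ℝ ∞ G := contDiff_borelTerm hχ k 1 hc
  have hGc : HasCompactSupport G := by
    refine HasCompactSupport.intro (hcc.isCompact.prod hχc.isCompact) fun p hp => ?_
    by_cases h1 : p.1 ∈ tsupport c
    · have h2 : p.2 ∉ tsupport χ := fun h2 => hp ⟨h1, h2⟩
      simp [G, borelTerm, image_eq_zero_of_notMem_tsupport h2]
    · simp [G, borelTerm, image_eq_zero_of_notMem_tsupport h1]
  have hb : ∀ i, ∃ C, ∀ p, ‖iteratedFDeriv ℝ i G p‖ ≤ C := fun i =>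
    (hGc.iteratedFDeriv i).exists_bound_of_continuous
      (hG.continuous_iteratedFDeriv (by exact_mod_cast le_top))
  choose C hC using hb
  have hC0 : ∀ i, 0 ≤ C i := fun i => (norm_nonneg _).trans (hC i 0)
  set D := ∑ i ∈ Finset.range k, C i
  have hD : ∀ i < k, C i ≤ D := fun i hi =>
    Finset.single_le_sum (fun j _ => hC0 j) (Finset.mem_range.2 hi)
  refine ⟨max 1 (D / δ), le_max_left _ _, fun i hi p => ?_⟩
  set μ := max 1 (D / δ)
  have hμ1 : 1 ≤ μ := le_max_left _ _
  have hμ0 : 0 < μ := by linarith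
  have hμD : D ≤ δ * μ := by
    have := le_max_right 1 (D / δ)
    rwa [div_le_iff₀' hδ] at this
  -- The term is `μ^{-k}` times a fixed compactly supported function rescaled by `μ` in `ρ`. Each
  -- derivative costs at most a factor `μ`, so orders `i < k` gain at least `1/μ`, and `μ ≥ D/δ` was
  -- chosen to bring this below `δ`.
  have he : borelTerm χ k μ c = fun p => (μ ^ k)⁻¹ • (G ∘ scaleRho μ) p := by
    funext p
    change c p.1 * (p.2 ^ k * χ (μ * p.2)) =
      (μ ^ k)⁻¹ * (c p.1 * ((μ * p.2) ^ k * χ (1 * (μ * p.2))))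
    rw [mul_pow, one_mul]
    field_simp
  have hcomp : ContDiff ℝ ∞ (G ∘ scaleRho μ) := hG.comp (scaleRho (W := W) μ).contDiff
  rw [he, iteratedFDeriv_const_smul_apply' (hcomp.contDiffAt.of_le (by exact_mod_cast le_top)),
    norm_smul, ContinuousLinearMap.iteratedFDeriv_comp_right (scaleRho μ) hG p
      (by exact_mod_cast le_top), Real.norm_of_nonneg (by positivity)]
  have h3 : ‖(iteratedFDeriv ℝ i G (scaleRho μ p)).compContinuousLinearMap
      fun _ : Fin i => scaleRho μ‖ ≤ D * μ ^ i := by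
    refine (ContinuousMultilinearMap.norm_compContinuousLinearMap_le _ _).trans ?_
    rw [Finset.prod_const, Finset.card_univ, Fintype.card_fin]
    have hD0 : 0 ≤ D := (hC0 i).trans (hD i hi)
    gcongr
    · exact (hC i _).trans (hD i hi)
    · exact norm_scaleRho_le hμ1
  have hD0 : 0 ≤ D := (hC0 i).trans (hD i hi)
  calc (μ ^ k)⁻¹ * _ ≤ (μ ^ k)⁻¹ * (D * μ ^ i) := by gcongr
    _ ≤ (μ ^ k)⁻¹ * (D * μ ^ (k - 1)) := by
      gcongr
      omega
    _ ≤ (μ ^ k)⁻¹ * (δ * μ * μ ^ (k - 1)) := by gcongr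
    _ = δ := by
      rw [mul_assoc, ← pow_succ', Nat.sub_add_cancel (by omega)]
      field_simp

theorem summable_half_pow_add (N : ℕ) : Summable fun j : ℕ => ((1 : ℝ) / 2) ^ (j + N) :=
  (summable_nat_add_iff N).2 summable_geometric_two

/-- **Borel's lemma** with smooth dependence on parameters. -/
theorem exists_borel {Ω : Set W} (hΩ : IsOpen Ω) {c : ℕ → W → ℝ}
    (hc : ∀ k, ContDiffOn ℝ ∞ (c k) Ω) :
    ∃ A : W → ℝ → ℝ, ContDiffOn ℝ ∞ (fun p : W × ℝ => A p.1 p.2) (Ω ×ˢ univ) ∧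
      ∀ w ∈ Ω, ∀ k : ℕ, iteratedDeriv k (A w) 0 = k.factorial * c k w := by
  obtain ⟨χ, hχ, hχc, hχ1⟩ := exists_cutoff
  have : LocallyCompactSpace Ω := hΩ.locallyCompactSpace
  let K : CompactExhaustion Ω := CompactExhaustion.choice Ω
  have hKc : ∀ k, IsCompact (Subtype.val '' K k : Set W) := fun k =>
    (K.isCompact k).image continuous_subtype_val
  have hKΩ : ∀ k, (Subtype.val '' K k : Set W) ⊆ Ω := fun k => by
    rintro _ ⟨x, -, rfl⟩; exact x.2
  -- The scales `μ k` need global derivative bounds, which the `c k` lack; they are chosen for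
  -- compactly supported `d k` that agree with `c k` on the `k`-th compact set.
  choose d hd hdc hde using fun k => exists_contDiff_compact_extension hΩ (hKc k) (hKΩ k) (hc k)
  choose μ hμ hb using fun k => exists_borel_scale hχ hχc k (hd k) (hdc k)
    (by positivity : (0 : ℝ) < (1 / 2) ^ k)
  set T : ℕ → W × ℝ → ℝ := fun k => borelTerm χ k (μ k) (d k) with hTdef
  have hT : ∀ k, ContDiff ℝ ∞ (T k) := fun k => contDiff_borelTerm hχ k (μ k) (hd k)
  have htail : ∀ N, ContDiff ℝ ∞ fun p => ∑' j, T (j + N) p := by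
    intro N
    -- Derivatives of order `k` are bounded only for the terms of index greater than `k`, which
    -- suffices for summability of the derivatives.
    refine contDiff_tsum_of_eventually (N := ⊤) (v := fun _ j => (1 / 2) ^ (j + N))
      (fun j => hT _) (fun _ _ => summable_half_pow_add N) fun k _ => ?_
    rw [Nat.cofinite_eq_atTop]
    filter_upwards [eventually_ge_atTop (k + 1)] with j hj p
    exact hb (j + N) k (by omega) p
  have hsum : ∀ p, Summable fun k => T k p := fun p => by
    refine (summable_nat_add_iff 1).1 (Summable.of_norm_bounded (summable_half_pow_add 1) ?_)
    intro j
    have := hb (j + 1) 0 (by omega) p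
    rwa [norm_iteratedFDeriv_zero] at this
  set A : W → ℝ → ℝ := fun w ρ => ∑' k, borelTerm χ k (μ k) (c k) (w, ρ) with hA
  -- On the `N`-th compact set all but the first `N` terms coincide with those built from `d`.
  -- Locally the sum is thus a finite smooth part plus the smooth tail.
  have hsplit : ∀ N, ∀ w ∈ (Subtype.val '' K N : Set W), ∀ ρ, A w ρ =
      ∑ k ∈ Finset.range N, borelTerm χ k (μ k) (c k) (w, ρ) + ∑' j, T (j + N) (w, ρ) := by
    intro N w hw ρ
    have heq : ∀ j, borelTerm χ (j + N) (μ (j + N)) (c (j + N)) (w, ρ) = T (j + N) (w, ρ) := by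
      intro j
      have : w ∈ (Subtype.val '' K (j + N) : Set W) := image_mono (K.subset (by omega)) hw
      simp only [T, borelTerm, hde (j + N) this]
    have hs : Summable fun k => borelTerm χ k (μ k) (c k) (w, ρ) := by
      refine (summable_nat_add_iff N).1 ?_
      simp only [heq]
      exact (summable_nat_add_iff N).2 (hsum (w, ρ))
    rw [hA]
    simp only []
    rw [← hs.sum_add_tsum_nat_add N]
    simp only [heq]
  refine ⟨A, ?_, ?_⟩
  · intro p hp
    obtain ⟨N, hN⟩ := K.exists_mem_nhds ⟨p.1, hp.1⟩
    have hnhds : (Subtype.val '' K N : Set W) ∈ 𝓝 p.1 := by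
      have := hΩ.isOpenEmbedding_subtypeVal.image_mem_nhds.2 hN
      exact this
    have hfin : ContDiffAt ℝ ∞ (fun q : W × ℝ =>
        ∑ k ∈ Finset.range N, borelTerm χ k (μ k) (c k) q + ∑' j, T (j + N) q) p := by
      refine ContDiffAt.add (ContDiffAt.sum fun k _ => ?_) (htail N).contDiffAt
      have h1 : ContDiffAt ℝ ∞ (fun q : W × ℝ => c k q.1) p :=
        ContDiffAt.comp p ((hc k).contDiffAt (hΩ.mem_nhds hp.1)) contDiffAt_fst
      unfold borelTerm
      exact h1.mul (ContDiff.contDiffAt (by fun_prop))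
    refine (hfin.congr_of_eventuallyEq ?_).contDiffWithinAt
    filter_upwards [continuousAt_fst.preimage_mem_nhds hnhds] with q hq
    exact hsplit N q.1 hq q.2
  · intro w hw k
    obtain ⟨N₀, hN₀⟩ := K.exists_mem ⟨w, hw⟩
    set N := max N₀ (k + 1) with hN
    have hwN : w ∈ (Subtype.val '' K N : Set W) := ⟨⟨w, hw⟩, K.subset (le_max_left _ _) hN₀, rfl⟩
    have hAw : A w = (fun ρ => ∑ j ∈ Finset.range N, borelTerm χ j (μ j) (c j) (w, ρ)) +
        fun ρ => ∑' j, T (j + N) (w, ρ) := by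
      funext ρ; exact hsplit N w hwN ρ
    have hterm : ∀ (j : ℕ) (a : W → ℝ), iteratedDeriv k (fun ρ => borelTerm χ j (μ j) a (w, ρ)) 0 =
        if j = k then k.factorial * a w else 0 := by
      intro j a
      have h1 : (fun ρ => borelTerm χ j (μ j) a (w, ρ)) =ᶠ[𝓝 0] fun ρ => a w * ρ ^ j := by
        have h2 : Tendsto (fun ρ : ℝ => μ j * ρ) (𝓝 0) (𝓝 0) := by
          have : Continuous fun ρ : ℝ => μ j * ρ := by fun_prop
          simpa using this.tendsto 0
        filter_upwards [h2.eventually hχ1] with ρ hρ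
        simp only [borelTerm, hρ, Pi.one_apply, mul_one]
      rw [h1.iteratedDeriv_eq, iteratedDeriv_const_mul_field, iteratedDeriv_fun_pow_zero]
      rcases eq_or_ne j k with rfl | hjk
      · simp [mul_comm]
      · simp [hjk, hjk.symm]
    have hslice : ContDiff ℝ ∞ fun ρ : ℝ => (w, ρ) := by fun_prop
    have hchi : ∀ (j : ℕ) (a : W → ℝ), ContDiff ℝ ∞ fun ρ => borelTerm χ j (μ j) a (w, ρ) := by
      intro j a
      exact (contDiff_const (c := a w)).mul (by fun_prop : ContDiff ℝ ∞ fun ρ : ℝ => ρ ^ j * χ (μ j * ρ))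
    -- The tail starts at an index above `k`, so each of its terms has zero `k`-th derivative at `ρ
    -- = 0`, and the derivative passes through the sum.
    have htz : iteratedDeriv k (fun ρ => ∑' j, T (j + N) (w, ρ)) 0 = 0 := by
      rw [iteratedDeriv_eq_iteratedFDeriv]
      have hbd : ∀ (i j : ℕ) (ρ : ℝ), ((i : ℕ∞) ≤ (k : ℕ∞)) →
          ‖iteratedFDeriv ℝ i (fun ρ => T (j + N) (w, ρ)) ρ‖ ≤ (1 / 2) ^ (j + N) := by
        intro i j ρ hi
        have hi' : i ≤ k := by exact_mod_cast hi
        have he : (fun ρ => T (j + N) (w, ρ)) =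
            (fun q => T (j + N) ((w, 0) + q)) ∘ ContinuousLinearMap.inr ℝ W ℝ := by
          funext ρ; simp
        have hc' : ContDiff ℝ ∞ fun q => T (j + N) ((w, 0) + q) :=
          (hT _).comp (contDiff_const.add contDiff_id)
        rw [he, ContinuousLinearMap.iteratedFDeriv_comp_right _ hc' _ (by exact_mod_cast le_top)]
        refine (ContinuousMultilinearMap.norm_compContinuousLinearMap_le _ _).trans ?_
        rw [iteratedFDeriv_comp_add_left, Finset.prod_const]
        refine (mul_le_mul (hb (j + N) i (by omega) _) (pow_le_one₀ (norm_nonneg _)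
          (ContinuousLinearMap.norm_inr_le_one ℝ W ℝ)) (by positivity) (by positivity)).trans ?_
        rw [mul_one]
      rw [iteratedFDeriv_tsum_apply (N := (k : ℕ∞)) (v := fun _ j => (1 / 2) ^ (j + N))
        (fun j => ((hchi _ _).of_le (by exact_mod_cast le_top)))
        (fun _ _ => summable_half_pow_add N) hbd le_rfl]
      have hz : ∀ j, iteratedFDeriv ℝ k (fun ρ => T (j + N) (w, ρ)) 0 = 0 := by
        intro j
        have h1 := hterm (j + N) (d (j + N))
        rw [if_neg (by omega), iteratedDeriv_eq_iteratedFDeriv] at h1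
        refine ContinuousMultilinearMap.ext fun m => ?_
        have : m = fun i => m i • (1 : ℝ) := by funext i; simp
        rw [this, ContinuousMultilinearMap.map_smul_univ]
        change _ • iteratedFDeriv ℝ k (fun ρ => borelTerm χ (j + N) (μ (j + N)) (d (j + N)) (w, ρ)) 0
          (fun _ => 1) = _
        rw [h1]; simp
      rw [tsum_congr hz, tsum_zero]; rfl
    rw [hAw, iteratedDeriv_add, htz, add_zero, iteratedDeriv_fun_sum]
    · rw [Finset.sum_congr rfl fun j _ => hterm j (c j)]
      rw [Finset.sum_ite_eq' (Finset.range N) k fun j => k.factorial * c j w, if_pos]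
      exact Finset.mem_range.2 (by omega)
    · exact fun j _ => (hchi j (c j)).contDiffAt.of_le (by exact_mod_cast le_top)
    · exact (ContDiff.sum fun j _ => hchi j (c j)).contDiffAt.of_le (by exact_mod_cast le_top)
    · exact ((htail N).comp hslice).contDiffAt.of_le (by exact_mod_cast le_top)

end Borel

/-! ### Taylor coefficients of solutions of the wave equation -/

section Recurrence

variable {n : ℕ} {Ω : Set (XU n)} {J : Set ℝ} {ε : ℝ}

/-- The coefficient of `ρ^k` in the wave operator applied to `Σ_k c_k ρ^k`. -/
def waveCoeff (a : ℝ) (c : ℕ → XU n → ℝ) (k : ℕ) (w : XU n) : ℝ :=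
  ((k : ℝ) + 1) * (k - a) * c (k + 1) w - (1 / 2) * lap (c k) w

theorem dr_iterate_waveOp_of_taylor (hΩ : IsOpen Ω) (hJ : IsOpen J) (h0 : (0 : ℝ) ∈ J)
    {F : XU n × ℝ → ℝ} (hF : ContDiffOn ℝ ∞ F (Ω ×ˢ J)) {c : ℕ → XU n → ℝ}
    (hc : ∀ k, ContDiffOn ℝ ∞ (c k) Ω)
    (hT : ∀ w ∈ Ω, ∀ k, dr^[k] F (w, 0) = k.factorial * c k w) (a : ℝ) (k : ℕ) {w : XU n}
    (hw : w ∈ Ω) : dr^[k] (waveOp a F) (w, 0) = k.factorial * waveCoeff a c k w := by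
  have h1 : EqOn (fun w => dr^[k] F (w, 0)) (fun w => k.factorial * c k w) Ω :=
    fun w hw => hT w hw k
  rw [dr_iterate_waveOp hΩ hJ h0 hF a k hw, lap_congr hΩ h1 hw, lap_const_mul hΩ (hc k) _ hw,
    hT w hw, waveCoeff, Nat.factorial_succ]
  push_cast
  ring

theorem hasSum_lapX_powerSum (hΩ : IsOpen Ω) {c : ℕ → XU n → ℝ} (h : SeriesBound Ω ε c)
    {p : XU n × ℝ} (hp : p ∈ Ω ×ˢ Ioo (-ε) ε) :
    HasSum (fun k => p.2 ^ k * lap (c k) p.1) (lapX (powerSum c) p) := by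
  have hU : IsOpen (Ω ×ˢ Ioo (-ε) ε) := hΩ.prod isOpen_Ioo
  have h1 : ∀ i : Fin (n - 2), HasSum (fun k => p.2 ^ k * dirD (xdir i) (dirD (xdir i) (c k)) p.1)
      (dirD (xdir i, (0 : ℝ)) (dirD (xdir i, (0 : ℝ)) (powerSum c)) p) := by
    intro i
    have hb := h.dirD_coeff hΩ (xdir i)
    rw [dirD_congr hU (h.dirD_powerSum hΩ (xdir i)) _ hp, hb.dirD_powerSum hΩ (xdir i) hp]
    exact (hb.dirD_coeff hΩ (xdir i)).hasSum hp
  refine (hasSum_sum fun i (_ : i ∈ Finset.univ) => h1 i).congr_fun fun k => ?_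
  rw [lap_eq hΩ (h.smooth k) hp.1, Finset.mul_sum]

theorem hasSum_waveOp_powerSum (hΩ : IsOpen Ω) {c : ℕ → XU n → ℝ} (h : SeriesBound Ω ε c) (a : ℝ)
    {p : XU n × ℝ} (hp : p ∈ Ω ×ˢ Ioo (-ε) ε) :
    HasSum (fun k => p.2 ^ k * waveCoeff a c k p.1) (waveOp a (powerSum c) p) := by
  have hU : IsOpen (Ω ×ˢ Ioo (-ε) ε) := hΩ.prod isOpen_Ioo
  have hs := h.shift hΩ
  have h1 := hs.hasSum_snd_mul_dr hΩ hp
  have h2 := (hs.hasSum hp).mul_left a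
  have h3 := (hasSum_lapX_powerSum hΩ h hp).mul_left (1 / 2)
  have he : waveOp a (powerSum c) p = p.2 * dr (powerSum (shiftCoeff c)) p -
      a * powerSum (shiftCoeff c) p - (1 / 2) * lapX (powerSum c) p := by
    rw [waveOp, h.dr_powerSum hΩ hp]
    have : dr (dr (powerSum c)) p = dr (powerSum (shiftCoeff c)) p :=
      dirD_congr hU (h.dr_powerSum hΩ) _ hp
    rw [this]
  rw [he]
  refine ((h1.sub h2).sub h3).congr_fun fun k => ?_
  simp only [waveCoeff, shiftCoeff, smul_eq_mul]
  ring

theorem waveOp_powerSum_eq_zero (hΩ : IsOpen Ω) {c : ℕ → XU n → ℝ} (h : SeriesBound Ω ε c)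
    {a : ℝ} (hz : ∀ k, ∀ w ∈ Ω, waveCoeff a c k w = 0) {p : XU n × ℝ}
    (hp : p ∈ Ω ×ˢ Ioo (-ε) ε) : waveOp a (powerSum c) p = 0 := by
  refine (hasSum_waveOp_powerSum hΩ h a hp).unique ?_
  simp only [hz _ _ hp.1, mul_zero]
  exact hasSum_zero

/-! ### The coefficients of the two series -/

/-- The Taylor coefficients of `H + a`. -/
def totalSeries (H : XU n → ℝ) (k : ℕ) (w : XU n) : ℝ := (if k = 0 then H w else 0) + hCoeff H k w

/-- The constant `-1 / (2 (s - 1)! ∏_{i=1}^{s-1} (2i - n))`, with `s = n / 2`. -/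
def obstructionConst (n : ℕ) : ℝ :=
  -(1 / 2) / ((n / 2 - 1).factorial * ∏ i ∈ Finset.Icc 1 (n / 2 - 1), (2 * (i : ℝ) - n))

/-- A zero factor forces `n = 2i` with `i ≤ k`, exactly the case in which `hCoeff` is truncated. -/
theorem prod_sub_ne_zero {k : ℕ} (h : ¬(Even n ∧ n ≤ 2 * k)) :
    ∏ i ∈ Finset.Icc 1 k, (2 * (i : ℝ) - n) ≠ 0 := by
  refine Finset.prod_ne_zero_iff.2 fun i hi h0 => h ?_
  have h1 : 2 * i = n := by exact_mod_cast sub_eq_zero.1 h0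
  have h2 := (Finset.mem_Icc.1 hi).2
  exact ⟨⟨i, by omega⟩, by omega⟩

theorem prod_add_pos (n k : ℕ) : 0 < ∏ i ∈ Finset.Icc 1 k, (2 * (i : ℝ) + n) := by
  refine Finset.prod_pos fun i hi => ?_
  have : (1 : ℝ) ≤ i := by exact_mod_cast (Finset.mem_Icc.1 hi).1
  positivity

theorem obstructionConst_ne_zero (hn : 3 ≤ n) : obstructionConst n ≠ 0 := by
  refine div_ne_zero (by norm_num) (mul_ne_zero (by positivity) (prod_sub_ne_zero fun h => ?_))
  omega

theorem totalSeries_eq (H : XU n → ℝ) {k : ℕ} (h : ¬(Even n ∧ n ≤ 2 * k))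
    (w : XU n) : totalSeries H k w =
      (k.factorial * ∏ i ∈ Finset.Icc 1 k, (2 * (i : ℝ) - n))⁻¹ * (lap^[k] H) w := by
  rcases Nat.eq_zero_or_pos k with rfl | hk
  · simp [totalSeries, hCoeff]
  · rw [totalSeries, if_neg hk.ne', zero_add, hCoeff, if_neg (by rintro (h1 | h1); omega; exact h h1),
      div_eq_inv_mul]

theorem totalSeries_of_le {H : XU n → ℝ} {k : ℕ} (hk : k ≠ 0) (h : Even n ∧ n ≤ 2 * k) (w : XU n) :
    totalSeries H k w = 0 := by
  rw [totalSeries, if_neg hk, hCoeff, if_pos (Or.inr h), add_zero]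

theorem contDiffOn_hCoeff (hΩ : IsOpen Ω) {H : XU n → ℝ} (hH : ContDiffOn ℝ ∞ H Ω) (k : ℕ) :
    ContDiffOn ℝ ∞ (hCoeff H k) Ω := by
  unfold hCoeff
  split_ifs
  · exact contDiffOn_const
  · exact (ContDiffOn.lap_iterate hΩ hH k).div_const _

theorem contDiffOn_fCoeff (hΩ : IsOpen Ω) {f : XU n → ℝ} (hf : ContDiffOn ℝ ∞ f Ω) (k : ℕ) :
    ContDiffOn ℝ ∞ (fCoeff f k) Ω :=
  (ContDiffOn.lap_iterate hΩ hf k).div_const _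

theorem contDiffOn_totalSeries (hΩ : IsOpen Ω) {H : XU n → ℝ} (hH : ContDiffOn ℝ ∞ H Ω) (k : ℕ) :
    ContDiffOn ℝ ∞ (totalSeries H k) Ω := by
  unfold totalSeries
  refine ContDiffOn.add ?_ (contDiffOn_hCoeff hΩ hH k)
  split_ifs
  · exact hH
  · exact contDiffOn_const

/-- The factor `(k + 1)(k + 1 + n/2)` is half of what the denominator acquires in passing from `k`
to `k + 1`. -/
theorem waveCoeff_fCoeff (hΩ : IsOpen Ω) {f : XU n → ℝ} (hf : ContDiffOn ℝ ∞ f Ω) (k : ℕ)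
    {w : XU n} (hw : w ∈ Ω) : waveCoeff (-((n : ℝ) / 2 + 1)) (fCoeff f) k w = 0 := by
  have h1 : fCoeff f k = fun w => (k.factorial * ∏ i ∈ Finset.Icc 1 k, (2 * (i : ℝ) + n))⁻¹ *
      (lap^[k] f) w := funext fun w => div_eq_inv_mul _ _
  rw [waveCoeff, h1, lap_const_mul hΩ (ContDiffOn.lap_iterate hΩ hf k) _ hw, fCoeff,
    Finset.prod_Icc_succ_top (by omega), Nat.factorial_succ, Function.iterate_succ_apply']
  have h2 := (prod_add_pos n k).ne'
  have h3 : (2 * ((k + 1 : ℕ) : ℝ) + n) ≠ 0 := by positivity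
  push_cast at h3 ⊢
  field_simp
  ring

/-- Below `n/2` this is the recurrence defining `a`, beyond it both terms are zero. At `k + 1 = n/2`
the factor of the next coefficient vanishes, and `-½Δ` of the last coefficient remains: this is the
obstruction. -/
theorem waveCoeff_totalSeries (hn : 3 ≤ n) (hΩ : IsOpen Ω) {H : XU n → ℝ}
    (hH : ContDiffOn ℝ ∞ H Ω) (k : ℕ) {w : XU n} (hw : w ∈ Ω) :
    waveCoeff ((n : ℝ) / 2 - 1) (totalSeries H) k w =
      if n = 2 * (k + 1) then obstructionConst n * (lap^[n / 2] H) w else 0 := by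
  by_cases hk : Even n ∧ n ≤ 2 * k
  · have hk0 : k ≠ 0 := by omega
    have h1 : totalSeries H k = fun _ => (0 : ℝ) * 0 :=
      funext fun w => by rw [totalSeries_of_le hk0 hk, mul_zero]
    rw [waveCoeff, totalSeries_of_le k.succ_ne_zero ⟨hk.1, by omega⟩, h1,
      lap_const_mul (F := fun _ => 0) hΩ contDiffOn_const 0 hw, if_neg (by omega)]
    ring
  have h1 : totalSeries H k = fun w =>
      (k.factorial * ∏ i ∈ Finset.Icc 1 k, (2 * (i : ℝ) - n))⁻¹ * (lap^[k] H) w :=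
    funext fun w => totalSeries_eq H hk w
  have h2 := prod_sub_ne_zero hk
  rw [waveCoeff, h1, lap_const_mul hΩ (ContDiffOn.lap_iterate hΩ hH k) _ hw]
  by_cases hk' : n = 2 * (k + 1)
  · have hk2 : n / 2 = k + 1 := by omega
    rw [if_pos hk', totalSeries_of_le k.succ_ne_zero ⟨⟨k + 1, by omega⟩, by omega⟩,
      obstructionConst, hk2, Nat.add_sub_cancel, Function.iterate_succ_apply']
    field_simp
    ring
  · have h3 : ¬(Even n ∧ n ≤ 2 * (k + 1)) := by
      rintro ⟨⟨j, hj⟩, h4⟩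
      exact hk ⟨⟨j, hj⟩, by omega⟩
    have h4 := prod_sub_ne_zero h3
    rw [if_neg hk', totalSeries_eq H h3, Function.iterate_succ_apply', Nat.factorial_succ]
    rw [Finset.prod_Icc_succ_top (by omega)] at h4 ⊢
    have h5 := right_ne_zero_of_mul h4
    have h6 : ((k : ℝ) + 1) * (k - ((n : ℝ) / 2 - 1)) =
        ((k : ℝ) + 1) / 2 * (2 * ((k + 1 : ℕ) : ℝ) - n) := by push_cast; ring
    rw [h6]
    generalize 2 * ((k + 1 : ℕ) : ℝ) - n = X at h5
    push_cast
    field_simp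
    ring

/-! ### Realisations of Taylor series -/

theorem HasTaylorSeries.dr_iterate (hΩ : IsOpen Ω) (hJ : IsOpen J) (h0 : (0 : ℝ) ∈ J)
    {c : ℕ → XU n → ℝ} {A : XU n → ℝ → ℝ} (h : HasTaylorSeries Ω J c A) :
    ∀ w ∈ Ω, ∀ k, dr^[k] (fun p : XU n × ℝ => A p.1 p.2) (w, 0) = k.factorial * c k w := by
  intro w hw k
  rw [dr_iterate_eq_iteratedDeriv hΩ hJ h.1 k hw 0 h0]
  exact h.2 w hw k

theorem hasTaylorSeries_of_dr_iterate (hΩ : IsOpen Ω) (hJ : IsOpen J) (h0 : (0 : ℝ) ∈ J)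
    {c : ℕ → XU n → ℝ} {A : XU n → ℝ → ℝ}
    (hA : ContDiffOn ℝ ∞ (fun p : XU n × ℝ => A p.1 p.2) (Ω ×ˢ J))
    (h : ∀ w ∈ Ω, ∀ k, dr^[k] (fun p : XU n × ℝ => A p.1 p.2) (w, 0) = k.factorial * c k w) :
    HasTaylorSeries Ω J c A := by
  refine ⟨hA, fun w hw k => ?_⟩
  rw [← h w hw k, dr_iterate_eq_iteratedDeriv hΩ hJ hA k hw 0 h0]

theorem HasTaylorSeries.eq_zero {c : ℕ → XU n → ℝ} {A : XU n → ℝ → ℝ}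
    (h : HasTaylorSeries Ω J c A) {w : XU n} (hw : w ∈ Ω) : A w 0 = c 0 w := by
  simpa using h.2 w hw 0

theorem dr_iterate_fst (hΩ : IsOpen Ω) (hJ : IsOpen J) {H : XU n → ℝ} (hH : ContDiffOn ℝ ∞ H Ω)
    (k : ℕ) {p : XU n × ℝ} (hp : p ∈ Ω ×ˢ J) :
    dr^[k] (fun p : XU n × ℝ => H p.1) p = if k = 0 then H p.1 else 0 := by
  have hU := hΩ.prod hJ
  rcases k with _ | k
  · rfl
  have := dr_iterate_eq_iteratedDeriv (F := fun p : XU n × ℝ => H p.1) hΩ hJ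
    (hH.comp contDiffOn_fst fun p hp => hp.1) (k + 1) hp.1 p.2 hp.2
  rw [if_neg k.succ_ne_zero, this]
  change iteratedDeriv (k + 1) (fun _ : ℝ => H p.1) p.2 = 0
  rw [iteratedDeriv_const]
  simp

theorem dr_iterate_totalCoeff (hΩ : IsOpen Ω) (hJ : IsOpen J) {H : XU n → ℝ}
    (hH : ContDiffOn ℝ ∞ H Ω) {A : XU n → ℝ → ℝ}
    (hA : ContDiffOn ℝ ∞ (fun p : XU n × ℝ => A p.1 p.2) (Ω ×ˢ J)) (k : ℕ) {p : XU n × ℝ}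
    (hp : p ∈ Ω ×ˢ J) : dr^[k] (totalCoeff H A) p =
      (if k = 0 then H p.1 else 0) + dr^[k] (fun p : XU n × ℝ => A p.1 p.2) p := by
  rw [← dr_iterate_fst hΩ hJ hH k hp]
  exact dr_iterate_add (hΩ.prod hJ) (hH.comp contDiffOn_fst fun p hp => hp.1) hA k hp

theorem dr_iterate_totalCoeff_hCoeff (hΩ : IsOpen Ω) (hJ : IsOpen J) (h0 : (0 : ℝ) ∈ J)
    {H : XU n → ℝ} (hH : ContDiffOn ℝ ∞ H Ω) {A : XU n → ℝ → ℝ}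
    (hA : HasTaylorSeries Ω J (hCoeff H) A) : ∀ w ∈ Ω, ∀ k,
      dr^[k] (totalCoeff H A) (w, 0) = k.factorial * totalSeries H k w := by
  intro w hw k
  rw [dr_iterate_totalCoeff hΩ hJ hH hA.1 k (mk_mem_prod hw h0), hA.dr_iterate hΩ hJ h0 w hw,
    totalSeries]
  rcases k with _ | k <;> simp

/-- The only jet that can be nonzero has order `n/2 - 1` with `n` even. Hence vanishing of `Δ^{n/2}
H` is demanded only when `m` exceeds that order. -/
theorem vanishesTo_waveOp_hCoeff (hn : 3 ≤ n) (hΩ : IsOpen Ω) (hJ : IsOpen J) (h0 : (0 : ℝ) ∈ J)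
    {H : XU n → ℝ} (hH : ContDiffOn ℝ ∞ H Ω) {A : XU n → ℝ → ℝ}
    (hA : HasTaylorSeries Ω J (hCoeff H) A) {m : ℕ}
    (hm : ∀ w ∈ Ω, n = 2 * (n / 2) → n / 2 ≤ m → (lap^[n / 2] H) w = 0) :
    VanishesTo Ω m (waveOp ((n : ℝ) / 2 - 1) (totalCoeff H A)) := by
  intro k hk w hw
  rw [dr_iterate_waveOp_of_taylor hΩ hJ h0 (contDiffOn_totalCoeff hH hA.1)
    (contDiffOn_totalSeries hΩ hH) (dr_iterate_totalCoeff_hCoeff hΩ hJ h0 hH hA) _ k hw,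
    waveCoeff_totalSeries hn hΩ hH k hw]
  split_ifs with h
  · rw [hm w hw (by omega) (by omega), mul_zero, mul_zero]
  · rw [mul_zero]

theorem vanishesTo_waveOp_fCoeff (hΩ : IsOpen Ω) (hJ : IsOpen J) (h0 : (0 : ℝ) ∈ J)
    {f : XU n → ℝ} (hf : ContDiffOn ℝ ∞ f Ω) {B : XU n → ℝ → ℝ}
    (hB : HasTaylorSeries Ω J (fCoeff f) B) (m : ℕ) :
    VanishesTo Ω m (waveOp (-((n : ℝ) / 2 + 1)) fun p => B p.1 p.2) := by
  intro k _ w hw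
  rw [dr_iterate_waveOp_of_taylor hΩ hJ h0 hB.1 (contDiffOn_fCoeff hΩ hf)
    (hB.dr_iterate hΩ hJ h0) _ k hw, waveCoeff_fCoeff hΩ hf k hw, mul_zero]

/-! ### Convergent series -/

theorem seriesSum_eq_powerSum (c : ℕ → XU n → ℝ) (w : XU n) (ρ : ℝ) :
    seriesSum c w ρ = powerSum c (w, ρ) :=
  tsum_congr fun _ => mul_comm _ _

theorem ConvergesOn.seriesBound {c : ℕ → XU n → ℝ} (h : ConvergesOn Ω ε c)
    (hc : ∀ k, ContDiffOn ℝ ∞ (c k) Ω) : SeriesBound Ω ε c := ⟨hc, h⟩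

theorem SeriesBound.hasTaylorSeries (hΩ : IsOpen Ω) (hε : 0 < ε) {c : ℕ → XU n → ℝ}
    (h : SeriesBound Ω ε c) : HasTaylorSeries Ω (Ioo (-ε) ε) c (seriesSum c) := by
  have he : (fun p : XU n × ℝ => seriesSum c p.1 p.2) = powerSum c :=
    funext fun p => seriesSum_eq_powerSum c p.1 p.2
  refine hasTaylorSeries_of_dr_iterate hΩ isOpen_Ioo ⟨by linarith, hε⟩ ?_ fun w hw k => ?_
  · rw [he]; exact h.contDiffOn hΩ
  · rw [he]; exact h.dr_iterate_powerSum hΩ hε k hw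

theorem SeriesBound.hasSum_seriesSum {c : ℕ → XU n → ℝ} (h : SeriesBound Ω ε c) {w : XU n}
    (hw : w ∈ Ω) {ρ : ℝ} (hρ : ρ ∈ Ioo (-ε) ε) :
    HasSum (fun k => c k w * ρ ^ k) (seriesSum c w ρ) := by
  rw [seriesSum_eq_powerSum]
  exact (h.hasSum (p := (w, ρ)) ⟨hw, hρ⟩).congr_fun fun k => mul_comm _ _

/-- Only the coefficient of index `0` differs from `hCoeff`, and its derivatives are bounded on
compact sets. -/
theorem seriesBound_totalSeries {H : XU n → ℝ} (hH : ContDiffOn ℝ ∞ H Ω)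
    (hΩ : IsOpen Ω) (h : ConvergesOn Ω ε (hCoeff H)) : SeriesBound Ω ε (totalSeries H) where
  smooth := contDiffOn_totalSeries hΩ hH
  bound j K hK hKc r hr hrε := by
    obtain ⟨C, hC⟩ := h j K hK hKc r hr hrε
    have hcont : ContinuousOn (fun w => ‖iteratedFDeriv ℝ j (totalSeries H 0) w‖ * r ^ 0) K :=
      (((contDiffOn_totalSeries hΩ hH 0).continuousOn_iteratedFDerivWithin
        (m := j) (by exact_mod_cast le_top) hΩ.uniqueDiffOn).congr
          fun w hw => (iteratedFDerivWithin_of_isOpen j hΩ hw).symm).mono hK |>.norm.mul_const _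
    obtain ⟨D, hD⟩ := hKc.bddAbove_image hcont
    refine ⟨max C D, fun k w hw => ?_⟩
    rcases k with _ | k
    · exact (hD (mem_image_of_mem _ hw)).trans (le_max_right _ _)
    · have : totalSeries H (k + 1) = hCoeff H (k + 1) := funext fun w => by simp [totalSeries]
      rw [this]
      exact (hC _ w hw).trans (le_max_left _ _)

theorem totalCoeff_seriesSum {H : XU n → ℝ} (hΩ : IsOpen Ω) (hH : ContDiffOn ℝ ∞ H Ω)
    (h : ConvergesOn Ω ε (hCoeff H)) : EqOn (totalCoeff H (seriesSum (hCoeff H)))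
      (powerSum (totalSeries H)) (Ω ×ˢ Ioo (-ε) ε) := by
  intro p hp
  have h1 := (h.seriesBound (contDiffOn_hCoeff hΩ hH)).hasSum_seriesSum hp.1 hp.2
  have h2 : HasSum (fun k : ℕ => (if k = 0 then H p.1 else 0) * p.2 ^ k) (H p.1) := by
    have := hasSum_single (f := fun k : ℕ => (if k = 0 then H p.1 else 0) * p.2 ^ k) 0
      fun k hk => by simp [hk]
    simpa using this
  refine (h2.add h1).unique (((seriesBound_totalSeries hH hΩ h).hasSum hp).congr_fun fun k => ?_)
  rw [totalSeries]
  ring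

/-- The series is a polynomial in `ρ`, so the maximum of finitely many continuous functions on `K`
gives the bound. The cutoff at `n` is generous. -/
theorem convergesOn_hCoeff_of_even (hev : Even n) (hΩ : IsOpen Ω) {H : XU n → ℝ}
    (hH : ContDiffOn ℝ ∞ H Ω) (ε : ℝ) : ConvergesOn Ω ε (hCoeff H) := by
  intro j K hK hKc r hr _
  have hb : ∀ k, ∃ D, ∀ w ∈ K, ‖iteratedFDeriv ℝ j (hCoeff H k) w‖ * r ^ k ≤ D := by
    intro k
    have hcont : ContinuousOn (fun w => ‖iteratedFDeriv ℝ j (hCoeff H k) w‖ * r ^ k) K :=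
      (((contDiffOn_hCoeff hΩ hH k).continuousOn_iteratedFDerivWithin
        (m := j) (by exact_mod_cast le_top) hΩ.uniqueDiffOn).congr
          fun w hw => (iteratedFDerivWithin_of_isOpen j hΩ hw).symm).mono hK |>.norm.mul_const _
    obtain ⟨D, hD⟩ := hKc.bddAbove_image hcont
    exact ⟨D, fun w hw => hD (mem_image_of_mem _ hw)⟩
  choose D hD using hb
  refine ⟨∑ k ∈ Finset.range n, |D k|, fun k w hw => ?_⟩
  by_cases hk : k < n
  · exact ((hD k w hw).trans (le_abs_self _)).trans (Finset.single_le_sum (f := fun k => |D k|)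
      (fun i _ => abs_nonneg _) (Finset.mem_range.2 hk))
  · have : hCoeff H k = fun _ => 0 := funext fun w => by
      rw [hCoeff, if_pos (Or.inr ⟨hev, by omega⟩)]
    rw [this]
    have h0 : iteratedFDeriv ℝ j (fun _ : XU n => (0 : ℝ)) w = 0 := by
      have := iteratedFDeriv_fun_zero (𝕜 := ℝ) (E := XU n) (F := ℝ) (n := j)
      exact congrFun this w
    rw [h0, norm_zero, zero_mul]
    positivity

theorem waveOp_totalCoeff_seriesSum (hn : 3 ≤ n) (hΩ : IsOpen Ω) {H : XU n → ℝ}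
    (hH : ContDiffOn ℝ ∞ H Ω) (h : ConvergesOn Ω ε (hCoeff H)) {p : XU n × ℝ}
    (hp : p ∈ Ω ×ˢ Ioo (-ε) ε) : waveOp ((n : ℝ) / 2 - 1) (totalCoeff H (seriesSum (hCoeff H))) p =
      if Even n then p.2 ^ (n / 2 - 1) * (obstructionConst n * (lap^[n / 2] H) p.1) else 0 := by
  rw [waveOp_congr (hΩ.prod isOpen_Ioo) (totalCoeff_seriesSum hΩ hH h) _ hp]
  refine (hasSum_waveOp_powerSum hΩ (seriesBound_totalSeries hH hΩ h) _ hp).unique ?_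
  simp only [waveCoeff_totalSeries hn hΩ hH _ hp.1]
  split_ifs with hev
  · obtain ⟨j, hj⟩ := hev
    have := hasSum_single (f := fun k : ℕ => p.2 ^ k *
      if n = 2 * (k + 1) then obstructionConst n * (lap^[n / 2] H) p.1 else 0) (n / 2 - 1)
      fun k hk => by rw [if_neg (by omega), mul_zero]
    rwa [if_pos (by omega)] at this
  · have : ∀ k, ¬n = 2 * (k + 1) := fun k hk => hev ⟨k + 1, by omega⟩
    simp only [this, if_false, mul_zero]
    exact hasSum_zero

theorem waveOp_seriesSum_fCoeff (hΩ : IsOpen Ω) {f : XU n → ℝ} (hf : ContDiffOn ℝ ∞ f Ω)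
    (h : ConvergesOn Ω ε (fCoeff f)) {p : XU n × ℝ} (hp : p ∈ Ω ×ˢ Ioo (-ε) ε) :
    waveOp (-((n : ℝ) / 2 + 1)) (fun p => seriesSum (fCoeff f) p.1 p.2) p = 0 := by
  have he : (fun p : XU n × ℝ => seriesSum (fCoeff f) p.1 p.2) = powerSum (fCoeff f) :=
    funext fun p => seriesSum_eq_powerSum _ p.1 p.2
  rw [he]
  exact waveOp_powerSum_eq_zero hΩ (h.seriesBound (contDiffOn_fCoeff hΩ hf))
    (fun k w hw => waveCoeff_fCoeff hΩ hf k hw) hp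

end Recurrence

/-! ### The metrics with `h = A + α(ρ) B`, where `α` is a power of `ρ` -/

/-- The function `α` is a solution of `ρ α' = s α` on `J`, continuous and zero at `ρ = 0`. -/
structure IsPower (s : ℝ) (J : Set ℝ) (α : ℝ → ℝ) : Prop where
  cont : Continuous α
  zero : α 0 = 0
  smooth : ContDiffOn ℝ ∞ α J
  ode : ∃ α₁ α₂ : ℝ → ℝ, ∀ ρ ∈ J, HasDerivAt α (α₁ ρ) ρ ∧ HasDerivAt α₁ (α₂ ρ) ρ ∧
    ρ * α₁ ρ = s * α ρ ∧ ρ * α₂ ρ = (s - 1) * α₁ ρ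

/-- The zero function solves the same equations. Used as `α` it removes `B` and gives the case `f =
0` on a two-sided interval, also for odd `n`. -/
theorem isPower_zero (s : ℝ) (J : Set ℝ) : IsPower s J 0 where
  cont := continuous_const
  zero := rfl
  smooth := contDiffOn_const
  ode := ⟨0, 0, fun ρ _ => ⟨hasDerivAt_const ρ 0, hasDerivAt_const ρ 0, by simp, by simp⟩⟩

theorem isPower_pow {s : ℕ} (hs : s ≠ 0) (J : Set ℝ) : IsPower s J fun ρ => ρ ^ s where
  cont := continuous_pow s
  zero := zero_pow hs
  smooth := contDiffOn_id.pow s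
  ode := by
    refine ⟨fun ρ => s * ρ ^ (s - 1), fun ρ => s * (((s - 1 : ℕ) : ℝ) * ρ ^ (s - 1 - 1)),
      fun ρ _ => ⟨hasDerivAt_pow s ρ, (hasDerivAt_pow (s - 1) ρ).const_mul _, ?_, ?_⟩⟩
    · obtain ⟨m, rfl⟩ := Nat.exists_eq_succ_of_ne_zero hs
      simp only [Nat.succ_eq_add_one, Nat.add_sub_cancel, pow_succ]
      ring
    · obtain ⟨m, rfl⟩ := Nat.exists_eq_succ_of_ne_zero hs
      rcases m with _ | m
      · simp
      · simp only [Nat.succ_eq_add_one, Nat.add_sub_cancel, pow_succ]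
        push_cast
        ring

theorem isPower_rpow {s : ℝ} (hs : 0 < s) {J : Set ℝ} (hJ : ∀ ρ ∈ J, 0 < ρ) :
    IsPower s J fun ρ => ρ ^ s where
  cont := Real.continuous_rpow_const hs.le
  zero := Real.zero_rpow hs.ne'
  smooth := fun ρ hρ => (Real.contDiffAt_rpow_const_of_ne (hJ ρ hρ).ne').contDiffWithinAt
  ode := by
    refine ⟨fun ρ => s * ρ ^ (s - 1), fun ρ => s * ((s - 1) * ρ ^ (s - 1 - 1)), fun ρ hρ => ?_⟩
    have h0 := hJ ρ hρ
    refine ⟨Real.hasDerivAt_rpow_const (Or.inl h0.ne'),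
      (Real.hasDerivAt_rpow_const (Or.inl h0.ne')).const_mul _, ?_, ?_⟩
    · simp only [Real.rpow_sub_one h0.ne']
      field_simp
    · simp only [Real.rpow_sub_one h0.ne' (s - 1)]
      field_simp

section Combine

variable {n : ℕ} {Ω : Set (XU n)} {J : Set ℝ} {ε : ℝ} {H : XU n → ℝ} {A B : XU n → ℝ → ℝ}
  {α : ℝ → ℝ}

theorem contDiffOn_combine (hα : IsPower ((n : ℝ) / 2) J α)
    (hA : ContDiffOn ℝ ∞ (fun p : XU n × ℝ => A p.1 p.2) (Ω ×ˢ J))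
    (hB : ContDiffOn ℝ ∞ (fun p : XU n × ℝ => B p.1 p.2) (Ω ×ˢ J)) :
    ContDiffOn ℝ ∞ (fun p : XU n × ℝ => A p.1 p.2 + α p.2 * B p.1 p.2) (Ω ×ˢ J) :=
  hA.add ((hα.smooth.comp contDiffOn_snd fun _ hp => hp.2).mul hB)

/-- The contributions of the two indicial roots decouple: the factor `α` passes through the operator
at the price of changing its first-order coefficient. -/
theorem waveOp_combine (hΩ : IsOpen Ω) (hJ : IsOpen J) (hH : ContDiffOn ℝ ∞ H Ω)
    (hα : IsPower ((n : ℝ) / 2) J α)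
    (hA : ContDiffOn ℝ ∞ (fun p : XU n × ℝ => A p.1 p.2) (Ω ×ˢ J))
    (hB : ContDiffOn ℝ ∞ (fun p : XU n × ℝ => B p.1 p.2) (Ω ×ˢ J)) :
    EqOn (waveOp ((n : ℝ) / 2 - 1) (totalCoeff H fun w ρ => A w ρ + α ρ * B w ρ))
      (fun p => waveOp ((n : ℝ) / 2 - 1) (totalCoeff H A) p +
        α p.2 * waveOp (-((n : ℝ) / 2 + 1)) (fun p => B p.1 p.2) p) (Ω ×ˢ J) := by
  have hU := hΩ.prod hJ
  obtain ⟨α₁, α₂, h⟩ := hα.ode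
  have he : (totalCoeff H fun w ρ => A w ρ + α ρ * B w ρ) =
      fun p => totalCoeff H A p + α p.2 * B p.1 p.2 := funext fun p => (add_assoc _ _ _).symm
  have hαB : ContDiffOn ℝ ∞ (fun p : XU n × ℝ => α p.2 * B p.1 p.2) (Ω ×ˢ J) :=
    (hα.smooth.comp contDiffOn_snd fun _ hp => hp.2).mul hB
  intro p hp
  rw [he, waveOp_add hU (contDiffOn_totalCoeff hH hA) hαB _ hp]
  simp only []
  rw [waveOp_pow_mul hU hB _ (fun p hp => (h p.2 hp.2).1) (fun p hp => (h p.2 hp.2).2.1)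
    (fun p hp => (h p.2 hp.2).2.2.1) (fun p hp => (h p.2 hp.2).2.2.2) hp]

variable {M : Set (Idx n → ℝ)}

/-- Both residues vanish to order `m` on the full interval, where `A` and `B` are smooth. Of `α`,
which may be smooth only on `J`, just boundedness near `ρ = 0` enters the estimate. -/
theorem ricciBigO_combine (hn : 3 ≤ n) (hM : IsOpen M) (hε : 0 < ε) (hJ : IsOpen J)
    (hJε : J ⊆ Ioo (-ε) ε) (hH : ContDiffOn ℝ ∞ H (proj '' M)) (hα : IsPower ((n : ℝ) / 2) J α)
    {f : XU n → ℝ} (hf : ContDiffOn ℝ ∞ f (proj '' M))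
    (hA : HasTaylorSeries (proj '' M) (Ioo (-ε) ε) (hCoeff H) A)
    (hB : HasTaylorSeries (proj '' M) (Ioo (-ε) ε) (fCoeff f) B) {m : ℕ}
    (hm : ∀ w ∈ proj '' M, n = 2 * (n / 2) → n / 2 ≤ m → (lap^[n / 2] H) w = 0) :
    RicciBigO M J (ppFamily H fun w ρ => A w ρ + α ρ * B w ρ) m := by
  have hΩ := isOpen_image_proj hM
  have h0 : (0 : ℝ) ∈ Ioo (-ε) ε := ⟨by linarith, hε⟩
  have hsub : (proj '' M) ×ˢ J ⊆ (proj '' M) ×ˢ Ioo (-ε) ε := prod_mono subset_rfl hJε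
  refine ricciBigO_ppFamily hn hM hJ hH
    (contDiffOn_combine hα (hA.1.mono hsub) (hB.1.mono hsub)) fun w hw => ?_
  have hU : IsOpen ((proj '' M) ×ˢ Ioo (-ε) ε) := hΩ.prod isOpen_Ioo
  have h1 := VanishesTo.isBigO hΩ isOpen_Ioo h0
    (ContDiffOn.waveOp hU (contDiffOn_totalCoeff hH hA.1) _)
    (vanishesTo_waveOp_hCoeff hn hΩ isOpen_Ioo h0 hH hA hm) hw
  have h2 := VanishesTo.isBigO hΩ isOpen_Ioo h0 (ContDiffOn.waveOp hU hB.1 _)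
    (vanishesTo_waveOp_fCoeff hΩ isOpen_Ioo h0 hf hB m) hw
  have h3 : (fun p : XU n × ℝ => α p.2) =O[𝓝 (w, (0 : ℝ))] fun _ => (1 : ℝ) :=
    ((hα.cont.comp continuous_snd).tendsto _).isBigO_one ℝ
  have h4 := h1.add ((h3.mul h2).congr_right fun p => one_mul _)
  refine (h4.mono nhdsWithin_le_nhds).congr' ?_ (Eventually.of_forall fun _ => rfl)
  filter_upwards [self_mem_nhdsWithin] with p hp
  exact (waveOp_combine hΩ hJ hH hα (hA.1.mono hsub) (hB.1.mono hsub) hp).symm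

theorem isAmbientMetric_combine (hn : 3 ≤ n) (hM : IsOpen M) (hε : 0 < ε) (hJ : IsOpen J)
    (hJε : J ⊆ Ioo (-ε) ε) (hH : ContDiffOn ℝ ∞ H (proj '' M)) (hα : IsPower ((n : ℝ) / 2) J α)
    {f : XU n → ℝ} (hf : ContDiffOn ℝ ∞ f (proj '' M))
    (hA : HasTaylorSeries (proj '' M) (Ioo (-ε) ε) (hCoeff H) A)
    (hB : HasTaylorSeries (proj '' M) (Ioo (-ε) ε) (fCoeff f) B) :
    IsAmbientMetric M J (ppMetric H) (ppFamily H fun w ρ => A w ρ + α ρ * B w ρ) := by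
  have h0 : (0 : ℝ) ∈ Ioo (-ε) ε := ⟨by linarith, hε⟩
  have hsub : (proj '' M) ×ˢ J ⊆ (proj '' M) ×ˢ Ioo (-ε) ε := prod_mono subset_rfl hJε
  have hsub' : (proj '' M) ×ˢ insert 0 J ⊆ (proj '' M) ×ˢ Ioo (-ε) ε :=
    prod_mono subset_rfl (insert_subset h0 hJε)
  refine isAmbientMetric_ppFamily hn hM hJ hH
    (contDiffOn_combine hα (hA.1.mono hsub) (hB.1.mono hsub)) ?_ (fun w hw => ?_)
    (fun hodd m => ?_) (fun hev => ?_)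
  · exact (hA.1.continuousOn.mono hsub').add
      ((hα.cont.comp continuous_snd).continuousOn.mul (hB.1.continuousOn.mono hsub'))
  · rw [hA.eq_zero hw, hα.zero, hCoeff, if_pos (Or.inl rfl)]
    ring
  · refine ricciBigO_combine hn hM hε hJ hJε hH hα hf hA hB fun w _ h => ?_
    obtain ⟨j, hj⟩ := hodd
    omega
  -- The order `n/2 - 1` lies below the obstruction, so the condition on `Δ^{n/2} H` is vacuous.
  · exact ricciBigO_combine hn hM hε hJ hJε hH hα hf hA hB fun w _ h h' => by omega

theorem ricciFlat_combine (hn : 3 ≤ n) (hM : IsOpen M) (hε : 0 < ε) (hJ : IsOpen J)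
    (hJε : J ⊆ Ioo (-ε) ε) (hH : ContDiffOn ℝ ∞ H (proj '' M)) (hα : IsPower ((n : ℝ) / 2) J α)
    {f : XU n → ℝ} (hf : ContDiffOn ℝ ∞ f (proj '' M))
    (hA : ConvergesOn (proj '' M) ε (hCoeff H)) (hB : ConvergesOn (proj '' M) ε (fCoeff f))
    (hO : Even n → ∀ w ∈ proj '' M, (lap^[n / 2] H) w = 0) :
    RicciFlat M J (ppFamily H fun w ρ =>
      seriesSum (hCoeff H) w ρ + α ρ * seriesSum (fCoeff f) w ρ) := by
  have hΩ := isOpen_image_proj hM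
  have hsub : (proj '' M) ×ˢ J ⊆ (proj '' M) ×ˢ Ioo (-ε) ε := prod_mono subset_rfl hJε
  have hA' := ((hA.seriesBound (contDiffOn_hCoeff hΩ hH)).hasTaylorSeries hΩ hε).1.mono hsub
  have hB' := ((hB.seriesBound (contDiffOn_fCoeff hΩ hf)).hasTaylorSeries hΩ hε).1.mono hsub
  refine ricciFlat_ppFamily hn hM hJ hH (contDiffOn_combine hα hA' hB') fun p hp => ?_
  rw [waveOp_combine hΩ hJ hH hα hA' hB' hp]
  simp only []
  rw [waveOp_totalCoeff_seriesSum hn hΩ hH hA (hsub hp),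
    waveOp_seriesSum_fCoeff hΩ hf hB (hsub hp)]
  split_ifs with hev
  · rw [hO hev _ hp.1]; ring
  · ring

theorem HasTaylorSeries.mono {J' : Set ℝ} {c : ℕ → XU n → ℝ} (h : HasTaylorSeries Ω J c A)
    (hJ : J' ⊆ J) : HasTaylorSeries Ω J' c A :=
  ⟨h.1.mono (prod_mono subset_rfl hJ), h.2⟩

theorem exists_hasTaylorSeries (hΩ : IsOpen Ω) {c : ℕ → XU n → ℝ}
    (hc : ∀ k, ContDiffOn ℝ ∞ (c k) Ω) : ∃ A, HasTaylorSeries Ω univ c A :=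
  exists_borel hΩ hc

theorem ppFamily_combine_zero : (ppFamily H fun w ρ => A w ρ + (0 : ℝ → ℝ) ρ * B w ρ) =
    ppFamily H A := by
  simp

/-- The case `f = 0`. -/
theorem isAmbientMetric_of_hasTaylorSeries (hn : 3 ≤ n) (hM : IsOpen M) (hε : 0 < ε)
    (hH : ContDiffOn ℝ ∞ H (proj '' M))
    (hA : HasTaylorSeries (proj '' M) (Ioo (-ε) ε) (hCoeff H) A) :
    IsAmbientMetric M (Ioo (-ε) ε) (ppMetric H) (ppFamily H A) := by
  have hf : ContDiffOn ℝ ∞ (fun _ : XU n => (0 : ℝ)) (proj '' M) := contDiffOn_const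
  obtain ⟨B, hB⟩ := exists_hasTaylorSeries (isOpen_image_proj hM)
    (contDiffOn_fCoeff (isOpen_image_proj hM) hf)
  have := isAmbientMetric_combine hn hM hε isOpen_Ioo subset_rfl hH (isPower_zero _ _) hf hA
    (hB.mono (subset_univ _))
  rwa [ppFamily_combine_zero] at this

theorem convergesOn_fCoeff_zero : ConvergesOn Ω ε (fCoeff fun _ : XU n => (0 : ℝ)) := by
  have h : ∀ k, lap^[k] (fun _ : XU n => (0 : ℝ)) = fun _ => 0 := by
    intro k
    induction k with
    | zero => rfl
    | succ k ih =>
      rw [Function.iterate_succ_apply', ih]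
      funext w
      have := lap_const_mul (F := fun _ : XU n => (0 : ℝ)) isOpen_univ contDiffOn_const 0
        (mem_univ w)
      simpa using this
  have h' : ∀ k, fCoeff (fun _ : XU n => (0 : ℝ)) k = fun _ => 0 := fun k => by
    funext w; rw [fCoeff, h, zero_div]
  intro j K _ _ r _ _
  refine ⟨0, fun k w _ => ?_⟩
  have h0 : iteratedFDeriv ℝ j (fun _ : XU n => (0 : ℝ)) w = 0 :=
    congrFun (iteratedFDeriv_fun_zero (𝕜 := ℝ) (E := XU n) (F := ℝ) (n := j)) w
  rw [h', h0, norm_zero, zero_mul]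

theorem ricciFlat_seriesSum (hn : 3 ≤ n) (hM : IsOpen M) (hε : 0 < ε)
    (hH : ContDiffOn ℝ ∞ H (proj '' M)) (hA : ConvergesOn (proj '' M) ε (hCoeff H))
    (hodd : Odd n) :
    RicciFlat M (Ioo (-ε) ε) (ppFamily H (seriesSum (hCoeff H))) := by
  have := ricciFlat_combine hn hM hε isOpen_Ioo subset_rfl hH (isPower_zero _ _) contDiffOn_const hA
    convergesOn_fCoeff_zero fun hev => absurd hev (Nat.not_even_iff_odd.2 hodd)
  rwa [ppFamily_combine_zero] at this

/-! ### Analyticity in `ρ` -/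

theorem analyticInRho_ppFamily {h : XU n → ℝ → ℝ}
    (ha : ∀ w ∈ proj '' M, AnalyticOnNhd ℝ (h w) J) : AnalyticInRho M J (ppFamily H h) := by
  intro z hz i j
  have : (fun ρ => ppFamily H h z ρ i j) = fun ρ =>
      ppMatrix n 0 i j + (H (proj z) + h (proj z) ρ) * (duCovector n i * duCovector n j) := by
    funext ρ; rw [ppFamily_eq, ppMatrix_apply]
  rw [this]
  exact analyticOnNhd_const.add
    ((analyticOnNhd_const.add (ha _ (mem_image_of_mem _ hz))).mul analyticOnNhd_const)

theorem SeriesBound.analyticOnNhd_seriesSum {c : ℕ → XU n → ℝ} (h : SeriesBound Ω ε c) {w : XU n}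
    (hw : w ∈ Ω) : AnalyticOnNhd ℝ (seriesSum c w) (Ioo (-ε) ε) := by
  have : seriesSum c w = fun ρ => powerSum c (w, ρ) := funext fun ρ => seriesSum_eq_powerSum c w ρ
  rw [this]
  exact h.analyticOnNhd hw

theorem AnalyticAt.hasSum_taylor {f : ℝ → ℝ} (hf : AnalyticAt ℝ f 0) :
    ∀ᶠ ρ in 𝓝 (0 : ℝ), HasSum (fun k : ℕ => iteratedDeriv k f 0 / k.factorial * ρ ^ k) (f ρ) := by
  have h := hf.hasFPowerSeriesAt.eventually_hasSum
  filter_upwards [h] with ρ hρ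
  rw [zero_add] at hρ
  refine hρ.congr_fun fun k => ?_
  rw [FormalMultilinearSeries.ofScalars_apply_eq]
  simp [smul_eq_mul]

end Combine

/-! ### Uniqueness of analytic ambient metrics in odd dimension -/

section Uniqueness

variable {n : ℕ} {ε : ℝ} {H : XU n → ℝ} {A : XU n → ℝ → ℝ} {M : Set (Idx n → ℝ)}
  {γ γ' : (Idx n → ℝ) → ℝ → Matrix (Idx n) (Idx n) ℝ}

theorem iteratedDeriv_eq_of_odd (hn : 3 ≤ n) (hodd : Odd n) (hM : IsOpen M) (hε : 0 < ε)
    {g : (Idx n → ℝ) → Matrix (Idx n) (Idx n) ℝ}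
    (h : IsAmbientMetric M (Ioo (-ε) ε) g γ) (h' : IsAmbientMetric M (Ioo (-ε) ε) g γ')
    {z : Idx n → ℝ} (hz : z ∈ M) (i j : Idx n) (k : ℕ) :
    iteratedDeriv k (fun ρ => γ z ρ i j) 0 = iteratedDeriv k (fun ρ => γ' z ρ i j) 0 := by
  have h0 : (0 : ℝ) ∈ Ioo (-ε) ε := ⟨by linarith, hε⟩
  have hc := (h.comparable_of_odd h' hM isOpen_Ioo h0 (by rwa [card_idx hn])
    (by rw [card_idx hn]; omega) k).agree i j k (by omega) z hz
  rw [dr_iterate_sub (F := comp γ i j) (G := comp γ' i j) (hM.prod isOpen_Ioo) (h.smooth i j) (h'.smooth i j) k (mk_mem_prod hz h0),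
    sub_eq_zero] at hc
  have e := dr_iterate_eq_iteratedDeriv (F := comp γ i j) hM isOpen_Ioo (h.smooth i j) k hz 0 h0
  have e' := dr_iterate_eq_iteratedDeriv (F := comp γ' i j) hM isOpen_Ioo (h'.smooth i j) k hz 0 h0
  exact (e.symm.trans hc).trans e'

/-- Equal Taylor coefficients give equality near `ρ = 0`, and the identity theorem extends it over
the connected interval. -/
theorem eq_of_analytic_of_odd (hn : 3 ≤ n) (hodd : Odd n) (hM : IsOpen M) (hε : 0 < ε)
    {g : (Idx n → ℝ) → Matrix (Idx n) (Idx n) ℝ}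
    (h : IsAmbientMetric M (Ioo (-ε) ε) g γ) (h' : IsAmbientMetric M (Ioo (-ε) ε) g γ')
    (ha : AnalyticInRho M (Ioo (-ε) ε) γ) (ha' : AnalyticInRho M (Ioo (-ε) ε) γ')
    {z : Idx n → ℝ} (hz : z ∈ M) {ρ : ℝ} (hρ : ρ ∈ Ioo (-ε) ε) : γ z ρ = γ' z ρ := by
  have h0 : (0 : ℝ) ∈ Ioo (-ε) ε := ⟨by linarith, hε⟩
  ext i j
  refine (ha z hz i j).eqOn_of_preconnected_of_eventuallyEq (ha' z hz i j) isPreconnected_Ioo h0 ?_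
    hρ
  filter_upwards [AnalyticAt.hasSum_taylor (ha z hz i j 0 h0),
    AnalyticAt.hasSum_taylor (ha' z hz i j 0 h0)] with s hs hs'
  refine hs.unique (hs'.congr_fun fun k => ?_)
  rw [iteratedDeriv_eq_of_odd hn hodd hM hε h h' hz i j k]

theorem iteratedDeriv_ppFamily
    (hA : HasTaylorSeries (proj '' M) (Ioo (-ε) ε) (hCoeff H) A) {z : Idx n → ℝ} (hz : z ∈ M)
    (i j : Idx n) (k : ℕ) : iteratedDeriv k (fun ρ => ppFamily H A z ρ i j) 0 =
      k.factorial * ((if k = 0 then ppMetric H z i j else 0) +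
        hCoeff H k (proj z) * (duCovector n i * duCovector n j)) := by
  have he : ∀ ρ, ppFamily H A z ρ i j =
      ppMetric H z i j + (duCovector n i * duCovector n j) * A (proj z) ρ := fun ρ => by
    rw [ppFamily_eq, ppMetric, ppMatrix_apply, ppMatrix_apply (H (proj z))]
    ring
  simp only [he]
  have hA' := hA.2 (proj z) (mem_image_of_mem _ hz) k
  rcases Nat.eq_zero_or_pos k with rfl | hk
  · simp only [iteratedDeriv_zero] at hA' ⊢
    rw [hA']
    simp
    ring
  · rw [iteratedDeriv_const_add hk, iteratedDeriv_const_mul_field, hA', if_neg hk.ne']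
    ring

/-- An analytic ambient metric in odd dimension is given by the series `a`, which converges. -/
theorem hasSum_of_analytic_of_odd (hn : 3 ≤ n) (hodd : Odd n) (hM : IsOpen M) (hε : 0 < ε)
    (hH : ContDiffOn ℝ ∞ H (proj '' M)) (h : IsAmbientMetric M (Ioo (-ε) ε) (ppMetric H) γ)
    (ha : AnalyticInRho M (Ioo (-ε) ε) γ) {z : Idx n → ℝ} (hz : z ∈ M) :
    ∀ᶠ ρ in 𝓝 (0 : ℝ), ∃ s : ℝ, HasSum (fun k : ℕ => hCoeff H k (proj z) * ρ ^ k) s ∧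
      γ z ρ = ppMetric H z + duSq n s := by
  have h0 : (0 : ℝ) ∈ Ioo (-ε) ε := ⟨by linarith, hε⟩
  -- A Borel realisation of `a` is the metric compared with. It yields the Taylor coefficients of
  -- `γ` without any convergence; analyticity of `γ` then makes the series converge.
  obtain ⟨A, hA⟩ := exists_hasTaylorSeries (isOpen_image_proj hM)
    (contDiffOn_hCoeff (isOpen_image_proj hM) hH)
  replace hA := hA.mono (subset_univ (Ioo (-ε) ε))
  have hT : ∀ᶠ ρ in 𝓝 (0 : ℝ), ∀ i j, HasSum (fun k : ℕ =>
      ((if k = 0 then ppMetric H z i j else 0) +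
        hCoeff H k (proj z) * (duCovector n i * duCovector n j)) * ρ ^ k) (γ z ρ i j) := by
    refine eventually_all.2 fun i => eventually_all.2 fun j => ?_
    filter_upwards [AnalyticAt.hasSum_taylor (ha z hz i j 0 h0)] with ρ hρ
    refine hρ.congr_fun fun k => ?_
    rw [iteratedDeriv_eq_of_odd hn hodd hM hε h
      (isAmbientMetric_of_hasTaylorSeries hn hM hε hH hA) hz i j k,
      iteratedDeriv_ppFamily hA hz]
    field_simp
  filter_upwards [hT] with ρ hρ
  have hconst : ∀ b : ℝ, HasSum (fun k : ℕ => (if k = 0 then b else 0) * ρ ^ k) b := fun b => by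
    have := hasSum_single (f := fun k : ℕ => (if k = 0 then b else 0) * ρ ^ k) 0
      fun k hk => by simp [hk]
    simpa using this
  set s := γ z ρ (Sum.inr 0) (Sum.inr 0) - ppMetric H z (Sum.inr 0) (Sum.inr 0) with hs
  have huu : duCovector n (Sum.inr 0) = 1 := rfl
  have hsum : HasSum (fun k : ℕ => hCoeff H k (proj z) * ρ ^ k) s := by
    refine ((hρ (Sum.inr 0) (Sum.inr 0)).sub (hconst _)).congr_fun fun k => ?_
    rw [huu]
    ring
  refine ⟨s, hsum, ?_⟩
  have he : ppMetric H z + duSq n s = ppMatrix n (H (proj z) + s) :=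
    ppFamily_eq H (fun _ _ => s) z ρ
  ext i j
  rw [he, ppMatrix_apply]
  refine (hρ i j).unique ?_
  have h1 := (hconst (ppMetric H z i j)).add (hsum.mul_left (duCovector n i * duCovector n j))
  rw [ppMetric, ppMatrix_apply] at h1
  have e : ppMatrix n 0 i j + (H (proj z) + s) * (duCovector n i * duCovector n j) =
    ppMatrix n 0 i j + H (proj z) * (duCovector n i * duCovector n j) +
      duCovector n i * duCovector n j * s := by ring
  rw [e]
  refine h1.congr_fun fun k => ?_
  rw [ppMetric, ppMatrix_apply]
  ring

end Uniqueness

/-! ### Solutions with exponents in `ℕ` and `n/2 + ℕ` -/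

section HalfInteger

variable {n : ℕ} {Ω : Set (XU n)} {J : Set ℝ}

/-- The recurrences determine the Taylor coefficients of a solution. -/
theorem dr_iterate_eq_of_vanishesTo (hΩ : IsOpen Ω) (hJ : IsOpen J) (h0 : (0 : ℝ) ∈ J)
    {F : XU n × ℝ → ℝ} (hF : ContDiffOn ℝ ∞ F (Ω ×ˢ J)) {c : ℕ → XU n → ℝ}
    (hc : ∀ k, ContDiffOn ℝ ∞ (c k) Ω) {a : ℝ} {m : ℕ} (hv : VanishesTo Ω m (waveOp a F))
    (hi : ∀ w ∈ Ω, F (w, 0) = c 0 w)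
    (hrec : ∀ k < m, ((k : ℝ) ≠ a ∧ ∀ w ∈ Ω, waveCoeff a c k w = 0) ∨
      ∀ w ∈ Ω, dr^[k + 1] F (w, 0) = (k + 1).factorial * c (k + 1) w) :
    ∀ k ≤ m, ∀ w ∈ Ω, dr^[k] F (w, 0) = k.factorial * c k w := by
  intro k
  induction k with
  | zero => intro _ w hw; simpa using hi w hw
  | succ k ih =>
    intro hk w hw
    -- Either `k - a ≠ 0` and the recurrence fixes the next coefficient, or, as at a resonance, that
    -- coefficient is supplied directly.
    rcases hrec k (by omega) with ⟨hka, hw0⟩ | h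
    · have h1 : EqOn (fun w => dr^[k] F (w, 0)) (fun w => k.factorial * c k w) Ω :=
        fun w hw => ih (by omega) w hw
      have h2 := hv k (by omega) w hw
      rw [dr_iterate_waveOp hΩ hJ h0 hF a k hw, lap_congr hΩ h1 hw,
        lap_const_mul hΩ (hc k) _ hw] at h2
      have h3 := hw0 w hw
      rw [waveCoeff] at h3
      refine mul_left_cancel₀ (sub_ne_zero.2 hka) ?_
      rw [Nat.factorial_succ]
      push_cast
      linear_combination h2 - (k.factorial : ℝ) * h3
    · exact h w hw

theorem isBigO_slice {E : Type*} [NormedAddCommGroup E] [NormedSpace ℝ E] {M : Set E}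
    (hM : IsOpen M) (hJ : IsOpen J) (h0 : (0 : ℝ) ∈ J)
    {F : E × ℝ → ℝ} (hF : ContDiffOn ℝ ∞ F (M ×ˢ J)) {k : ℕ} (h : VanishesTo M k F) {x : E}
    (hx : x ∈ M) : (fun ρ => F (x, ρ)) =O[𝓝[>] (0 : ℝ)] fun ρ => ρ ^ k := by
  have h1 : Tendsto (fun ρ : ℝ => (x, ρ)) (𝓝[>] 0) (𝓝 (x, 0)) :=
    ((Continuous.prodMk_right x).tendsto 0).mono_left nhdsWithin_le_nhds
  exact (VanishesTo.isBigO hM hJ h0 hF h hx).comp_tendsto h1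

/-- A smooth function that is `O(ρ^{k + 1/2})` vanishes to order `k + 1`. -/
theorem vanishesTo_succ_of_isBigO_half {E : Type*} [NormedAddCommGroup E] [NormedSpace ℝ E]
    {M : Set E} (hM : IsOpen M) (hJ : IsOpen J) (h0 : (0 : ℝ) ∈ J)
    {F : E × ℝ → ℝ} (hF : ContDiffOn ℝ ∞ F (M ×ˢ J)) {k : ℕ}
    (h : ∀ x ∈ M, (fun ρ => F (x, ρ)) =O[𝓝[>] (0 : ℝ)] fun ρ => ρ ^ k * √ρ) :
    VanishesTo M (k + 1) F := by
  have hs : Tendsto (fun ρ => √ρ) (𝓝[>] 0) (𝓝 0) := by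
    have := (Real.continuous_sqrt.tendsto 0).mono_left (nhdsWithin_le_nhds (s := Ioi 0))
    rwa [Real.sqrt_zero] at this
  have hk : VanishesTo M k F := vanishesTo_of_isBigO hM hJ h0 hF fun x hx => by
    have h1 : (fun ρ : ℝ => ρ ^ k * √ρ) =O[𝓝[>] 0] fun ρ => ρ ^ k * 1 :=
      (Asymptotics.isBigO_refl _ _).mul (hs.isBigO_one ℝ)
    exact (h x hx).trans (by simpa using h1)
  refine vanishesTo_succ'.2 ⟨hk, fun x hx => ?_⟩
  have h1 : Tendsto (fun ρ : ℝ => (x, ρ)) (𝓝[>] 0) (𝓝[{p | p.2 ≠ 0}] (x, 0)) := by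
    refine tendsto_nhdsWithin_iff.2
      ⟨((Continuous.prodMk_right x).tendsto 0).mono_left nhdsWithin_le_nhds, ?_⟩
    filter_upwards [self_mem_nhdsWithin] with ρ hρ
    exact (ne_of_gt hρ : ρ ≠ 0)
  have h2 := (VanishesTo.tendsto_div hM hJ h0 hF hk hx).comp h1
  have h3 : Tendsto (fun ρ => (ρ ^ k)⁻¹ * F (x, ρ)) (𝓝[>] 0) (𝓝 0) := by
    -- The quotient by `ρ^k` tends to the `k`-th Taylor coefficient, yet it is `O(√ρ)`; the
    -- coefficient is therefore zero.
    have h4 : (fun ρ => (ρ ^ k)⁻¹ * F (x, ρ)) =O[𝓝[>] (0 : ℝ)] fun ρ => √ρ := by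
      refine ((Asymptotics.isBigO_refl (fun ρ : ℝ => (ρ ^ k)⁻¹) _).mul (h x hx)).congr'
        EventuallyEq.rfl ?_
      filter_upwards [self_mem_nhdsWithin] with ρ hρ
      have : (ρ : ℝ) ^ k ≠ 0 := pow_ne_zero k (ne_of_gt hρ)
      field_simp
    exact h4.trans_tendsto hs
  have h5 := tendsto_nhds_unique h2 h3
  exact (div_eq_zero_iff.1 h5).resolve_right (by positivity)

theorem rpow_half_odd (r : ℕ) {ρ : ℝ} (hρ : 0 < ρ) :
    ρ ^ (((2 * r + 1 : ℕ) : ℝ) / 2) = ρ ^ r * √ρ := by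
  rw [Real.sqrt_eq_rpow, ← Real.rpow_natCast, ← Real.rpow_add hρ]
  congr 1
  push_cast
  ring

/-- If `P + ρ^{n/2} Q` vanishes to infinite order, with `n` odd and `P`, `Q` smooth, then so do
`P` and `Q`. -/
theorem vanishesTo_of_isBigO_add {E : Type*} [NormedAddCommGroup E] [NormedSpace ℝ E]
    {M : Set E} (hM : IsOpen M) (hJ : IsOpen J) (h0 : (0 : ℝ) ∈ J) {n : ℕ} (hodd : Odd n)
    {P Q : E × ℝ → ℝ} (hP : ContDiffOn ℝ ∞ P (M ×ˢ J)) (hQ : ContDiffOn ℝ ∞ Q (M ×ˢ J))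
    (h : ∀ x ∈ M, ∀ m : ℕ, (fun ρ => P (x, ρ) + ρ ^ ((n : ℝ) / 2) * Q (x, ρ)) =O[𝓝[>] (0 : ℝ)]
      fun ρ => ρ ^ m) (m : ℕ) : VanishesTo M m P ∧ VanishesTo M m Q := by
  obtain ⟨r, rfl⟩ := hodd
  have h' : ∀ x ∈ M, ∀ m : ℕ, (fun ρ => P (x, ρ) + ρ ^ r * √ρ * Q (x, ρ)) =O[𝓝[>] (0 : ℝ)]
      fun ρ => ρ ^ m := fun x hx m => by
    refine (h x hx m).congr' ?_ EventuallyEq.rfl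
    filter_upwards [self_mem_nhdsWithin] with ρ hρ
    rw [rpow_half_odd r hρ]
  have hsq : (fun ρ : ℝ => ρ) =O[𝓝[>] 0] fun ρ => √ρ := by
    have h1 : (fun ρ : ℝ => √ρ) =O[𝓝[>] 0] fun _ => (1 : ℝ) :=
      ((Real.continuous_sqrt.tendsto 0).mono_left nhdsWithin_le_nhds).isBigO_one ℝ
    refine (h1.mul (Asymptotics.isBigO_refl (fun ρ : ℝ => √ρ) _)).congr' ?_ (by simp)
    filter_upwards [self_mem_nhdsWithin] with ρ hρ
    exact Real.mul_self_sqrt (le_of_lt hρ)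
  -- A zigzag: if `Q` vanishes to order `k`, then `P` is `O(ρ^{k+r+1/2})`, and smoothness promotes
  -- this to order `k + r + 1`. Then `Q` is `O(ρ^{k+1/2})`, which is promoted to order `k + 1`.
  have step1 : ∀ k, VanishesTo M k Q → VanishesTo M (k + r + 1) P := by
    intro k hk
    refine vanishesTo_succ_of_isBigO_half hM hJ h0 hP fun x hx => ?_
    have h1 := (Asymptotics.isBigO_refl (fun ρ : ℝ => ρ ^ r * √ρ) (𝓝[>] 0)).mul
      (isBigO_slice hM hJ h0 hQ hk hx)
    have h2 : (fun ρ : ℝ => ρ ^ (k + r + 1)) =O[𝓝[>] 0] fun ρ => ρ ^ r * √ρ * ρ ^ k :=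
      (((Asymptotics.isBigO_refl (fun ρ : ℝ => ρ ^ (k + r)) (𝓝[>] 0)).mul hsq).congr
        (fun ρ => (pow_succ _ _).symm) fun ρ => by ring)
    exact (((h' x hx (k + r + 1)).trans h2).sub h1).congr (fun ρ => by ring) fun ρ => by ring
  have step2 : ∀ k, VanishesTo M (k + r + 1) P → VanishesTo M (k + 1) Q := by
    intro k hk
    refine vanishesTo_succ_of_isBigO_half hM hJ h0 hQ fun x hx => ?_
    have h1 := (h' x hx (k + r + 1)).sub (isBigO_slice hM hJ h0 hP hk hx)
    have h2 := (Asymptotics.isBigO_refl (fun ρ : ℝ => (ρ ^ r * √ρ)⁻¹) (𝓝[>] 0)).mul h1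
    refine h2.congr' ?_ ?_
    · filter_upwards [self_mem_nhdsWithin] with ρ hρ
      have e1 : (ρ : ℝ) ^ r ≠ 0 := pow_ne_zero r (ne_of_gt hρ)
      have e2 : √ρ ≠ 0 := (Real.sqrt_pos.2 hρ).ne'
      field_simp
      ring
    · filter_upwards [self_mem_nhdsWithin] with ρ hρ
      have e1 : (ρ : ℝ) ^ r ≠ 0 := pow_ne_zero r (ne_of_gt hρ)
      have e2 : √ρ ≠ 0 := (Real.sqrt_pos.2 hρ).ne'
      have e3 : √ρ * √ρ = ρ := Real.mul_self_sqrt (le_of_lt hρ)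
      rw [inv_mul_eq_iff_eq_mul₀ (mul_ne_zero e1 e2)]
      calc ρ ^ (k + r + 1) = ρ ^ k * ρ ^ r * ρ := by ring
        _ = ρ ^ k * ρ ^ r * (√ρ * √ρ) := by rw [e3]
        _ = _ := by ring
  have hQ' : ∀ k, VanishesTo M k Q := by
    intro k
    induction k with
    | zero => exact vanishesTo_zero
    | succ k ih => exact step2 k (step1 k ih)
  exact ⟨(step1 m (hQ' m)).mono (by omega), hQ' m⟩

variable {ε : ℝ} {H : XU n → ℝ} {A B h : XU n → ℝ → ℝ} {M : Set (Idx n → ℝ)}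

theorem ppFamily_initial (hA : IsAmbientMetric M J (ppMetric H) (ppFamily H h)) {w : XU n}
    (hw : w ∈ proj '' M) : h w 0 = 0 := by
  obtain ⟨z, hz, rfl⟩ := hw
  have := congrFun (congrFun (hA.initial z hz) (Sum.inr 0)) (Sum.inr 0)
  rw [ppFamily_eq, ppMetric, ppMatrix_apply, ppMatrix_apply (H (proj z))] at this
  simpa [duCovector] using this

theorem isBigO_waveOp_of_ricciBigO (hn : 3 ≤ n) (hM : IsOpen M) (hε : 0 < ε)
    (hH : ContDiffOn ℝ ∞ H (proj '' M))
    (hh : ContDiffOn ℝ ∞ (fun p : XU n × ℝ => h p.1 p.2) ((proj '' M) ×ˢ Ioo 0 ε)) {m : ℕ}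
    (hR : RicciBigO M (Ioo 0 ε) (ppFamily H h) m) {w : XU n} (hw : w ∈ proj '' M) :
    (fun ρ => waveOp ((n : ℝ) / 2 - 1) (totalCoeff H h) (w, ρ)) =O[𝓝[>] 0] fun ρ => ρ ^ m := by
  obtain ⟨z, hz, rfl⟩ := hw
  have hmem : ∀ᶠ ρ in 𝓝[>] (0 : ℝ), ambientPoint 1 z ρ ∈ ambientDomain M (Ioo 0 ε) := by
    filter_upwards [Ioo_mem_nhdsGT hε] with ρ hρ
    exact ⟨hz, one_pos, hρ⟩
  have hcont : Continuous fun ρ => ambientPoint (ι := Idx n) 1 z ρ := by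
    refine continuous_pi fun i => ?_
    rcases i with i | i
    · exact continuous_const
    · fin_cases i
      · exact continuous_const
      · exact continuous_id
  have h1 : Tendsto (fun ρ => ambientPoint (ι := Idx n) 1 z ρ) (𝓝[>] 0)
      (𝓝[ambientDomain M (Ioo 0 ε)] (ambientPoint 1 z 0)) :=
    tendsto_nhdsWithin_iff.2 ⟨(hcont.tendsto 0).mono_left nhdsWithin_le_nhds, hmem⟩
  have h2 := (hR z hz 1 one_pos (Sum.inl (Sum.inr 0)) (Sum.inl (Sum.inr 0))).comp_tendsto h1
  refine h2.congr' ?_ EventuallyEq.rfl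
  filter_upwards [hmem] with ρ hρ
  exact ricci_ppFamily_uu hn hM isOpen_Ioo hH hh hρ

theorem isPower_rpow_dim (hn : 3 ≤ n) (ε : ℝ) :
    IsPower ((n : ℝ) / 2) (Ioo 0 ε) fun ρ => ρ ^ ((n : ℝ) / 2) :=
  isPower_rpow (by positivity) fun _ hρ => hρ.1

/-- The smooth functions `A`, `B` in an ambient metric `g + (A + ρ^{n/2} B) du²` in odd dimension
have the Taylor series `a` and `b_f`. -/
theorem hasTaylorSeries_of_isAmbientMetric (hn : 3 ≤ n) (hodd : Odd n) (hM : IsOpen M)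
    (hε : 0 < ε) (hH : ContDiffOn ℝ ∞ H (proj '' M))
    (hA : ContDiffOn ℝ ∞ (fun p : XU n × ℝ => A p.1 p.2) ((proj '' M) ×ˢ Ioo (-ε) ε))
    (hB : ContDiffOn ℝ ∞ (fun p : XU n × ℝ => B p.1 p.2) ((proj '' M) ×ˢ Ioo (-ε) ε))
    (hh : IsAmbientMetric M (Ioo 0 ε) (ppMetric H)
      (ppFamily H fun w ρ => A w ρ + ρ ^ ((n : ℝ) / 2) * B w ρ)) :
    HasTaylorSeries (proj '' M) (Ioo (-ε) ε) (hCoeff H) A ∧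
      HasTaylorSeries (proj '' M) (Ioo (-ε) ε) (fCoeff fun w => B w 0) B := by
  have hΩ := isOpen_image_proj hM
  have h0 : (0 : ℝ) ∈ Ioo (-ε) ε := ⟨by linarith, hε⟩
  have hU : IsOpen ((proj '' M) ×ˢ Ioo (-ε) ε) := hΩ.prod isOpen_Ioo
  have hsub' : Ioo 0 ε ⊆ Ioo (-ε) ε := Ioo_subset_Ioo_left (by linarith)
  have hsub : (proj '' M) ×ˢ Ioo 0 ε ⊆ (proj '' M) ×ˢ Ioo (-ε) ε := prod_mono subset_rfl hsub'
  have hα := isPower_rpow_dim hn ε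
  have hF := contDiffOn_totalCoeff hH hA
  -- The metric is controlled for `ρ > 0` only, but the operators applied to `A` and `B` are smooth
  -- across `ρ = 0`, so the one-sided estimate determines their jets.
  have hv := vanishesTo_of_isBigO_add hΩ isOpen_Ioo h0 hodd
    (ContDiffOn.waveOp hU hF ((n : ℝ) / 2 - 1)) (ContDiffOn.waveOp hU hB (-((n : ℝ) / 2 + 1)))
    fun w hw m => by
      have h1 := isBigO_waveOp_of_ricciBigO hn hM hε hH
        (contDiffOn_combine hα (hA.mono hsub) (hB.mono hsub))
        (hh.ricci_odd (by rwa [card_idx hn]) m) hw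
      refine h1.congr' ?_ EventuallyEq.rfl
      filter_upwards [Ioo_mem_nhdsGT hε] with ρ hρ
      exact waveOp_combine hΩ isOpen_Ioo hH hα (hA.mono hsub) (hB.mono hsub)
        (mk_mem_prod hw hρ : (w, ρ) ∈ (proj '' M) ×ˢ Ioo 0 ε)
  have hAz : ∀ w ∈ proj '' M, A w 0 = 0 := fun w hw => by
    have := ppFamily_initial hh hw
    rwa [Real.zero_rpow (by positivity), zero_mul, add_zero] at this
  have hf : ContDiffOn ℝ ∞ (fun w => B w 0) (proj '' M) :=
    hB.comp (contDiff_prodMk_left (0 : ℝ)).contDiffOn fun w hw => mk_mem_prod hw h0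
  obtain ⟨r, hr⟩ := hodd
  constructor
  · refine hasTaylorSeries_of_dr_iterate hΩ isOpen_Ioo h0 hA fun w hw k => ?_
    have h1 := dr_iterate_eq_of_vanishesTo hΩ isOpen_Ioo h0 hF (contDiffOn_totalSeries hΩ hH)
      (hv k).1 (fun w hw => by simp [totalCoeff, totalSeries, hCoeff, hAz w hw])
      (fun k _ => Or.inl ⟨fun he => ?_, fun w hw => ?_⟩) k le_rfl w hw
    · rw [dr_iterate_totalCoeff hΩ isOpen_Ioo hH hA k (mk_mem_prod hw h0), totalSeries,
        mul_add] at h1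
      rcases k with _ | k <;> simpa using h1
    -- The resonance `k + 1 = n/2` would make `n` even.
    · have : ((2 * k + 2 : ℕ) : ℝ) = (n : ℝ) := by push_cast; linarith
      have : 2 * k + 2 = n := by exact_mod_cast this
      omega
    · rw [waveCoeff_totalSeries hn hΩ hH k hw, if_neg (by omega)]
  · refine hasTaylorSeries_of_dr_iterate hΩ isOpen_Ioo h0 hB fun w hw k => ?_
    refine dr_iterate_eq_of_vanishesTo hΩ isOpen_Ioo h0 hB (contDiffOn_fCoeff hΩ hf)
      (hv k).2 (fun w hw => by simp [fCoeff])
      (fun k _ => Or.inl ⟨fun he => ?_, fun w hw => waveCoeff_fCoeff hΩ hf k hw⟩) k le_rfl w hw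
    have : (0 : ℝ) ≤ k := Nat.cast_nonneg k
    have : (0 : ℝ) ≤ n := Nat.cast_nonneg n
    linarith

end HalfInteger

/-! ### The obstruction tensor -/

section Obstruction

variable {n : ℕ} {J : Set ℝ} {ε κ : ℝ} {H : XU n → ℝ} {A B h : XU n → ℝ → ℝ}
  {M : Set (Idx n → ℝ)}

theorem duSq_apply (a : ℝ) (i j : Idx n) : duSq n a i j = a * (duCovector n i * duCovector n j) := by
  rcases i with i | i <;> rcases j with j | j
  · simp [duSq, duCovector]
  · simp [duSq, duCovector]
  · simp [duSq, duCovector]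
  · fin_cases i <;> fin_cases j <;> simp [duSq, duCovector]

theorem dr_iterate_comp_projRho (hM : IsOpen M) (hJ : IsOpen J) {F : XU n × ℝ → ℝ}
    (hF : ContDiffOn ℝ ∞ F ((proj '' M) ×ˢ J)) (k : ℕ) :
    EqOn (dr^[k] fun p => F (projRho p)) (fun p => dr^[k] F (projRho p)) (M ×ˢ J) := by
  have hU := (isOpen_image_proj hM).prod hJ
  have e0 : projRho ((0 : Idx n → ℝ), (1 : ℝ)) = (0, 1) :=
    Prod.ext (map_zero (projL (n := n))) rfl
  induction k generalizing F with
  | zero => exact fun _ _ => rfl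
  | succ k ih =>
    have h1 : EqOn (dr fun p => F (projRho p)) (fun p => dr F (projRho p)) (M ×ˢ J) := fun p hp => by
      have := dirD_comp_clm ((0 : Idx n → ℝ), (1 : ℝ)) projRho
        (ContDiffOn.differentiableAt_of_isOpen hF hU (mapsTo_projRho hp))
      rwa [e0] at this
    exact (dr_iterate_congr (hM.prod hJ) h1 k).trans (ih (ContDiffOn.dr hF hU))

/-- Makes the limits defining the obstruction tensor unique. -/
theorem neBot_ambientDomain (hε : 0 < ε) {ι : Type*} [Fintype ι] [DecidableEq ι] {M : Set (ι → ℝ)}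
    {t : ℝ} (ht : 0 < t) {x : ι → ℝ} (hx : x ∈ M) :
    (𝓝[ambientDomain M (Ioo (-ε) ε \ {0})] (ambientPoint t x 0)).NeBot := by
  have h1 := tendsto_ambientPoint (M := M) isOpen_Ioo
    (⟨by linarith, hε⟩ : (0 : ℝ) ∈ Ioo (-ε) ε) ht hx
  have h2 := tendsto_nhdsWithin_iff.1 h1
  have h3 : Tendsto (ambientPoint t x) (𝓝[>] 0)
      (𝓝[ambientDomain M (Ioo (-ε) ε \ {0})] (ambientPoint t x 0)) := by
    refine tendsto_nhdsWithin_iff.2 ⟨h2.1, ?_⟩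
    filter_upwards [h2.2, self_mem_nhdsWithin] with ρ hρ hρ'
    exact ⟨hρ.1, hρ.2.1, hρ.2.2, (ne_of_gt hρ' : ρ ≠ 0)⟩
  exact h3.neBot

theorem ricciTan_ppFamily (hn : 3 ≤ n) (hM : IsOpen M) (hJ : IsOpen J)
    (hH : ContDiffOn ℝ ∞ H (proj '' M))
    (hh : ContDiffOn ℝ ∞ (fun p : XU n × ℝ => h p.1 p.2) ((proj '' M) ×ˢ J)) (i j : Idx n) :
    EqOn (ricciTan (ppFamily H h) i j) (fun p => duCovector n i * duCovector n j *
      waveOp ((n : ℝ) / 2 - 1) (totalCoeff H h) (projRho p)) (M ×ˢ J) := by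
  intro p hp
  have hy : ambientPoint 1 p.1 p.2 ∈ ambientDomain M J := ⟨hp.1, one_pos, hp.2⟩
  exact ((isPPFamily hM hJ hH hh).regular.ricci_eq_ricciTan i j hy).symm.trans
    (ricci_ppFamily hn hM hJ hH hh hy (Sum.inl i) (Sum.inl j))

theorem dr_iterate_ricciTan_ppFamily (hn : 3 ≤ n) (hev : Even n) (hM : IsOpen M) (hε : 0 < ε)
    (hH : ContDiffOn ℝ ∞ H (proj '' M))
    (hA : HasTaylorSeries (proj '' M) (Ioo (-ε) ε) (hCoeff H) A) (i j : Idx n) {x : Idx n → ℝ}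
    (hx : x ∈ M) : dr^[n / 2 - 1] (ricciTan (ppFamily H A) i j) (x, 0) =
      (n / 2 - 1).factorial * (obstructionConst n * (lap^[n / 2] H) (proj x) *
        (duCovector n i * duCovector n j)) := by
  have hΩ := isOpen_image_proj hM
  have h0 : (0 : ℝ) ∈ Ioo (-ε) ε := ⟨by linarith, hε⟩
  have hp : (x, (0 : ℝ)) ∈ M ×ˢ Ioo (-ε) ε := mk_mem_prod hx h0
  have hF := contDiffOn_totalCoeff hH hA.1
  have hW := ContDiffOn.waveOp (hΩ.prod isOpen_Ioo) hF ((n : ℝ) / 2 - 1)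
  obtain ⟨r, hr⟩ := hev
  rw [dr_iterate_congr (hM.prod isOpen_Ioo) (ricciTan_ppFamily hn hM isOpen_Ioo hH hA.1 i j) _ hp,
    dr_iterate_const_mul (F := fun p => waveOp ((n : ℝ) / 2 - 1) (totalCoeff H A) (projRho p))
      (hM.prod isOpen_Ioo) (hW.comp projRho.contDiff.contDiffOn mapsTo_projRho) _ _ hp,
    dr_iterate_comp_projRho hM isOpen_Ioo hW (n / 2 - 1) hp]
  have h1 := dr_iterate_waveOp_of_taylor hΩ isOpen_Ioo h0 hF (contDiffOn_totalSeries hΩ hH)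
    (dr_iterate_totalCoeff_hCoeff hΩ isOpen_Ioo h0 hH hA) ((n : ℝ) / 2 - 1) (n / 2 - 1)
    (mem_image_of_mem _ hx)
  rw [waveCoeff_totalSeries hn hΩ hH _ (mem_image_of_mem _ hx), if_pos (by omega)] at h1
  change _ * dr^[n / 2 - 1] (waveOp ((n : ℝ) / 2 - 1) (totalCoeff H A)) (proj x, 0) = _
  rw [h1]
  ring

/-- The limit is a jet that is the same for all ambient metrics (`ricciTan_jet_eq`), so it can be
evaluated on a realisation of `a`. -/
theorem tendsto_ricci_of_even (hn : 3 ≤ n) (hev : Even n) (hM : IsOpen M) (hε : 0 < ε)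
    (hH : ContDiffOn ℝ ∞ H (proj '' M)) {γ : (Idx n → ℝ) → ℝ → Matrix (Idx n) (Idx n) ℝ}
    (h : IsAmbientMetric M (Ioo (-ε) ε) (ppMetric H) γ) (κ : ℝ) {x : Idx n → ℝ} (hx : x ∈ M) (t : ℝ)
    (i j : Idx n) :
    Tendsto (fun y => κ * ((rhoCoord y ^ (Fintype.card (Idx n) / 2 - 1))⁻¹ *
      ricci (ambientMetric γ) (Sum.inl i) (Sum.inl j) y))
      (𝓝[ambientDomain M (Ioo (-ε) ε \ {0})] (ambientPoint t x 0))
      (𝓝 (κ * (obstructionConst n * (lap^[n / 2] H) (proj x) *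
        (duCovector n i * duCovector n j)))) := by
  have h0 : (0 : ℝ) ∈ Ioo (-ε) ε := ⟨by linarith, hε⟩
  have hcard := card_idx hn
  have hreg := h.regular hM isOpen_Ioo
  obtain ⟨A, hA⟩ := exists_hasTaylorSeries (isOpen_image_proj hM)
    (contDiffOn_hCoeff (isOpen_image_proj hM) hH)
  replace hA := hA.mono (subset_univ (Ioo (-ε) ε))
  have hjet := h.ricciTan_jet_eq (isAmbientMetric_of_hasTaylorSeries hn hM hε hH hA) hM isOpen_Ioo h0
    (by rwa [hcard]) (by omega) i j hx
  rw [hcard, dr_iterate_ricciTan_ppFamily hn hev hM hε hH hA i j hx] at hjet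
  have hv : VanishesTo M (n / 2 - 1) (ricciTan γ i j) := by
    have := (h.ricci_even (by rwa [hcard])).vanishesTo hM isOpen_Ioo h0 (hreg.ricciTan i j)
      fun y hy => hreg.ricci_eq_ricciTan i j hy
    rwa [hcard] at this
  have hlim := VanishesTo.tendsto_div hM isOpen_Ioo h0 (hreg.ricciTan i j) hv hx
  rw [hjet, mul_div_cancel_left₀ _ (by positivity)] at hlim
  have hproj : Tendsto ambientProj (𝓝[ambientDomain M (Ioo (-ε) ε \ {0})] (ambientPoint t x 0))
      (𝓝[{p | p.2 ≠ 0}] (x, 0)) := by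
    refine tendsto_nhdsWithin_iff.2 ⟨tendsto_ambientProj t x _, ?_⟩
    filter_upwards [self_mem_nhdsWithin] with y hy
    exact hy.2.2.2
  refine ((hlim.comp hproj).const_mul κ).congr' ?_
  filter_upwards [self_mem_nhdsWithin] with y hy
  have hy' : y ∈ ambientDomain M (Ioo (-ε) ε) := ⟨hy.1, hy.2.1, hy.2.2.1⟩
  rw [hreg.ricci_eq_ricciTan i j hy', hcard]
  rfl

theorem isObstructionTensor_ppMetric (hn : 3 ≤ n) (hev : Even n) (hM : IsOpen M)
    (hH : ContDiffOn ℝ ∞ H (proj '' M)) (κ : ℝ) :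
    IsObstructionTensor κ M (ppMetric H)
      (fun z => duSq n (κ * obstructionConst n * (lap^[n / 2] H) (proj z))) := by
  constructor
  · obtain ⟨A, hA⟩ := exists_hasTaylorSeries (isOpen_image_proj hM)
      (contDiffOn_hCoeff (isOpen_image_proj hM) hH)
    exact ⟨1, one_pos, _, isAmbientMetric_of_hasTaylorSeries hn hM one_pos hH
      (hA.mono (subset_univ _))⟩
  · intro ε hε γ hγ x hx t _ i j
    refine (tendsto_ricci_of_even hn hev hM hε hH hγ κ hx t i j).mono_right
      (le_of_eq (congrArg 𝓝 ?_))
    change _ = duSq n (κ * obstructionConst n * (lap^[n / 2] H) (proj x)) i j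
    rw [duSq_apply]
    ring

/-- The existence clause of the definition supplies an ambient metric, whose limit in the component
`uu` is a nonzero multiple of `Δ^{n/2} H`. -/
theorem lap_iterate_eq_zero_of_isObstructionTensor (hn : 3 ≤ n) (hev : Even n) (hM : IsOpen M)
    (hH : ContDiffOn ℝ ∞ H (proj '' M)) (hκ : κ ≠ 0)
    (h : IsObstructionTensor κ M (ppMetric H) 0) : ∀ w ∈ proj '' M, (lap^[n / 2] H) w = 0 := by
  rintro w ⟨z, hz, rfl⟩
  obtain ⟨⟨ε, hε, γ, hγ⟩, hlim⟩ := h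
  have := neBot_ambientDomain hε one_pos hz
  have h1 := tendsto_nhds_unique (hlim ε hε γ hγ z hz 1 one_pos (Sum.inr 0) (Sum.inr 0))
    (tendsto_ricci_of_even hn hev hM hε hH hγ κ hz 1 (Sum.inr 0) (Sum.inr 0))
  have h2 : (0 : ℝ) = κ * (obstructionConst n * (lap^[n / 2] H) (proj z) * (1 * 1)) := h1
  have h3 := obstructionConst_ne_zero hn
  simpa [hκ, h3] using h2.symm

theorem isObstructionTensor_zero (hn : 3 ≤ n) (hev : Even n) (hM : IsOpen M)
    (hH : ContDiffOn ℝ ∞ H (proj '' M)) (κ : ℝ)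
    (h : ∀ w ∈ proj '' M, (lap^[n / 2] H) w = 0) : IsObstructionTensor κ M (ppMetric H) 0 := by
  obtain ⟨h1, h2⟩ := isObstructionTensor_ppMetric hn hev hM hH κ
  refine ⟨h1, fun ε hε γ hγ x hx t ht i j => ?_⟩
  refine (h2 ε hε γ hγ x hx t ht i j).mono_right (le_of_eq (congrArg 𝓝 ?_))
  change duSq n (κ * obstructionConst n * (lap^[n / 2] H) (proj x)) i j = 0
  rw [duSq_apply, h _ (mem_image_of_mem _ hx), mul_zero, zero_mul]

/-! ### Ricci-flat analytic solutions in even dimension -/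

theorem component_ppFamily (z : Idx n → ℝ) (ρ : ℝ) :
    ppFamily H h z ρ (Sum.inr 0) (Sum.inr 0) = H (proj z) + h (proj z) ρ := by
  rw [ppFamily_eq, ppMatrix_apply]
  simp [duCovector, ppMatrix]

/-- Smoothness is given for the matrix entries on `M`. It descends to `(x, u)` along the section of
`proj` with the value of `v` frozen at a chosen point of the fibre. -/
theorem contDiffOn_of_isAmbientMetric (hM : IsOpen M) (hH : ContDiffOn ℝ ∞ H (proj '' M))
    (hJ : IsOpen J) (hh : IsAmbientMetric M J (ppMetric H) (ppFamily H h)) :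
    ContDiffOn ℝ ∞ (fun p : XU n × ℝ => h p.1 p.2) ((proj '' M) ×ˢ J) := by
  rintro ⟨w, ρ⟩ ⟨⟨z, hz, hzw⟩, hρ⟩
  simp only at hzw hρ
  subst hzw
  set v := z (Sum.inr 1)
  let L : XU n × ℝ → (Idx n → ℝ) × ℝ := fun p => (lift v p.1, p.2)
  let G : (Idx n → ℝ) × ℝ → ℝ := fun p => ppFamily H h p.1 p.2 (Sum.inr 0) (Sum.inr 0)
  have hl : ContDiff ℝ ∞ L := ((contDiff_lift v).comp contDiff_fst).prodMk contDiff_snd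
  have hz' : L (proj z, ρ) = (z, ρ) := Prod.ext (lift_proj z) rfl
  have hG : ContDiffAt ℝ ∞ G (L (proj z, ρ)) := by
    rw [hz']
    exact (hh.smooth (Sum.inr 0) (Sum.inr 0)).contDiffAt ((hM.prod hJ).mem_nhds ⟨hz, hρ⟩)
  have h1 : ContDiffAt ℝ ∞ (G ∘ L) (proj z, ρ) := hG.comp (proj z, ρ) hl.contDiffAt
  have h2 : ContDiffAt ℝ ∞ (fun p : XU n × ℝ => H p.1) (proj z, ρ) :=
    ContDiffAt.comp (g := H) (f := Prod.fst) (proj z, ρ) (hH.contDiffAt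
      ((isOpen_image_proj hM).mem_nhds (mem_image_of_mem _ hz))) contDiffAt_fst
  refine ((h1.sub h2).congr_of_eventuallyEq (Eventually.of_forall fun p => ?_)).contDiffWithinAt
  have h3 : G (L p) = H p.1 + h p.1 p.2 := component_ppFamily (lift v p.1) p.2
  change h p.1 p.2 = G (L p) - H p.1
  rw [h3]
  ring

theorem waveOp_eq_zero_of_ricciFlat (hn : 3 ≤ n) (hM : IsOpen M) (hJ : IsOpen J)
    (hH : ContDiffOn ℝ ∞ H (proj '' M))
    (hh : ContDiffOn ℝ ∞ (fun p : XU n × ℝ => h p.1 p.2) ((proj '' M) ×ˢ J))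
    (hR : RicciFlat M J (ppFamily H h)) :
    EqOn (waveOp ((n : ℝ) / 2 - 1) (totalCoeff H h)) (fun _ => 0) ((proj '' M) ×ˢ J) := by
  rintro ⟨w, ρ⟩ ⟨⟨z, hz, hzw⟩, hρ⟩
  simp only at hzw hρ
  subst hzw
  have hy : ambientPoint 1 z ρ ∈ ambientDomain M J := ⟨hz, one_pos, hρ⟩
  exact (ricci_ppFamily_uu hn hM hJ hH hh hy).symm.trans (hR _ hy _ _)

theorem analyticAt_of_analyticInRho (ha : AnalyticInRho M J (ppFamily H h)) (h0 : (0 : ℝ) ∈ J)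
    {w : XU n} (hw : w ∈ proj '' M) : AnalyticAt ℝ (h w) 0 := by
  obtain ⟨z, hz, rfl⟩ := hw
  have h1 := (ha z hz (Sum.inr 0) (Sum.inr 0) 0 h0).sub
    (analyticAt_const (v := H (proj z)))
  refine h1.congr (Eventually.of_forall fun ρ => ?_)
  simp only [Pi.sub_apply, component_ppFamily]
  ring

/-- The Taylor coefficients of `H + a + ρ^{n/2} b_f` for `n` even. -/
def evenSeries (H f : XU n → ℝ) (k : ℕ) (w : XU n) : ℝ :=
  if k < n / 2 then totalSeries H k w else fCoeff f (k - n / 2) w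

theorem contDiffOn_evenSeries {Ω : Set (XU n)} (hΩ : IsOpen Ω) {f : XU n → ℝ}
    (hH : ContDiffOn ℝ ∞ H Ω) (hf : ContDiffOn ℝ ∞ f Ω) (k : ℕ) :
    ContDiffOn ℝ ∞ (evenSeries H f k) Ω := by
  unfold evenSeries
  split_ifs
  · exact contDiffOn_totalSeries hΩ hH k
  · exact contDiffOn_fCoeff hΩ hf _

/-- All jets of the equation vanish. Below order `n/2` they force the coefficients of `a`; at the
resonance they leave only the condition on `Δ^{n/2} H`; beyond it they are the recurrence of `b_f`,
shifted by `n/2`. -/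
theorem exists_taylor_of_ricciFlat_of_even (hn : 3 ≤ n) (hev : Even n) (hM : IsOpen M) (hε : 0 < ε)
    (hH : ContDiffOn ℝ ∞ H (proj '' M))
    (hh : IsAmbientMetric M (Ioo (-ε) ε) (ppMetric H) (ppFamily H h))
    (hR : RicciFlat M (Ioo (-ε) ε) (ppFamily H h)) :
    (∀ w ∈ proj '' M, (lap^[n / 2] H) w = 0) ∧
      ∃ f : XU n → ℝ, ContDiffOn ℝ ∞ f (proj '' M) ∧ ∀ w ∈ proj '' M, ∀ k : ℕ,
        iteratedDeriv k (h w) 0 = k.factorial *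
          (if k < n / 2 then hCoeff H k w else fCoeff f (k - n / 2) w) := by
  have hΩ := isOpen_image_proj hM
  have h0 : (0 : ℝ) ∈ Ioo (-ε) ε := ⟨by linarith, hε⟩
  have hU : IsOpen ((proj '' M) ×ˢ Ioo (-ε) ε) := hΩ.prod isOpen_Ioo
  have hsm := contDiffOn_of_isAmbientMetric hM hH isOpen_Ioo hh
  have hF := contDiffOn_totalCoeff hH hsm
  have hv : ∀ m, VanishesTo (proj '' M) m (waveOp ((n : ℝ) / 2 - 1) (totalCoeff H h)) := by
    intro m k _ w hw
    rw [dr_iterate_congr hU (waveOp_eq_zero_of_ricciFlat hn hM isOpen_Ioo hH hsm hR) k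
      (mk_mem_prod hw h0)]
    rcases k with _ | k
    · rfl
    · have := dr_iterate_fst (H := fun _ : XU n => (0 : ℝ)) hΩ isOpen_Ioo contDiffOn_const (k + 1)
        (mk_mem_prod hw h0)
      simpa using this
  obtain ⟨r, hr⟩ := hev
  have hr2 : n / 2 = r := by omega
  have hnr : (n : ℝ) / 2 = r := by rw [hr]; push_cast; ring
  have hinit : ∀ w ∈ proj '' M, totalCoeff H h (w, 0) = totalSeries H 0 w := fun w hw => by
    simp [totalCoeff, totalSeries, hCoeff, ppFamily_initial hh hw]
  have hlow := dr_iterate_eq_of_vanishesTo hΩ isOpen_Ioo h0 hF (contDiffOn_totalSeries hΩ hH)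
    (hv (r - 1)) hinit fun k hk => Or.inl ⟨fun he => by
      rw [hnr] at he
      have : k + 1 = r := by exact_mod_cast (by linarith : (k : ℝ) + 1 = r)
      omega, fun w hw => by rw [waveCoeff_totalSeries hn hΩ hH k hw, if_neg (by omega)]⟩
  -- In the jet of order `r - 1` the factor of the unknown coefficient is zero, so the equation
  -- reduces to `-½Δ` of the coefficient before it, a nonzero multiple of `Δ^r H`.
  have hobs : ∀ w ∈ proj '' M, (lap^[n / 2] H) w = 0 := by
    intro w hw
    have h1 := hv r (r - 1) (by omega) w hw
    have h2 : EqOn (fun w => dr^[r - 1] (totalCoeff H h) (w, 0))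
      (fun w => ((r - 1).factorial : ℝ) * totalSeries H (r - 1) w) (proj '' M) :=
      fun w hw => hlow (r - 1) le_rfl w hw
    have h4 := waveCoeff_totalSeries hn hΩ hH (r - 1) hw
    have hz : ((r - 1 : ℕ) : ℝ) - ((n : ℝ) / 2 - 1) = 0 := by
      rw [hnr, Nat.cast_sub (by omega)]
      push_cast
      ring
    rw [if_pos (by omega), waveCoeff, hz, mul_zero, zero_mul, zero_sub] at h4
    rw [dr_iterate_waveOp hΩ isOpen_Ioo h0 hF _ (r - 1) hw, hz, lap_congr hΩ h2 hw,
      lap_const_mul hΩ (contDiffOn_totalSeries hΩ hH _) _ hw] at h1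
    have h5 : ((r - 1).factorial : ℝ) * (obstructionConst n * (lap^[n / 2] H) w) = 0 := by
      rw [← h4]; linear_combination h1
    have h6 := obstructionConst_ne_zero hn
    have h7 : ((r - 1).factorial : ℝ) ≠ 0 := by positivity
    simpa [h6, h7] using h5
  -- The coefficient of `ρ^{n/2}` is not constrained by any jet, and it serves as `f`.
  refine ⟨hobs, fun w => dr^[r] (totalCoeff H h) (w, 0) / r.factorial, ?_, ?_⟩
  · exact ((ContDiffOn.dr_iterate hF hU r).comp (contDiff_prodMk_left (0 : ℝ)).contDiffOn
      fun w hw => mk_mem_prod hw h0).div_const _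
  · set f : XU n → ℝ := fun w => dr^[r] (totalCoeff H h) (w, 0) / r.factorial with hf
    have hfs : ContDiffOn ℝ ∞ f (proj '' M) :=
      ((ContDiffOn.dr_iterate hF hU r).comp (contDiff_prodMk_left (0 : ℝ)).contDiffOn
        fun w hw => mk_mem_prod hw h0).div_const _
    intro w hw k
    have hall := dr_iterate_eq_of_vanishesTo hΩ isOpen_Ioo h0 hF (contDiffOn_evenSeries hΩ hH hfs)
      (hv k) (fun w hw => by rw [hinit w hw, evenSeries, if_pos (by omega)]) (fun j hj => by
        rcases lt_trichotomy (j + 1) r with hlt | heq | hgt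
        · refine Or.inr fun w hw => ?_
          rw [hlow (j + 1) (by omega) w hw, evenSeries, if_pos (by omega)]
        · refine Or.inr fun w hw => ?_
          rw [heq, evenSeries, if_neg (by omega), hr2, Nat.sub_self, hf]
          have : (r.factorial : ℝ) ≠ 0 := by positivity
          simp [fCoeff]
          field_simp
        · refine Or.inl ⟨fun he => ?_, fun w hw => ?_⟩
          · rw [hnr] at he
            have : j + 1 = r := by exact_mod_cast (by linarith : (j : ℝ) + 1 = r)
            omega
          · have h1 := waveCoeff_fCoeff hΩ hfs (j - r) hw
            have e1 : evenSeries H f j = fCoeff f (j - r) := funext fun w => by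
              rw [evenSeries, if_neg (by omega), hr2]
            have e2 : evenSeries H f (j + 1) w = fCoeff f (j - r + 1) w := by
              rw [evenSeries, if_neg (by omega), hr2, Nat.sub_add_comm (by omega)]
            rw [waveCoeff, hnr, Nat.cast_sub (by omega)] at h1
            rw [waveCoeff, e1, e2, hnr]
            linear_combination h1) k le_rfl w hw
    rw [dr_iterate_totalCoeff hΩ isOpen_Ioo hH hsm k (mk_mem_prod hw h0),
      dr_iterate_eq_iteratedDeriv hΩ isOpen_Ioo hsm k hw 0 h0] at hall
    rcases k with _ | k
    · simp only [iteratedDeriv_zero, if_true, evenSeries, totalSeries] at hall ⊢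
      rw [if_pos (by omega)] at hall ⊢
      linear_combination hall
    · rw [if_neg k.succ_ne_zero, zero_add, evenSeries] at hall
      rw [hall]
      simp only [totalSeries, if_neg k.succ_ne_zero, zero_add]

theorem hasSum_of_ricciFlat_of_even (hn : 3 ≤ n) (hev : Even n) (hM : IsOpen M) (hε : 0 < ε)
    (hH : ContDiffOn ℝ ∞ H (proj '' M))
    (hh : IsAmbientMetric M (Ioo (-ε) ε) (ppMetric H) (ppFamily H h))
    (ha : AnalyticInRho M (Ioo (-ε) ε) (ppFamily H h))
    (hR : RicciFlat M (Ioo (-ε) ε) (ppFamily H h)) :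
    (∀ w ∈ proj '' M, (lap^[n / 2] H) w = 0) ∧
      ∃ f : XU n → ℝ, ContDiffOn ℝ ∞ f (proj '' M) ∧ ∀ w ∈ proj '' M, ∀ᶠ ρ in 𝓝 (0 : ℝ),
        HasSum (fun k : ℕ => hCoeff H k w * ρ ^ k + fCoeff f k w * ρ ^ (n / 2 + k)) (h w ρ) := by
  obtain ⟨hobs, f, hf, hT⟩ := exists_taylor_of_ricciFlat_of_even hn hev hM hε hH hh hR
  refine ⟨hobs, f, hf, fun w hw => ?_⟩
  have h0 : (0 : ℝ) ∈ Ioo (-ε) ε := ⟨by linarith, hε⟩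
  filter_upwards [AnalyticAt.hasSum_taylor (analyticAt_of_analyticInRho ha h0 hw)] with ρ hρ
  have h1 : HasSum (fun k : ℕ => (if k < n / 2 then hCoeff H k w else fCoeff f (k - n / 2) w) *
      ρ ^ k) (h w ρ) := by
    refine hρ.congr_fun fun k => ?_
    rw [hT w hw k]
    field_simp
  have h2 : HasSum (fun k : ℕ => hCoeff H k w * ρ ^ k)
      (∑ k ∈ Finset.range (n / 2), hCoeff H k w * ρ ^ k) :=
    hasSum_sum_of_ne_finset_zero fun k hk => by
      rw [hCoeff, if_pos (Or.inr ⟨hev, by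
          obtain ⟨r, hr⟩ := hev
          have := Finset.mem_range.not.1 hk
          omega⟩), zero_mul]
  -- The first `n/2` terms are the polynomial `a`; the tail, reindexed from `n/2`, is the series of
  -- `b_f`.
  have h3 := (hasSum_nat_add_iff' (n / 2)).2 h1
  have h4 : ∑ k ∈ Finset.range (n / 2), (if k < n / 2 then hCoeff H k w
      else fCoeff f (k - n / 2) w) * ρ ^ k = ∑ k ∈ Finset.range (n / 2), hCoeff H k w * ρ ^ k :=
    Finset.sum_congr rfl fun k hk => by rw [if_pos (Finset.mem_range.1 hk)]
  rw [h4] at h3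
  have h5 := h2.add h3
  rw [add_sub_cancel] at h5
  refine h5.congr_fun fun k => ?_
  rw [if_neg (by omega), Nat.add_sub_cancel, add_comm k]

end Obstruction

/-! ### Solutions with logarithms -/

section Logarithm

variable {n : ℕ} {Ω : Set (XU n)} {ε : ℝ}

theorem logShift_succ (n k : ℕ) : logShift n (k + 1) = logShift n k +
    ((n : ℝ) + 4 * ((k : ℝ) + 1)) / (((k : ℝ) + 1) * ((n : ℝ) + 2 * ((k : ℝ) + 1))) := by
  rw [logShift, Finset.sum_Icc_succ_top (by omega), logShift]
  push_cast
  rfl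

/-- Each summand equals `1/i + 2/(n + 2i)` and is at most `2`. Linear growth is what
`SeriesBound.scale` tolerates. -/
theorem abs_logShift_le (n k : ℕ) : |logShift n k| ≤ 2 * ((k : ℝ) + 1) := by
  have h : 0 ≤ logShift n k ∧ logShift n k ≤ 2 * k := by
    induction k with
    | zero => simp [logShift]
    | succ k ih =>
      have h1 : 0 ≤ ((n : ℝ) + 4 * ((k : ℝ) + 1)) / (((k : ℝ) + 1) * ((n : ℝ) + 2 * ((k : ℝ) + 1))) :=
        by positivity
      have h2 : ((n : ℝ) + 4 * ((k : ℝ) + 1)) / (((k : ℝ) + 1) * ((n : ℝ) + 2 * ((k : ℝ) + 1))) ≤ 2 := by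
        rw [div_le_iff₀ (by positivity)]
        have hk : (0 : ℝ) ≤ k := Nat.cast_nonneg k
        have hn : (0 : ℝ) ≤ n := Nat.cast_nonneg n
        nlinarith [mul_nonneg hk hn, mul_nonneg hk hk]
      rw [logShift_succ]
      push_cast
      exact ⟨by linarith [ih.1], by linarith [ih.2]⟩
  rw [abs_of_nonneg h.1]
  linarith [h.2]

/-- The product in `logConst` starts at `i = 0` and so has the extra factor `-n`. The identity says
that the logarithmic term cancels the obstruction. -/
theorem logConst_mul (hn : 3 ≤ n) (hev : Even n) :
    logConst n * ((n : ℝ) / 2) = -obstructionConst n := by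
  obtain ⟨r, hr⟩ := hev
  have hr2 : n / 2 = r := by omega
  obtain ⟨m, rfl⟩ : ∃ m, r = m + 1 := ⟨r - 1, by omega⟩
  have h1 : ∏ i ∈ Finset.range (m + 1), (2 * (i : ℝ) - n) =
      (∏ i ∈ Finset.Icc 1 m, (2 * (i : ℝ) - n)) * (-n) := by
    rw [Finset.prod_range_succ', Finset.range_eq_Ico, Finset.prod_Ico_add' (fun i : ℕ =>
      2 * (i : ℝ) - n) 0 m 1]
    simp [Finset.Ico_add_one_right_eq_Icc]
  have h2 : ∏ i ∈ Finset.Icc 1 m, (2 * (i : ℝ) - n) ≠ 0 := prod_sub_ne_zero (by omega)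
  have h3 : (n : ℝ) ≠ 0 := by positivity
  rw [logConst, obstructionConst, hr2, Nat.add_sub_cancel, h1]
  field_simp

/-- The coefficients `q_k b_k`. -/
def shiftedCoeff (f : XU n → ℝ) (k : ℕ) (w : XU n) : ℝ := logShift n k • fCoeff f k w

theorem seriesBound_shiftedCoeff (hΩ : IsOpen Ω) {f : XU n → ℝ}
    (h : SeriesBound Ω ε (fCoeff f)) : SeriesBound Ω ε (shiftedCoeff f) :=
  h.scale hΩ (abs_logShift_le n)

/-- Frobenius' method: `q_k = Σ (1/i + 1/(i + n/2))` is minus the logarithmic derivative of the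
coefficients in the exponent. The step `q_{k+1} - q_k` times `x(x + n/2)` at `x = k + 1` is the
derivative `2x + n/2` of that factor. -/
theorem waveCoeff_shiftedCoeff (hΩ : IsOpen Ω) {f : XU n → ℝ} (hf : ContDiffOn ℝ ∞ f Ω) (k : ℕ)
    {w : XU n} (hw : w ∈ Ω) : waveCoeff (-((n : ℝ) / 2 + 1)) (shiftedCoeff f) k w =
      ((n : ℝ) / 2 + 2 * ((k : ℝ) + 1)) * fCoeff f (k + 1) w := by
  have h1 := waveCoeff_fCoeff hΩ hf k hw
  have h2 : lap (shiftedCoeff f k) w = logShift n k * lap (fCoeff f k) w :=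
    lap_const_mul hΩ (contDiffOn_fCoeff hΩ hf k) _ hw
  have h3 : ((k : ℝ) + 1) * (k + (n : ℝ) / 2 + 1) * (((n : ℝ) + 4 * ((k : ℝ) + 1)) /
      (((k : ℝ) + 1) * ((n : ℝ) + 2 * ((k : ℝ) + 1)))) = (n : ℝ) / 2 + 2 * ((k : ℝ) + 1) := by
    field_simp
    ring
  rw [waveCoeff] at h1 ⊢
  rw [h2, shiftedCoeff, logShift_succ, smul_eq_mul]
  linear_combination logShift n k * h1 + fCoeff f (k + 1) w * h3

/-- Multiplication by `ρ` shifts the index by one, so the constant term `(n/2) f` is missing from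
the left side. That missing term is what later cancels the obstruction. -/
theorem snd_mul_waveOp_shifted (hΩ : IsOpen Ω) {f : XU n → ℝ} (hf : ContDiffOn ℝ ∞ f Ω)
    (h : SeriesBound Ω ε (fCoeff f)) {p : XU n × ℝ} (hp : p ∈ Ω ×ˢ Ioo (-ε) ε) :
    p.2 * waveOp (-((n : ℝ) / 2 + 1)) (powerSum (shiftedCoeff f)) p =
      (n : ℝ) / 2 * powerSum (fCoeff f) p + 2 * (p.2 * dr (powerSum (fCoeff f)) p) -
        (n : ℝ) / 2 * f p.1 := by
  have h1 := (hasSum_waveOp_powerSum hΩ (seriesBound_shiftedCoeff hΩ h) (-((n : ℝ) / 2 + 1))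
    hp).mul_left p.2
  have h2 := ((h.hasSum hp).mul_left ((n : ℝ) / 2)).add
    ((h.hasSum_snd_mul_dr hΩ hp).mul_left 2)
  have h3 := (hasSum_nat_add_iff' 1).2 h2
  have h4 : fCoeff f 0 p.1 = f p.1 := by simp [fCoeff]
  rw [Finset.sum_range_one, h4] at h3
  refine h1.unique ?_
  simp only [pow_zero, Nat.cast_zero, zero_mul, mul_zero, add_zero, one_mul] at h3
  refine h3.congr_fun fun k => ?_
  rw [waveCoeff_shiftedCoeff hΩ hf k hp.1]
  push_cast
  ring

/-- The derivatives `1/ρ` and `-1/ρ²` of the logarithm produce the extra terms `2F' + sF/ρ`;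
multiplying by `ρ` clears the denominator. -/
theorem snd_mul_waveOp_log (hΩ : IsOpen Ω) {F : XU n × ℝ → ℝ}
    (hF : ContDiffOn ℝ ∞ F (Ω ×ˢ Ioo 0 ε)) (s : ℝ) {p : XU n × ℝ} (hp : p ∈ Ω ×ˢ Ioo 0 ε) :
    p.2 * waveOp (-(s + 1)) (fun p => Real.log p.2 * F p) p =
      p.2 * (Real.log p.2 * waveOp (-(s + 1)) F p) + 2 * (p.2 * dr F p) + s * F p := by
  have hU : IsOpen (Ω ×ˢ Ioo 0 ε) := hΩ.prod isOpen_Ioo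
  have h0 : p.2 ≠ 0 := hp.2.1.ne'
  have h1 := waveOp_mul (α := Real.log) (α₁ := fun ρ => ρ⁻¹) (α₂ := fun ρ => -(ρ ^ 2)⁻¹) hU hF
    (-(s + 1)) (fun p hp => Real.hasDerivAt_log hp.2.1.ne') (fun p hp => hasDerivAt_inv hp.2.1.ne') hp
  rw [h1]
  simp only [waveOp]
  field_simp
  ring

/-- The solution `b_f + C (log ρ · Σ b_k ρ^k - Σ q_k b_k ρ^k)`. -/
def logSolution (f g : XU n → ℝ) (w : XU n) (ρ : ℝ) : ℝ :=
  seriesSum (fCoeff f) w ρ +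
    logConst n * (Real.log ρ * powerSum (fCoeff g) (w, ρ) - powerSum (shiftedCoeff g) (w, ρ))

theorem tsum_log_eq (hΩ : IsOpen Ω) {g : XU n → ℝ} (h : SeriesBound Ω ε (fCoeff g)) {w : XU n}
    (hw : w ∈ Ω) {ρ : ℝ} (hρ : ρ ∈ Ioo (-ε) ε) :
    ∑' k : ℕ, (Real.log ρ - logShift n k) * fCoeff g k w * ρ ^ k =
      Real.log ρ * powerSum (fCoeff g) (w, ρ) - powerSum (shiftedCoeff g) (w, ρ) := by
  have hp : (w, ρ) ∈ Ω ×ˢ Ioo (-ε) ε := ⟨hw, hρ⟩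
  have h1 := (h.hasSum hp).mul_left (Real.log ρ)
  have h2 := (seriesBound_shiftedCoeff hΩ h).hasSum hp
  refine ((h1.sub h2).congr_fun fun k => ?_).tsum_eq
  simp only [shiftedCoeff, smul_eq_mul]
  ring

theorem contDiffOn_log_snd : ContDiffOn ℝ ∞ (fun p : XU n × ℝ => Real.log p.2) (Ω ×ˢ Ioo 0 ε) :=
  contDiffOn_snd.log fun _ hp => hp.2.1.ne'

variable {f g : XU n → ℝ}

theorem contDiffOn_logSolution (hΩ : IsOpen Ω) (hε : 0 < ε)
    (hf : SeriesBound Ω ε (fCoeff f)) (hg : SeriesBound Ω ε (fCoeff g)) :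
    ContDiffOn ℝ ∞ (fun p : XU n × ℝ => logSolution f g p.1 p.2) (Ω ×ˢ Ioo 0 ε) := by
  have hsub : Ω ×ˢ Ioo 0 ε ⊆ Ω ×ˢ Ioo (-ε) ε :=
    prod_mono subset_rfl (Ioo_subset_Ioo_left (by linarith))
  exact ((hf.hasTaylorSeries hΩ hε).1.mono hsub).add (contDiffOn_const.mul
    ((contDiffOn_log_snd.mul ((hg.contDiffOn hΩ).mono hsub)).sub
      (((seriesBound_shiftedCoeff hΩ hg).contDiffOn hΩ).mono hsub)))

theorem waveOp_const_mul {U : Set (XU n × ℝ)} (hU : IsOpen U) {F : XU n × ℝ → ℝ}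
    (hF : ContDiffOn ℝ ∞ F U) (c a : ℝ) :
    EqOn (waveOp c fun p => a * F p) (fun p => a * waveOp c F p) U := by
  intro p hp
  have h1 := waveOp_mul (α := fun _ => a) (α₁ := fun _ => 0) (α₂ := fun _ => 0) hU hF c
    (fun p _ => hasDerivAt_const p.2 a) (fun p _ => hasDerivAt_const p.2 0) hp
  rw [h1]
  simp only [waveOp]
  ring

/-- With `G` the sum of the series of `g`, the terms `(n/2) G + 2ρG'` from the logarithm cancel
against the shifted series, except for its missing constant term. -/
theorem waveOp_logSolution (hΩ : IsOpen Ω) (hε : 0 < ε) (hf : ContDiffOn ℝ ∞ f Ω)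
    (hg : ContDiffOn ℝ ∞ g Ω) (hf' : ConvergesOn Ω ε (fCoeff f))
    (hg' : ConvergesOn Ω ε (fCoeff g)) {p : XU n × ℝ} (hp : p ∈ Ω ×ˢ Ioo 0 ε) :
    p.2 * waveOp (-((n : ℝ) / 2 + 1)) (fun p => logSolution f g p.1 p.2) p =
      logConst n * ((n : ℝ) / 2 * g p.1) := by
  have hU : IsOpen (Ω ×ˢ Ioo 0 ε) := hΩ.prod isOpen_Ioo
  have hsub : Ω ×ˢ Ioo 0 ε ⊆ Ω ×ˢ Ioo (-ε) ε :=
    prod_mono subset_rfl (Ioo_subset_Ioo_left (by linarith))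
  have bf := hf'.seriesBound (contDiffOn_fCoeff hΩ hf)
  have bg := hg'.seriesBound (contDiffOn_fCoeff hΩ hg)
  have s1 := (bf.hasTaylorSeries hΩ hε).1.mono hsub
  have s2 := (bg.contDiffOn hΩ).mono hsub
  have s3 := ((seriesBound_shiftedCoeff hΩ bg).contDiffOn hΩ).mono hsub
  have s4 : ContDiffOn ℝ ∞ (fun p : XU n × ℝ => Real.log p.2 * powerSum (fCoeff g) p) (Ω ×ˢ Ioo 0 ε) :=
    contDiffOn_log_snd.mul s2
  have s5 : ContDiffOn ℝ ∞ (fun p : XU n × ℝ => (-1) * powerSum (shiftedCoeff g) p) (Ω ×ˢ Ioo 0 ε) :=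
    contDiffOn_const.mul s3
  have s6 := s4.add s5
  have he : (fun p : XU n × ℝ => logSolution f g p.1 p.2) = fun p =>
      (fun p => seriesSum (fCoeff f) p.1 p.2) p + (fun p : XU n × ℝ => logConst n *
        (Real.log p.2 * powerSum (fCoeff g) p + (-1) * powerSum (shiftedCoeff g) p)) p := by
    funext p
    simp only [logSolution, Prod.mk.eta]
    ring
  rw [he, waveOp_add hU s1 (contDiffOn_const.mul s6) _ hp]
  simp only []
  rw [waveOp_seriesSum_fCoeff hΩ hf hf' (hsub hp), waveOp_const_mul hU s6 _ _ hp]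
  simp only []
  rw [waveOp_add hU s4 s5 _ hp]
  simp only []
  rw [waveOp_const_mul hU s3 _ _ hp]
  simp only []
  have e1 := snd_mul_waveOp_log hΩ s2 ((n : ℝ) / 2) hp
  have e2 := snd_mul_waveOp_shifted hΩ hg bg (hsub hp)
  rw [waveOp_powerSum_eq_zero hΩ bg (fun k w hw => waveCoeff_fCoeff hΩ hg k hw) (hsub hp)] at e1
  linear_combination logConst n * e1 - logConst n * e2

variable {H : XU n → ℝ} {M : Set (Idx n → ℝ)}

/-- The coefficient `h` of the solution with logarithms. -/
def logMetricCoeff (H f : XU n → ℝ) (w : XU n) (ρ : ℝ) : ℝ :=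
  seriesSum (hCoeff H) w ρ + ρ ^ (n / 2) * seriesSum (fCoeff f) w ρ +
    logConst n * ρ ^ (n / 2) * ∑' k : ℕ,
      (Real.log ρ - logShift n k) * fCoeff (lap^[n / 2] H) k w * ρ ^ k

theorem logMetricCoeff_eq (hΩ : IsOpen Ω) (hg : SeriesBound Ω ε (fCoeff (lap^[n / 2] H))) {w : XU n}
    (hw : w ∈ Ω) {ρ : ℝ} (hρ : ρ ∈ Ioo (-ε) ε) : logMetricCoeff H f w ρ =
      seriesSum (hCoeff H) w ρ + ρ ^ (n / 2) * logSolution f (lap^[n / 2] H) w ρ := by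
  rw [logMetricCoeff, tsum_log_eq hΩ hg hw hρ, logSolution]
  ring

theorem isPower_pow_dim (hn : 3 ≤ n) (hev : Even n) (J : Set ℝ) :
    IsPower ((n : ℝ) / 2) J fun ρ => ρ ^ (n / 2) := by
  have h := isPower_pow (s := n / 2) (by omega) J
  obtain ⟨r, hr⟩ := hev
  have : ((n / 2 : ℕ) : ℝ) = (n : ℝ) / 2 := by
    have : n / 2 = r := by omega
    rw [this, hr]
    push_cast
    ring
  rwa [this] at h

theorem logMetric (hn : 3 ≤ n) (hev : Even n) (hM : IsOpen M) (hε : 0 < ε)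
    (hH : ContDiffOn ℝ ∞ H (proj '' M)) (hf : ContDiffOn ℝ ∞ f (proj '' M))
    (hf' : ConvergesOn (proj '' M) ε (fCoeff f))
    (hg' : ConvergesOn (proj '' M) ε (fCoeff (lap^[n / 2] H))) :
    IsAmbientMetric M (Ioo 0 ε) (ppMetric H) (ppFamily H (logMetricCoeff H f)) ∧
      RicciFlat M (Ioo 0 ε) (ppFamily H (logMetricCoeff H f)) := by
  have hΩ := isOpen_image_proj hM
  have hg := ContDiffOn.lap_iterate hΩ hH (n / 2)
  have hA := convergesOn_hCoeff_of_even hev hΩ hH ε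
  have bf := hf'.seriesBound (contDiffOn_fCoeff hΩ hf)
  have bg := hg'.seriesBound (contDiffOn_fCoeff hΩ hg)
  have bA := hA.seriesBound (contDiffOn_hCoeff hΩ hH)
  have hU : IsOpen ((proj '' M) ×ˢ Ioo 0 ε) := hΩ.prod isOpen_Ioo
  have hsub' : Ioo 0 ε ⊆ Ioo (-ε) ε := Ioo_subset_Ioo_left (by linarith)
  have hsub : (proj '' M) ×ˢ Ioo 0 ε ⊆ (proj '' M) ×ˢ Ioo (-ε) ε := prod_mono subset_rfl hsub'
  have hα := isPower_pow_dim hn hev (Ioo 0 ε)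
  have sA := (bA.hasTaylorSeries hΩ hε).1
  have sB := contDiffOn_logSolution hΩ hε bf bg
  have he : EqOn (fun p : XU n × ℝ => logMetricCoeff H f p.1 p.2) (fun p =>
      seriesSum (hCoeff H) p.1 p.2 + p.2 ^ (n / 2) * logSolution f (lap^[n / 2] H) p.1 p.2)
      ((proj '' M) ×ˢ Ioo (-ε) ε) := fun p hp => logMetricCoeff_eq hΩ bg hp.1 hp.2
  have hsm : ContDiffOn ℝ ∞ (fun p : XU n × ℝ => logMetricCoeff H f p.1 p.2)
      ((proj '' M) ×ˢ Ioo 0 ε) :=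
    (contDiffOn_combine hα (sA.mono hsub) sB).congr (he.mono hsub)
  have hflat : RicciFlat M (Ioo 0 ε) (ppFamily H (logMetricCoeff H f)) := by
    refine ricciFlat_ppFamily hn hM isOpen_Ioo hH hsm fun p hp => ?_
    have he' : EqOn (totalCoeff H (logMetricCoeff H f)) (totalCoeff H fun w ρ =>
        seriesSum (hCoeff H) w ρ + ρ ^ (n / 2) * logSolution f (lap^[n / 2] H) w ρ)
        ((proj '' M) ×ˢ Ioo 0 ε) := fun p hp => congrArg (H p.1 + ·) (he (hsub hp))
    rw [waveOp_congr hU he' _ hp, waveOp_combine hΩ isOpen_Ioo hH hα (sA.mono hsub) sB hp]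
    simp only []
    rw [waveOp_totalCoeff_seriesSum hn hΩ hH hA (hsub hp), if_pos hev]
    have h1 := waveOp_logSolution hΩ hε hf hg hf' hg' hp
    -- One factor `ρ` is spent on the `1/ρ` in the residue of the logarithmic part; what is left
    -- matches the power `ρ^{n/2-1}` of the obstruction, and `logConst` has the cancelling value.
    have h2 : p.2 ^ (n / 2) = p.2 ^ (n / 2 - 1) * p.2 := by
      rw [← pow_succ, Nat.sub_add_cancel (by omega)]
    have h3 := logConst_mul hn hev
    rw [h2]
    linear_combination p.2 ^ (n / 2 - 1) * h1 + p.2 ^ (n / 2 - 1) * (lap^[n / 2] H) p.1 * h3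
  refine ⟨?_, hflat⟩
  have h0 : (0 : ℝ) ∈ Ioo (-ε) ε := ⟨by linarith, hε⟩
  have hsub0 : (proj '' M) ×ˢ insert 0 (Ioo 0 ε) ⊆ (proj '' M) ×ˢ Ioo (-ε) ε :=
    prod_mono subset_rfl (insert_subset h0 hsub')
  refine isAmbientMetric_ppFamily hn hM isOpen_Ioo hH hsm ?_ (fun w hw => ?_)
    (fun hodd => absurd hev (Nat.not_even_iff_odd.2 hodd)) fun _ => hflat.ricciBigO _
  · refine ContinuousOn.mono ?_ hsub0
    -- Continuity at `ρ = 0` rests on `ρ log ρ → 0`, with `n/2 ≥ 1`.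
    have hlog : Continuous fun ρ : ℝ => ρ ^ (n / 2) * Real.log ρ := by
      have : (fun ρ : ℝ => ρ ^ (n / 2) * Real.log ρ) =
          fun ρ => ρ ^ (n / 2 - 1) * (ρ * Real.log ρ) := by
        funext ρ
        rw [← mul_assoc, ← pow_succ, Nat.sub_add_cancel (by omega)]
      rw [this]
      exact (continuous_pow _).mul Real.continuous_mul_log
    have c1 : ContinuousOn (fun p : XU n × ℝ => seriesSum (hCoeff H) p.1 p.2 +
        p.2 ^ (n / 2) * seriesSum (fCoeff f) p.1 p.2 + logConst n *
          ((p.2 ^ (n / 2) * Real.log p.2) * powerSum (fCoeff (lap^[n / 2] H)) p -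
            p.2 ^ (n / 2) * powerSum (shiftedCoeff (lap^[n / 2] H)) p))
        ((proj '' M) ×ˢ Ioo (-ε) ε) :=
      (sA.continuousOn.add ((continuous_snd.pow _).continuousOn.mul
        (bf.hasTaylorSeries hΩ hε).1.continuousOn)).add (continuousOn_const.mul
        (((hlog.comp continuous_snd).continuousOn.mul (bg.contDiffOn hΩ).continuousOn).sub
          ((continuous_snd.pow _).continuousOn.mul
            ((seriesBound_shiftedCoeff hΩ bg).contDiffOn hΩ).continuousOn)))
    refine c1.congr fun p hp => ?_
    refine (he hp).trans ?_
    simp only [logSolution, Prod.mk.eta]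
    ring
  · rw [logMetricCoeff, (bA.hasTaylorSeries hΩ hε).eq_zero hw, zero_pow (by omega), hCoeff,
      if_pos (Or.inl rfl)]
    ring

end Logarithm

/-! ### The parts of the theorem -/

section Parts

variable {n : ℕ} {ε : ℝ} {H f : XU n → ℝ} {A B : XU n → ℝ → ℝ} {M : Set (Idx n → ℝ)}

theorem rhoRange_of_odd (hodd : Odd n) (ε : ℝ) : rhoRange n ε = Ioo 0 ε := by
  ext ρ
  simp only [rhoRange, mem_ofPred_eq, mem_Ioo, abs_lt]
  exact ⟨fun h => ⟨h.2 hodd, h.1.2⟩, fun h => ⟨⟨by linarith [h.1, h.2], h.2⟩, fun _ => h.1⟩⟩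

theorem rhoRange_of_even (hev : Even n) (ε : ℝ) : rhoRange n ε = Ioo (-ε) ε := by
  ext ρ
  simp only [rhoRange, mem_ofPred_eq, mem_Ioo, abs_lt]
  exact ⟨fun h => h.1, fun h => ⟨h, fun ho => absurd hev (Nat.not_even_iff_odd.2 ho)⟩⟩

/-- For even `n` the real power is a natural power at every `ρ`, negative ones included, which
permits the two-sided interval. -/
theorem rpow_half_even (hev : Even n) (ρ : ℝ) : ρ ^ ((n : ℝ) / 2) = ρ ^ (n / 2) := by
  obtain ⟨r, hr⟩ := hev
  have h1 : n / 2 = r := by omega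
  have h2 : (n : ℝ) / 2 = (r : ℝ) := by rw [hr]; push_cast; ring
  rw [h1, h2, Real.rpow_natCast]

theorem isAmbientMetric_rhoRange (hn : 3 ≤ n) (hM : IsOpen M) (hε : 0 < ε)
    (hH : ContDiffOn ℝ ∞ H (proj '' M)) (hf : ContDiffOn ℝ ∞ f (proj '' M))
    (hA : HasTaylorSeries (proj '' M) (Ioo (-ε) ε) (hCoeff H) A)
    (hB : HasTaylorSeries (proj '' M) (Ioo (-ε) ε) (fCoeff f) B) :
    IsAmbientMetric M (rhoRange n ε) (ppMetric H)
      (ppFamily H fun w ρ => A w ρ + ρ ^ ((n : ℝ) / 2) * B w ρ) := by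
  rcases Nat.even_or_odd n with hev | hodd
  · rw [rhoRange_of_even hev]
    simp only [rpow_half_even hev]
    exact isAmbientMetric_combine hn hM hε isOpen_Ioo subset_rfl hH (isPower_pow_dim hn hev _) hf
      hA hB
  · rw [rhoRange_of_odd hodd]
    exact isAmbientMetric_combine hn hM hε isOpen_Ioo (Ioo_subset_Ioo_left (by linarith)) hH
      (isPower_rpow_dim hn ε) hf hA hB

theorem seriesSum_of_odd (hn : 3 ≤ n) (hodd : Odd n) (hM : IsOpen M) (hε : 0 < ε)
    (hH : ContDiffOn ℝ ∞ H (proj '' M)) (h : ConvergesOn (proj '' M) ε (hCoeff H)) :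
    IsAmbientMetric M (Ioo (-ε) ε) (ppMetric H) (ppFamily H (seriesSum (hCoeff H))) ∧
      RicciFlat M (Ioo (-ε) ε) (ppFamily H (seriesSum (hCoeff H))) ∧
      AnalyticInRho M (Ioo (-ε) ε) (ppFamily H (seriesSum (hCoeff H))) ∧
      ∀ γ, IsAmbientMetric M (Ioo (-ε) ε) (ppMetric H) γ → AnalyticInRho M (Ioo (-ε) ε) γ →
        ∀ z ∈ M, ∀ ρ ∈ Ioo (-ε) ε, γ z ρ = ppFamily H (seriesSum (hCoeff H)) z ρ := by
  have hΩ := isOpen_image_proj hM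
  have hb := h.seriesBound (contDiffOn_hCoeff hΩ hH)
  have h1 := isAmbientMetric_of_hasTaylorSeries hn hM hε hH (hb.hasTaylorSeries hΩ hε)
  have h2 : AnalyticInRho M (Ioo (-ε) ε) (ppFamily H (seriesSum (hCoeff H))) :=
    analyticInRho_ppFamily fun w hw => hb.analyticOnNhd_seriesSum hw
  exact ⟨h1, ricciFlat_seriesSum hn hM hε hH h hodd, h2, fun γ hγ ha z hz ρ hρ =>
    eq_of_analytic_of_odd hn hodd hM hε hγ h1 ha h2 hz hρ⟩

theorem seriesSum_add_of_odd (hn : 3 ≤ n) (hodd : Odd n) (hM : IsOpen M) (hε : 0 < ε)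
    (hH : ContDiffOn ℝ ∞ H (proj '' M)) (hf : ContDiffOn ℝ ∞ f (proj '' M))
    (hA : ConvergesOn (proj '' M) ε (hCoeff H)) (hB : ConvergesOn (proj '' M) ε (fCoeff f)) :
    IsAmbientMetric M (Ioo 0 ε) (ppMetric H) (ppFamily H fun w ρ =>
      seriesSum (hCoeff H) w ρ + ρ ^ ((n : ℝ) / 2) * seriesSum (fCoeff f) w ρ) ∧
    RicciFlat M (Ioo 0 ε) (ppFamily H fun w ρ =>
      seriesSum (hCoeff H) w ρ + ρ ^ ((n : ℝ) / 2) * seriesSum (fCoeff f) w ρ) := by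
  have hΩ := isOpen_image_proj hM
  have bA := hA.seriesBound (contDiffOn_hCoeff hΩ hH)
  have bB := hB.seriesBound (contDiffOn_fCoeff hΩ hf)
  have hsub : Ioo 0 ε ⊆ Ioo (-ε) ε := Ioo_subset_Ioo_left (by linarith)
  exact ⟨isAmbientMetric_combine hn hM hε isOpen_Ioo hsub hH (isPower_rpow_dim hn ε) hf
      (bA.hasTaylorSeries hΩ hε) (bB.hasTaylorSeries hΩ hε),
    ricciFlat_combine hn hM hε isOpen_Ioo hsub hH (isPower_rpow_dim hn ε) hf hA hB
      fun hev => absurd hev (Nat.not_even_iff_odd.2 hodd)⟩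

theorem seriesSum_add_of_even (hn : 3 ≤ n) (hev : Even n) (hM : IsOpen M) (hε : 0 < ε)
    (hH : ContDiffOn ℝ ∞ H (proj '' M)) (hf : ContDiffOn ℝ ∞ f (proj '' M))
    (hO : ∀ w ∈ proj '' M, (lap^[n / 2] H) w = 0) (hB : ConvergesOn (proj '' M) ε (fCoeff f)) :
    IsAmbientMetric M (Ioo (-ε) ε) (ppMetric H) (ppFamily H fun w ρ =>
      seriesSum (hCoeff H) w ρ + ρ ^ (n / 2) * seriesSum (fCoeff f) w ρ) ∧
    RicciFlat M (Ioo (-ε) ε) (ppFamily H fun w ρ =>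
      seriesSum (hCoeff H) w ρ + ρ ^ (n / 2) * seriesSum (fCoeff f) w ρ) ∧
    AnalyticInRho M (Ioo (-ε) ε) (ppFamily H fun w ρ =>
      seriesSum (hCoeff H) w ρ + ρ ^ (n / 2) * seriesSum (fCoeff f) w ρ) := by
  have hΩ := isOpen_image_proj hM
  have hA := convergesOn_hCoeff_of_even hev hΩ hH ε
  have bA := hA.seriesBound (contDiffOn_hCoeff hΩ hH)
  have bB := hB.seriesBound (contDiffOn_fCoeff hΩ hf)
  have hα := isPower_pow_dim hn hev (Ioo (-ε) ε)
  refine ⟨isAmbientMetric_combine hn hM hε isOpen_Ioo subset_rfl hH hα hf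
      (bA.hasTaylorSeries hΩ hε) (bB.hasTaylorSeries hΩ hε),
    ricciFlat_combine hn hM hε isOpen_Ioo subset_rfl hH hα hf hA hB fun _ => hO,
    analyticInRho_ppFamily fun w hw => ?_⟩
  exact (bA.analyticOnNhd_seriesSum hw).add
    ((analyticOnNhd_id.pow (n / 2)).mul (bB.analyticOnNhd_seriesSum hw))

end Parts

end PPWave

end

theorem mainTheorem7 (n : ℕ) (hn : 3 ≤ n) (κ : ℝ) (hκ : κ ≠ 0) :
    ∃ c : ℝ, c ≠ 0 ∧
    ∀ M : Set (PPWave.Idx n → ℝ), IsOpen M →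
    ∀ H : PPWave.XU n → ℝ, ContDiffOn ℝ ∞ H (PPWave.proj '' M) →
    -- the metric given by the series, for an arbitrary smooth function `f`, is an ambient metric
    (∀ f : PPWave.XU n → ℝ, ContDiffOn ℝ ∞ f (PPWave.proj '' M) →
      (∃ A B : PPWave.XU n → ℝ → ℝ,
        PPWave.HasTaylorSeries (PPWave.proj '' M) univ (PPWave.hCoeff H) A ∧
        PPWave.HasTaylorSeries (PPWave.proj '' M) univ (PPWave.fCoeff f) B) ∧
      (∀ ε : ℝ, 0 < ε → ∀ A B : PPWave.XU n → ℝ → ℝ,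
        PPWave.HasTaylorSeries (PPWave.proj '' M) (Ioo (-ε) ε) (PPWave.hCoeff H) A →
        PPWave.HasTaylorSeries (PPWave.proj '' M) (Ioo (-ε) ε) (PPWave.fCoeff f) B →
        PPWave.IsAmbientMetric M (PPWave.rhoRange n ε) (PPWave.ppMetric H)
          (PPWave.ppFamily H fun w ρ => A w ρ + ρ ^ ((n : ℝ) / 2) * B w ρ))) ∧
    -- odd dimension
    (Odd n →
      -- `f = 0`: an ambient metric on both sides of `ρ = 0`
      (∀ ε : ℝ, 0 < ε → ∀ A : PPWave.XU n → ℝ → ℝ,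
        PPWave.HasTaylorSeries (PPWave.proj '' M) (Ioo (-ε) ε) (PPWave.hCoeff H) A →
        PPWave.IsAmbientMetric M (Ioo (-ε) ε) (PPWave.ppMetric H) (PPWave.ppFamily H A)) ∧
      -- `f = 0`, convergent series: Ricci-flat, analytic in `ρ`, and unique
      (∀ ε : ℝ, 0 < ε → PPWave.ConvergesOn (PPWave.proj '' M) ε (PPWave.hCoeff H) →
        PPWave.IsAmbientMetric M (Ioo (-ε) ε) (PPWave.ppMetric H)
          (PPWave.ppFamily H (PPWave.seriesSum (PPWave.hCoeff H))) ∧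
        PPWave.RicciFlat M (Ioo (-ε) ε)
          (PPWave.ppFamily H (PPWave.seriesSum (PPWave.hCoeff H))) ∧
        PPWave.AnalyticInRho M (Ioo (-ε) ε)
          (PPWave.ppFamily H (PPWave.seriesSum (PPWave.hCoeff H))) ∧
        ∀ γ, PPWave.IsAmbientMetric M (Ioo (-ε) ε) (PPWave.ppMetric H) γ →
          PPWave.AnalyticInRho M (Ioo (-ε) ε) γ →
          ∀ z ∈ M, ∀ ρ ∈ Ioo (-ε) ε,
            γ z ρ = PPWave.ppFamily H (PPWave.seriesSum (PPWave.hCoeff H)) z ρ) ∧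
      -- uniqueness without assuming convergence, which is then a conclusion
      (∀ ε : ℝ, 0 < ε → ∀ γ, PPWave.IsAmbientMetric M (Ioo (-ε) ε) (PPWave.ppMetric H) γ →
        PPWave.AnalyticInRho M (Ioo (-ε) ε) γ →
        ∀ z ∈ M, ∀ᶠ ρ in 𝓝 (0 : ℝ), ∃ h : ℝ,
          HasSum (fun k : ℕ => PPWave.hCoeff H k (PPWave.proj z) * ρ ^ k) h ∧
          γ z ρ = PPWave.ppMetric H z + PPWave.duSq n h) ∧
      -- arbitrary `f`, convergent series: Ricci-flat for `ρ > 0`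
      (∀ f : PPWave.XU n → ℝ, ContDiffOn ℝ ∞ f (PPWave.proj '' M) → ∀ ε : ℝ, 0 < ε →
        PPWave.ConvergesOn (PPWave.proj '' M) ε (PPWave.hCoeff H) →
        PPWave.ConvergesOn (PPWave.proj '' M) ε (PPWave.fCoeff f) →
        PPWave.IsAmbientMetric M (Ioo 0 ε) (PPWave.ppMetric H)
          (PPWave.ppFamily H fun w ρ => PPWave.seriesSum (PPWave.hCoeff H) w ρ +
            ρ ^ ((n : ℝ) / 2) * PPWave.seriesSum (PPWave.fCoeff f) w ρ) ∧
        PPWave.RicciFlat M (Ioo 0 ε)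
          (PPWave.ppFamily H fun w ρ => PPWave.seriesSum (PPWave.hCoeff H) w ρ +
            ρ ^ ((n : ℝ) / 2) * PPWave.seriesSum (PPWave.fCoeff f) w ρ)) ∧
      -- the solutions with exponents in `ℕ` and `n/2 + ℕ` are parametrised by `f`
      (∀ ε : ℝ, 0 < ε → ∀ A B : PPWave.XU n → ℝ → ℝ,
        ContDiffOn ℝ ∞ (fun p : PPWave.XU n × ℝ => A p.1 p.2)
          ((PPWave.proj '' M) ×ˢ Ioo (-ε) ε) →
        ContDiffOn ℝ ∞ (fun p : PPWave.XU n × ℝ => B p.1 p.2)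
          ((PPWave.proj '' M) ×ˢ Ioo (-ε) ε) →
        PPWave.IsAmbientMetric M (Ioo 0 ε) (PPWave.ppMetric H)
          (PPWave.ppFamily H fun w ρ => A w ρ + ρ ^ ((n : ℝ) / 2) * B w ρ) →
        PPWave.HasTaylorSeries (PPWave.proj '' M) (Ioo (-ε) ε) (PPWave.hCoeff H) A ∧
        PPWave.HasTaylorSeries (PPWave.proj '' M) (Ioo (-ε) ε)
          (PPWave.fCoeff fun w => B w 0) B)) ∧
    -- even dimension
    (Even n →
      -- the obstruction tensor
      PPWave.IsObstructionTensor κ M (PPWave.ppMetric H)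
        (fun z => PPWave.duSq n (c * (PPWave.lap^[n / 2] H) (PPWave.proj z))) ∧
      -- if the obstruction tensor vanishes, the metric is Ricci-flat
      (PPWave.IsObstructionTensor κ M (PPWave.ppMetric H) 0 →
        ∀ f : PPWave.XU n → ℝ, ContDiffOn ℝ ∞ f (PPWave.proj '' M) → ∀ ε : ℝ, 0 < ε →
        (∀ A B : PPWave.XU n → ℝ → ℝ,
          PPWave.HasTaylorSeries (PPWave.proj '' M) (Ioo (-ε) ε) (PPWave.hCoeff H) A →
          PPWave.HasTaylorSeries (PPWave.proj '' M) (Ioo (-ε) ε) (PPWave.fCoeff f) B →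
          ∀ m : ℕ, PPWave.RicciBigO M (Ioo (-ε) ε)
            (PPWave.ppFamily H fun w ρ => A w ρ + ρ ^ (n / 2) * B w ρ) m) ∧
        (PPWave.ConvergesOn (PPWave.proj '' M) ε (PPWave.fCoeff f) →
          PPWave.IsAmbientMetric M (Ioo (-ε) ε) (PPWave.ppMetric H)
            (PPWave.ppFamily H fun w ρ => PPWave.seriesSum (PPWave.hCoeff H) w ρ +
              ρ ^ (n / 2) * PPWave.seriesSum (PPWave.fCoeff f) w ρ) ∧
          PPWave.RicciFlat M (Ioo (-ε) ε)
            (PPWave.ppFamily H fun w ρ => PPWave.seriesSum (PPWave.hCoeff H) w ρ +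
              ρ ^ (n / 2) * PPWave.seriesSum (PPWave.fCoeff f) w ρ) ∧
          PPWave.AnalyticInRho M (Ioo (-ε) ε)
            (PPWave.ppFamily H fun w ρ => PPWave.seriesSum (PPWave.hCoeff H) w ρ +
              ρ ^ (n / 2) * PPWave.seriesSum (PPWave.fCoeff f) w ρ))) ∧
      -- the Ricci-flat metrics `g + h(x, u, ρ) du²` analytic in `ρ` exist only if the obstruction
      -- tensor vanishes, and are parametrised by `f`
      (∀ ε : ℝ, 0 < ε → ∀ h : PPWave.XU n → ℝ → ℝ,
        PPWave.IsAmbientMetric M (Ioo (-ε) ε) (PPWave.ppMetric H) (PPWave.ppFamily H h) →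
        PPWave.AnalyticInRho M (Ioo (-ε) ε) (PPWave.ppFamily H h) →
        PPWave.RicciFlat M (Ioo (-ε) ε) (PPWave.ppFamily H h) →
        PPWave.IsObstructionTensor κ M (PPWave.ppMetric H) 0 ∧
        ∃ f : PPWave.XU n → ℝ, ContDiffOn ℝ ∞ f (PPWave.proj '' M) ∧
          ∀ w ∈ PPWave.proj '' M, ∀ᶠ ρ in 𝓝 (0 : ℝ),
            HasSum (fun k : ℕ => PPWave.hCoeff H k w * ρ ^ k +
              PPWave.fCoeff f k w * ρ ^ (n / 2 + k)) (h w ρ)) ∧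
      -- solutions with logarithms, whether or not the obstruction tensor vanishes
      (∀ f : PPWave.XU n → ℝ, ContDiffOn ℝ ∞ f (PPWave.proj '' M) → ∀ ε : ℝ, 0 < ε →
        PPWave.ConvergesOn (PPWave.proj '' M) ε (PPWave.fCoeff f) →
        PPWave.ConvergesOn (PPWave.proj '' M) ε (PPWave.fCoeff (PPWave.lap^[n / 2] H)) →
        PPWave.IsAmbientMetric M (Ioo 0 ε) (PPWave.ppMetric H)
          (PPWave.ppFamily H fun w ρ => PPWave.seriesSum (PPWave.hCoeff H) w ρ +
            ρ ^ (n / 2) * PPWave.seriesSum (PPWave.fCoeff f) w ρ +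
            PPWave.logConst n * ρ ^ (n / 2) * ∑' k : ℕ,
              (Real.log ρ - PPWave.logShift n k) *
                PPWave.fCoeff (PPWave.lap^[n / 2] H) k w * ρ ^ k) ∧
        PPWave.RicciFlat M (Ioo 0 ε)
          (PPWave.ppFamily H fun w ρ => PPWave.seriesSum (PPWave.hCoeff H) w ρ +
            ρ ^ (n / 2) * PPWave.seriesSum (PPWave.fCoeff f) w ρ +
            PPWave.logConst n * ρ ^ (n / 2) * ∑' k : ℕ,
              (Real.log ρ - PPWave.logShift n k) *
                PPWave.fCoeff (PPWave.lap^[n / 2] H) k w * ρ ^ k))) := by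
  open PPWave in
  -- The constant depends on `n` and `κ` alone, as it must be fixed before `M` and `H`.
  refine ⟨κ * obstructionConst n, mul_ne_zero hκ (obstructionConst_ne_zero hn),
    fun M hM H hH => ⟨fun f hf => ⟨?_, fun ε hε A B hA hB =>
      isAmbientMetric_rhoRange hn hM hε hH hf hA hB⟩, fun hodd => ⟨?_, ?_, ?_, ?_, ?_⟩,
      fun hev => ⟨?_, ?_, ?_, ?_⟩⟩⟩
  · have hΩ := isOpen_image_proj hM
    obtain ⟨A, hA⟩ := exists_hasTaylorSeries hΩ (contDiffOn_hCoeff hΩ hH)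
    obtain ⟨B, hB⟩ := exists_hasTaylorSeries hΩ (contDiffOn_fCoeff hΩ hf)
    exact ⟨A, B, hA, hB⟩
  · exact fun ε hε A hA => isAmbientMetric_of_hasTaylorSeries hn hM hε hH hA
  · exact fun ε hε h => seriesSum_of_odd hn hodd hM hε hH h
  · exact fun ε hε γ hγ ha z hz => hasSum_of_analytic_of_odd hn hodd hM hε hH hγ ha hz
  · exact fun f hf ε hε hA hB => seriesSum_add_of_odd hn hodd hM hε hH hf hA hB
  · exact fun ε hε A B hA hB hh =>
      hasTaylorSeries_of_isAmbientMetric hn hodd hM hε hH hA hB hh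
  · exact isObstructionTensor_ppMetric hn hev hM hH κ
  · intro hO f hf ε hε
    have hO' := lap_iterate_eq_zero_of_isObstructionTensor hn hev hM hH hκ hO
    exact ⟨fun A B hA hB m => ricciBigO_combine hn hM hε isOpen_Ioo subset_rfl hH
      (isPower_pow_dim hn hev _) hf hA hB fun w hw _ _ => hO' w hw,
      seriesSum_add_of_even hn hev hM hε hH hf hO'⟩
  · intro ε hε h hh ha hR
    obtain ⟨h1, h2⟩ := hasSum_of_ricciFlat_of_even hn hev hM hε hH hh ha hR
    exact ⟨isObstructionTensor_zero hn hev hM hH κ h1, h2⟩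
  · exact fun f hf ε hε hB hG => logMetric hn hev hM hε hH hf hB hG
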